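/- Let $(\Sigma,g)$ be an oriented smooth Riemannian $3$-manifold, and extend $g$ complex bilinearly to $\mathbb{C}T^*\Sigma$. Let $\hat M=\{\zeta\in\mathbb{C}T^*\Sigma : g(\zeta,\zeta)=0,\ \zeta\ne 0\}$ and let $\tilde\pi\colon\hat M\to M:=\hat M/\mathbb{C}^*$ be the twistor CR manifold: $T^{1,0}M=\overline{\tilde\pi_*D}$, where $D=\operatorname{Ker}\, d(\zeta_i dx^i)|_{\hat M}\subset\mathbb{C}T\hat M$. Put $$\widehat{\mathcal C}=\{\zeta\in\mathbb{C}T^*\Sigma : g(\zeta,\zeta)=0,\ g(\zeta,\bar\zeta)=1\},$$ $\eta=i\,\zeta\times\bar\zeta=2\operatorname{Re}\zeta\times\operatorname{Im}\zeta$, $\delta\zeta_j=d\zeta_j-\Gamma_{kj}{}^l\zeta_l\,dx^k$ ($\Gamma$ the Christoffel symbols of $g$), and define on $\widehat{\mathcal C}$ the adapted coframe $(\theta,\tilde\theta^1,\tilde\theta^2,\tilde\theta^{\bar1}=\overline{\tilde\theta^1},\tilde\theta^{\bar2}=\overline{\tilde\theta^2},\tilde\theta^3)$ by $$\theta=\eta_i\,dx^i,\qquad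 \tilde\theta^1=\zeta_i\,dx^i,\qquad \tilde\theta^2=i\,\eta^j\delta\zeta_j,\qquad \tilde\theta^3=-\tfrac{i}{2}\bigl(\overline{\zeta^j}\,\delta\zeta_j-\zeta^j\,\delta\bar\zeta_j\bigr).$$ The form $\theta$ descends to a contact form on $M$, also denoted $\theta$. Let $K_M=\{\xi\in\bigwedge^3\mathbb{C}T^*M : \bar Z\lrcorner\,\xi=0 \text{ for all } \bar Z\in T^{0,1}M\}$ be the CR canonical bundle and $\mathcal C=K_M^\times/\mathbb{R}_+$ the Fefferman space of $M$, a circle bundle over $M$. The Fefferman metric of $(M,\theta)$ is the metric on $\mathcal C$ given as follows. Let $(\theta,\theta^\alpha,\theta^{\bar\alpha})$, $\alpha=1,2$, be a local admissible coframe (dual to $(T,Z_\alpha,\overline{Z_\alpha})$ with $T$ the Reeb field of $\theta$ and $(Z_\alpha)$ a frame of $T^{1,0}M$) with $d\theta=i h_{\alpha\bar\beta}\theta^\alpha\wedge\theta^{\bar\beta}$ and $|\det(h_{\alpha\bar\beta})|=1$; it gives the fibre coordinate $s$ of the point $[e^{is}\theta\wedge\theta^1\wedge\theta^2]$ of $\mathcal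 C$. With $\varphi=e^{is}\theta^1\wedge\theta^2$, $\xi=\theta\wedge\varphi$, and $\sigma$ the unique real $1$-form with $$d\xi=4i\,\sigma\wedge\xi,\qquad \sigma\wedge d\varphi\wedge\bar\varphi=(\operatorname{Tr}d\sigma)\,i\,\sigma\wedge\theta\wedge\varphi\wedge\bar\varphi,$$ where $\operatorname{Tr}\omega=h^{\alpha\bar\beta}\omega_{\alpha\bar\beta}$ for $\omega=i\omega_{\alpha\bar\beta}\theta^\alpha\wedge\theta^{\bar\beta}+\cdots$, it is $$g^{\mathrm F}=2h_{\alpha\bar\beta}\,\theta^\alpha\cdot\theta^{\bar\beta}+4\,\theta\cdot\sigma,\qquad (\phi\cdot\psi)(V,W)=\tfrac12\bigl(\phi(V)\psi(W)+\phi(W)\psi(V)\bigr).$$ Then the map $\varpi\colon\widehat{\mathcal C}\to\mathcal C$, $u\mapsto[(\theta\wedge\tilde\theta^1\wedge\tilde\theta^2)_u]$, is well defined and is a (smooth) double covering, the form $\sigma$ exists, and $$\varpi^*g^{\mathrm F}=2\bigl(\tilde\theta^1\cdot\tilde\theta^{\bar2}+\tilde\theta^2\cdot\tilde\theta^{\bar1}+\theta\cdot\tilde\theta^3\bigr).$$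 -/

import Mathlib

open Bundle Manifold ContDiff Matrix
open scoped Topology

noncomputable section

namespace TwistorFefferman

/-! ## Differential forms on normed spaces -/

section Forms

variable {E : Type*} [NormedAddCommGroup E] [NormedSpace ℝ E]

/-- A complex valued covector, regarded as an alternating form of degree one. -/
def oneForm (α : E →L[ℝ] ℂ) : E [⋀^Fin 1]→L[ℝ] ℂ :=
  ContinuousAlternatingMap.ofSubsingleton ℝ E ℂ (0 : Fin 1) α

/-- The wedge product `α ∧ ψ` of a covector with a `k`-form:
`(α ∧ ψ)(v₀, …, v_k) = ∑ i, (-1)ⁱ α(v_i) ψ(v₀, …, v̂_i, …, v_k)`. -/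
def wedge {k : ℕ} (α : E →L[ℝ] ℂ) (ψ : E [⋀^Fin k]→L[ℝ] ℂ) : E [⋀^Fin (k + 1)]→L[ℝ] ℂ :=
  ContinuousAlternatingMap.alternatizeUncurryFin (α.smulRight ψ)

/-- The complex conjugate of a complex valued covector. -/
def conjForm (α : E →L[ℝ] ℂ) : E →L[ℝ] ℂ :=
  (Complex.conjCLE : ℂ →L[ℝ] ℂ).comp α

/-- The symmetric product `(φ·ψ)(v,w) = (φ(v)ψ(w) + φ(w)ψ(v))/2` of two covectors. -/
def symProd (φ ψ : E →L[ℝ] ℂ) (v w : E) : ℂ := (φ v * ψ w + φ w * ψ v) / 2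

/-- The exterior derivative of a complex valued `1`-form. -/
def dOne (α : E → E →L[ℝ] ℂ) (y : E) : E [⋀^Fin 2]→L[ℝ] ℂ :=
  extDeriv (fun z => oneForm (α z)) y

/-- A complexified vector `a + i b` is represented by the pair `(a, b)`; this is the complex linear
extension of a covector. -/
def evalC (α : E →L[ℝ] ℂ) (z : E × E) : ℂ := α z.1 + Complex.I * α z.2

/-- The complex bilinear extension of a `2`-form to complexified vectors. -/
def evalC2 (ψ : E [⋀^Fin 2]→L[ℝ] ℂ) (z w : E × E) : ℂ :=
  ψ ![z.1, w.1] + Complex.I * ψ ![z.2, w.1] + Complex.I * ψ ![z.1, w.2] - ψ ![z.2, w.2]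

/-- Complex conjugation `a + i b ↦ a - i b` of complexified vectors. -/
def conjVec (z : E × E) : E × E := (z.1, -z.2)

end Forms

/-! ## Pseudohermitian geometry and the Fefferman metric on a coordinate patch of dimension five

A coordinate patch is an open set `W` of `ℝ⁵`.  A CR structure on it is given by the subspaces
`T10 y` of complexified vectors.  The restriction of the circle bundle of the Fefferman space to the
patch is described by its cover `W × ℝ`, with fibre coordinate `s`. -/

/-- The model space of the CR manifold. -/
abbrev E5 : Type := EuclideanSpace ℝ (Fin 5)

/-- The model space of the Fefferman space. -/
abbrev E6 : Type := E5 × ℝ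

/-- An admissible frame `(T, Z_α, Z̄_α)` on `W` of a CR structure `T10` with contact form `θ`,
its dual coframe `(θ, θ^α, θ̄^α)` and the Levi matrix `h`, normalized by `|det h| = 1`. -/
structure UnitAdmissibleFrame (W : Set E5) (T10 : E5 → Set (E5 × E5)) (θ : E5 → E5 →L[ℝ] ℂ) where
  /-- the Reeb vector field -/
  T : E5 → E5
  /-- the frame `Z_α` of `T10` -/
  Z : Fin 2 → E5 → E5 × E5
  /-- the coframe `θ^α` -/
  coframe : Fin 2 → E5 → E5 →L[ℝ] ℂ
  /-- the Levi matrix -/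
  h : E5 → Matrix (Fin 2) (Fin 2) ℂ
  smooth_T : ContDiffOn ℝ ∞ T W
  smooth_Z : ∀ α, ContDiffOn ℝ ∞ (Z α) W
  smooth_coframe : ∀ α, ContDiffOn ℝ ∞ (coframe α) W
  reeb_one : ∀ y ∈ W, θ y (T y) = 1
  reeb_contract : ∀ y ∈ W, ∀ v, dOne θ y ![T y, v] = 0
  Z_mem : ∀ y ∈ W, ∀ α, Z α y ∈ T10 y
  Z_span : ∀ y ∈ W, ∀ z ∈ T10 y, ∃ c : Fin 2 → ℂ,
    z = (∑ α, ((c α).re • (Z α y).1 - (c α).im • (Z α y).2),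
         ∑ α, ((c α).re • (Z α y).2 + (c α).im • (Z α y).1))
  theta_Z : ∀ y ∈ W, ∀ α, evalC (θ y) (Z α y) = 0
  coframe_T : ∀ y ∈ W, ∀ α, coframe α y (T y) = 0
  coframe_Z : ∀ y ∈ W, ∀ α β, evalC (coframe α y) (Z β y) = if α = β then 1 else 0
  coframe_conjZ : ∀ y ∈ W, ∀ α β, evalC (coframe α y) (conjVec (Z β y)) = 0
  levi : ∀ y ∈ W, ∀ v w, dOne θ y ![v, w] = Complex.I * ∑ α, ∑ β, h y α β *
    (coframe α y v * (starRingEnd ℂ) (coframe β y w)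
      - coframe α y w * (starRingEnd ℂ) (coframe β y v))
  unit_det : ∀ y ∈ W, ‖(h y).det‖ = 1

namespace UnitAdmissibleFrame

variable {W : Set E5} {T10 : E5 → Set (E5 × E5)} {θ : E5 → E5 →L[ℝ] ℂ}

/-- Pull back of a covector from the patch to `W × ℝ`. -/
def lift (α : E5 →L[ℝ] ℂ) : E6 →L[ℝ] ℂ := α.comp (ContinuousLinearMap.fst ℝ E5 ℝ)

/-- The `3`-form `e^{is} θ ∧ θ¹ ∧ θ²` at the point `y` of the patch: the point of the canonical
bundle with fibre coordinate `s`. -/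
def canonicalForm (F : UnitAdmissibleFrame W T10 θ) (q : E6) : E5 [⋀^Fin 3]→L[ℝ] ℂ :=
  Complex.exp (Complex.I * q.2) •
    wedge (θ q.1) (wedge (F.coframe 0 q.1) (oneForm (F.coframe 1 q.1)))

/-- The form `φ = e^{is} θ¹ ∧ θ²` on `W × ℝ`. -/
def phi (F : UnitAdmissibleFrame W T10 θ) (q : E6) : E6 [⋀^Fin 2]→L[ℝ] ℂ :=
  Complex.exp (Complex.I * q.2) •
    wedge (lift (F.coframe 0 q.1)) (oneForm (lift (F.coframe 1 q.1)))

/-- The tautological form `ξ = e^{is} θ ∧ θ¹ ∧ θ² = θ ∧ φ` on `W × ℝ`. -/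
def xi (F : UnitAdmissibleFrame W T10 θ) (q : E6) : E6 [⋀^Fin 3]→L[ℝ] ℂ :=
  wedge (lift (θ q.1)) (F.phi q)

/-- The product `φ̄ ∧ ψ`, where `φ̄ = e^{-is} θ̄¹ ∧ θ̄²`; as `φ̄` has even degree, it is
equal to `ψ ∧ φ̄`. -/
def wedgePhiBar {k : ℕ} (F : UnitAdmissibleFrame W T10 θ) (q : E6) (ψ : E6 [⋀^Fin k]→L[ℝ] ℂ) :
    E6 [⋀^Fin (k + 2)]→L[ℝ] ℂ :=
  (starRingEnd ℂ) (Complex.exp (Complex.I * q.2)) •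
    wedge (conjForm (lift (F.coframe 0 q.1))) (wedge (conjForm (lift (F.coframe 1 q.1))) ψ)

/-- The trace `Tr ψ = h^{αβ̄} ψ_{αβ̄}` of a `2`-form `ψ = i ψ_{αβ̄} θ^α ∧ θ̄^β + ⋯`, where
`ψ_{αβ̄} = -i ψ(Z_α, Z̄_β)` and `h^{αβ̄}h_{γβ̄} = δ^α_γ`.  The vectors `Z_α` are lifted
to `W × ℝ` with zero `s`-component. -/
def trace (F : UnitAdmissibleFrame W T10 θ) (q : E6) (ψ : E6 [⋀^Fin 2]→L[ℝ] ℂ) : ℂ :=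
  ∑ α, ∑ β, ((F.h q.1)ᵀ)⁻¹ α β * (-Complex.I *
    evalC2 ψ (((F.Z α q.1).1, 0), ((F.Z α q.1).2, 0))
      (conjVec (((F.Z β q.1).1, 0), ((F.Z β q.1).2, 0))))

/-- A real covector regarded as a complex valued one. -/
def ofRealForm (σ : E6 →L[ℝ] ℝ) : E6 →L[ℝ] ℂ := Complex.ofRealCLM.comp σ

/-- The real `1`-form `σ` on `W × ℝ` in the construction of the Fefferman metric (`n = 2`):
`dξ = i (n+2) σ ∧ ξ` and `σ ∧ dφ ∧ φ̄ = (Tr dσ) i σ ∧ θ ∧ φ ∧ φ̄`. -/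
structure IsFeffermanConnection (F : UnitAdmissibleFrame W T10 θ) (σ : E6 → E6 →L[ℝ] ℝ) :
    Prop where
  smooth : ContDiffOn ℝ ∞ σ (W ×ˢ Set.univ)
  d_xi : ∀ q ∈ W ×ˢ (Set.univ : Set ℝ),
    extDeriv F.xi q = (4 * Complex.I) • wedge (ofRealForm (σ q)) (F.xi q)
  d_phi : ∀ q ∈ W ×ˢ (Set.univ : Set ℝ),
    wedge (ofRealForm (σ q)) (F.wedgePhiBar q (extDeriv F.phi q)) =
      (F.trace q (dOne (fun z => ofRealForm (σ z)) q) * Complex.I) •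
        wedge (ofRealForm (σ q)) (wedge (lift (θ q.1)) (F.wedgePhiBar q (F.phi q)))

/-- The Fefferman metric `2 h_{αβ̄} θ^α·θ̄^β + 4 θ·σ` on `W × ℝ`. -/
def feffermanMetric (F : UnitAdmissibleFrame W T10 θ) (σ : E6 → E6 →L[ℝ] ℝ) (q v w : E6) : ℂ :=
  2 * ∑ α, ∑ β, F.h q.1 α β *
      symProd (lift (F.coframe α q.1)) (conjForm (lift (F.coframe β q.1))) v w
    + 4 * symProd (lift (θ q.1)) (ofRealForm (σ q)) v w

end UnitAdmissibleFrame

/-! ## Oriented Riemannian `3`-manifolds and their complexified cotangent bundle -/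

/-- The model space of the `3`-manifold. -/
abbrev E3 : Type := EuclideanSpace ℝ (Fin 3)

/-- The given atlas is oriented: all coordinate changes have positive Jacobian.  The manifold carries
the orientation for which these charts are positive. -/
def IsOrientedAtlas (S : Type*) [TopologicalSpace S] [ChartedSpace E3 S] : Prop :=
  ∀ e ∈ atlas E3 S, ∀ e' ∈ atlas E3 S, ∀ z ∈ (e.symm.trans e').source,
    0 < (fderiv ℝ (e.symm.trans e') z).det

section Manifold

variable {S : Type*} [TopologicalSpace S] [ChartedSpace E3 S] [IsManifold (𝓡 3) ∞ S]

variable (S) in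
/-- Smooth Riemannian metrics on `S`. -/
abbrev Metric3 : Type _ :=
  ContMDiffRiemannianMetric (𝓡 3) ∞ E3 (fun x : S => TangentSpace (𝓡 3) x)

variable (S) in
/-- The total space `ℂT*S` of the complexified cotangent bundle: pairs `(x, ζ)` with
`ζ : T_xS → ℂ` real linear. -/
abbrev CCot : Type _ :=
  TotalSpace (E3 →L[ℝ] ℂ)
    (fun x : S => TangentSpace (𝓡 3) x →L[ℝ] Bundle.Trivial S ℂ x)

/-- The model with corners of `ℂT*S`. -/
abbrev ICot : ModelWithCorners ℝ (E3 × (E3 →L[ℝ] ℂ)) (ModelProd E3 (E3 →L[ℝ] ℂ)) :=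
  (𝓡 3).prod 𝓘(ℝ, E3 →L[ℝ] ℂ)

/-- The tangent space of `ℂT*S` at any of its points `(x, ζ)`.  A tangent vector is `(a, w)` with
`a = (dx^i)` and `w = (dζ_i)` its components in the coordinates `(x^i, ζ_i)` induced by the preferred
chart at `x`. -/
abbrev TCot : Type := E3 × (E3 →L[ℝ] ℂ)

/-- The coordinate vector `∂/∂x^i`. -/
def coordVec (i : Fin 3) : E3 := EuclideanSpace.single i 1

/-- The components `g_{ij}` at `x`, in the preferred chart at `x`. -/
def gram (g : Metric3 S) (x : S) : Matrix (Fin 3) (Fin 3) ℝ :=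
  Matrix.of fun i j => g.inner x (coordVec i) (coordVec j)

/-- The components `g_{ij}` as functions of the coordinates `y` of the preferred chart at `x`. -/
def gramChart (g : Metric3 S) (x : S) (y : E3) (i j : Fin 3) : ℝ :=
  g.inner ((extChartAt (𝓡 3) x).symm y)
    (mfderiv 𝓘(ℝ, E3) (𝓡 3) (extChartAt (𝓡 3) x).symm y (coordVec i))
    (mfderiv 𝓘(ℝ, E3) (𝓡 3) (extChartAt (𝓡 3) x).symm y (coordVec j))

/-- The derivative `∂_k g_{ij}` at `x` in the preferred chart at `x`. -/
def dGram (g : Metric3 S) (x : S) (k i j : Fin 3) : ℝ :=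
  fderiv ℝ (fun y => gramChart g x y i j) (extChartAt (𝓡 3) x x) (coordVec k)

/-- The Christoffel symbol `Γ_{ij}{}^k` of the Levi-Civita connection at `x`, in the preferred chart
at `x`. -/
def christoffel (g : Metric3 S) (x : S) (i j k : Fin 3) : ℝ :=
  (1 / 2) * ∑ l, (gram g x)⁻¹ k l * (dGram g x i j l + dGram g x j i l - dGram g x l i j)

/-- The covector `ζ` of the point `(x, ζ)`, in the coordinates of the preferred chart at `x`. -/
def covec (p : CCot S) : E3 →L[ℝ] ℂ := p.2

/-- The components `ζ_i` of a complex covector. -/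
def comp (p : CCot S) (i : Fin 3) : ℂ := covec p (coordVec i)

/-- The components `ζ^i` of the complex tangent vector corresponding to `ζ`. -/
def compUp (g : Metric3 S) (p : CCot S) (i : Fin 3) : ℂ :=
  ∑ j, (((gram g p.1)⁻¹ i j : ℝ) : ℂ) * comp p j

/-- The complex bilinear square `g(ζ, ζ)`. -/
def nullFn (g : Metric3 S) (p : CCot S) : ℂ := ∑ i, compUp g p i * comp p i

/-- The hermitian square `g(ζ, ζ̄)`. -/
def hermFn (g : Metric3 S) (p : CCot S) : ℂ := ∑ i, compUp g p i * (starRingEnd ℂ) (comp p i)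

/-- The action `δ_c` of a complex number `c` on `ℂT*S`. -/
def scale (c : ℂ) (p : CCot S) : CCot S :=
  ⟨p.1, (c • covec p : E3 →L[ℝ] ℂ)⟩

/-- The differential of `scale c`. -/
def dScale (c : ℂ) (v : TCot) : TCot := (v.1, c • v.2)

/-! ## The twistor CR manifold -/

/-- The space `M̂` of non-zero complex null covectors. -/
def NullCone (g : Metric3 S) : Set (CCot S) := {p | nullFn g p = 0 ∧ ∃ i, comp p i ≠ 0}

theorem scale_mul (c d : ℂ) (p : CCot S) : scale (c * d) p = scale c (scale d p) := by
  have h : (c * d) • covec p = c • (d • covec p) := mul_smul c d (covec p)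
  exact congrArg (fun a : E3 →L[ℝ] ℂ => (⟨p.1, a⟩ : CCot S)) h

theorem scale_one (p : CCot S) : scale 1 p = p := by
  have h : (1 : ℂ) • covec p = covec p := one_smul ℂ (covec p)
  exact congrArg (fun a : E3 →L[ℝ] ℂ => (⟨p.1, a⟩ : CCot S)) h

/-- Two null covectors are equivalent if they lie in the same orbit of `ℂˣ`. -/
def orbitSetoid (g : Metric3 S) : Setoid (NullCone g) where
  r p p' := ∃ c : ℂ, c ≠ 0 ∧ (p' : CCot S) = scale c p
  iseqv :=
    { refl := fun p => ⟨1, one_ne_zero, (scale_one _).symm⟩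
      symm := by
        rintro p p' ⟨c, hc, h⟩
        exact ⟨c⁻¹, inv_ne_zero hc, by rw [h, ← scale_mul, inv_mul_cancel₀ hc, scale_one]⟩
      trans := by
        rintro p p' p'' ⟨c, hc, h⟩ ⟨d, hd, h'⟩
        exact ⟨d * c, mul_ne_zero hd hc, by rw [h', h, scale_mul]⟩ }

/-- The twistor CR manifold `M = M̂ / ℂˣ`, as a set. -/
def TwistorSpace (g : Metric3 S) : Type _ := Quotient (orbitSetoid g)

/-- The tangent space of `M̂` at `p`. -/
def tangentNull (g : Metric3 S) (p : CCot S) : Set TCot :=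
  {v | mfderiv ICot 𝓘(ℝ, ℂ) (nullFn g) p v = 0}

/-- The tangent space at `p` of the orbit of `ℂˣ`, that is, the kernel of `T_pM̂ → T_{[p]}M`. -/
def vertical (p : CCot S) : Set TCot :=
  {v | ∃ c : ℂ, v = (0, c • covec p)}

/-- The exterior derivative `ω = dζ_i ∧ dx^i` of the tautological form `ζ_i dx^i` on `ℂT*S`. -/
def omega (v w : TCot) : ℂ := v.2 w.1 - w.2 v.1

/-- The kernel `D` of the restriction of `ω` to `M̂`, a space of complexified tangent vectors
`a + i b` of `M̂`, represented by pairs `(a, b)`. -/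
def kernelD (g : Metric3 S) (p : CCot S) : Set (TCot × TCot) :=
  {z | z.1 ∈ tangentNull g p ∧ z.2 ∈ tangentNull g p ∧
    ∀ v ∈ tangentNull g p, omega z.1 v + Complex.I * omega z.2 v = 0}

/-! ## The adapted coframe -/

/-- The covector `dx^i` on `ℂT*S`. -/
def dx (i : Fin 3) : TCot →L[ℝ] ℂ :=
  (Complex.ofRealCLM.comp (EuclideanSpace.proj i : E3 →L[ℝ] ℝ)).comp
    (ContinuousLinearMap.fst ℝ E3 (E3 →L[ℝ] ℂ))

/-- The covector `dζ_i` on `ℂT*S`. -/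
def dzeta (i : Fin 3) : TCot →L[ℝ] ℂ :=
  (ContinuousLinearMap.apply ℝ ℂ (coordVec i)).comp
    (ContinuousLinearMap.snd ℝ E3 (E3 →L[ℝ] ℂ))

/-- The covector `δζ_j = dζ_j - Γ_{kj}{}^l ζ_l dx^k`. -/
def deltaZeta (g : Metric3 S) (p : CCot S) (j : Fin 3) : TCot →L[ℝ] ℂ :=
  dzeta j - ∑ k, ∑ l, ((christoffel g p.1 k j l : ℂ) * comp p l) • dx k

/-- The components `η^j` of the vector `η = i ζ × ζ̄ = 2 Re ζ × Im ζ`, that is,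
`η^j = i ε^{jkl} ζ_k ζ̄_l`, where `ε^{123} = (det g_{ij})^{-1/2}` as the charts are positive. -/
def etaUp (g : Metric3 S) (p : CCot S) : Fin 3 → ℝ :=
  (2 / Real.sqrt (gram g p.1).det) • ((fun i => (comp p i).re) ⨯₃ (fun i => (comp p i).im))

/-- The components `η_j = g_{jk} η^k`. -/
def etaDown (g : Metric3 S) (p : CCot S) : Fin 3 → ℝ := (gram g p.1) *ᵥ (etaUp g p)

/-- `θ = η_i dx^i`. -/
def theta (g : Metric3 S) (p : CCot S) : TCot →L[ℝ] ℂ := ∑ i, (etaDown g p i : ℂ) • dx i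

/-- `θ̃¹ = ζ_i dx^i`. -/
def theta1 (p : CCot S) : TCot →L[ℝ] ℂ := ∑ i, comp p i • dx i

/-- `θ̃² = i η^j δζ_j`. -/
def theta2 (g : Metric3 S) (p : CCot S) : TCot →L[ℝ] ℂ :=
  ∑ j, (Complex.I * (etaUp g p j : ℂ)) • deltaZeta g p j

/-- `θ̃³ = -(i/2) (ζ̄^j δζ_j - ζ^j δζ̄_j)`. -/
def theta3 (g : Metric3 S) (p : CCot S) : TCot →L[ℝ] ℂ :=
  (-(Complex.I / 2)) • ∑ j, ((starRingEnd ℂ) (compUp g p j) • deltaZeta g p j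
    - compUp g p j • conjForm (deltaZeta g p j))

/-- The `3`-form `θ ∧ θ̃¹ ∧ θ̃²`. -/
def theta012 (g : Metric3 S) (p : CCot S) : TCot [⋀^Fin 3]→L[ℝ] ℂ :=
  wedge (theta g p) (wedge (theta1 p) (oneForm (theta2 g p)))

/-- The tensor `2 (θ̃¹·conj θ̃² + θ̃²·conj θ̃¹ + θ·θ̃³)`. -/
def adaptedMetric (g : Metric3 S) (p : CCot S) (v w : TCot) : ℂ :=
  2 * (symProd (theta1 p) (conjForm (theta2 g p)) v w
    + symProd (theta2 g p) (conjForm (theta1 p)) v w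
    + symProd (theta g p) (theta3 g p) v w)

/-- The space `Ĉ` of complex covectors with `g(ζ, ζ) = 0` and `g(ζ, ζ̄) = 1`. -/
def CHat (g : Metric3 S) : Set (CCot S) := {p | nullFn g p = 0 ∧ hermFn g p = 1}

/-! ## The canonical bundle and the Fefferman space -/

/-- A non-zero element of the canonical bundle `K_M` at `[p]`, presented by a representative
`p ∈ M̂` and a `3`-form.  Only the restriction of the form to `T_pM̂` matters; it is the pull back of
a `3`-form on `T_{[p]}M = T_pM̂ / vertical`, and it is annihilated by `T^{0,1}M`, the image of `D`. -/
structure CanonicalElement (g : Metric3 S) where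
  pt : CCot S
  pt_mem : pt ∈ NullCone g
  form : TCot [⋀^Fin 3]→L[ℝ] ℂ
  vertical_contract : ∀ c ∈ vertical pt, ∀ v ∈ tangentNull g pt, ∀ w ∈ tangentNull g pt,
    form ![c, v, w] = 0
  kernel_contract : ∀ z ∈ kernelD g pt, ∀ v ∈ tangentNull g pt, ∀ w ∈ tangentNull g pt,
    form ![z.1, v, w] + Complex.I * form ![z.2, v, w] = 0
  ne_zero : ∃ v : Fin 3 → TCot, (∀ i, v i ∈ tangentNull g pt) ∧ form v ≠ 0

/-- Two presentations give the same point of the Fefferman space `K_M^× / ℝ₊`: the representatives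
`p` and `p' = c p` give the same point of `M`, and under this identification (the pull back by
`δ_c`) the two forms on `M̂` agree up to a positive factor. -/
def CanonicalElement.Rel {g : Metric3 S} (k k' : CanonicalElement g) : Prop :=
  ∃ c : ℂ, c ≠ 0 ∧ k'.pt = scale c k.pt ∧ ∃ r : ℝ, 0 < r ∧
    ∀ v : Fin 3 → TCot, (∀ i, v i ∈ tangentNull g k.pt) →
      k'.form (fun i => dScale c (v i)) = (r : ℂ) * k.form v

/-- The Fefferman space `𝒞 = K_M^× / ℝ₊` of the twistor CR manifold. -/
def FeffermanSpace (g : Metric3 S) : Type _ :=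
  Quot (CanonicalElement.Rel : CanonicalElement g → CanonicalElement g → Prop)

/-- A local parametrization `W → M` of the twistor CR manifold by an open set of `ℝ⁵`, given by a
smooth map `f : W → M̂` that induces an injective immersion `W → M = M̂ / ℂˣ`. -/
structure TwistorPatch (g : Metric3 S) where
  W : Set E5
  isOpen : IsOpen W
  f : E5 → NullCone g
  smooth : ContMDiffOn 𝓘(ℝ, E5) ICot ∞ (fun y => (f y : CCot S)) W
  inj : Set.InjOn (fun y => (Quotient.mk (orbitSetoid g) (f y) : TwistorSpace g)) W
  immersive : ∀ y ∈ W, ∀ v : E5,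
    mfderiv 𝓘(ℝ, E5) ICot (fun z => (f z : CCot S)) y v ∈ vertical (f y : CCot S) → v = 0

namespace TwistorPatch

variable {g : Metric3 S}

/-- The differential of `f` at `y`. -/
def df (P : TwistorPatch g) (y : E5) : E5 →L[ℝ] TCot :=
  mfderiv 𝓘(ℝ, E5) ICot (fun z => (P.f z : CCot S)) y

/-- The space `T^{0,1}M = π̃_* D` in the parametrization. -/
def T01 (P : TwistorPatch g) (y : E5) : Set (E5 × E5) :=
  {z | ∃ c₁ ∈ vertical (P.f y : CCot S), ∃ c₂ ∈ vertical (P.f y : CCot S),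
    (P.df y z.1 + c₁, P.df y z.2 + c₂) ∈ kernelD g (P.f y : CCot S)}

/-- The CR structure `T^{1,0}M`, the complex conjugate of `π̃_* D`, in the parametrization. -/
def T10 (P : TwistorPatch g) (y : E5) : Set (E5 × E5) := {z | conjVec z ∈ P.T01 y}

/-- The contact form on `M` to which `θ = η_i dx^i` descends, in the parametrization.  It is computed
at the representative `ζ / g(ζ, ζ̄)^{1/2} ∈ Ĉ` of the point `[ζ] ∈ M`, and `η` is homogeneous of
degree two. -/
def contactForm (P : TwistorPatch g) (y : E5) : E5 →L[ℝ] ℂ :=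
  ((hermFn g (P.f y : CCot S))⁻¹ • theta g (P.f y : CCot S)).comp (P.df y)

end TwistorPatch

/-- A local trivialization `(y, s) ↦ [e^{is} θ ∧ θ¹ ∧ θ²]` of the circle bundle `𝒞 → M`, given by a
local parametrization of `M` and a normalized admissible coframe. -/
structure FeffermanChart (g : Metric3 S) where
  patch : TwistorPatch g
  frame : UnitAdmissibleFrame patch.W patch.T10 patch.contactForm
  /-- the element `e^{is} θ ∧ θ¹ ∧ θ²` of the canonical bundle at the point `y` of the patch -/
  elt : E6 → CanonicalElement g
  elt_pt : ∀ q ∈ patch.W ×ˢ (Set.univ : Set ℝ), (elt q).pt = (patch.f q.1 : CCot S)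
  elt_form : ∀ q ∈ patch.W ×ˢ (Set.univ : Set ℝ), ∀ v : Fin 3 → E5,
    (elt q).form (fun i => patch.df q.1 (v i)) = frame.canonicalForm q v

namespace FeffermanChart

variable {g : Metric3 S}

/-- The domain `W × ℝ`. -/
def domain (Φ : FeffermanChart g) : Set E6 := Φ.patch.W ×ˢ (Set.univ : Set ℝ)

/-- The map `W × ℝ → 𝒞`. -/
def param (Φ : FeffermanChart g) (q : E6) : FeffermanSpace g := Quot.mk _ (Φ.elt q)

end FeffermanChart

/-- The topology of the circle bundle `𝒞`: a set is open if its preimages under all the local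
trivializations `W × ℝ → 𝒞` are open. -/
instance (g : Metric3 S) : TopologicalSpace (FeffermanSpace g) :=
  ⨆ Φ : FeffermanChart g,
    TopologicalSpace.coinduced (fun q : Φ.domain => Φ.param q) inferInstance

/-- `ϖ : Ĉ → 𝒞` is the map `u ↦ [(θ ∧ θ̃¹ ∧ θ̃²)_u]`. -/
def IsCanonicalMap (g : Metric3 S) (ϖ : CHat g → FeffermanSpace g) : Prop :=
  ∀ u : CHat g, ∃ k : CanonicalElement g,
    k.pt = (u : CCot S) ∧ k.form = theta012 g (u : CCot S) ∧ ϖ u = Quot.mk _ k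

/-- The smooth map `τ : O → Ĉ`, on an open subset `O` of `W × ℝ`, is a lift of the local
parametrization `W × ℝ → 𝒞` through `ϖ`. -/
structure IsLocalLift {g : Metric3 S} (ϖ : CHat g → FeffermanSpace g) (Φ : FeffermanChart g)
    (O : Set E6) (τ : E6 → CHat g) : Prop where
  isOpen : IsOpen O
  subset : O ⊆ Φ.domain
  smooth : ContMDiffOn 𝓘(ℝ, E6) ICot ∞ (fun q => (τ q : CCot S)) O
  lift : ∀ q ∈ O, ϖ (τ q) = Φ.param q

/-- The differential of a map `τ : W × ℝ → Ĉ`. -/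
def dLift {g : Metric3 S} (τ : E6 → CHat g) (q : E6) : E6 →L[ℝ] TCot :=
  mfderiv 𝓘(ℝ, E6) ICot (fun z => (τ z : CCot S)) q

end Manifold

end TwistorFefferman

end

open TwistorFefferman

/-! The proof is Cartan's method of moving frames on `CHat`, followed by a comparison with an
arbitrary normalized coframe of the CR manifold.

A null covector ζ, its conjugate and η form a complex triad (`triad_complete`). The Levi-Civita
connection is metric and torsion free, so differentiating g(ζ,ζ) = 0, g(ζ,ζ̄) = 1, g(η,ζ) = 0 and
g(η,η) = 1 determines every contraction that occurs in the exterior derivatives of ζ_i dx^i and η_i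
dx^i. The result is dθ̃¹ = i(θ̃³∧θ̃¹ − θ̃²∧θ) and dθ = i(θ̃¹∧conj θ̃² + θ̃²∧conj θ̃¹)
(`dOne_cTheta1`, `dOne_cTheta`). In particular the Levi matrix of (θ̃¹, θ̃²) is antidiagonal with
entries 1.

These two equations and d² = 0 imply (`StructureEqs`) that d(θ∧θ̃¹∧θ̃²) = 2i θ̃³∧θ∧θ̃¹∧θ̃², that
θ̃³∧d(θ̃¹∧θ̃²) vanishes after multiplication by conj(θ̃¹∧θ̃²), and that dθ̃³ has no trace. So σ =
θ̃³/2 solves both equations of the Fefferman connection form. By the first equation and reality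
another solution has the form θ̃³/2 + aθ. Since dθ has trace 2, the second equation becomes −2ia =
ia, hence a = 0 (`connection_unique`). Inserting σ = θ̃³/2 gives the formula for the metric.

A chart of the Fefferman space carries some coframe θ^α, and a local lift to `CHat` pulls back θ̃¹,
θ̃². The two pairs are related by a 2×2 matrix without θ-components, because the Reeb field is the
same, and its determinant is r e^{is} with r > 0. Both Levi determinants have modulus one, so r = 1
(`frame_change`). Then φ and the Levi form take the same shape in either frame.

For the covering, each canonical element is κ θ∧θ̃¹∧θ̃² with κ ≠ 0 (`CanonicalElement.exists_coef`),
and scaling ζ by c multiplies θ∧θ̃¹∧θ̃² by |c|⁴c² (`theta012_scale`). Points of the Fefferman space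
are therefore compared through c² up to positive factors. On `CHat`, where |c| = 1, this leaves c =
±1. Square roots of κ give surjectivity, and smooth local square roots give local lifts
(`exists_localLift`). The lifts make ϖ open, stereographic charts make it continuous, and the free
involution ζ ↦ −ζ makes it a covering.

No transformation law of Christoffel symbols is needed. Calculations take place in one chart,
θ∧θ̃¹∧θ̃² = i θ̃¹∧dθ̃¹ is visibly independent of it, and for the metric at a point the chart is the
preferred one at that point. -/

open Bundle Manifold ContDiff Matrix
open scoped Topology

noncomputable section

namespace TwistorFefferman

/-! ### Exterior algebra and exterior derivative of complex valued forms. -/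

section WedgeAlgebra

set_option synthInstance.maxHeartbeats 400000
set_option maxHeartbeats 1000000

variable {E : Type*} [NormedAddCommGroup E] [NormedSpace ℝ E] {k : ℕ}

theorem wedge_apply (α : E →L[ℝ] ℂ) (ψ : E [⋀^Fin k]→L[ℝ] ℂ) (v : Fin (k + 1) → E) :
    wedge α ψ v = ∑ i : Fin (k + 1), (-1) ^ (i : ℕ) * (α (v i) * ψ (i.removeNth v)) := by
  simp [wedge, ContinuousAlternatingMap.alternatizeUncurryFin_apply, zsmul_eq_mul]

/-- The wedge product as a continuous bilinear map. -/
def wedgeCLM : (E →L[ℝ] ℂ) →L[ℝ] (E [⋀^Fin k]→L[ℝ] ℂ) →L[ℝ] (E [⋀^Fin (k + 1)]→L[ℝ] ℂ) :=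
  (ContinuousLinearMap.compL ℝ (E [⋀^Fin k]→L[ℝ] ℂ) (E →L[ℝ] E [⋀^Fin k]→L[ℝ] ℂ)
    (E [⋀^Fin (k + 1)]→L[ℝ] ℂ)
    (ContinuousAlternatingMap.alternatizeUncurryFinCLM ℝ E ℂ)).comp
    ((ContinuousLinearMap.flipₗᵢ ℝ E (E [⋀^Fin k]→L[ℝ] ℂ)
      (E [⋀^Fin k]→L[ℝ] ℂ)).toContinuousLinearEquiv.toContinuousLinearMap.comp
      (ContinuousLinearMap.compL ℝ E ℂ _ (ContinuousLinearMap.lsmul ℝ ℂ)))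

theorem wedgeCLM_apply (α : E →L[ℝ] ℂ) (ψ : E [⋀^Fin k]→L[ℝ] ℂ) : wedgeCLM α ψ = wedge α ψ := rfl

theorem wedge_add_left (α β : E →L[ℝ] ℂ) (ψ : E [⋀^Fin k]→L[ℝ] ℂ) :
    wedge (α + β) ψ = wedge α ψ + wedge β ψ := by
  ext v
  simp only [wedge_apply, _root_.add_apply, ContinuousAlternatingMap.add_apply, add_mul, mul_add,
    Finset.sum_add_distrib]

theorem wedge_add_right (α : E →L[ℝ] ℂ) (ψ χ : E [⋀^Fin k]→L[ℝ] ℂ) :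
    wedge α (ψ + χ) = wedge α ψ + wedge α χ := by
  ext v
  simp only [wedge_apply, ContinuousAlternatingMap.add_apply, mul_add, Finset.sum_add_distrib]

theorem wedge_sub_left (α β : E →L[ℝ] ℂ) (ψ : E [⋀^Fin k]→L[ℝ] ℂ) :
    wedge (α - β) ψ = wedge α ψ - wedge β ψ := by
  ext v
  simp only [wedge_apply, _root_.sub_apply, ContinuousAlternatingMap.sub_apply, sub_mul, mul_sub,
    Finset.sum_sub_distrib]

theorem wedge_sub_right (α : E →L[ℝ] ℂ) (ψ χ : E [⋀^Fin k]→L[ℝ] ℂ) :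
    wedge α (ψ - χ) = wedge α ψ - wedge α χ := by
  ext v
  simp only [wedge_apply, ContinuousAlternatingMap.sub_apply, mul_sub, Finset.sum_sub_distrib]

theorem wedge_neg_right (α : E →L[ℝ] ℂ) (ψ : E [⋀^Fin k]→L[ℝ] ℂ) :
    wedge α (-ψ) = -wedge α ψ := by
  ext v
  simp only [wedge_apply, ContinuousAlternatingMap.neg_apply, mul_neg, Finset.sum_neg_distrib]

@[simp] theorem wedge_zero_right (α : E →L[ℝ] ℂ) : wedge α (0 : E [⋀^Fin k]→L[ℝ] ℂ) = 0 := by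
  simp [← wedgeCLM_apply]

@[simp] theorem wedge_zero_left (ψ : E [⋀^Fin k]→L[ℝ] ℂ) : wedge (0 : E →L[ℝ] ℂ) ψ = 0 := by
  simp [← wedgeCLM_apply]

theorem wedge_smul_left (c : ℂ) (α : E →L[ℝ] ℂ) (ψ : E [⋀^Fin k]→L[ℝ] ℂ) :
    wedge (c • α) ψ = c • wedge α ψ := by
  ext v
  simp only [wedge_apply, ContinuousAlternatingMap.smul_apply, _root_.smul_apply,
    smul_eq_mul, Finset.mul_sum]
  exact Finset.sum_congr rfl fun i _ => by ring

theorem wedge_smul_right (c : ℂ) (α : E →L[ℝ] ℂ) (ψ : E [⋀^Fin k]→L[ℝ] ℂ) :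
    wedge α (c • ψ) = c • wedge α ψ := by
  ext v
  simp only [wedge_apply, ContinuousAlternatingMap.smul_apply, smul_eq_mul, Finset.mul_sum]
  exact Finset.sum_congr rfl fun i _ => by ring

theorem alternatizeUncurryFin_neg (F : E →L[ℝ] E [⋀^Fin k]→L[ℝ] ℂ) :
    ContinuousAlternatingMap.alternatizeUncurryFin (-F) =
      -ContinuousAlternatingMap.alternatizeUncurryFin F := by
  ext v
  rw [ContinuousAlternatingMap.neg_apply, ContinuousAlternatingMap.alternatizeUncurryFin_apply,
    ContinuousAlternatingMap.alternatizeUncurryFin_apply, ← Finset.sum_neg_distrib]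
  exact Finset.sum_congr rfl fun i _ => smul_neg _ _

/-- Alternating twice a bilinear map with values in forms is antisymmetric in the bilinear map. -/
theorem alternatize_wedge_family (α : E →L[ℝ] ℂ) (F : E →L[ℝ] E [⋀^Fin k]→L[ℝ] ℂ) :
    ContinuousAlternatingMap.alternatizeUncurryFin ((wedgeCLM α).comp F) =
      -wedge α (ContinuousAlternatingMap.alternatizeUncurryFin F) := by
  -- Alternating f(v, w) = α(w) F(v) over w and then over v gives the left side; doing the same with
  -- the flipped map gives α ∧ Alt F.
  let f : E →L[ℝ] E →L[ℝ] E [⋀^Fin k]→L[ℝ] ℂ :=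
    ((ContinuousLinearMap.flipₗᵢ ℝ E (E [⋀^Fin k]→L[ℝ] ℂ) (E [⋀^Fin k]→L[ℝ] ℂ)
      (ContinuousLinearMap.compL ℝ E ℂ _ (ContinuousLinearMap.lsmul ℝ ℂ) α))).comp F
  have hf : ∀ v w, f v w = α w • F v := fun v w => rfl
  -- The double alternation depends on f only through the differences f(a, b) − f(b, a), so flipping
  -- f changes its sign.
  have key : ContinuousAlternatingMap.alternatizeUncurryFin
      ((ContinuousAlternatingMap.alternatizeUncurryFinCLM ℝ E ℂ).comp f) =
      -ContinuousAlternatingMap.alternatizeUncurryFin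
      ((ContinuousAlternatingMap.alternatizeUncurryFinCLM ℝ E ℂ).comp f.flip) := by
    ext v
    rw [ContinuousAlternatingMap.neg_apply,
      ContinuousAlternatingMap.alternatizeUncurryFin_alternatizeUncurryFinCLM_comp_apply,
      ContinuousAlternatingMap.alternatizeUncurryFin_alternatizeUncurryFinCLM_comp_apply,
      ← Finset.sum_neg_distrib]
    refine Finset.sum_congr rfl fun i _ => ?_
    rw [← Finset.sum_neg_distrib]
    refine Finset.sum_congr rfl fun j _ => ?_
    rw [← smul_neg, neg_sub]
    rfl
  have h1 : (ContinuousAlternatingMap.alternatizeUncurryFinCLM ℝ E ℂ).comp f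
      = (wedgeCLM α).comp F := rfl
  have h2 : (ContinuousAlternatingMap.alternatizeUncurryFinCLM ℝ E ℂ).comp f.flip
      = α.smulRight (ContinuousAlternatingMap.alternatizeUncurryFin F) := by
    ext1 v
    have : f.flip v = α v • F := by ext1 w; simp [hf]
    change ContinuousAlternatingMap.alternatizeUncurryFin (f.flip v) = _
    rw [this]
    simp [ContinuousAlternatingMap.alternatizeUncurryFin_smul]
  rw [h1, h2] at key
  exact key

/-- The special case F = β ⊗ ψ of the antisymmetry above. Together with bilinearity it replaces
associativity and graded commutativity: all products are iterated multiplications by covectors from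
the left. -/
theorem wedge_wedge_comm (α β : E →L[ℝ] ℂ) (ψ : E [⋀^Fin k]→L[ℝ] ℂ) :
    wedge α (wedge β ψ) = -wedge β (wedge α ψ) := by
  have := alternatize_wedge_family α (β.smulRight ψ)
  have h : (wedgeCLM α).comp (β.smulRight ψ) = β.smulRight (wedge α ψ) := by
    ext1 v
    simp [wedgeCLM_apply, wedge_smul_right]
  rw [h] at this
  exact (neg_eq_iff_eq_neg.mpr this).symm

theorem self_eq_neg' {ψ : E [⋀^Fin k]→L[ℝ] ℂ} (h : ψ = -ψ) : ψ = 0 := by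
  ext v
  have := congrArg (fun χ : E [⋀^Fin k]→L[ℝ] ℂ => χ v) h
  exact self_eq_neg.mp this

@[simp] theorem wedge_wedge_self (α : E →L[ℝ] ℂ) (ψ : E [⋀^Fin k]→L[ℝ] ℂ) :
    wedge α (wedge α ψ) = 0 := self_eq_neg' (wedge_wedge_comm α α ψ)

@[simp] theorem oneForm_apply (α : E →L[ℝ] ℂ) (v : Fin 1 → E) : oneForm α v = α (v 0) := rfl

theorem wedge_oneForm_apply (α β : E →L[ℝ] ℂ) (v w : E) :
    wedge α (oneForm β) ![v, w] = α v * β w - α w * β v := by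
  simp [wedge_apply, Fin.sum_univ_succ, Fin.removeNth]
  ring

theorem twoForm_ext {ψ χ : E [⋀^Fin 2]→L[ℝ] ℂ} (h : ∀ v w, ψ ![v, w] = χ ![v, w]) : ψ = χ := by
  ext v
  have hv : v = ![v 0, v 1] := by ext i; fin_cases i <;> rfl
  rw [hv]; exact h _ _

theorem wedge_oneForm_comm (α β : E →L[ℝ] ℂ) : wedge α (oneForm β) = -wedge β (oneForm α) :=
  twoForm_ext fun v w => by
    rw [ContinuousAlternatingMap.neg_apply, wedge_oneForm_apply, wedge_oneForm_apply]; ring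

@[simp] theorem wedge_oneForm_self (α : E →L[ℝ] ℂ) : wedge α (oneForm α) = 0 :=
  self_eq_neg' (wedge_oneForm_comm α α)

/-- `oneForm` as a continuous linear map. -/
def oneFormCLM : (E →L[ℝ] ℂ) →L[ℝ] (E [⋀^Fin 1]→L[ℝ] ℂ) :=
  (ContinuousAlternatingMap.ofSubsingletonLIE (𝕜 := ℝ) (E := E) (F := ℂ) (0 : Fin 1)).toContinuousLinearEquiv.toContinuousLinearMap

theorem oneFormCLM_apply (α : E →L[ℝ] ℂ) : oneFormCLM α = oneForm α := rfl

variable {α β γ : E → E →L[ℝ] ℂ} {y : E}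

theorem dOne_eq (hα : DifferentiableAt ℝ α y) :
    dOne α y = ContinuousAlternatingMap.alternatizeUncurryFin (oneFormCLM.comp (fderiv ℝ α y)) := by
  have : fderiv ℝ (fun z => oneForm (α z)) y = oneFormCLM.comp (fderiv ℝ α y) :=
    (HasFDerivAt.comp (g := oneFormCLM) y oneFormCLM.hasFDerivAt hα.hasFDerivAt).fderiv
  rw [dOne, extDeriv, this]

theorem dOne_apply (hα : DifferentiableAt ℝ α y) (v w : E) :
    dOne α y ![v, w] = fderiv ℝ α y v w - fderiv ℝ α y w v := by
  rw [dOne_eq hα, ContinuousAlternatingMap.alternatizeUncurryFin_apply]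
  simp [Fin.sum_univ_succ, Fin.removeNth, oneFormCLM_apply]
  ring

theorem dOne_congr (h : α =ᶠ[𝓝 y] β) : dOne α y = dOne β y :=
  Filter.EventuallyEq.extDeriv_eq (h.fun_comp oneForm)

theorem dOne_smul (hα : DifferentiableAt ℝ α y) {c : E → ℂ} (hc : DifferentiableAt ℝ c y) :
    dOne (fun z => c z • α z) y = c y • dOne α y + wedge (fderiv ℝ c y) (oneForm (α y)) := by
  refine twoForm_ext fun v w => ?_
  have h : HasFDerivAt (fun z => c z • α z) _ y := hc.hasFDerivAt.smul hα.hasFDerivAt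
  rw [dOne_apply h.differentiableAt, ContinuousAlternatingMap.add_apply,
    ContinuousAlternatingMap.smul_apply, dOne_apply hα, wedge_oneForm_apply, h.fderiv]
  simp
  ring

/-- The Leibniz rule for the derivative of a bilinear map. The first term stands for dα ∧ ψ; a
product of a two-form with ψ is not available, so it stays an alternation until ψ is itself a
product of covectors. -/
theorem extDeriv_wedge {ψ : E → E [⋀^Fin k]→L[ℝ] ℂ} (hα : DifferentiableAt ℝ α y)
    (hψ : DifferentiableAt ℝ ψ y) :
    extDeriv (fun z => wedge (α z) (ψ z)) y =
      ContinuousAlternatingMap.alternatizeUncurryFin ((wedgeCLM.flip (ψ y)).comp (fderiv ℝ α y))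
        - wedge (α y) (extDeriv ψ y) := by
  have h : fderiv ℝ (fun z => wedge (α z) (ψ z)) y =
      (wedgeCLM (α y)).comp (fderiv ℝ ψ y) + (wedgeCLM.flip (ψ y)).comp (fderiv ℝ α y) := by
    have := (wedgeCLM (E := E) (k := k)).isBoundedBilinearMap.hasFDerivAt (α y, ψ y)
    have h2 := this.comp y (hα.hasFDerivAt.prodMk hψ.hasFDerivAt)
    refine h2.fderiv.trans ?_
    ext1 v
    simp [IsBoundedBilinearMap.deriv]
  rw [extDeriv, h, ContinuousAlternatingMap.alternatizeUncurryFin_add, alternatize_wedge_family,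
    ← extDeriv]
  abel

/-- A two-form commutes with every form, so dα ∧ β can be written β ∧ dα, with the covector on the
left. -/
theorem extDeriv_wedge_oneForm (hα : DifferentiableAt ℝ α y) (hβ : DifferentiableAt ℝ β y) :
    extDeriv (fun z => wedge (α z) (oneForm (β z))) y =
      wedge (β y) (dOne α y) - wedge (α y) (dOne β y) := by
  have hβ' : DifferentiableAt ℝ (fun z => oneForm (β z)) y :=
    DifferentiableAt.comp (g := oneFormCLM) y (oneFormCLM.differentiableAt (x := β y)) hβ
  rw [extDeriv_wedge hα hβ']
  congr 1
  have : (wedgeCLM.flip (oneForm (β y))).comp (fderiv ℝ α y) =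
      -((wedgeCLM (β y)).comp (oneFormCLM.comp (fderiv ℝ α y))) := by
    ext1 v
    exact wedge_oneForm_comm (fderiv ℝ α y v) (β y)
  rw [this, dOne_eq hα]
  have h2 := alternatize_wedge_family (β y) (oneFormCLM.comp (fderiv ℝ α y))
  rw [alternatizeUncurryFin_neg, h2, neg_neg]

theorem extDeriv_wedge_wedge_oneForm (hα : DifferentiableAt ℝ α y) (hβ : DifferentiableAt ℝ β y)
    (hγ : DifferentiableAt ℝ γ y) :
    extDeriv (fun z => wedge (α z) (wedge (β z) (oneForm (γ z)))) y =
      wedge (β y) (wedge (γ y) (dOne α y)) -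
        wedge (α y) (wedge (γ y) (dOne β y) - wedge (β y) (dOne γ y)) := by
  have hγ' : DifferentiableAt ℝ (fun z => oneForm (γ z)) y :=
    DifferentiableAt.comp (g := oneFormCLM) y (oneFormCLM.differentiableAt (x := γ y)) hγ
  have hβγ : DifferentiableAt ℝ (fun z => wedge (β z) (oneForm (γ z))) y :=
    DifferentiableAt.comp (g := fun x : (E →L[ℝ] ℂ) × (E [⋀^Fin 1]→L[ℝ] ℂ) => wedgeCLM x.1 x.2)
      (f := fun z => (β z, oneForm (γ z))) y
      ((wedgeCLM (E := E) (k := 1)).isBoundedBilinearMap.differentiableAt (β y, oneForm (γ y)))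
      (hβ.prodMk hγ')
  rw [extDeriv_wedge hα hβγ, extDeriv_wedge_oneForm hβ hγ]
  congr 1
  have h1 : (wedgeCLM.flip (wedge (β y) (oneForm (γ y)))).comp (fderiv ℝ α y) =
      (wedgeCLM (β y)).comp ((wedgeCLM (γ y)).comp (oneFormCLM.comp (fderiv ℝ α y))) := by
    ext1 v
    change wedge _ (wedge _ _) = wedge _ (wedge _ (oneForm _))
    rw [wedge_wedge_comm, wedge_oneForm_comm, wedge_neg_right, neg_neg]
  rw [h1, alternatize_wedge_family, alternatize_wedge_family, wedge_neg_right, neg_neg, dOne_eq hα]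

/-- Evaluation of a wedge product on a tuple whose tail is annihilated by the first factor. -/
theorem wedge_cons_of_tail (α : E →L[ℝ] ℂ) (ψ : E [⋀^Fin k]→L[ℝ] ℂ) (v : E) (w : Fin k → E)
    (h : ∀ i, α (w i) = 0) : wedge α ψ (Matrix.vecCons v w) = α v * ψ w := by
  rw [wedge_apply, Fin.sum_univ_succ]
  rw [Finset.sum_eq_zero fun i _ => ?_]
  · simp only [Fin.val_zero, pow_zero, one_mul, Matrix.cons_val_zero, add_zero]
    congr 1
  · have : α (Matrix.vecCons v w i.succ) = 0 := h i
    rw [this]; ring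

end WedgeAlgebra

/-! ### Linear algebra of null covectors and the Levi-Civita connection at a point. -/

section NullTriads

open ComplexConjugate

/-- The cross product transforms by the cofactor matrix. This yields both the length of η and its
behaviour under changes of coordinates. -/
theorem crossProduct_mulVec (M : Matrix (Fin 3) (Fin 3) ℝ) (u v : Fin 3 → ℝ) :
    (M *ᵥ u) ⨯₃ (M *ᵥ v) = (M.adjugate)ᵀ *ᵥ (u ⨯₃ v) := by
  rw [Matrix.adjugate_fin_three]
  ext i
  fin_cases i <;>
    simp [cross_apply, Matrix.mulVec, dotProduct, Fin.sum_univ_three, Matrix.transpose] <;> ring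

/-- The complex inverse metric. -/
def invC (G : Matrix (Fin 3) (Fin 3) ℝ) : Matrix (Fin 3) (Fin 3) ℂ := G⁻¹.map Complex.ofReal

/-- Raising the index of a complex covector. -/
def upC (G : Matrix (Fin 3) (Fin 3) ℝ) (z : Fin 3 → ℂ) : Fin 3 → ℂ := invC G *ᵥ z

/-- The complex bilinear inverse metric. -/
def pairC (G : Matrix (Fin 3) (Fin 3) ℝ) (z w : Fin 3 → ℂ) : ℂ := upC G z ⬝ᵥ w

/-- The vector `2 Re z × Im z`. -/
def etaU (G : Matrix (Fin 3) (Fin 3) ℝ) (z : Fin 3 → ℂ) : Fin 3 → ℝ :=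
  (2 / Real.sqrt G.det) • ((fun i => (z i).re) ⨯₃ (fun i => (z i).im))

/-- The covector `2 Re z × Im z`. -/
def etaD (G : Matrix (Fin 3) (Fin 3) ℝ) (z : Fin 3 → ℂ) : Fin 3 → ℝ := G *ᵥ etaU G z

/-- The complex conjugate of a complex covector. -/
def conjC (z : Fin 3 → ℂ) : Fin 3 → ℂ := fun i => conj (z i)

/-- A real tuple regarded as a complex one. -/
def realC (a : Fin 3 → ℝ) : Fin 3 → ℂ := fun i => (a i : ℂ)

variable {G : Matrix (Fin 3) (Fin 3) ℝ} {z w : Fin 3 → ℂ}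

theorem invC_transpose (hG : G.PosDef) : (invC G)ᵀ = invC G := by
  have h : (G⁻¹)ᵀ = G⁻¹ := by
    have := hG.isHermitian.inv
    rwa [Matrix.IsHermitian, Matrix.conjTranspose_eq_transpose_of_trivial] at this
  rw [invC, ← Matrix.transpose_map, h]

theorem posDef_transpose (hG : G.PosDef) : Gᵀ = G := by
  have := hG.isHermitian
  rwa [Matrix.IsHermitian, Matrix.conjTranspose_eq_transpose_of_trivial] at this

theorem pairC_comm (hG : G.PosDef) (z w : Fin 3 → ℂ) : pairC G z w = pairC G w z := by
  rw [pairC, pairC, upC, upC, dotProduct_comm, dotProduct_mulVec, ← Matrix.mulVec_transpose,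
    invC_transpose hG]

theorem upC_realC (G : Matrix (Fin 3) (Fin 3) ℝ) (a : Fin 3 → ℝ) :
    upC G (realC a) = realC (G⁻¹ *ᵥ a) := by
  ext i
  simp [upC, invC, realC, Matrix.mulVec, dotProduct]

theorem upC_etaD (hG : G.PosDef) (z : Fin 3 → ℂ) : upC G (realC (etaD G z)) = realC (etaU G z) := by
  rw [upC_realC, etaD, Matrix.mulVec_mulVec, Matrix.nonsing_inv_mul _ (hG.det_pos.ne'.isUnit),
    Matrix.one_mulVec]

theorem etaU_dot (G : Matrix (Fin 3) (Fin 3) ℝ) (z : Fin 3 → ℂ) :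
    realC (etaU G z) ⬝ᵥ z = 0 := by
  apply Complex.ext <;>
    simp [realC, etaU, dotProduct, Fin.sum_univ_three, cross_apply] <;> ring

theorem etaU_conjC (G : Matrix (Fin 3) (Fin 3) ℝ) (z : Fin 3 → ℂ) :
    realC (etaU G z) ⬝ᵥ conjC z = 0 := by
  have := congrArg conj (etaU_dot G z)
  simpa [dotProduct, realC, conjC] using this

theorem upC_conjC (G : Matrix (Fin 3) (Fin 3) ℝ) (z : Fin 3 → ℂ) :
    upC G (conjC z) = conjC (upC G z) := by
  ext i; simp [upC, conjC, invC, Matrix.mulVec, dotProduct]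

theorem conj_dot (a b : Fin 3 → ℂ) : conj (a ⬝ᵥ b) = conjC a ⬝ᵥ conjC b := by
  simp [dotProduct, conjC]

@[simp] theorem conjC_conjC (z : Fin 3 → ℂ) : conjC (conjC z) = z := by
  ext i; simp [conjC]

@[simp] theorem conjC_realC (a : Fin 3 → ℝ) : conjC (realC a) = realC a := by
  ext i; simp [conjC, realC]

theorem conj_pairC (G : Matrix (Fin 3) (Fin 3) ℝ) (z w : Fin 3 → ℂ) :
    conj (pairC G z w) = pairC G (conjC z) (conjC w) := by
  rw [pairC, conj_dot, pairC, upC_conjC]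

/-- The real inverse metric. -/
def pairR (G : Matrix (Fin 3) (Fin 3) ℝ) (a b : Fin 3 → ℝ) : ℝ := (G⁻¹ *ᵥ a) ⬝ᵥ b

theorem pairC_re_im (hG : G.PosDef) (z : Fin 3 → ℂ) :
    pairC G z z = (pairR G (fun i => (z i).re) (fun i => (z i).re) -
      pairR G (fun i => (z i).im) (fun i => (z i).im) : ℝ)
      + (2 * pairR G (fun i => (z i).re) (fun i => (z i).im) : ℝ) * Complex.I := by
  have hz : z = realC (fun i => (z i).re) + Complex.I • realC (fun i => (z i).im) := by
    ext i; simp [realC, mul_comm Complex.I]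
  set a : Fin 3 → ℝ := fun i => (z i).re
  set b : Fin 3 → ℝ := fun i => (z i).im
  have hr : ∀ c d : Fin 3 → ℝ, pairC G (realC c) (realC d) = (pairR G c d : ℂ) := fun c d => by
    rw [pairC, upC_realC, pairR]; simp [realC, dotProduct]
  have hab : pairC G (realC b) (realC a) = pairC G (realC a) (realC b) := pairC_comm hG _ _
  have : pairC G z z = pairC G (realC a) (realC a) + Complex.I * pairC G (realC a) (realC b)
      + Complex.I * pairC G (realC b) (realC a) + Complex.I * Complex.I * pairC G (realC b) (realC b) := by
    conv_lhs => rw [hz]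
    simp only [pairC, upC, Matrix.mulVec_add, Matrix.mulVec_smul, add_dotProduct, dotProduct_add,
      smul_dotProduct, dotProduct_smul, smul_eq_mul]
    ring
  rw [this, hab, hr, hr, hr, Complex.I_mul_I]
  push_cast; ring

theorem pairC_conj_re_im (hG : G.PosDef) (z : Fin 3 → ℂ) :
    pairC G z (conjC z) = (pairR G (fun i => (z i).re) (fun i => (z i).re) +
      pairR G (fun i => (z i).im) (fun i => (z i).im) : ℝ) := by
  have hz : z = realC (fun i => (z i).re) + Complex.I • realC (fun i => (z i).im) := by
    ext i; simp [realC, mul_comm Complex.I]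
  have hz' : conjC z = realC (fun i => (z i).re) - Complex.I • realC (fun i => (z i).im) := by
    ext i
    apply Complex.ext <;> simp [realC, conjC]
  set a : Fin 3 → ℝ := fun i => (z i).re
  set b : Fin 3 → ℝ := fun i => (z i).im
  have hr : ∀ c d : Fin 3 → ℝ, pairC G (realC c) (realC d) = (pairR G c d : ℂ) := fun c d => by
    rw [pairC, upC_realC, pairR]; simp [realC, dotProduct]
  have hab : pairC G (realC b) (realC a) = pairC G (realC a) (realC b) := pairC_comm hG _ _
  have : pairC G z (conjC z) = pairC G (realC a) (realC a) - Complex.I * pairC G (realC a) (realC b)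
      + Complex.I * pairC G (realC b) (realC a) - Complex.I * Complex.I * pairC G (realC b) (realC b) := by
    rw [hz']
    conv_lhs => rw [hz]
    simp only [pairC, upC, Matrix.mulVec_add, Matrix.mulVec_smul, add_dotProduct, dotProduct_sub,
      smul_dotProduct, dotProduct_smul, smul_eq_mul]
    ring
  rw [this, hab, hr, hr, hr, Complex.I_mul_I]
  push_cast; ring

theorem pairR_pos (hG : G.PosDef) {a : Fin 3 → ℝ} (ha : a ≠ 0) : 0 < pairR G a a := by
  have := hG.inv.dotProduct_mulVec_pos ha
  rw [pairR, dotProduct_comm]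
  simpa using this

theorem pairR_nonneg (hG : G.PosDef) (a : Fin 3 → ℝ) : 0 ≤ pairR G a a := by
  by_cases ha : a = 0
  · simp [ha, pairR]
  · exact (pairR_pos hG ha).le

/-- The hermitian square of a complex covector, as a real number. -/
def hermR (G : Matrix (Fin 3) (Fin 3) ℝ) (z : Fin 3 → ℂ) : ℝ :=
  pairR G (fun i => (z i).re) (fun i => (z i).re) + pairR G (fun i => (z i).im) (fun i => (z i).im)

theorem pairC_conjC (hG : G.PosDef) (z : Fin 3 → ℂ) : pairC G z (conjC z) = (hermR G z : ℂ) :=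
  pairC_conj_re_im hG z

theorem hermR_pos (hG : G.PosDef) (hz : z ≠ 0) : 0 < hermR G z := by
  by_cases h : (fun i => (z i).re) = 0
  · have h' : (fun i => (z i).im) ≠ 0 := fun h' => hz <| by
      ext i; exact Complex.ext (congrFun h i) (congrFun h' i)
    exact add_pos_of_nonneg_of_pos (pairR_nonneg hG _) (pairR_pos hG h')
  · exact add_pos_of_pos_of_nonneg (pairR_pos hG h) (pairR_nonneg hG _)

/-- With a = Re z and b = Im z, Lagrange's identity gives 4(|a|²|b|² − (a·b)²). Nullity means a·b =
0 and |a| = |b|, which turns this into (|a|² + |b|²)². -/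
theorem etaU_dot_etaD (hG : G.PosDef) (h0 : pairC G z z = 0) :
    realC (etaU G z) ⬝ᵥ realC (etaD G z) = (hermR G z : ℂ) ^ 2 := by
  rw [pairC_re_im hG] at h0
  have hre := congrArg Complex.re h0
  have him := congrArg Complex.im h0
  simp only [Complex.add_re, Complex.ofReal_re, Complex.mul_re, Complex.I_re, mul_zero,
    Complex.ofReal_im, Complex.I_im, mul_one, sub_self, add_zero, Complex.zero_re] at hre
  simp only [Complex.add_im, Complex.ofReal_im, Complex.mul_im, Complex.ofReal_re, Complex.I_im,
    mul_one, Complex.I_re, mul_zero, add_zero, zero_add, Complex.zero_im] at him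
  rw [hermR]
  set a : Fin 3 → ℝ := fun i => (z i).re
  set b : Fin 3 → ℝ := fun i => (z i).im
  have hu : IsUnit G.det := hG.det_pos.ne'.isUnit
  -- The factor det G produced here cancels the two factors (det G)^{-1/2} in the definition of η.
  have hc : G *ᵥ (a ⨯₃ b) = G.det • ((G⁻¹ *ᵥ a) ⨯₃ (G⁻¹ *ᵥ b)) := by
    have h := crossProduct_mulVec G (G⁻¹ *ᵥ a) (G⁻¹ *ᵥ b)
    rw [Matrix.mulVec_mulVec, Matrix.mulVec_mulVec, Matrix.mul_nonsing_inv _ hu, Matrix.one_mulVec,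
      Matrix.one_mulVec] at h
    rw [h, Matrix.mulVec_mulVec]
    conv_lhs => rw [← posDef_transpose hG]
    rw [← Matrix.transpose_mul, posDef_transpose hG, Matrix.adjugate_mul, Matrix.transpose_smul,
      Matrix.transpose_one, Matrix.smul_mulVec, Matrix.one_mulVec]
  have hreal : etaU G z ⬝ᵥ etaD G z = (pairR G a a + pairR G b b) ^ 2 := by
    have hs : (2 / Real.sqrt G.det) ^ 2 * G.det = 4 := by
      rw [div_pow, Real.sq_sqrt hG.det_pos.le]
      field_simp [hG.det_pos.ne']
      norm_num
    have hx : (a ⨯₃ b) ⬝ᵥ ((G⁻¹ *ᵥ a) ⨯₃ (G⁻¹ *ᵥ b)) =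
        pairR G a a * pairR G b b - pairR G a b * pairR G b a := by
      rw [cross_dot_cross, pairR, pairR, pairR, pairR]
      simp only [dotProduct_comm _ a, dotProduct_comm _ b]
      ring
    have h1 : etaU G z = (2 / Real.sqrt G.det) • (a ⨯₃ b) := rfl
    rw [etaD, h1, Matrix.mulVec_smul, hc, smul_dotProduct, dotProduct_smul, dotProduct_smul, hx]
    simp only [smul_eq_mul]
    have : pairR G a b = 0 := by linarith
    rw [this, zero_mul, sub_zero, ← mul_assoc, ← mul_assoc, ← pow_two, hs]
    have : pairR G a a = pairR G b b := by linarith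
    rw [this]; ring
  have : realC (etaU G z) ⬝ᵥ realC (etaD G z) = ((etaU G z ⬝ᵥ etaD G z : ℝ) : ℂ) := by
    simp [realC, dotProduct]
  rw [this, hreal]; push_cast; ring

/-- For square matrices P Qᵀ = 1 implies Qᵀ P = 1, which is the completeness relation. -/
theorem expand_of_biorthogonal (p q : Fin 3 → Fin 3 → ℂ)
    (h : ∀ i j, p i ⬝ᵥ q j = if i = j then 1 else 0) (w : Fin 3 → ℂ) :
    w = ∑ i, (p i ⬝ᵥ w) • q i := by
  have hPQ : (Matrix.of p) * (Matrix.of q)ᵀ = 1 := by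
    ext i j
    rw [Matrix.one_apply]
    exact h i j
  have hw := congrArg (fun M => M *ᵥ w) (mul_eq_one_comm.mp hPQ)
  simp only [Matrix.one_mulVec, ← Matrix.mulVec_mulVec] at hw
  conv_lhs => rw [← hw]
  ext i
  simp only [Matrix.mulVec, dotProduct, Matrix.transpose_apply, Matrix.of_apply, Finset.sum_apply,
    Pi.smul_apply, smul_eq_mul]
  exact Finset.sum_congr rfl fun j _ => by ring

/-- Completeness of the triad `(z, z̄, η)` of a null covector. -/
theorem triad_complete (hG : G.PosDef) (h0 : pairC G z z = 0) (hz : z ≠ 0) (w : Fin 3 → ℂ) :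
    w = ((z ⬝ᵥ w) / hermR G z) • conjC (upC G z) + ((conjC z ⬝ᵥ w) / hermR G z) • upC G z
      + ((realC (etaD G z) ⬝ᵥ w) / (hermR G z : ℂ) ^ 2) • realC (etaU G z) := by
  have hH : (hermR G z : ℂ) ≠ 0 := by exact_mod_cast (hermR_pos hG hz).ne'
  have hzz : z ⬝ᵥ upC G z = 0 := by rw [dotProduct_comm]; exact h0
  have hzc : z ⬝ᵥ conjC (upC G z) = hermR G z := by
    rw [← upC_conjC, dotProduct_comm]
    exact (pairC_comm hG _ _).trans (pairC_conjC hG z)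
  have hcz : conjC z ⬝ᵥ upC G z = hermR G z := by
    rw [dotProduct_comm]; exact pairC_conjC hG z
  have hcc : conjC z ⬝ᵥ conjC (upC G z) = 0 := by rw [← conj_dot, hzz, map_zero]
  have hze : z ⬝ᵥ realC (etaU G z) = 0 := by rw [dotProduct_comm]; exact etaU_dot G z
  have hce : conjC z ⬝ᵥ realC (etaU G z) = 0 := by rw [dotProduct_comm]; exact etaU_conjC G z
  have hez : realC (etaD G z) ⬝ᵥ upC G z = 0 := by
    rw [dotProduct_comm]
    change pairC G _ _ = 0
    rw [pairC_comm hG, pairC, upC_etaD hG]; exact etaU_dot G z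
  have hec : realC (etaD G z) ⬝ᵥ conjC (upC G z) = 0 := by
    have := congrArg conj hez
    rwa [conj_dot, conjC_realC, map_zero] at this
  have hee : realC (etaD G z) ⬝ᵥ realC (etaU G z) = (hermR G z : ℂ) ^ 2 := by
    rw [dotProduct_comm]; exact etaU_dot_etaD hG h0
  have hi : (hermR G z : ℂ) ^ 2 ≠ 0 := pow_ne_zero 2 hH
  -- The triad dual to (z, z̄, η) consists of the raised z̄ and z divided by the hermitian square,
  -- and the raised η divided by its square.
  have key := expand_of_biorthogonal
    ![z, conjC z, realC (etaD G z)] ![(hermR G z : ℂ)⁻¹ • conjC (upC G z),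
      (hermR G z : ℂ)⁻¹ • upC G z, ((hermR G z : ℂ) ^ 2)⁻¹ • realC (etaU G z)] (by
        intro i j
        fin_cases i <;> fin_cases j <;>
          simp [dotProduct_smul, -dotProduct_cons, hzz, hzc, hcz, hcc, hze, hce, hez, hec, hee, hH]) w
  conv_lhs => rw [key]
  simp only [Fin.sum_univ_three, Matrix.cons_val_zero, Matrix.cons_val_one, Matrix.cons_val,
    smul_smul, div_eq_mul_inv]

/-! ### Change of coordinates -/

/-- The components of a covector in new coordinates, `K` being the matrix of the old components of
the new coordinate vectors. -/
def pullC (K : Matrix (Fin 3) (Fin 3) ℝ) (z : Fin 3 → ℂ) : Fin 3 → ℂ :=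
  (K.map Complex.ofReal)ᵀ *ᵥ z

theorem pairC_pullC (K : Matrix (Fin 3) (Fin 3) ℝ) (hK : IsUnit K.det) (G : Matrix (Fin 3) (Fin 3) ℝ)
    (z w : Fin 3 → ℂ) : pairC (Kᵀ * G * K) (pullC K z) (pullC K w) = pairC G z w := by
  have hm : ∀ A B : Matrix (Fin 3) (Fin 3) ℝ, (A * B).map Complex.ofReal =
      A.map Complex.ofReal * B.map Complex.ofReal := fun A B => Matrix.map_mul (f := Complex.ofRealHom)
  have h1 : K.map Complex.ofReal * (K⁻¹).map Complex.ofReal = 1 := by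
    rw [← hm, Matrix.mul_nonsing_inv _ hK]; simp
  rw [pairC, pairC, upC, upC, pullC, pullC, invC, invC, Matrix.mul_inv_rev, Matrix.mul_inv_rev,
    ← Matrix.transpose_nonsing_inv, dotProduct_mulVec, Matrix.vecMul_transpose, Matrix.mulVec_mulVec,
    Matrix.mulVec_mulVec, hm, hm, Matrix.transpose_map]
  have h2 : ((K⁻¹).map Complex.ofReal)ᵀ * (K.map Complex.ofReal)ᵀ = 1 := by
    rw [← Matrix.transpose_mul, h1, Matrix.transpose_one]
  rw [← Matrix.mul_assoc, ← Matrix.mul_assoc, h1, Matrix.one_mul, Matrix.mul_assoc, h2,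
    Matrix.mul_one]

theorem conjC_pullC (K : Matrix (Fin 3) (Fin 3) ℝ) (z : Fin 3 → ℂ) :
    conjC (pullC K z) = pullC K (conjC z) := by
  ext i; simp [conjC, pullC, Matrix.mulVec, dotProduct]

/-- The cross product contributes K adj(K) = det K, while the normalization contributes the inverse
of the square root of (det K)². They cancel only for positive determinant: η is a vector because of
the orientation. -/
theorem etaU_pullC {K : Matrix (Fin 3) (Fin 3) ℝ} (hK : 0 < K.det) (G : Matrix (Fin 3) (Fin 3) ℝ)
    (z : Fin 3 → ℂ) : K *ᵥ etaU (Kᵀ * G * K) (pullC K z) = etaU G z := by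
  have hre : (fun i => (pullC K z i).re) = Kᵀ *ᵥ fun i => (z i).re := by
    ext i; simp [pullC, Matrix.mulVec, dotProduct]
  have him : (fun i => (pullC K z i).im) = Kᵀ *ᵥ fun i => (z i).im := by
    ext i; simp [pullC, Matrix.mulVec, dotProduct]
  rw [etaU, etaU, hre, him, crossProduct_mulVec, Matrix.det_mul, Matrix.det_mul,
    Matrix.det_transpose, ← Matrix.adjugate_transpose, Matrix.transpose_transpose,
    Matrix.mulVec_smul, Matrix.mulVec_mulVec, Matrix.mul_adjugate, Matrix.smul_mulVec,
    Matrix.one_mulVec, smul_smul]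
  congr 1
  have : K.det * G.det * K.det = K.det ^ 2 * G.det := by ring
  rw [this, Real.sqrt_mul (sq_nonneg _), Real.sqrt_sq hK.le]
  field_simp

theorem etaD_pullC {K : Matrix (Fin 3) (Fin 3) ℝ} (hK : 0 < K.det) (G : Matrix (Fin 3) (Fin 3) ℝ)
    (z : Fin 3 → ℂ) : etaD (Kᵀ * G * K) (pullC K z) = Kᵀ *ᵥ etaD G z := by
  rw [etaD, ← Matrix.mulVec_mulVec, etaU_pullC hK, ← Matrix.mulVec_mulVec]
  rfl

/-! ### Christoffel symbols -/

/-- The Christoffel symbols of a metric `G` with first derivatives `dG`. -/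
def chris (G : Matrix (Fin 3) (Fin 3) ℝ) (dG : Fin 3 → Fin 3 → Fin 3 → ℝ) (i j k : Fin 3) : ℝ :=
  (1 / 2) * ∑ l, G⁻¹ k l * (dG i j l + dG j i l - dG l i j)

/-- The covariant differential of a covector `z` with ordinary differential `z'` in the direction
`a`. -/
def delta (G : Matrix (Fin 3) (Fin 3) ℝ) (dG : Fin 3 → Fin 3 → Fin 3 → ℝ) (z z' : Fin 3 → ℂ)
    (a : Fin 3 → ℝ) : Fin 3 → ℂ :=
  fun j => z' j - ∑ k, ∑ l, ((chris G dG k j l : ℂ) * z l) * (a k : ℂ)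

/-- The connection matrix in the direction `a`. -/
def connMat (G : Matrix (Fin 3) (Fin 3) ℝ) (dG : Fin 3 → Fin 3 → Fin 3 → ℝ) (a : Fin 3 → ℝ) :
    Matrix (Fin 3) (Fin 3) ℝ := Matrix.of fun j l => ∑ k, chris G dG k j l * a k

variable {dG : Fin 3 → Fin 3 → Fin 3 → ℝ}

theorem delta_eq (z z' : Fin 3 → ℂ) (a : Fin 3 → ℝ) :
    delta G dG z z' a = z' - (connMat G dG a).map Complex.ofReal *ᵥ z := by
  ext j
  simp only [delta, connMat, Pi.sub_apply, Matrix.mulVec, dotProduct, Matrix.map_apply, Matrix.of_apply,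
    Complex.ofReal_sum, Finset.sum_mul]
  rw [Finset.sum_comm]
  congr 1
  refine Finset.sum_congr rfl fun i _ => Finset.sum_congr rfl fun k _ => ?_
  push_cast; ring

theorem chris_symm (hdG : ∀ k i j, dG k i j = dG k j i) (i j k : Fin 3) :
    chris G dG i j k = chris G dG j i k := by
  simp only [chris]
  congr 1
  exact Finset.sum_congr rfl fun l _ => by rw [hdG l i j]; ring

/-- Multiplication by G lowers the upper index, so the inverse metric in the Christoffel symbols
disappears. Compatibility with the metric is then linear in the derivatives of G. -/
theorem connMat_mul (hG : G.PosDef) (a : Fin 3 → ℝ) (i j : Fin 3) :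
    (connMat G dG a * G) i j =
      ∑ k, (1 / 2) * (dG k i j + dG i k j - dG j k i) * a k := by
  have hu : IsUnit G.det := hG.det_pos.ne'.isUnit
  have hGI : ∀ l m, ∑ n, G⁻¹ n l * G n m = if l = m then 1 else 0 := fun l m => by
    have h1 : (G⁻¹)ᵀ = G⁻¹ := by
      have := hG.isHermitian.inv
      rwa [Matrix.IsHermitian, Matrix.conjTranspose_eq_transpose_of_trivial] at this
    have h2 := congrFun (congrFun (Matrix.nonsing_inv_mul G hu) l) m
    rw [Matrix.mul_apply, Matrix.one_apply] at h2
    rw [← h2]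
    exact Finset.sum_congr rfl fun n _ => by rw [← h1, Matrix.transpose_apply, h1]
  rw [Matrix.mul_apply]
  simp only [connMat, Matrix.of_apply, chris, Finset.sum_mul]
  rw [Finset.sum_comm]
  refine Finset.sum_congr rfl fun k _ => ?_
  refine Eq.trans (b := ∑ n, ∑ l, (G⁻¹ n l * G n j) *
    (1 / 2 * (dG k i l + dG i k l - dG l k i) * a k)) ?_ ?_
  · refine Finset.sum_congr rfl fun n _ => ?_
    rw [Finset.mul_sum, Finset.sum_mul, Finset.sum_mul]
    exact Finset.sum_congr rfl fun l _ => by ring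
  · rw [Finset.sum_comm]
    simp only [← Finset.sum_mul, hGI]
    simp

/-- The metric is covariantly constant. -/
theorem connMat_compat (hG : G.PosDef) (hdG : ∀ k i j, dG k i j = dG k j i) (a : Fin 3 → ℝ) :
    (Matrix.of fun i j => ∑ k, dG k i j * a k) =
      connMat G dG a * G + G * (connMat G dG a)ᵀ := by
  have : G * (connMat G dG a)ᵀ = (connMat G dG a * G)ᵀ := by
    rw [Matrix.transpose_mul, posDef_transpose hG]
  rw [this]
  ext i j
  rw [Matrix.add_apply, Matrix.transpose_apply, connMat_mul hG, connMat_mul hG,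
    ← Finset.sum_add_distrib]
  change ∑ k, dG k i j * a k = _
  refine Finset.sum_congr rfl fun k _ => ?_
  rw [hdG k j i, hdG i k j, hdG j k i]; ring

/-- The differential of the inverse metric. -/
theorem inv_metric_deriv (hG : G.PosDef) (hdG : ∀ k i j, dG k i j = dG k j i) (a : Fin 3 → ℝ) :
    -(G⁻¹ * (Matrix.of fun i j => ∑ k, dG k i j * a k) * G⁻¹) =
      -(G⁻¹ * connMat G dG a + (connMat G dG a)ᵀ * G⁻¹) := by
  have hu : IsUnit G.det := hG.det_pos.ne'.isUnit
  rw [connMat_compat hG hdG, Matrix.mul_add, Matrix.add_mul, ← Matrix.mul_assoc, ← Matrix.mul_assoc,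
    Matrix.nonsing_inv_mul _ hu, Matrix.one_mul, Matrix.mul_assoc, Matrix.mul_assoc,
    Matrix.mul_nonsing_inv _ hu, Matrix.mul_one]

/-- The derivative of the pairing of two covectors is the pairing of the covariant derivatives. -/
theorem pairC_deriv (hG : G.PosDef) (hdG : ∀ k i j, dG k i j = dG k j i) (a : Fin 3 → ℝ)
    (z w z' w' : Fin 3 → ℂ) :
    ((-(G⁻¹ * (Matrix.of fun i j => ∑ k, dG k i j * a k) * G⁻¹)).map Complex.ofReal *ᵥ z) ⬝ᵥ w
      + pairC G z' w + pairC G z w' =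
      pairC G (delta G dG z z' a) w + pairC G z (delta G dG w w' a) := by
  have hm : ∀ A B : Matrix (Fin 3) (Fin 3) ℝ, (A * B).map Complex.ofReal =
      A.map Complex.ofReal * B.map Complex.ofReal := fun A B => Matrix.map_mul (f := Complex.ofRealHom)
  have hn : ∀ A : Matrix (Fin 3) (Fin 3) ℝ, (-A).map Complex.ofReal = -A.map Complex.ofReal :=
    fun A => by ext; simp
  have ha : ∀ A B : Matrix (Fin 3) (Fin 3) ℝ, (A + B).map Complex.ofReal =
      A.map Complex.ofReal + B.map Complex.ofReal := fun A B => by ext; simp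
  rw [inv_metric_deriv hG hdG, hn, ha, hm, hm, delta_eq, delta_eq, Matrix.neg_mulVec,
    Matrix.add_mulVec, neg_dotProduct, add_dotProduct, ← Matrix.mulVec_mulVec, ← Matrix.mulVec_mulVec]
  simp only [pairC, upC, Matrix.mulVec_sub, sub_dotProduct, dotProduct_sub]
  change -((invC G *ᵥ _) ⬝ᵥ w + (_ *ᵥ invC G *ᵥ z) ⬝ᵥ w) + _ + _ = _
  have : ((connMat G dG a)ᵀ.map Complex.ofReal *ᵥ invC G *ᵥ z) ⬝ᵥ w =
      (invC G *ᵥ z) ⬝ᵥ ((connMat G dG a).map Complex.ofReal *ᵥ w) := by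
    rw [dotProduct_mulVec, ← Matrix.mulVec_transpose, Matrix.transpose_map]
  rw [this]; ring

/-- The connection is torsion free. -/
theorem delta_torsion (hdG : ∀ k i j, dG k i j = dG k j i) (z z₁ z₂ : Fin 3 → ℂ) (a₁ a₂ : Fin 3 → ℝ) :
    delta G dG z z₁ a₁ ⬝ᵥ realC a₂ - delta G dG z z₂ a₂ ⬝ᵥ realC a₁ =
      z₁ ⬝ᵥ realC a₂ - z₂ ⬝ᵥ realC a₁ := by
  have h : ∀ a b : Fin 3 → ℝ, ∀ z' : Fin 3 → ℂ, delta G dG z z' a ⬝ᵥ realC b =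
      z' ⬝ᵥ realC b - ∑ j, ∑ k, ∑ l, (chris G dG k j l : ℂ) * z l * (a k : ℂ) * (b j : ℂ) := by
    intro a b z'
    simp only [delta, dotProduct, realC, sub_mul, Finset.sum_sub_distrib, Finset.sum_mul]
  rw [h, h]
  have : ∑ j, ∑ k, ∑ l, (chris G dG k j l : ℂ) * z l * (a₁ k : ℂ) * (a₂ j : ℂ) =
      ∑ j, ∑ k, ∑ l, (chris G dG k j l : ℂ) * z l * (a₂ k : ℂ) * (a₁ j : ℂ) := by
    rw [Finset.sum_comm]
    exact Finset.sum_congr rfl fun j _ => Finset.sum_congr rfl fun k _ => Finset.sum_congr rfl fun l _ => by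
      rw [chris_symm hdG]; ring
  rw [this]; ring

end NullTriads

/-! ### Coordinates on the complexified cotangent bundle and the metric in a chart. -/

section Coordinates

variable {S : Type*} [TopologicalSpace S] [ChartedSpace E3 S]

/-- The components of a complex covector of the model space. -/
def compv (ζ : E3 →L[ℝ] ℂ) : Fin 3 → ℂ := fun i => ζ (coordVec i)

theorem vec_eq_sum (a : E3) : a = ∑ i, a i • coordVec i := by
  ext j
  simp [coordVec, Finset.sum_apply, Pi.single_apply]

theorem covec_apply (ζ : E3 →L[ℝ] ℂ) (a : E3) : ζ a = compv ζ ⬝ᵥ realC a := by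
  conv_lhs => rw [vec_eq_sum a]
  simp [compv, realC, dotProduct, mul_comm]

/-- The covector with given components. -/
def ofComp (z : Fin 3 → ℂ) : E3 →L[ℝ] ℂ :=
  ∑ i, z i • Complex.ofRealCLM.comp (EuclideanSpace.proj i : E3 →L[ℝ] ℝ)

theorem ofComp_apply (z : Fin 3 → ℂ) (a : E3) : ofComp z a = z ⬝ᵥ realC a := by
  simp [ofComp, dotProduct, realC]

@[simp] theorem compv_ofComp (z : Fin 3 → ℂ) : compv (ofComp z) = z := by
  ext i
  have : ∀ j, (coordVec i) j = if j = i then (1 : ℝ) else 0 := fun j => by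
    simp [coordVec]
  simp only [compv, ofComp_apply, realC, dotProduct, this]
  rw [Finset.sum_eq_single i] <;> simp +contextual

@[simp] theorem ofComp_compv (ζ : E3 →L[ℝ] ℂ) : ofComp (compv ζ) = ζ := by
  ext a; rw [ofComp_apply, covec_apply]

variable [IsManifold (𝓡 3) ∞ S]

/-- The differential of the inverse of the preferred chart at `x₀`, at the point `x`, in terms of
the preferred chart at `x`. -/
def chartK (x₀ x : S) : E3 →L[ℝ] E3 :=
  mfderiv 𝓘(ℝ, E3) (𝓡 3) (extChartAt (𝓡 3) x₀).symm (extChartAt (𝓡 3) x₀ x)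

/-- The differential of the preferred chart at `x₀`, at the point `x`. -/
def chartD (x₀ x : S) : E3 →L[ℝ] E3 := mfderiv (𝓡 3) 𝓘(ℝ, E3) (extChartAt (𝓡 3) x₀) x

/-- Tangent vectors at x are expressed in the preferred chart at x, so this derivative is the
inverse trivialization of the tangent bundle. Its inverse relations and its coordinate expression
follow from there. -/
theorem chartK_eq_symmL {x₀ x : S} (hx : x ∈ (chartAt E3 x₀).source) :
    chartK x₀ x = (trivializationAt E3 (TangentSpace (𝓡 3)) x₀).symmL ℝ x := by
  rw [TangentBundle.symmL_trivializationAt hx, chartK]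
  simp only [modelWithCornersSelf_coe, Set.range_id, mfderivWithin_univ]
  rfl

theorem chartD_eq {x₀ x : S} (hx : x ∈ (chartAt E3 x₀).source) :
    chartD x₀ x = (trivializationAt E3 (TangentSpace (𝓡 3)) x₀).continuousLinearMapAt ℝ x := by
  rw [TangentBundle.continuousLinearMapAt_trivializationAt hx]; rfl

theorem chartK_chartD {x₀ x : S} (hx : x ∈ (chartAt E3 x₀).source) (v : E3) :
    chartK x₀ x (chartD x₀ x v) = v := by
  rw [chartK_eq_symmL hx, chartD_eq hx]
  exact (trivializationAt E3 (TangentSpace (𝓡 3)) x₀).symmL_continuousLinearMapAt hx v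

theorem chartD_chartK {x₀ x : S} (hx : x ∈ (chartAt E3 x₀).source) (v : E3) :
    chartD x₀ x (chartK x₀ x v) = v := by
  rw [chartK_eq_symmL hx, chartD_eq hx]
  exact (trivializationAt E3 (TangentSpace (𝓡 3)) x₀).continuousLinearMapAt_symmL hx v

theorem chartD_self (x : S) : chartD x x = ContinuousLinearMap.id ℝ E3 := mfderiv_extChartAt_self

theorem chartK_self (x : S) : chartK x x = ContinuousLinearMap.id ℝ E3 := by
  ext1 v
  have := chartK_chartD (mem_chart_source E3 x) v
  rwa [chartD_self] at this

/-- The matrix of `chartK`. -/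
def matK (x₀ x : S) : Matrix (Fin 3) (Fin 3) ℝ := Matrix.of fun i j => chartK x₀ x (coordVec j) i

/-- The orientation enters here: `chartK x₀ x` is the Jacobian of the coordinate change from the
preferred chart at x₀ to the one at x. -/
theorem matK_det_pos (hS : IsOrientedAtlas S) {x₀ x : S} (hx : x ∈ (chartAt E3 x₀).source) :
    0 < (matK x₀ x).det := by
  have h1 : chartK x₀ x = fderiv ℝ ((chartAt E3 x₀).symm.trans (chartAt E3 x)) (chartAt E3 x₀ x) := by
    rw [chartK_eq_symmL hx, TangentBundle.symmL_trivializationAt_eq_core hx,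
      tangentBundleCore_coordChange_achart]
    simp [extChartAt, fderivWithin_univ]
  have h2 := hS (chartAt E3 x₀) (chart_mem_atlas E3 x₀) (chartAt E3 x) (chart_mem_atlas E3 x)
    (chartAt E3 x₀ x) (by
      simp [hx])
  rw [← h1] at h2
  have h3 : (chartK x₀ x).det = (matK x₀ x).det := by
    rw [ContinuousLinearMap.det, ← LinearMap.det_toMatrix (EuclideanSpace.basisFun (Fin 3) ℝ).toBasis]
    congr 1
  rwa [h3] at h2

/-- The components of the covector in the coordinates of the preferred chart at `x₀`. -/
def covCrd (x₀ : S) (p : CCot S) : E3 →L[ℝ] ℂ := (covec p).comp (chartK x₀ p.1)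

/-- The coordinates on `ℂT*S` induced by the preferred chart at `x₀`. -/
def crd (x₀ : S) (p : CCot S) : TCot := (extChartAt (𝓡 3) x₀ p.1, covCrd x₀ p)

theorem compv_covCrd (x₀ : S) (p : CCot S) : compv (covCrd x₀ p) = pullC (matK x₀ p.1) (comp p) := by
  ext i
  change covec p (chartK x₀ p.1 (coordVec i)) = _
  rw [covec_apply]
  simp [pullC, Matrix.mulVec, dotProduct, realC, matK, mul_comm]
  rfl

/-- The trivialization of the bundle of homomorphisms precomposes with the inverse tangent
trivialization and leaves the trivial target unchanged. It makes `crd` the extended chart, so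
smoothness into the bundle can be tested with `crd`. -/
theorem trivializationAt_cot {x₀ : S} {p : CCot S} (hp : p.1 ∈ (chartAt E3 x₀).source) :
    (trivializationAt (E3 →L[ℝ] ℂ)
      (fun x : S => TangentSpace (𝓡 3) x →L[ℝ] Bundle.Trivial S ℂ x) x₀ p).2 = covCrd x₀ p := by
  rw [hom_trivializationAt_apply, covCrd, chartK_eq_symmL hp]
  ext v
  simp [ContinuousLinearMap.inCoordinates, covec]
  rfl

theorem extChartAt_cot {p₀ p : CCot S} (hp : p.1 ∈ (chartAt E3 p₀.1).source) :
    extChartAt ICot p₀ p = crd p₀.1 p := by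
  rw [FiberBundle.extChartAt, crd, ← trivializationAt_cot hp]
  rfl

/-- The point of `ℂT*S` with given coordinates. -/
def crdInv (x₀ : S) (q : TCot) : CCot S :=
  ⟨(extChartAt (𝓡 3) x₀).symm q.1, (q.2.comp (chartD x₀ ((extChartAt (𝓡 3) x₀).symm q.1)) : E3 →L[ℝ] ℂ)⟩

theorem crd_crdInv {x₀ : S} {q : TCot} (hq : q.1 ∈ (chartAt E3 x₀).target) :
    crd x₀ (crdInv x₀ q) = q := by
  have hq' : q.1 ∈ (extChartAt (𝓡 3) x₀).target := by simpa using hq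
  have hx : (extChartAt (𝓡 3) x₀).symm q.1 ∈ (chartAt E3 x₀).source := by
    have := (extChartAt (𝓡 3) x₀).map_target hq'
    rwa [extChartAt_source] at this
  refine Prod.ext ((extChartAt (𝓡 3) x₀).right_inv hq') ?_
  ext v
  exact congrArg q.2 (chartD_chartK hx v)

theorem crdInv_crd {x₀ : S} {p : CCot S} (hp : p.1 ∈ (chartAt E3 x₀).source) :
    crdInv x₀ (crd x₀ p) = p := by
  have h1 : (extChartAt (𝓡 3) x₀).symm (extChartAt (𝓡 3) x₀ p.1) = p.1 :=
    (extChartAt (𝓡 3) x₀).left_inv (by rwa [extChartAt_source])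
  obtain ⟨x, ζ⟩ := p
  change (TotalSpace.mk _ _ : CCot S) = TotalSpace.mk x ζ
  -- The type of the covector depends on the base point, so the base point is made a variable before
  -- it is identified with x.
  have h2 : ∀ x', x' = x → (TotalSpace.mk x' ((covCrd x₀ (TotalSpace.mk x ζ : CCot S)).comp (chartD x₀ x') : E3 →L[ℝ] ℂ) : CCot S)
      = TotalSpace.mk x ζ := by
    rintro x' rfl
    congr 1
    refine ContinuousLinearMap.ext fun v => ?_
    change ζ (chartK x₀ x' (chartD x₀ x' v)) = ζ v
    rw [chartK_chartD hp]
  exact h2 _ h1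

section Maps

variable {E : Type*} [NormedAddCommGroup E] [NormedSpace ℝ E] {f : E → CCot S} {z₀ : E}

theorem contDiffAt_crd {x₀ : S} (hx : (f z₀).1 ∈ (chartAt E3 x₀).source)
    (hf : ContMDiffAt 𝓘(ℝ, E) ICot ∞ f z₀) :
    ContDiffAt ℝ ∞ (fun z => crd x₀ (f z)) z₀ := by
  have h := ((trivializationAt (E3 →L[ℝ] ℂ)
      (fun x : S => TangentSpace (𝓡 3) x →L[ℝ] Bundle.Trivial S ℂ x) x₀).contMDiffAt_iff
      (IB := 𝓡 3) (n := ∞) (f := f) (x₀ := z₀) (by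
        rw [Trivialization.mem_source]; exact ⟨hx, Set.mem_univ _⟩)).1 hf
  have h1 : ContDiffAt ℝ ∞ (fun z => extChartAt (𝓡 3) x₀ (f z).1) z₀ := by
    have := (contMDiffAt_extChartAt' (I := 𝓡 3) (n := ∞) hx).comp z₀ h.1
    exact this.contDiffAt
  have h2 := h.2.contDiffAt
  refine h1.prodMk (h2.congr_of_eventuallyEq ?_)
  have : ∀ᶠ z in 𝓝 z₀, (f z).1 ∈ (chartAt E3 x₀).source :=
    h.1.continuousAt.preimage_mem_nhds ((chartAt E3 x₀).open_source.mem_nhds hx)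
  filter_upwards [this] with z hz
  exact (trivializationAt_cot hz).symm

theorem contMDiffAt_crdInv {x₀ : S} {c : E → TCot} (hx : (c z₀).1 ∈ (chartAt E3 x₀).target)
    (hc : ContDiffAt ℝ ∞ c z₀) :
    ContMDiffAt 𝓘(ℝ, E) ICot ∞ (fun z => crdInv x₀ (c z)) z₀ := by
  have htar : ∀ᶠ z in 𝓝 z₀, (c z).1 ∈ (chartAt E3 x₀).target :=
    hc.continuousAt.fst.preimage_mem_nhds ((chartAt E3 x₀).open_target.mem_nhds hx)
  have hsrc : ∀ y ∈ (chartAt E3 x₀).target, (extChartAt (𝓡 3) x₀).symm y ∈ (chartAt E3 x₀).source :=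
    fun y hy => by
      have := (extChartAt (𝓡 3) x₀).map_target (x := y) (by simpa using hy)
      rwa [extChartAt_source] at this
  refine ((trivializationAt (E3 →L[ℝ] ℂ)
      (fun x : S => TangentSpace (𝓡 3) x →L[ℝ] Bundle.Trivial S ℂ x) x₀).contMDiffAt_iff
      (IB := 𝓡 3) (n := ∞) (x₀ := z₀) (by
        rw [Trivialization.mem_source]; exact ⟨hsrc _ hx, Set.mem_univ _⟩)).2 ⟨?_, ?_⟩
  · have h1 : ContMDiffAt 𝓘(ℝ, E3) (𝓡 3) ∞ (extChartAt (𝓡 3) x₀).symm (c z₀).1 :=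
      (contMDiffOn_extChartAt_symm (n := ∞) x₀).contMDiffAt (by
        simpa using (chartAt E3 x₀).open_target.mem_nhds hx)
    exact ContMDiffAt.comp (g := (extChartAt (𝓡 3) x₀).symm) (f := fun z => (c z).1) z₀ h1
      hc.fst.contMDiffAt
  · refine (hc.snd.contMDiffAt).congr_of_eventuallyEq ?_
    filter_upwards [htar] with z hz
    rw [trivializationAt_cot (hsrc _ hz)]
    exact congrArg Prod.snd (crd_crdInv hz)

variable (f z₀) in
/-- The differential of a map to `ℂT*S`. -/
def mapDeriv : E →L[ℝ] TCot := mfderiv 𝓘(ℝ, E) ICot f z₀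

/-- The manifold derivative is by definition the derivative in the preferred chart at the image
point, and this chart is `crd` near that point. -/
theorem hasFDerivAt_crd (hf : ContMDiffAt 𝓘(ℝ, E) ICot ∞ f z₀) :
    HasFDerivAt (fun z => crd (f z₀).1 (f z)) (mapDeriv f z₀) z₀ := by
  have h := (hf.mdifferentiableAt (by norm_num)).hasMFDerivAt.2
  simp only [writtenInExtChartAt, extChartAt_model_space_eq_id, modelWithCornersSelf_coe, Set.range_id,
    PartialEquiv.refl_symm, PartialEquiv.refl_coe, id_eq] at h
  have h' : HasFDerivWithinAt (fun z => extChartAt ICot (f z₀) (f z)) (mapDeriv f z₀) Set.univ z₀ := h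
  rw [hasFDerivWithinAt_univ] at h'
  refine HasFDerivAt.congr_of_eventuallyEq h' ?_
  have : ∀ᶠ z in 𝓝 z₀, (f z).1 ∈ (chartAt E3 (f z₀).1).source :=
    ((FiberBundle.continuous_proj _ _).continuousAt.comp hf.continuousAt).preimage_mem_nhds
      ((chartAt E3 (f z₀).1).open_source.mem_nhds (mem_chart_source E3 _))
  filter_upwards [this] with z hz
  exact (extChartAt_cot hz).symm

/-- The differential of the base point in the coordinates of the chart at `x₀`. -/
theorem fderiv_base {x₀ : S} (hx : (f z₀).1 ∈ (chartAt E3 x₀).source)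
    (hf : ContMDiffAt 𝓘(ℝ, E) ICot ∞ f z₀) (v : E) :
    fderiv ℝ (fun z => extChartAt (𝓡 3) x₀ (f z).1) z₀ v = chartD x₀ (f z₀).1 (mapDeriv f z₀ v).1 := by
  have hp : ContMDiffAt 𝓘(ℝ, E) (𝓡 3) ∞ (fun z => (f z).1) z₀ :=
    (contMDiffAt_totalSpace.1 hf).1
  have hpd := hp.mdifferentiableAt (by norm_num)
  -- The tangent spaces are definitionally the model space; naming the derivative with the model
  -- type hides the dependence on the base point.
  obtain ⟨L, hL⟩ : ∃ L : E →L[ℝ] E3, L = mfderiv 𝓘(ℝ, E) (𝓡 3) (fun z => (f z).1) z₀ := ⟨_, rfl⟩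
  have h1 : L v = (mapDeriv f z₀ v).1 := by
    have h2 : HasFDerivAt (fun z => extChartAt (𝓡 3) (f z₀).1 (f z).1) L z₀ := by
      have h := hpd.hasMFDerivAt.2
      simp only [writtenInExtChartAt, extChartAt_model_space_eq_id, modelWithCornersSelf_coe,
        Set.range_id, PartialEquiv.refl_symm, PartialEquiv.refl_coe, id_eq] at h
      rw [← hL] at h
      have h' : HasFDerivWithinAt (fun z => extChartAt (𝓡 3) (f z₀).1 (f z).1) L Set.univ z₀ := h
      rwa [hasFDerivWithinAt_univ] at h'
    rw [h2.unique (hasFDerivAt_crd hf).fst]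
    rfl
  have h4 : MDifferentiableAt (𝓡 3) 𝓘(ℝ, E3) (extChartAt (𝓡 3) x₀) (f z₀).1 :=
    mdifferentiableAt_extChartAt hx
  have h5 := mfderiv_comp z₀ h4 hpd
  rw [← h1, hL, ← mfderiv_eq_fderiv]
  exact congrArg (fun L : E →L[ℝ] E3 => L v) h5

end Maps

/-! ### The metric in coordinates -/

/-- The Gram matrix in the coordinates of the preferred chart at `x₀`. -/
def gramC (g : Metric3 S) (x₀ : S) (y : E3) : Matrix (Fin 3) (Fin 3) ℝ := Matrix.of (gramChart g x₀ y)

theorem inner_eq_gram (g : Metric3 S) (x : S) (a b : E3) :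
    g.inner x a b = (a : Fin 3 → ℝ) ⬝ᵥ gram g x *ᵥ (b : Fin 3 → ℝ) := by
  obtain ⟨B, hB⟩ : ∃ B : E3 →L[ℝ] E3 →L[ℝ] ℝ, B = g.inner x := ⟨_, rfl⟩
  have h : ∀ i j, gram g x i j = B (coordVec i) (coordVec j) := fun i j => by rw [hB]; rfl
  have h' : g.inner x a b = B a b := by rw [hB]; rfl
  rw [h']
  conv_lhs => rw [vec_eq_sum a, vec_eq_sum b]
  simp only [map_sum, map_smul, _root_.sum_apply, _root_.smul_apply, smul_eq_mul, Matrix.mulVec,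
    dotProduct, h, Finset.mul_sum]
  rw [Finset.sum_comm]
  exact Finset.sum_congr rfl fun i _ => Finset.sum_congr rfl fun j _ => by ring

theorem gram_posDef (g : Metric3 S) (x : S) : (gram g x).PosDef := by
  refine Matrix.PosDef.of_dotProduct_mulVec_pos ?_ fun a ha => ?_
  · ext i j
    exact g.symm x _ _
  · have h := g.pos x (WithLp.toLp 2 a : E3) (fun h => ha (by
      have := congrArg (fun b : E3 => (b : Fin 3 → ℝ)) h
      exact this))
    have h2 := inner_eq_gram g x (WithLp.toLp 2 a : E3) (WithLp.toLp 2 a : E3)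
    rw [star_trivial]
    exact h.trans_eq h2

/-- The link between the Gram matrix of a fixed chart and the pointwise one, which changes chart
with the point. Through it all invariants of ζ can be computed in one chart. -/
theorem gramC_eq (g : Metric3 S) {x₀ x : S} (hx : x ∈ (chartAt E3 x₀).source) :
    gramC g x₀ (extChartAt (𝓡 3) x₀ x) = (matK x₀ x)ᵀ * gram g x * matK x₀ x := by
  have h1 : (extChartAt (𝓡 3) x₀).symm (extChartAt (𝓡 3) x₀ x) = x :=
    (extChartAt (𝓡 3) x₀).left_inv (by rwa [extChartAt_source])
  ext i j
  have h2 : ∀ x', x' = x → g.inner x' (chartK x₀ x (coordVec i)) (chartK x₀ x (coordVec j)) =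
      g.inner x (chartK x₀ x (coordVec i)) (chartK x₀ x (coordVec j)) := by rintro x' rfl; rfl
  refine (h2 _ h1).trans ?_
  rw [inner_eq_gram, Matrix.mul_assoc, Matrix.mul_apply']
  rfl

theorem gramC_self (g : Metric3 S) (x : S) : gramC g x (extChartAt (𝓡 3) x x) = gram g x := by
  have : matK x x = 1 := by
    ext i j
    simp [matK, chartK_self, coordVec, Matrix.one_apply]
  rw [gramC_eq g (mem_chart_source E3 x), this]
  simp

theorem gramC_posDef (hS : IsOrientedAtlas S) (g : Metric3 S) {x₀ : S} {y : E3}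
    (hy : y ∈ (chartAt E3 x₀).target) : (gramC g x₀ y).PosDef := by
  have hy' : y ∈ (extChartAt (𝓡 3) x₀).target := by simpa using hy
  have hx : (extChartAt (𝓡 3) x₀).symm y ∈ (chartAt E3 x₀).source := by
    have := (extChartAt (𝓡 3) x₀).map_target hy'
    rwa [extChartAt_source] at this
  have h := gramC_eq g hx
  rw [(extChartAt (𝓡 3) x₀).right_inv hy'] at h
  rw [h]
  have hinj : Function.Injective (matK x₀ ((extChartAt (𝓡 3) x₀).symm y)).mulVec :=
    Matrix.mulVec_injective_iff_isUnit.2 ((Matrix.isUnit_iff_isUnit_det _).2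
      (matK_det_pos hS hx).ne'.isUnit)
  have := (gram_posDef g ((extChartAt (𝓡 3) x₀).symm y)).conjTranspose_mul_mul_same hinj
  rwa [Matrix.conjTranspose_eq_transpose_of_trivial] at this

/-- The coordinate fields of the chart at x₀ are constant in the tangent trivialization at x₀, hence
smooth sections; the smooth metric evaluated on them is a smooth function. -/
theorem contDiffOn_gramChart (g : Metric3 S) (x₀ : S) (i j : Fin 3) :
    ContDiffOn ℝ ∞ (fun y => gramChart g x₀ y i j) (chartAt E3 x₀).target := by
  have hM : ContMDiffOn (𝓡 3) 𝓘(ℝ, ℝ) ∞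
      (fun x => g.inner x (chartK x₀ x (coordVec i)) (chartK x₀ x (coordVec j)))
      (chartAt E3 x₀).source := by
    intro x hx
    have hsec : ∀ i, ContMDiffAt (𝓡 3) ((𝓡 3).prod 𝓘(ℝ, E3)) ∞ (fun x : S =>
        (TotalSpace.mk' E3 x (chartK x₀ x (coordVec i) : TangentSpace (𝓡 3) x) :
          TotalSpace E3 (fun x : S => TangentSpace (𝓡 3) x))) x := by
      intro i
      let s : ∀ x : S, TangentSpace (𝓡 3) x := fun x => chartK x₀ x (coordVec i)
      refine ((trivializationAt E3 (TangentSpace (𝓡 3)) x₀).contMDiffAt_section_iff (IB := 𝓡 3)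
        (E := TangentSpace (𝓡 3)) (F := E3) (s := s) hx).2 ?_
      refine (contMDiffAt_const (c := (coordVec i : E3))).congr_of_eventuallyEq ?_
      filter_upwards [(chartAt E3 x₀).open_source.mem_nhds hx] with x' hx'
      have := chartD_chartK hx' (coordVec i)
      rw [chartD_eq hx'] at this
      exact Eq.trans (congrFun ((trivializationAt E3 (TangentSpace (𝓡 3)) x₀).coe_linearMapAt_of_mem
        (R := ℝ) hx') (s x')).symm this
    have h2 : ContMDiffAt (𝓡 3) ((𝓡 3).prod 𝓘(ℝ)) ∞
      (fun m ↦ TotalSpace.mk' ℝ (E := Bundle.Trivial S ℝ) m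
        (g.inner m (chartK x₀ m (coordVec i)) (chartK x₀ m (coordVec j)))) x := by
      apply ContMDiffAt.clm_bundle_apply₂ (F₁ := E3) (F₂ := E3)
      · exact g.contMDiff.contMDiffAt
      · exact hsec i
      · exact hsec j
    exact (contMDiffAt_totalSpace.1 h2).2.contMDiffWithinAt
  have h3 := (contMDiffOn_extChartAt_symm (I := 𝓡 3) (n := ∞) x₀)
  have h4 := (hM.comp (t := (chartAt E3 x₀).source) h3 (fun y hy => by
    have := (extChartAt (𝓡 3) x₀).map_target hy
    rwa [extChartAt_source] at this)).contDiffOn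
  have ht : (extChartAt (𝓡 3) x₀).target = (chartAt E3 x₀).target := by simp
  rw [ht] at h4
  refine h4.congr fun y hy => ?_
  have hy' : y ∈ (extChartAt (𝓡 3) x₀).target := by simpa using hy
  have hK : chartK x₀ ((extChartAt (𝓡 3) x₀).symm y) =
      (mfderiv 𝓘(ℝ, E3) (𝓡 3) (extChartAt (𝓡 3) x₀).symm y : E3 →L[ℝ] E3) :=
    have h : ∀ y', y' = y → (mfderiv 𝓘(ℝ, E3) (𝓡 3) (extChartAt (𝓡 3) x₀).symm y' : E3 →L[ℝ] E3) =
        (mfderiv 𝓘(ℝ, E3) (𝓡 3) (extChartAt (𝓡 3) x₀).symm y : E3 →L[ℝ] E3) := by rintro _ rfl; rfl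
    h _ ((extChartAt (𝓡 3) x₀).right_inv hy')
  simp only [Function.comp, hK]
  rfl

theorem nullFn_eq (g : Metric3 S) (p : CCot S) : nullFn g p = pairC (gram g p.1) (comp p) (comp p) :=
  rfl

theorem hermFn_eq (g : Metric3 S) (p : CCot S) :
    hermFn g p = pairC (gram g p.1) (comp p) (conjC (comp p)) := rfl

theorem etaDown_eq (g : Metric3 S) (p : CCot S) : etaDown g p = etaD (gram g p.1) (comp p) := rfl

theorem nullFn_crd (hS : IsOrientedAtlas S) (g : Metric3 S) {x₀ : S} {p : CCot S}
    (hp : p.1 ∈ (chartAt E3 x₀).source) :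
    nullFn g p = pairC (gramC g x₀ (crd x₀ p).1) (compv (crd x₀ p).2) (compv (crd x₀ p).2) := by
  rw [crd, gramC_eq g hp, compv_covCrd, pairC_pullC _ (matK_det_pos hS hp).ne'.isUnit]; rfl

theorem hermFn_crd (hS : IsOrientedAtlas S) (g : Metric3 S) {x₀ : S} {p : CCot S}
    (hp : p.1 ∈ (chartAt E3 x₀).source) :
    hermFn g p = pairC (gramC g x₀ (crd x₀ p).1) (compv (crd x₀ p).2) (conjC (compv (crd x₀ p).2)) := by
  rw [crd, gramC_eq g hp, compv_covCrd, conjC_pullC, pairC_pullC _ (matK_det_pos hS hp).ne'.isUnit]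
  rfl

theorem hermFn_eq_hermR (g : Metric3 S) (p : CCot S) :
    hermFn g p = (hermR (gram g p.1) (comp p) : ℂ) := pairC_conjC (gram_posDef g p.1) _

theorem realC_chartK (x₀ x : S) (a : E3) :
    realC (chartK x₀ x a) = (matK x₀ x).map Complex.ofReal *ᵥ realC a := by
  ext i
  conv_lhs => rw [vec_eq_sum a]
  simp [realC, Matrix.mulVec, dotProduct, matK, mul_comm]

/-- The pull back of `ζ_i dx^i` in the coordinates at `x₀`. -/
theorem theta1_crd {x₀ : S} {p : CCot S} (hp : p.1 ∈ (chartAt E3 x₀).source) (a : TCot) :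
    theta1 p a = (crd x₀ p).2 (chartD x₀ p.1 a.1) := by
  have h : (crd x₀ p).2 (chartD x₀ p.1 a.1) = covec p a.1 :=
    congrArg (covec p) (chartK_chartD hp a.1)
  rw [h, covec_apply]
  simp only [theta1, _root_.sum_apply, _root_.smul_apply, smul_eq_mul, dotProduct]
  rfl

theorem theta_apply (g : Metric3 S) (p : CCot S) (a : TCot) :
    theta g p a = realC (etaDown g p) ⬝ᵥ realC a.1 := by
  simp only [theta, _root_.sum_apply, _root_.smul_apply, smul_eq_mul, dotProduct]
  rfl

/-- The pull back of `η_i dx^i` in the coordinates at `x₀`. -/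
theorem theta_crd (hS : IsOrientedAtlas S) (g : Metric3 S) {x₀ : S} {p : CCot S}
    (hp : p.1 ∈ (chartAt E3 x₀).source) (a : TCot) :
    theta g p a = realC (etaD (gramC g x₀ (crd x₀ p).1) (compv (crd x₀ p).2)) ⬝ᵥ
      realC (chartD x₀ p.1 a.1) := by
  rw [theta_apply]
  conv_lhs => rw [← chartK_chartD hp a.1]
  rw [crd, gramC_eq g hp, compv_covCrd, etaD_pullC (matK_det_pos hS hp), realC_chartK,
    dotProduct_mulVec, ← Matrix.mulVec_transpose]
  congr 1
  ext i
  simp [realC, Matrix.mulVec, dotProduct]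
  rfl

end Coordinates

/-! ### Expressions of the forms in one chart, and their smoothness. -/

section FixedChart

open ComplexConjugate

variable {S : Type*} [TopologicalSpace S] [ChartedSpace E3 S] [IsManifold (𝓡 3) ∞ S]

/-! ### The adapted coframe in the coordinates of a fixed chart -/

/-- The derivatives of the metric in the coordinates of the preferred chart at `x₀`. -/
def dGramC (g : Metric3 S) (x₀ : S) (y : E3) (k i j : Fin 3) : ℝ :=
  fderiv ℝ (fun y => gramChart g x₀ y i j) y (coordVec k)

/-- The covectors `δζ_j` in the coordinates of the preferred chart at `x₀`. -/
def cDelta (g : Metric3 S) (x₀ : S) (q : TCot) (j : Fin 3) : TCot →L[ℝ] ℂ :=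
  dzeta j - ∑ k, ∑ l,
    ((chris (gramC g x₀ q.1) (dGramC g x₀ q.1) k j l : ℂ) * compv q.2 l) • dx k

/-- The form `θ` in the coordinates of the preferred chart at `x₀`. -/
def cTheta (g : Metric3 S) (x₀ : S) (q : TCot) : TCot →L[ℝ] ℂ :=
  ∑ i, (etaD (gramC g x₀ q.1) (compv q.2) i : ℂ) • dx i

/-- The form `θ̃¹` in coordinates. -/
def cTheta1 (q : TCot) : TCot →L[ℝ] ℂ := ∑ i, compv q.2 i • dx i

/-- The form `θ̃²` in the coordinates of the preferred chart at `x₀`. -/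
def cTheta2 (g : Metric3 S) (x₀ : S) (q : TCot) : TCot →L[ℝ] ℂ :=
  ∑ j, (Complex.I * (etaU (gramC g x₀ q.1) (compv q.2) j : ℂ)) • cDelta g x₀ q j

/-- The form `θ̃³` in the coordinates of the preferred chart at `x₀`. -/
def cTheta3 (g : Metric3 S) (x₀ : S) (q : TCot) : TCot →L[ℝ] ℂ :=
  (-(Complex.I / 2)) • ∑ j, (conj (upC (gramC g x₀ q.1) (compv q.2) j) • cDelta g x₀ q j
    - upC (gramC g x₀ q.1) (compv q.2) j • conjForm (cDelta g x₀ q j))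

theorem crd_self (p : CCot S) : crd p.1 p = (extChartAt (𝓡 3) p.1 p.1, covec p) := by
  refine Prod.ext rfl ?_
  ext v
  change covec p (chartK p.1 p.1 v) = covec p v
  rw [chartK_self]; rfl

theorem cDelta_self (g : Metric3 S) (p : CCot S) (j : Fin 3) :
    cDelta g p.1 (crd p.1 p) j = deltaZeta g p j := by
  rw [crd_self, cDelta, gramC_self]; rfl

/-- The invariantly defined form uses the Christoffel symbols of the preferred chart at p itself, so
the agreement with the fixed-chart form is immediate over the centre of the chart. Agreement
elsewhere is not required. -/
theorem cTheta2_self (g : Metric3 S) (p : CCot S) : cTheta2 g p.1 (crd p.1 p) = theta2 g p := by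
  rw [cTheta2]; simp only [cDelta_self]; rw [crd_self, gramC_self]; rfl

theorem cTheta3_self (g : Metric3 S) (p : CCot S) : cTheta3 g p.1 (crd p.1 p) = theta3 g p := by
  rw [cTheta3]; simp only [cDelta_self]; rw [crd_self, gramC_self]; rfl

theorem cDelta_apply (g : Metric3 S) (x₀ : S) (q a : TCot) (j : Fin 3) :
    cDelta g x₀ q j a =
      delta (gramC g x₀ q.1) (dGramC g x₀ q.1) (compv q.2) (compv a.2) a.1 j := by
  simp only [cDelta, _root_.sub_apply, _root_.sum_apply, _root_.smul_apply, smul_eq_mul]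
  rfl

theorem cTheta_apply (g : Metric3 S) (x₀ : S) (q a : TCot) :
    cTheta g x₀ q a = realC (etaD (gramC g x₀ q.1) (compv q.2)) ⬝ᵥ realC a.1 := by
  simp only [cTheta, _root_.sum_apply, _root_.smul_apply, smul_eq_mul]
  rfl

theorem cTheta1_apply (q a : TCot) : cTheta1 q a = compv q.2 ⬝ᵥ realC a.1 := by
  simp only [cTheta1, _root_.sum_apply, _root_.smul_apply, smul_eq_mul]
  rfl

theorem cTheta2_apply (g : Metric3 S) (x₀ : S) (q a : TCot) :
    cTheta2 g x₀ q a = Complex.I * (realC (etaU (gramC g x₀ q.1) (compv q.2)) ⬝ᵥ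
      delta (gramC g x₀ q.1) (dGramC g x₀ q.1) (compv q.2) (compv a.2) a.1) := by
  simp only [cTheta2, _root_.sum_apply, _root_.smul_apply, smul_eq_mul, cDelta_apply, dotProduct,
    Finset.mul_sum]
  exact Finset.sum_congr rfl fun i _ => by rw [realC]; ring

theorem conjForm_apply {E : Type*} [NormedAddCommGroup E] [NormedSpace ℝ E] (α : E →L[ℝ] ℂ) (v : E) :
    conjForm α v = conj (α v) := rfl

set_option synthInstance.maxHeartbeats 400000 in
theorem cTheta3_apply (g : Metric3 S) (x₀ : S) (q a : TCot) :
    cTheta3 g x₀ q a = -(Complex.I / 2) * (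
      conjC (upC (gramC g x₀ q.1) (compv q.2)) ⬝ᵥ
        delta (gramC g x₀ q.1) (dGramC g x₀ q.1) (compv q.2) (compv a.2) a.1
      - conj (conjC (upC (gramC g x₀ q.1) (compv q.2)) ⬝ᵥ
        delta (gramC g x₀ q.1) (dGramC g x₀ q.1) (compv q.2) (compv a.2) a.1)) := by
  simp only [cTheta3, _root_.sum_apply, _root_.smul_apply, _root_.sub_apply, smul_eq_mul, cDelta_apply,
    conjForm_apply, dotProduct, map_sum, map_mul, Finset.sum_sub_distrib]
  simp [conjC]

/-! ### Smoothness -/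

section Generic

variable {E F : Type*} [NormedAddCommGroup E] [NormedSpace ℝ E] [NormedAddCommGroup F]
  [NormedSpace ℝ F] {f : F → E →L[ℝ] ℂ} {z : F}

theorem contDiffAt_smulForm {c : F → ℂ} (hc : ContDiffAt ℝ ∞ c z) (hf : ContDiffAt ℝ ∞ f z) :
    ContDiffAt ℝ ∞ (fun z => c z • f z) z := hc.smul hf

theorem contDiffAt_conjForm (hf : ContDiffAt ℝ ∞ f z) :
    ContDiffAt ℝ ∞ (fun z => conjForm (f z)) z :=
  contDiffAt_const.clm_comp hf

end Generic

theorem inv_apply_eq {G : Matrix (Fin 3) (Fin 3) ℝ} (i j : Fin 3) :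
    G⁻¹ i j = G.det⁻¹ * G.adjugate i j := by
  rw [Matrix.inv_def]; simp

section Smooth

variable {E : Type*} [NormedAddCommGroup E] [NormedSpace ℝ E] {z₀ : E}
  {G : E → Matrix (Fin 3) (Fin 3) ℝ}

theorem ContDiffAt.matrix_det (hG : ∀ i j, ContDiffAt ℝ ∞ (fun z => G z i j) z₀) :
    ContDiffAt ℝ ∞ (fun z => (G z).det) z₀ := by
  simp only [Matrix.det_fin_three]
  have := hG 0 0; have := hG 0 1; have := hG 0 2; have := hG 1 0; have := hG 1 1; have := hG 1 2
  have := hG 2 0; have := hG 2 1; have := hG 2 2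
  fun_prop

theorem ContDiffAt.matrix_inv (hG : ∀ i j, ContDiffAt ℝ ∞ (fun z => G z i j) z₀)
    (h0 : (G z₀).det ≠ 0) (i j : Fin 3) : ContDiffAt ℝ ∞ (fun z => (G z)⁻¹ i j) z₀ := by
  simp only [inv_apply_eq]
  refine ((ContDiffAt.matrix_det hG).inv h0).mul ?_
  have := hG 0 0; have := hG 0 1; have := hG 0 2; have := hG 1 0; have := hG 1 1; have := hG 1 2
  have := hG 2 0; have := hG 2 1; have := hG 2 2
  simp only [Matrix.adjugate_fin_three]
  fin_cases i <;> fin_cases j <;> simp <;> fun_prop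

theorem ContDiffAt.ofReal {f : E → ℝ} (hf : ContDiffAt ℝ ∞ f z₀) :
    ContDiffAt ℝ ∞ (fun z => (f z : ℂ)) z₀ :=
  Complex.ofRealCLM.contDiff.contDiffAt.comp z₀ hf

theorem ContDiffAt.upC {Z : E → Fin 3 → ℂ} (hG : ∀ i j, ContDiffAt ℝ ∞ (fun z => G z i j) z₀)
    (h0 : (G z₀).det ≠ 0) (hZ : ∀ i, ContDiffAt ℝ ∞ (fun z => Z z i) z₀) (i : Fin 3) :
    ContDiffAt ℝ ∞ (fun z => upC (G z) (Z z) i) z₀ := by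
  simp only [TwistorFefferman.upC, invC, Matrix.mulVec, dotProduct, Matrix.map_apply]
  exact ContDiffAt.sum fun j _ => (ContDiffAt.ofReal (ContDiffAt.matrix_inv hG h0 i j)).mul (hZ j)

theorem ContDiffAt.etaU {Z : E → Fin 3 → ℂ} (hG : ∀ i j, ContDiffAt ℝ ∞ (fun z => G z i j) z₀)
    (h0 : 0 < (G z₀).det) (hZ : ∀ i, ContDiffAt ℝ ∞ (fun z => Z z i) z₀) (i : Fin 3) :
    ContDiffAt ℝ ∞ (fun z => etaU (G z) (Z z) i) z₀ := by
  have hd := ContDiffAt.matrix_det hG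
  have hs : ContDiffAt ℝ ∞ (fun z => 2 / Real.sqrt (G z).det) z₀ :=
    contDiffAt_const.div (hd.sqrt h0.ne') (Real.sqrt_ne_zero'.2 h0)
  have hre : ∀ i, ContDiffAt ℝ ∞ (fun z => (Z z i).re) z₀ := fun i =>
    Complex.reCLM.contDiff.contDiffAt.comp z₀ (hZ i)
  have him : ∀ i, ContDiffAt ℝ ∞ (fun z => (Z z i).im) z₀ := fun i =>
    Complex.imCLM.contDiff.contDiffAt.comp z₀ (hZ i)
  simp only [TwistorFefferman.etaU, Pi.smul_apply, smul_eq_mul, cross_apply]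
  refine hs.mul ?_
  have := hre 0; have := hre 1; have := hre 2; have := him 0; have := him 1; have := him 2
  fin_cases i <;> simp <;> fun_prop

theorem ContDiffAt.etaD {Z : E → Fin 3 → ℂ} (hG : ∀ i j, ContDiffAt ℝ ∞ (fun z => G z i j) z₀)
    (h0 : 0 < (G z₀).det) (hZ : ∀ i, ContDiffAt ℝ ∞ (fun z => Z z i) z₀) (i : Fin 3) :
    ContDiffAt ℝ ∞ (fun z => etaD (G z) (Z z) i) z₀ := by
  simp only [TwistorFefferman.etaD, Matrix.mulVec, dotProduct]
  exact ContDiffAt.sum fun j _ => (hG i j).mul (ContDiffAt.etaU hG h0 hZ j)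

end Smooth

theorem contDiffAt_compv (q : TCot) (i : Fin 3) : ContDiffAt ℝ ∞ (fun q : TCot => compv q.2 i) q :=
  ((ContinuousLinearMap.apply ℝ ℂ (coordVec i)).contDiff.comp contDiff_snd).contDiffAt

theorem contDiffAt_gramC (g : Metric3 S) {x₀ : S} {y : E3} (hy : y ∈ (chartAt E3 x₀).target)
    (i j : Fin 3) : ContDiffAt ℝ ∞ (fun y => gramC g x₀ y i j) y :=
  (contDiffOn_gramChart g x₀ i j).contDiffAt ((chartAt E3 x₀).open_target.mem_nhds hy)

theorem contDiffAt_dGramC (g : Metric3 S) {x₀ : S} {y : E3} (hy : y ∈ (chartAt E3 x₀).target)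
    (k i j : Fin 3) : ContDiffAt ℝ ∞ (fun y => dGramC g x₀ y k i j) y :=
  ((contDiffAt_gramC g hy i j).fderiv_right (m := ∞) (by norm_num)).clm_apply contDiffAt_const

variable {g : Metric3 S} {x₀ : S} {q : TCot}

theorem contDiffAt_gramC_fst (g : Metric3 S) (hq : q.1 ∈ (chartAt E3 x₀).target) (i j : Fin 3) :
    ContDiffAt ℝ ∞ (fun q : TCot => gramC g x₀ q.1 i j) q :=
  (contDiffAt_gramC g hq i j).comp q contDiffAt_fst

theorem contDiffAt_cDelta (hS : IsOrientedAtlas S) (hq : q.1 ∈ (chartAt E3 x₀).target) (j : Fin 3) :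
    ContDiffAt ℝ ∞ (fun q => cDelta g x₀ q j) q := by
  have hdG : ∀ k i j, ContDiffAt ℝ ∞ (fun q : TCot => dGramC g x₀ q.1 k i j) q := fun k i j =>
    (contDiffAt_dGramC g hq k i j).comp q contDiffAt_fst
  have hGI := ContDiffAt.matrix_inv (contDiffAt_gramC_fst g hq) (gramC_posDef hS g hq).det_pos.ne'
  refine contDiffAt_const.sub (ContDiffAt.sum fun k _ => ContDiffAt.sum fun l _ =>
    contDiffAt_smulForm (ContDiffAt.mul (ContDiffAt.ofReal ?_) (contDiffAt_compv q l)) contDiffAt_const)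
  exact contDiffAt_const.mul (ContDiffAt.sum fun m _ =>
    (hGI l m).mul (((hdG _ _ _).add (hdG _ _ _)).sub (hdG _ _ _)))

theorem contDiffAt_cTheta (hS : IsOrientedAtlas S) (hq : q.1 ∈ (chartAt E3 x₀).target) :
    ContDiffAt ℝ ∞ (fun q => cTheta g x₀ q) q :=
  ContDiffAt.sum fun i _ => contDiffAt_smulForm (ContDiffAt.ofReal (ContDiffAt.etaD
    (contDiffAt_gramC_fst g hq) (gramC_posDef hS g hq).det_pos (contDiffAt_compv q) i))
      contDiffAt_const

theorem contDiffAt_cTheta1 : ContDiffAt ℝ ∞ (fun q => cTheta1 q) q :=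
  ContDiffAt.sum fun i _ => contDiffAt_smulForm (contDiffAt_compv q i) contDiffAt_const

theorem contDiffAt_cTheta2 (hS : IsOrientedAtlas S) (hq : q.1 ∈ (chartAt E3 x₀).target) :
    ContDiffAt ℝ ∞ (fun q => cTheta2 g x₀ q) q :=
  ContDiffAt.sum fun i _ => contDiffAt_smulForm (contDiffAt_const.mul (ContDiffAt.ofReal
    (ContDiffAt.etaU (contDiffAt_gramC_fst g hq) (gramC_posDef hS g hq).det_pos
      (contDiffAt_compv q) i))) (contDiffAt_cDelta hS hq i)

set_option synthInstance.maxHeartbeats 400000 in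
theorem contDiffAt_cTheta3 (hS : IsOrientedAtlas S) (hq : q.1 ∈ (chartAt E3 x₀).target) :
    ContDiffAt ℝ ∞ (fun q => cTheta3 g x₀ q) q := by
  have hup := ContDiffAt.upC (contDiffAt_gramC_fst g hq) (gramC_posDef hS g hq).det_pos.ne'
    (contDiffAt_compv q)
  have hconj : ∀ i, ContDiffAt ℝ ∞ (fun q : TCot => conj (upC (gramC g x₀ q.1) (compv q.2) i)) q :=
    fun i => Complex.conjCLE.contDiff.contDiffAt.comp q (hup i)
  exact contDiffAt_smulForm contDiffAt_const (ContDiffAt.sum fun i _ =>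
    (contDiffAt_smulForm (hconj i) (contDiffAt_cDelta hS hq i)).sub
    (contDiffAt_smulForm (hup i) (contDiffAt_conjForm (contDiffAt_cDelta hS hq i))))

end FixedChart

/-! ### Covariant derivatives along maps and the first structure equations. -/

section StructureEquations

open ComplexConjugate

variable {S : Type*} [TopologicalSpace S] [ChartedSpace E3 S] [IsManifold (𝓡 3) ∞ S]
variable {E F : Type*} [NormedAddCommGroup E] [NormedSpace ℝ E] [NormedAddCommGroup F] [NormedSpace ℝ F]

/-! ### Structure equations -/

/-- The exterior derivative of the form `α_i dX^i`. -/
theorem dOne_comp_fderiv {α : E → F →L[ℝ] ℂ} {X : E → F} {z : E} (hα : DifferentiableAt ℝ α z)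
    (hX : ContDiffAt ℝ ∞ X z) (v w : E) :
    dOne (fun z => (α z).comp (fderiv ℝ X z)) z ![v, w] =
      fderiv ℝ α z v (fderiv ℝ X z w) - fderiv ℝ α z w (fderiv ℝ X z v) := by
  have hX' : DifferentiableAt ℝ (fderiv ℝ X) z :=
    (hX.fderiv_right (m := 1) (by norm_cast)).differentiableAt (by norm_num)
  have hd := hα.hasFDerivAt.clm_comp hX'.hasFDerivAt
  rw [dOne_apply hd.differentiableAt, hd.fderiv]
  -- This symmetry is d(dX) = 0.
  have hsymm : fderiv ℝ (fderiv ℝ X) z v w = fderiv ℝ (fderiv ℝ X) z w v :=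
    (hX.isSymmSndFDerivAt (by simp; norm_cast)).eq v w
  simp [hsymm]

/-- The pull back of a form by a map `c`. -/
def pbForm (Ω : F → F →L[ℝ] ℂ) (c : E → F) (z : E) : E →L[ℝ] ℂ := (Ω (c z)).comp (fderiv ℝ c z)

theorem pbForm_apply (Ω : F → F →L[ℝ] ℂ) (c : E → F) (z v : E) :
    pbForm Ω c z v = Ω (c z) (fderiv ℝ c z v) := rfl

theorem contDiffAt_pbForm {Ω : F → F →L[ℝ] ℂ} {c : E → F} {z : E} (hΩ : ContDiffAt ℝ ∞ Ω (c z))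
    (hc : ContDiffAt ℝ ∞ c z) : ContDiffAt ℝ ∞ (pbForm Ω c) z :=
  (hΩ.comp z hc).clm_comp (hc.fderiv_right (m := ∞) (by norm_num))

theorem dGramC_symm (g : Metric3 S) (x₀ : S) (y : E3) (k i j : Fin 3) :
    dGramC g x₀ y k i j = dGramC g x₀ y k j i := by
  have : (fun y => gramChart g x₀ y i j) = fun y => gramChart g x₀ y j i :=
    funext fun y => g.symm _ _ _
  rw [dGramC, this]; rfl

theorem fderiv_gramC (g : Metric3 S) {x₀ : S} {X : E → E3} {z : E}
    (hx : X z ∈ (chartAt E3 x₀).target) (hX : DifferentiableAt ℝ X z) (v : E) (i j : Fin 3) :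
    fderiv ℝ (fun z => gramC g x₀ (X z) i j) z v = ∑ k, dGramC g x₀ (X z) k i j * fderiv ℝ X z v k := by
  have h := ((contDiffAt_gramC g hx i j).differentiableAt (by norm_num)).hasFDerivAt.comp z
    hX.hasFDerivAt
  rw [show fderiv ℝ (fun z => gramC g x₀ (X z) i j) z = _ from h.fderiv]
  rw [ContinuousLinearMap.comp_apply]
  conv_lhs => rw [vec_eq_sum (fderiv ℝ X z v)]
  rw [map_sum]
  exact Finset.sum_congr rfl fun k _ => by rw [map_smul, smul_eq_mul, mul_comm]; rfl

/-- Differentiate G⁻¹G = 1, which holds throughout a neighbourhood of z. -/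
theorem fderiv_gramC_inv (hS : IsOrientedAtlas S) (g : Metric3 S) {x₀ : S} {X : E → E3} {z : E}
    (hx : X z ∈ (chartAt E3 x₀).target) (hX : ContDiffAt ℝ ∞ X z) (v : E) :
    (Matrix.of fun i j => fderiv ℝ (fun z => (gramC g x₀ (X z))⁻¹ i j) z v) =
      -((gramC g x₀ (X z))⁻¹ * (Matrix.of fun i j => ∑ k, dGramC g x₀ (X z) k i j * fderiv ℝ X z v k)
        * (gramC g x₀ (X z))⁻¹) := by
  have hG : ∀ i j, ContDiffAt ℝ ∞ (fun z => gramC g x₀ (X z) i j) z := fun i j =>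
    (contDiffAt_gramC g hx i j).comp z hX
  have hu : IsUnit (gramC g x₀ (X z)).det := (gramC_posDef hS g hx).det_pos.ne'.isUnit
  have hI := ContDiffAt.matrix_inv hG hu.ne_zero
  have hG' := fun i j => (hG i j).differentiableAt (by norm_num)
  have hI' := fun i j => (hI i j).differentiableAt (by norm_num)
  set N : Matrix (Fin 3) (Fin 3) ℝ :=
    Matrix.of fun i j => fderiv ℝ (fun z => (gramC g x₀ (X z))⁻¹ i j) z v with hN
  set D : Matrix (Fin 3) (Fin 3) ℝ :=
    Matrix.of fun i j => ∑ k, dGramC g x₀ (X z) k i j * fderiv ℝ X z v k with hD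
  have hkey : N * gramC g x₀ (X z) + (gramC g x₀ (X z))⁻¹ * D = 0 := by
    ext i j
    have h1 : ∀ᶠ z' in 𝓝 z, ∑ k, (gramC g x₀ (X z'))⁻¹ i k * gramC g x₀ (X z') k j =
        (1 : Matrix (Fin 3) (Fin 3) ℝ) i j := by
      filter_upwards [hX.continuousAt.preimage_mem_nhds ((chartAt E3 x₀).open_target.mem_nhds hx)]
        with z' hz'
      rw [← Matrix.mul_apply, Matrix.nonsing_inv_mul _ (gramC_posDef hS g hz').det_pos.ne'.isUnit]
    have h2 : fderiv ℝ (fun z' => ∑ k, (gramC g x₀ (X z'))⁻¹ i k * gramC g x₀ (X z') k j) z = 0 := by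
      rw [Filter.EventuallyEq.fderiv_eq h1]; simp
    have h3 : HasFDerivAt (fun z' => ∑ k, (gramC g x₀ (X z'))⁻¹ i k * gramC g x₀ (X z') k j) _ z :=
      HasFDerivAt.fun_sum fun k _ => (hI' i k).hasFDerivAt.mul (hG' k j).hasFDerivAt
    rw [h3.fderiv] at h2
    have h4 := congrArg (fun L : E →L[ℝ] ℝ => L v) h2
    simp only [_root_.sum_apply, _root_.add_apply, _root_.smul_apply, smul_eq_mul, _root_.zero_apply,
      fderiv_gramC g hx (hX.differentiableAt (by norm_num))] at h4
    rw [Matrix.add_apply, Matrix.mul_apply, Matrix.mul_apply, Matrix.zero_apply, ← h4,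
      ← Finset.sum_add_distrib]
    refine Finset.sum_congr rfl fun k _ => ?_
    rw [hN, hD, Matrix.of_apply, Matrix.of_apply]; ring
  have h5 := congrArg (· * (gramC g x₀ (X z))⁻¹) hkey
  simp only [Matrix.add_mul, Matrix.mul_assoc, Matrix.mul_nonsing_inv _ hu, Matrix.mul_one,
    Matrix.zero_mul] at h5
  rw [eq_neg_of_add_eq_zero_left h5, Matrix.mul_assoc]

/-- The covariant derivative of a covector field along a map. -/
def covDeriv (g : Metric3 S) (x₀ : S) (X : E → E3) (α : E → Fin 3 → ℂ) (z v : E) : Fin 3 → ℂ :=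
  delta (gramC g x₀ (X z)) (dGramC g x₀ (X z)) (α z) (fun i => fderiv ℝ (fun z => α z i) z v)
    (fderiv ℝ X z v)

/-- Compatibility of the connection with the metric, along a map: `pairC_deriv` absorbs the
derivative of the inverse metric into the two covariant derivatives. -/
theorem fderiv_pairC (hS : IsOrientedAtlas S) (g : Metric3 S) {x₀ : S} {X : E → E3} {z : E}
    (hx : X z ∈ (chartAt E3 x₀).target) (hX : ContDiffAt ℝ ∞ X z) {α β : E → Fin 3 → ℂ}
    (hα : ∀ i, DifferentiableAt ℝ (fun z => α z i) z) (hβ : ∀ i, DifferentiableAt ℝ (fun z => β z i) z)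
    (v : E) :
    fderiv ℝ (fun z => pairC (gramC g x₀ (X z)) (α z) (β z)) z v =
      pairC (gramC g x₀ (X z)) (covDeriv g x₀ X α z v) (β z)
        + pairC (gramC g x₀ (X z)) (α z) (covDeriv g x₀ X β z v) := by
  have hpd := gramC_posDef hS g hx
  have hI' : ∀ i j, HasFDerivAt (fun z => (((gramC g x₀ (X z))⁻¹ i j : ℝ) : ℂ))
      (Complex.ofRealCLM.comp (fderiv ℝ (fun z => (gramC g x₀ (X z))⁻¹ i j) z)) z := fun i j =>
    Complex.ofRealCLM.hasFDerivAt.comp z ((ContDiffAt.matrix_inv (G := fun z => gramC g x₀ (X z))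
      (fun i j => (contDiffAt_gramC g hx i j).comp z hX) hpd.det_pos.ne' i j).differentiableAt
      (by norm_num)).hasFDerivAt
  rw [covDeriv, covDeriv, ← pairC_deriv hpd (dGramC_symm g x₀ (X z)),
    ← fderiv_gramC_inv hS g hx hX]
  have h : HasFDerivAt (fun z => ∑ i, (∑ j, (((gramC g x₀ (X z))⁻¹ i j : ℝ) : ℂ) * α z j) * β z i) _ z :=
    HasFDerivAt.fun_sum fun i _ => (HasFDerivAt.fun_sum (u := Finset.univ)
      (A := fun j z => (((gramC g x₀ (X z))⁻¹ i j : ℝ) : ℂ) * α z j)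
      fun j _ => (hI' i j).mul (hα j).hasFDerivAt).mul (hβ i).hasFDerivAt
  change fderiv ℝ (fun z => ∑ i, (∑ j, (((gramC g x₀ (X z))⁻¹ i j : ℝ) : ℂ) * α z j) * β z i) z v = _
  rw [h.fderiv]
  simp only [pairC, upC, invC, Matrix.mulVec, dotProduct, Matrix.map_apply, Matrix.of_apply,
    _root_.sum_apply, _root_.add_apply, _root_.smul_apply, smul_eq_mul, ContinuousLinearMap.comp_apply,
    Complex.ofRealCLM_apply]
  rw [← Finset.sum_add_distrib, ← Finset.sum_add_distrib]
  refine Finset.sum_congr rfl fun i _ => ?_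
  simp only [Fin.sum_univ_three]
  ring

/-- Contraction of the exterior derivative of `α_i dX^i` in terms of covariant derivatives. -/
theorem dOne_covDeriv (g : Metric3 S) (x₀ : S) {X : E → E3} {z : E} (hX : ContDiffAt ℝ ∞ X z)
    {α : E → Fin 3 → ℂ} (hα : ∀ i, ContDiffAt ℝ ∞ (fun z => α z i) z) (v w : E) :
    dOne (fun z => (ofComp (α z)).comp (fderiv ℝ X z)) z ![v, w] =
      covDeriv g x₀ X α z v ⬝ᵥ realC (fderiv ℝ X z w)
        - covDeriv g x₀ X α z w ⬝ᵥ realC (fderiv ℝ X z v) := by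
  have hd : HasFDerivAt (fun z => ofComp (α z)) _ z := HasFDerivAt.fun_sum fun i _ =>
    ((hα i).differentiableAt (by norm_num)).hasFDerivAt.smul
      (hasFDerivAt_const (Complex.ofRealCLM.comp (EuclideanSpace.proj i : E3 →L[ℝ] ℝ)) z)
  have hd' : ∀ v a, fderiv ℝ (fun z => ofComp (α z)) z v a =
      (fun i => fderiv ℝ (fun z => α z i) z v) ⬝ᵥ realC a := by
    intro v a
    rw [hd.fderiv]
    simp [dotProduct, realC]
  rw [dOne_comp_fderiv hd.differentiableAt hX, hd', hd', covDeriv, covDeriv,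
    delta_torsion (dGramC_symm g x₀ (X z))]

/-! ### The structure equations of the adapted coframe -/

/-- A map to the coordinate space of `ℂT*S` whose values satisfy `g(ζ, ζ) = 0`, `g(ζ, ζ̄) = 1`. -/
def IsUnitNull (g : Metric3 S) (x₀ : S) (c : E → TCot) (z : E) : Prop :=
  (c z).1 ∈ (chartAt E3 x₀).target ∧
  (∀ᶠ z in 𝓝 z, ContDiffAt ℝ ∞ c z) ∧
  (∀ᶠ z in 𝓝 z, pairC (gramC g x₀ (c z).1) (compv (c z).2) (compv (c z).2) = 0) ∧
  (∀ᶠ z in 𝓝 z, pairC (gramC g x₀ (c z).1) (compv (c z).2) (conjC (compv (c z).2)) = 1)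

variable {g : Metric3 S} {x₀ : S} {c : E → TCot} {z : E}

theorem IsUnitNull.mem (h : IsUnitNull g x₀ c z) :
    (c z).1 ∈ (chartAt E3 x₀).target := h.1

theorem IsUnitNull.smooth_nhds (h : IsUnitNull g x₀ c z) :
    ∀ᶠ z in 𝓝 z, ContDiffAt ℝ ∞ c z := h.2.1

theorem IsUnitNull.null (h : IsUnitNull g x₀ c z) :
    ∀ᶠ z in 𝓝 z, pairC (gramC g x₀ (c z).1) (compv (c z).2) (compv (c z).2) = 0 := h.2.2.1

theorem IsUnitNull.unit (h : IsUnitNull g x₀ c z) :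
    ∀ᶠ z in 𝓝 z, pairC (gramC g x₀ (c z).1) (compv (c z).2) (conjC (compv (c z).2)) = 1 := h.2.2.2

theorem IsUnitNull.smooth (h : IsUnitNull g x₀ c z) : ContDiffAt ℝ ∞ c z := h.smooth_nhds.self_of_nhds

theorem pairC_zero_left (G : Matrix (Fin 3) (Fin 3) ℝ) (w : Fin 3 → ℂ) : pairC G 0 w = 0 := by
  rw [pairC, upC, Matrix.mulVec_zero, zero_dotProduct]

theorem IsUnitNull.ne_zero (h : IsUnitNull g x₀ c z) : compv (c z).2 ≠ 0 := fun h0 =>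
  zero_ne_one ((pairC_zero_left _ _).symm.trans (h0 ▸ h.unit.self_of_nhds))

theorem IsUnitNull.hermR_eq (h : IsUnitNull g x₀ c z) (hS : IsOrientedAtlas S) :
    hermR (gramC g x₀ (c z).1) (compv (c z).2) = 1 := by
  have := h.unit.self_of_nhds
  rw [pairC_conjC (gramC_posDef hS g h.mem)] at this
  exact_mod_cast this

theorem IsUnitNull.eventually (h : IsUnitNull g x₀ c z) : ∀ᶠ z' in 𝓝 z, IsUnitNull g x₀ c z' := by
  filter_upwards [h.smooth.continuousAt.fst.preimage_mem_nhds
    ((chartAt E3 x₀).open_target.mem_nhds h.mem), h.smooth_nhds.eventually_nhds,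
    h.null.eventually_nhds, h.unit.eventually_nhds] with z' h1 h2 h3 h4
  exact ⟨h1, h2, h3, h4⟩

theorem fderiv_fst_apply (hc : DifferentiableAt ℝ c z) (v : E) :
    (fderiv ℝ c z v).1 = fderiv ℝ (fun z => (c z).1) z v := by
  rw [hc.hasFDerivAt.fst.fderiv]; rfl

theorem compv_fderiv_snd (hc : DifferentiableAt ℝ c z) (v : E) :
    compv (fderiv ℝ c z v).2 = fun i => fderiv ℝ (fun z => compv (c z).2 i) z v := by
  ext i
  have : HasFDerivAt (fun z => compv (c z).2 i) _ z :=
    (ContinuousLinearMap.apply ℝ ℂ (coordVec i)).hasFDerivAt.comp z hc.hasFDerivAt.snd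
  rw [this.fderiv]; rfl

/-- The covariant derivative of the covector `ζ`. -/
theorem covDeriv_zeta (hc : DifferentiableAt ℝ c z) (v : E) :
    covDeriv g x₀ (fun z => (c z).1) (fun z => compv (c z).2) z v =
      delta (gramC g x₀ (c z).1) (dGramC g x₀ (c z).1) (compv (c z).2) (compv (fderiv ℝ c z v).2)
        (fderiv ℝ c z v).1 := by
  rw [covDeriv, compv_fderiv_snd hc, fderiv_fst_apply hc]

theorem covDeriv_conj (X : E → E3) {α : E → Fin 3 → ℂ}
    (hα : ∀ i, DifferentiableAt ℝ (fun z => α z i) z) (v : E) :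
    covDeriv g x₀ X (fun z => conjC (α z)) z v = conjC (covDeriv g x₀ X α z v) := by
  ext i
  have h : HasFDerivAt (fun z => conj (α z i)) _ z :=
    (Complex.conjCLE : ℂ →L[ℝ] ℂ).hasFDerivAt.comp z (hα i).hasFDerivAt
  simp only [covDeriv, delta, conjC, map_sub, map_sum, map_mul, Complex.conj_ofReal, h.fderiv]
  rfl

theorem contDiffAt_compv_comp (hc : ContDiffAt ℝ ∞ c z) (i : Fin 3) :
    ContDiffAt ℝ ∞ (fun z => compv (c z).2 i) z := (contDiffAt_compv (c z) i).comp z hc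

theorem IsUnitNull.contDiffAt_eta (h : IsUnitNull g x₀ c z) (hS : IsOrientedAtlas S) (i : Fin 3) :
    ContDiffAt ℝ ∞ (fun z => realC (etaD (gramC g x₀ (c z).1) (compv (c z).2)) i) z :=
  (ContDiffAt.ofReal (ContDiffAt.etaD (G := fun q : TCot => gramC g x₀ q.1)
    (contDiffAt_gramC_fst g h.mem) (gramC_posDef hS g h.mem).det_pos (contDiffAt_compv (c z)) i)).comp
    z h.smooth

section Contractions

variable (g x₀ c z) in
/-- `δζ` along the map `c`. -/
def dZ (v : E) : Fin 3 → ℂ :=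
  delta (gramC g x₀ (c z).1) (dGramC g x₀ (c z).1) (compv (c z).2) (compv (fderiv ℝ c z v).2)
    (fderiv ℝ c z v).1

/-- The derivative of the constraint g(ζ, ζ) = 0. -/
theorem IsUnitNull.zeta_contract (h : IsUnitNull g x₀ c z) (hS : IsOrientedAtlas S) (v : E) :
    upC (gramC g x₀ (c z).1) (compv (c z).2) ⬝ᵥ dZ g x₀ c z v = 0 := by
  have hd := h.smooth.differentiableAt (by norm_num)
  have h1 := fderiv_pairC hS g (X := fun z => (c z).1) h.mem h.smooth.fst
    (fun i => (contDiffAt_compv_comp h.smooth i).differentiableAt (by norm_num))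
    (fun i => (contDiffAt_compv_comp h.smooth i).differentiableAt (by norm_num)) v
  rw [Filter.EventuallyEq.fderiv_eq h.null, covDeriv_zeta hd,
    pairC_comm (gramC_posDef hS g h.mem) (delta _ _ _ _ _)] at h1
  simp only [fderiv_fun_const, Pi.zero_apply, _root_.zero_apply] at h1
  change _ = upC _ _ ⬝ᵥ dZ g x₀ c z v + upC _ _ ⬝ᵥ dZ g x₀ c z v at h1
  linear_combination -(1 / 2 : ℂ) * h1

/-- Differentiating g(ζ, ζ̄) = 1 shows that ζ̄^j δζ_j is purely imaginary. The form θ̃³ is its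
imaginary part, so nothing is lost. -/
theorem IsUnitNull.zetaBar_contract (h : IsUnitNull g x₀ c z) (hS : IsOrientedAtlas S) (v : E) :
    conjC (upC (gramC g x₀ (c z).1) (compv (c z).2)) ⬝ᵥ dZ g x₀ c z v =
      Complex.I * pbForm (cTheta3 g x₀) c z v := by
  have hd := h.smooth.differentiableAt (by norm_num)
  have hpd := gramC_posDef hS g h.mem
  have hcd := fun i => (contDiffAt_compv_comp h.smooth i).differentiableAt (by norm_num)
  have h1 := fderiv_pairC hS g (X := fun z => (c z).1) h.mem h.smooth.fst
    hcd (β := fun z => conjC (compv (c z).2))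
    (fun i => (Complex.conjCLE : ℂ →L[ℝ] ℂ).differentiableAt.comp z (hcd i)) v
  rw [Filter.EventuallyEq.fderiv_eq h.unit, covDeriv_conj _ hcd, covDeriv_zeta hd,
    pairC_comm hpd (delta _ _ _ _ _)] at h1
  simp only [fderiv_fun_const, Pi.zero_apply, _root_.zero_apply] at h1
  rw [pbForm_apply, cTheta3_apply]
  change _ = _ * (_ * (_ ⬝ᵥ dZ g x₀ c z v - conj (_ ⬝ᵥ dZ g x₀ c z v)))
  rw [conj_dot, conjC_conjC, ← upC_conjC]
  change _ = pairC _ _ (dZ g x₀ c z v) + pairC _ _ (conjC (dZ g x₀ c z v)) at h1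
  change pairC _ _ (dZ g x₀ c z v) = _ * (_ * (pairC _ _ (dZ g x₀ c z v) - pairC _ _ (conjC (dZ g x₀ c z v))))
  rw [eq_neg_of_add_eq_zero_right h1.symm]
  linear_combination (pairC (gramC g x₀ (c z).1) (conjC (compv (c z).2)) (dZ g x₀ c z v)) *
    Complex.I_mul_I

theorem eta_contract (v : E) :
    realC (etaU (gramC g x₀ (c z).1) (compv (c z).2)) ⬝ᵥ dZ g x₀ c z v =
      -Complex.I * pbForm (cTheta2 g x₀) c z v := by
  rw [pbForm_apply, cTheta2_apply]
  change _ = -Complex.I * (Complex.I * (_ ⬝ᵥ dZ g x₀ c z v))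
  linear_combination (realC (etaU (gramC g x₀ (c z).1) (compv (c z).2)) ⬝ᵥ dZ g x₀ c z v) *
    Complex.I_mul_I

/-- Completeness of the triad applied to dx. In a derivative of the form ∇α_i ∧ dx^i it leaves only
the contractions of ∇α with ζ, ζ̄ and η. -/
theorem IsUnitNull.dot_base (h : IsUnitNull g x₀ c z) (hS : IsOrientedAtlas S) (α : Fin 3 → ℂ) (w : E) :
    α ⬝ᵥ realC (fderiv ℝ c z w).1 =
      pbForm cTheta1 c z w * (conjC (upC (gramC g x₀ (c z).1) (compv (c z).2)) ⬝ᵥ α)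
      + conj (pbForm cTheta1 c z w) * (upC (gramC g x₀ (c z).1) (compv (c z).2) ⬝ᵥ α)
      + pbForm (cTheta g x₀) c z w * (realC (etaU (gramC g x₀ (c z).1) (compv (c z).2)) ⬝ᵥ α) := by
  have hpd := gramC_posDef hS g h.mem
  conv_lhs => rw [triad_complete hpd h.null.self_of_nhds h.ne_zero (realC (fderiv ℝ c z w).1),
    h.hermR_eq hS]
  simp only [pbForm_apply, cTheta1_apply, cTheta_apply, dotProduct_add, dotProduct_smul, conj_dot,
    conjC_realC, smul_eq_mul, Complex.ofReal_one, div_one, one_pow]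
  rw [dotProduct_comm α, dotProduct_comm α, dotProduct_comm α]

end Contractions

/-- Torsion-freeness gives dθ̃¹ = δζ_j ∧ dx^j. The contractions of δζ with ζ, ζ̄ and η are 0, iθ̃³
and −iθ̃². -/
theorem dOne_cTheta1 (h : IsUnitNull g x₀ c z) (hS : IsOrientedAtlas S) :
    dOne (pbForm cTheta1 c) z = Complex.I •
      (wedge (pbForm (cTheta3 g x₀) c z) (oneForm (pbForm cTheta1 c z))
        - wedge (pbForm (cTheta2 g x₀) c z) (oneForm (pbForm (cTheta g x₀) c z))) := by
  have hd := h.smooth.differentiableAt (by norm_num)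
  refine twoForm_ext fun v w => ?_
  have he : pbForm cTheta1 c =ᶠ[𝓝 z]
      fun z => (ofComp (compv (c z).2)).comp (fderiv ℝ (fun z => (c z).1) z) := by
    filter_upwards [h.eventually] with z' h'
    ext v
    rw [pbForm_apply, cTheta1_apply, ContinuousLinearMap.comp_apply, ofComp_apply,
      fderiv_fst_apply (h'.smooth.differentiableAt (by norm_num))]
  rw [dOne_congr he, dOne_covDeriv g x₀ h.smooth.fst (contDiffAt_compv_comp h.smooth),
    covDeriv_zeta hd, covDeriv_zeta hd, ← fderiv_fst_apply hd, ← fderiv_fst_apply hd]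
  change dZ g x₀ c z v ⬝ᵥ _ - dZ g x₀ c z w ⬝ᵥ _ = _
  rw [h.dot_base hS, h.dot_base hS, h.zeta_contract hS, h.zeta_contract hS, h.zetaBar_contract hS,
    h.zetaBar_contract hS, eta_contract, eta_contract]
  simp only [ContinuousAlternatingMap.smul_apply, ContinuousAlternatingMap.sub_apply,
    wedge_oneForm_apply, smul_eq_mul]
  ring

/-- Again dθ = ∇η_j ∧ dx^j. Differentiating g(η, ζ) = 0 gives the contraction with ζ, reality of η
the one with ζ̄, and g(η, η) = 1 shows that the contraction with η vanishes. -/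
theorem dOne_cTheta (h : IsUnitNull g x₀ c z) (hS : IsOrientedAtlas S) :
    dOne (pbForm (cTheta g x₀) c) z = Complex.I •
      (wedge (pbForm cTheta1 c z) (oneForm (conjForm (pbForm (cTheta2 g x₀) c z)))
        + wedge (pbForm (cTheta2 g x₀) c z) (oneForm (conjForm (pbForm cTheta1 c z)))) := by
  have hd := h.smooth.differentiableAt (by norm_num)
  have hpd := gramC_posDef hS g h.mem
  have hcd := fun i => (contDiffAt_compv_comp h.smooth i).differentiableAt (by norm_num)
  have hed := fun i => (h.contDiffAt_eta hS i).differentiableAt (by norm_num)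
  refine twoForm_ext fun v w => ?_
  have he : pbForm (cTheta g x₀) c =ᶠ[𝓝 z] fun z =>
      (ofComp (realC (etaD (gramC g x₀ (c z).1) (compv (c z).2)))).comp (fderiv ℝ (fun z => (c z).1) z) := by
    filter_upwards [h.eventually] with z' h'
    ext v
    rw [pbForm_apply, cTheta_apply, ContinuousLinearMap.comp_apply, ofComp_apply,
      fderiv_fst_apply (h'.smooth.differentiableAt (by norm_num))]
  rw [dOne_congr he, dOne_covDeriv g x₀ h.smooth.fst (h.contDiffAt_eta hS),
    ← fderiv_fst_apply hd, ← fderiv_fst_apply hd]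
  set Dη := covDeriv g x₀ (fun z => (c z).1)
    (fun z => realC (etaD (gramC g x₀ (c z).1) (compv (c z).2))) z with hDη
  have h1 : ∀ v, upC (gramC g x₀ (c z).1) (compv (c z).2) ⬝ᵥ Dη v =
      Complex.I * pbForm (cTheta2 g x₀) c z v := by
    intro v
    have h2 := fderiv_pairC hS g (X := fun z => (c z).1) h.mem h.smooth.fst hed hcd v
    have h0 : ∀ᶠ z in 𝓝 z, pairC (gramC g x₀ (c z).1)
        (realC (etaD (gramC g x₀ (c z).1) (compv (c z).2))) (compv (c z).2) = 0 := by
      filter_upwards [h.eventually] with z' h'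
      rw [pairC, upC_etaD (gramC_posDef hS g h'.mem), etaU_dot]
    rw [Filter.EventuallyEq.fderiv_eq h0, covDeriv_zeta hd, pairC_comm hpd, ← hDη] at h2
    simp only [fderiv_fun_const, Pi.zero_apply, _root_.zero_apply] at h2
    change _ = upC _ _ ⬝ᵥ Dη v + upC _ _ ⬝ᵥ dZ g x₀ c z v at h2
    rw [upC_etaD hpd, eta_contract] at h2
    linear_combination -h2
  have h1' : ∀ v, conjC (upC (gramC g x₀ (c z).1) (compv (c z).2)) ⬝ᵥ Dη v =
      -Complex.I * conj (pbForm (cTheta2 g x₀) c z v) := by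
    intro v
    have hreal : conjC (Dη v) = Dη v := by
      rw [hDη, ← covDeriv_conj _ hed]; simp only [conjC_realC]
    have := congrArg conj (h1 v)
    rw [conj_dot, hreal] at this
    rw [this]; simp
  have h3 : ∀ v, realC (etaU (gramC g x₀ (c z).1) (compv (c z).2)) ⬝ᵥ Dη v = 0 := by
    intro v
    have h2 := fderiv_pairC hS g (X := fun z => (c z).1) h.mem h.smooth.fst hed hed v
    have h0 : ∀ᶠ z in 𝓝 z, pairC (gramC g x₀ (c z).1)
        (realC (etaD (gramC g x₀ (c z).1) (compv (c z).2)))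
        (realC (etaD (gramC g x₀ (c z).1) (compv (c z).2))) = 1 := by
      filter_upwards [h.eventually] with z' h'
      have hp := gramC_posDef hS g h'.mem
      rw [pairC, upC_etaD hp]
      have := etaU_dot_etaD hp h'.null.self_of_nhds
      rwa [h'.hermR_eq hS, Complex.ofReal_one, one_pow] at this
    rw [Filter.EventuallyEq.fderiv_eq h0, pairC_comm hpd, ← hDη] at h2
    simp only [fderiv_fun_const, Pi.zero_apply, _root_.zero_apply, pairC, upC_etaD hpd] at h2
    linear_combination -(1 / 2 : ℂ) * h2
  rw [h.dot_base hS, h.dot_base hS, h1, h1, h1', h1', h3, h3]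
  simp only [ContinuousAlternatingMap.smul_apply, ContinuousAlternatingMap.add_apply,
    wedge_oneForm_apply, smul_eq_mul, conjForm_apply]
  ring

end StructureEquations

/-! ### Complexified vectors, and what d² = 0 adds to the structure equations. -/

section CoframeAlgebra

open ComplexConjugate

variable {E : Type*} [NormedAddCommGroup E] [NormedSpace ℝ E]

set_option synthInstance.maxHeartbeats 400000
set_option maxHeartbeats 1000000

theorem dOne_const_smul {α : E → E →L[ℝ] ℂ} {y : E} (hα : DifferentiableAt ℝ α y) (c : ℂ) :
    dOne (fun z => c • α z) y = c • dOne α y := by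
  rw [dOne_smul hα (differentiableAt_const c)]
  simp [wedge_zero_left]

theorem differentiableAt_smulForm {α : E → E →L[ℝ] ℂ} {y : E} {c : E → ℂ}
    (hc : DifferentiableAt ℝ c y) (hα : DifferentiableAt ℝ α y) :
    DifferentiableAt ℝ (fun z => c z • α z) y := hc.smul hα

theorem differentiableAt_conjForm {α : E → E →L[ℝ] ℂ} {y : E} (hα : DifferentiableAt ℝ α y) :
    DifferentiableAt ℝ (fun z => conjForm (α z)) y :=
  (differentiableAt_const (Complex.conjCLE : ℂ →L[ℝ] ℂ)).clm_comp hα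

theorem differentiableAt_wedge_oneForm {α β : E → E →L[ℝ] ℂ} {y : E} (hα : DifferentiableAt ℝ α y)
    (hβ : DifferentiableAt ℝ β y) : DifferentiableAt ℝ (fun z => wedge (α z) (oneForm (β z))) y :=
  DifferentiableAt.comp (g := fun x : (E →L[ℝ] ℂ) × (E [⋀^Fin 1]→L[ℝ] ℂ) => wedgeCLM x.1 x.2)
    (f := fun z => (α z, oneForm (β z))) y
    ((wedgeCLM (E := E) (k := 1)).isBoundedBilinearMap.differentiableAt (α y, oneForm (β y)))
    (hα.prodMk (DifferentiableAt.comp (g := oneFormCLM) y (oneFormCLM.differentiableAt (x := β y)) hβ))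

theorem dOne_conjForm {α : E → E →L[ℝ] ℂ} {y : E} (hα : DifferentiableAt ℝ α y) (v w : E) :
    dOne (fun z => conjForm (α z)) y ![v, w] = conj (dOne α y ![v, w]) := by
  have h : HasFDerivAt (fun z => conjForm (α z)) _ y :=
    (hasFDerivAt_const (Complex.conjCLE : ℂ →L[ℝ] ℂ) y).clm_comp hα.hasFDerivAt
  rw [dOne_apply h.differentiableAt, dOne_apply hα, h.fderiv, map_sub]
  simp

theorem extDeriv_dOne {α : E → E →L[ℝ] ℂ} {y : E} (hα : ContDiffAt ℝ ∞ α y) :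
    extDeriv (dOne α) y = 0 := by
  have h : ContDiffAt ℝ ∞ (fun z => oneForm (α z)) y :=
    ContDiffAt.comp (g := oneFormCLM) y
      (ContinuousLinearMap.contDiff (𝕜 := ℝ) (oneFormCLM (E := E))).contDiffAt hα
  exact extDeriv_extDeriv_apply h (by simp; norm_cast)

/-- The exterior derivative of a `1`-form whose exterior derivative is `c (α ∧ β + γ ∧ δ)`
vanishes. -/
theorem extDeriv_wedge_add_wedge {κ α β γ δ : E → E →L[ℝ] ℂ} {y : E} {c : ℂ} (hκ : ContDiffAt ℝ ∞ κ y)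
    (hc : c ≠ 0) (hα : DifferentiableAt ℝ α y) (hβ : DifferentiableAt ℝ β y)
    (hγ : DifferentiableAt ℝ γ y) (hδ : DifferentiableAt ℝ δ y)
    (h : ∀ᶠ z in 𝓝 y, dOne κ z = c • (wedge (α z) (oneForm (β z)) + wedge (γ z) (oneForm (δ z)))) :
    wedge (β y) (dOne α y) - wedge (α y) (dOne β y) + (wedge (δ y) (dOne γ y) - wedge (γ y) (dOne δ y))
      = 0 := by
  have h1 : dOne κ =ᶠ[𝓝 y] fun z => wedge (c • α z) (oneForm (β z)) + wedge (c • γ z) (oneForm (δ z)) := by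
    filter_upwards [h] with z hz
    rw [hz, smul_add, wedge_smul_left, wedge_smul_left]
  have hα' := differentiableAt_smulForm (differentiableAt_const c) hα
  have hγ' := differentiableAt_smulForm (differentiableAt_const c) hγ
  have h2 := extDeriv_dOne hκ
  rw [h1.extDeriv_eq, extDeriv_fun_add (differentiableAt_wedge_oneForm hα' hβ)
    (differentiableAt_wedge_oneForm hγ' hδ), extDeriv_wedge_oneForm hα' hβ,
    extDeriv_wedge_oneForm hγ' hδ, dOne_const_smul hα, dOne_const_smul hγ] at h2
  simp only [wedge_smul_left, wedge_smul_right] at h2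
  refine (smul_eq_zero.1 (Eq.trans ?_ h2)).resolve_left hc
  module

theorem wedge_apply_three (α : E →L[ℝ] ℂ) (ψ : E [⋀^Fin 2]→L[ℝ] ℂ) (u v w : E) :
    wedge α ψ ![u, v, w] = α u * ψ ![v, w] - α v * ψ ![u, w] + α w * ψ ![u, v] := by
  have h1 : (Fin.removeNth 1 ![u, v, w] : Fin 2 → E) = ![u, w] := by ext i; fin_cases i <;> rfl
  have h2 : (Fin.removeNth 2 ![u, v, w] : Fin 2 → E) = ![u, v] := by ext i; fin_cases i <;> rfl
  have h0 : (Fin.removeNth 0 ![u, v, w] : Fin 2 → E) = ![v, w] := by ext i; fin_cases i <;> rfl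
  rw [wedge_apply, Fin.sum_univ_three, h0, h1, h2]
  simp
  ring

theorem wedge_apply_four (α : E →L[ℝ] ℂ) (ψ : E [⋀^Fin 3]→L[ℝ] ℂ) (t u v w : E) :
    wedge α ψ ![t, u, v, w] = α t * ψ ![u, v, w] - α u * ψ ![t, v, w] + α v * ψ ![t, u, w]
      - α w * ψ ![t, u, v] := by
  have h0 : (Fin.removeNth 0 ![t, u, v, w] : Fin 3 → E) = ![u, v, w] := by ext i; fin_cases i <;> rfl
  have h1 : (Fin.removeNth 1 ![t, u, v, w] : Fin 3 → E) = ![t, v, w] := by ext i; fin_cases i <;> rfl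
  have h2 : (Fin.removeNth 2 ![t, u, v, w] : Fin 3 → E) = ![t, u, w] := by ext i; fin_cases i <;> rfl
  have h3 : (Fin.removeNth 3 ![t, u, v, w] : Fin 3 → E) = ![t, u, v] := by ext i; fin_cases i <;> rfl
  rw [wedge_apply, Fin.sum_univ_four, h0, h1, h2, h3]
  simp [pow_succ]
  ring

/-- The product of two linear combinations of a pair of covectors. -/
theorem wedge_wedge_comb {k : ℕ} (α β : E →L[ℝ] ℂ) (a b c d : ℂ) (ψ : E [⋀^Fin k]→L[ℝ] ℂ) :
    wedge (a • α + b • β) (wedge (c • α + d • β) ψ) = (a * d - b * c) • wedge α (wedge β ψ) := by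
  simp only [wedge_add_left, wedge_add_right, wedge_smul_left, wedge_smul_right, wedge_wedge_self]
  rw [wedge_wedge_comm β α]
  module

theorem wedge_oneForm_comb (α β : E →L[ℝ] ℂ) (a b c d : ℂ) :
    wedge (a • α + b • β) (oneForm (c • α + d • β)) = (a * d - b * c) • wedge α (oneForm β) := by
  refine twoForm_ext fun v w => ?_
  simp only [wedge_oneForm_apply, ContinuousAlternatingMap.smul_apply, _root_.add_apply,
    _root_.smul_apply, smul_eq_mul]
  ring

/-- Multiplication of a complexified vector by a complex number. -/
def smulVec (c : ℂ) (z : E × E) : E × E := (c.re • z.1 - c.im • z.2, c.re • z.2 + c.im • z.1)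

theorem evalC_smulVec (α : E →L[ℝ] ℂ) (c : ℂ) (z : E × E) :
    evalC α (smulVec c z) = c * evalC α z := by
  simp only [evalC, smulVec, map_sub, map_add, map_smul, Complex.real_smul]
  linear_combination (α z.1 + Complex.I * α z.2) * Complex.re_add_im c - c.im * α z.2 * Complex.I_mul_I

theorem evalC_add (α : E →L[ℝ] ℂ) (z w : E × E) : evalC α (z + w) = evalC α z + evalC α w := by
  simp only [evalC, Prod.fst_add, Prod.snd_add, map_add]; ring

theorem map_add_left₂ (ψ : E [⋀^Fin 2]→L[ℝ] ℂ) (u v w : E) :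
    ψ ![u + v, w] = ψ ![u, w] + ψ ![v, w] := by
  have h : ∀ a : E, Function.update ![0, w] 0 a = ![a, w] := fun a => by
    ext i; fin_cases i <;> rfl
  have := ψ.map_update_add ![0, w] 0 u v
  rwa [h, h, h] at this

theorem map_smul_left₂ (ψ : E [⋀^Fin 2]→L[ℝ] ℂ) (r : ℝ) (v w : E) :
    ψ ![r • v, w] = r * ψ ![v, w] := by
  have h : ∀ a : E, Function.update ![0, w] 0 a = ![a, w] := fun a => by
    ext i; fin_cases i <;> rfl
  have := ψ.map_update_smul ![0, w] 0 r v
  rwa [h, h, Complex.real_smul] at this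

theorem map_swap₂ (ψ : E [⋀^Fin 2]→L[ℝ] ℂ) (v w : E) : ψ ![v, w] = -ψ ![w, v] := by
  refine Eq.trans ?_ (ψ.map_swap ![w, v] (i := 0) (j := 1) (by decide))
  refine congrArg ψ ?_
  ext i; fin_cases i <;> rfl

theorem evalC2_add_left (ψ : E [⋀^Fin 2]→L[ℝ] ℂ) (z z' w : E × E) :
    evalC2 ψ (z + z') w = evalC2 ψ z w + evalC2 ψ z' w := by
  simp only [evalC2, Prod.fst_add, Prod.snd_add, map_add_left₂]; ring

theorem evalC2_smulVec_left (ψ : E [⋀^Fin 2]→L[ℝ] ℂ) (c : ℂ) (z w : E × E) :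
    evalC2 ψ (smulVec c z) w = c * evalC2 ψ z w := by
  have h : ∀ u v w : E, ψ ![u - v, w] = ψ ![u, w] - ψ ![v, w] := fun u v w => by
    have := map_add_left₂ ψ (u - v) v w
    rw [sub_add_cancel] at this; rw [this]; ring
  simp only [evalC2, smulVec, map_add_left₂, map_smul_left₂, h]
  have hc := Complex.re_add_im c
  linear_combination (ψ ![z.1, w.1] + Complex.I * ψ ![z.2, w.1] + Complex.I * ψ ![z.1, w.2]
    - ψ ![z.2, w.2]) * hc - (c.im * ψ ![z.2, w.1] + c.im * ψ ![z.1, w.2]) * Complex.I_mul_I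

/-- Conjugation exchanges z with z̄ and w̄ with w; the sign restores the order of the arguments.
Thus i times a real two-form is hermitian on vectors of type (1,0). -/
theorem evalC2_conj {ψ : E [⋀^Fin 2]→L[ℝ] ℂ} (hψ : ∀ v w, conj (ψ ![v, w]) = ψ ![v, w]) (z w : E × E) :
    conj (evalC2 ψ z (conjVec w)) = -evalC2 ψ w (conjVec z) := by
  have hn : ∀ u v : E, ψ ![u, -v] = -ψ ![u, v] := fun u v => by
    rw [map_swap₂, show -v = (-1 : ℝ) • v by simp, map_smul_left₂, map_swap₂ ψ v u]; simp
  simp only [evalC2, conjVec, map_add, map_sub, map_mul, Complex.conj_I, hψ, hn]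
  rw [map_swap₂ ψ w.1 z.1, map_swap₂ ψ w.2 z.1, map_swap₂ ψ w.1 z.2, map_swap₂ ψ w.2 z.2]
  simp only [map_neg, hψ]
  ring

theorem evalC2_wedge (α β : E →L[ℝ] ℂ) (z w : E × E) :
    evalC2 (wedge α (oneForm β)) z w = evalC α z * evalC β w - evalC α w * evalC β z := by
  simp only [evalC2, evalC, wedge_oneForm_apply]
  linear_combination (α w.2 * β z.2 - α z.2 * β w.2) * Complex.I_mul_I

theorem evalC2_add (ψ χ : E [⋀^Fin 2]→L[ℝ] ℂ) (z w : E × E) :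
    evalC2 (ψ + χ) z w = evalC2 ψ z w + evalC2 χ z w := by
  simp only [evalC2, ContinuousAlternatingMap.add_apply]; ring

theorem evalC2_smul (c : ℂ) (ψ : E [⋀^Fin 2]→L[ℝ] ℂ) (z w : E × E) :
    evalC2 (c • ψ) z w = c * evalC2 ψ z w := by
  simp only [evalC2, ContinuousAlternatingMap.smul_apply, smul_eq_mul]; ring

theorem evalC_conjForm (α : E →L[ℝ] ℂ) (z : E × E) :
    evalC (conjForm α) z = conj (evalC α (conjVec z)) := by
  simp [evalC, conjVec, conjForm_apply]

/-- Forms `θ, λ, τ, ρ` (`τ`, `ρ` in the role of `θ̃²`, `θ̃³`) that satisfy the structure equations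
near a point. -/
def StructureEqs (θ l τ ρ : E → E →L[ℝ] ℂ) (y : E) : Prop :=
  ContDiffAt ℝ ∞ θ y ∧
  ContDiffAt ℝ ∞ l y ∧
  ContDiffAt ℝ ∞ τ y ∧
  ContDiffAt ℝ ∞ ρ y ∧
  (∀ᶠ z in 𝓝 y, conjForm (θ z) = θ z) ∧
  (∀ᶠ z in 𝓝 y, conjForm (ρ z) = ρ z) ∧
  (∀ᶠ z in 𝓝 y, dOne l z = Complex.I •
    (wedge (ρ z) (oneForm (l z)) - wedge (τ z) (oneForm (θ z)))) ∧
  (∀ᶠ z in 𝓝 y, dOne θ z = Complex.I •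
    (wedge (l z) (oneForm (conjForm (τ z))) + wedge (τ z) (oneForm (conjForm (l z)))))

namespace StructureEqs

variable {θ l τ ρ : E → E →L[ℝ] ℂ} {y : E}

theorem smooth_θ (h : StructureEqs θ l τ ρ y) :
    ContDiffAt ℝ ∞ θ y := h.1

theorem smooth_l (h : StructureEqs θ l τ ρ y) :
    ContDiffAt ℝ ∞ l y := h.2.1

theorem smooth_τ (h : StructureEqs θ l τ ρ y) :
    ContDiffAt ℝ ∞ τ y := h.2.2.1

theorem smooth_ρ (h : StructureEqs θ l τ ρ y) :
    ContDiffAt ℝ ∞ ρ y := h.2.2.2.1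

theorem real_θ (h : StructureEqs θ l τ ρ y) :
    ∀ᶠ z in 𝓝 y, conjForm (θ z) = θ z := h.2.2.2.2.1

theorem real_ρ (h : StructureEqs θ l τ ρ y) :
    ∀ᶠ z in 𝓝 y, conjForm (ρ z) = ρ z := h.2.2.2.2.2.1

theorem d_l (h : StructureEqs θ l τ ρ y) :
    ∀ᶠ z in 𝓝 y, dOne l z = Complex.I •
    (wedge (ρ z) (oneForm (l z)) - wedge (τ z) (oneForm (θ z))) := h.2.2.2.2.2.2.1

theorem d_θ (h : StructureEqs θ l τ ρ y) :
    ∀ᶠ z in 𝓝 y, dOne θ z = Complex.I •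
    (wedge (l z) (oneForm (conjForm (τ z))) + wedge (τ z) (oneForm (conjForm (l z)))) := h.2.2.2.2.2.2.2

/-- This is d²λ = 0 with dλ and dθ inserted. The unknown derivatives dρ and dτ occur only multiplied
by λ and by θ respectively, so suitable products isolate either of them. -/
theorem dd_l (h : StructureEqs θ l τ ρ y) :
    wedge (l y) (dOne ρ y) + Complex.I • wedge (ρ y) (wedge (τ y) (oneForm (θ y)))
      - wedge (θ y) (dOne τ y) + Complex.I • wedge (τ y) (wedge (l y) (oneForm (conjForm (τ y)))) = 0 := by
  have dθ := h.smooth_θ.differentiableAt (by norm_num)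
  have dl := h.smooth_l.differentiableAt (by norm_num)
  have dτ := h.smooth_τ.differentiableAt (by norm_num)
  have dρ := h.smooth_ρ.differentiableAt (by norm_num)
  have h1 := extDeriv_wedge_add_wedge (α := ρ) (β := l) (γ := fun z => (-1 : ℂ) • τ z) (δ := θ)
    h.smooth_l Complex.I_ne_zero dρ dl (differentiableAt_smulForm (differentiableAt_const _) dτ) dθ (by
      filter_upwards [h.d_l] with z hz
      rw [hz, wedge_smul_left]; module)
  rw [dOne_const_smul dτ, h.d_l.self_of_nhds, h.d_θ.self_of_nhds] at h1
  simp only [wedge_smul_left, wedge_smul_right, wedge_sub_right, wedge_add_right, wedge_wedge_self,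
    zero_sub] at h1
  rw [← h1]; module

/-- This is d²θ = 0; it relates dτ and its conjugate. -/
theorem dd_θ (h : StructureEqs θ l τ ρ y) :
    wedge (conjForm (τ y)) (dOne l y) - wedge (l y) (dOne (fun z => conjForm (τ z)) y)
      + (wedge (conjForm (l y)) (dOne τ y) - wedge (τ y) (dOne (fun z => conjForm (l z)) y)) = 0 := by
  have dl := h.smooth_l.differentiableAt (by norm_num)
  have dτ := h.smooth_τ.differentiableAt (by norm_num)
  have dl' := differentiableAt_conjForm dl
  have dτ' := differentiableAt_conjForm dτ
  exact extDeriv_wedge_add_wedge (κ := θ) (α := l) (β := fun z => conjForm (τ z)) (γ := τ)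
    (δ := fun z => conjForm (l z)) (c := Complex.I) h.smooth_θ Complex.I_ne_zero dl dτ' dτ dl' h.d_θ

theorem d_conj_l (h : StructureEqs θ l τ ρ y) :
    dOne (fun z => conjForm (l z)) y = -Complex.I •
      (wedge (ρ y) (oneForm (conjForm (l y))) - wedge (conjForm (τ y)) (oneForm (θ y))) := by
  refine twoForm_ext fun v w => ?_
  rw [dOne_conjForm (h.smooth_l.differentiableAt (by norm_num)), h.d_l.self_of_nhds]
  have hθ : ∀ v, conj (θ y v) = θ y v := fun v =>
    congrArg (fun L : E →L[ℝ] ℂ => L v) h.real_θ.self_of_nhds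
  have hρ : ∀ v, conj (ρ y v) = ρ y v := fun v =>
    congrArg (fun L : E →L[ℝ] ℂ => L v) h.real_ρ.self_of_nhds
  simp only [ContinuousAlternatingMap.smul_apply, ContinuousAlternatingMap.sub_apply,
    wedge_oneForm_apply, smul_eq_mul, map_mul, map_sub, hθ, hρ, Complex.conj_I, conjForm_apply]

/-- `d(θ ∧ λ ∧ τ) = 2i ρ ∧ θ ∧ λ ∧ τ`. -/
theorem d_xi (h : StructureEqs θ l τ ρ y) :
    extDeriv (fun z => wedge (θ z) (wedge (l z) (oneForm (τ z)))) y =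
      (2 * Complex.I) • wedge (ρ y) (wedge (θ y) (wedge (l y) (oneForm (τ y)))) := by
  have dθ := h.smooth_θ.differentiableAt (by norm_num)
  have dl := h.smooth_l.differentiableAt (by norm_num)
  have dτ := h.smooth_τ.differentiableAt (by norm_num)
  -- Multiplication by λ removes dρ from d²λ = 0 and leaves an expression for θ ∧ λ ∧ dτ, the only
  -- unknown term in dξ.
  have h1 := congrArg (wedge (l y)) h.dd_l
  simp only [wedge_smul_right, wedge_sub_right, wedge_add_right, wedge_wedge_self, wedge_zero_right] at h1
  rw [wedge_wedge_comm (τ y) (l y), wedge_neg_right, wedge_wedge_self] at h1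
  have h2 : wedge (θ y) (wedge (l y) (dOne τ y)) =
      -(Complex.I • wedge (l y) (wedge (ρ y) (wedge (τ y) (oneForm (θ y))))) := by
    rw [wedge_wedge_comm (θ y)]
    have := sub_eq_zero.1 (show Complex.I • wedge (l y) (wedge (ρ y) (wedge (τ y) (oneForm (θ y)))) -
      wedge (l y) (wedge (θ y) (dOne τ y)) = 0 by rw [← h1]; module)
    rw [this]
  rw [extDeriv_wedge_wedge_oneForm dθ dl dτ, h.d_l.self_of_nhds, h.d_θ.self_of_nhds]
  simp only [wedge_smul_right, wedge_sub_right, wedge_add_right, wedge_wedge_self, wedge_zero_right, h2]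
  have e1 : wedge (l y) (wedge (τ y) (wedge (l y) (oneForm (conjForm (τ y))))) = 0 := by
    rw [wedge_wedge_comm (τ y) (l y), wedge_neg_right, wedge_wedge_self, neg_zero]
  have e2 : wedge (θ y) (wedge (τ y) (wedge (ρ y) (oneForm (l y)))) =
      -wedge (ρ y) (wedge (θ y) (wedge (l y) (oneForm (τ y)))) := by
    rw [wedge_wedge_comm (τ y) (ρ y), wedge_neg_right, wedge_wedge_comm (θ y) (ρ y),
      wedge_oneForm_comm (τ y) (l y), wedge_neg_right, wedge_neg_right, neg_neg]
  have e3 : wedge (l y) (wedge (ρ y) (wedge (τ y) (oneForm (θ y)))) =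
      -wedge (ρ y) (wedge (θ y) (wedge (l y) (oneForm (τ y)))) := by
    rw [wedge_wedge_comm (l y) (ρ y), wedge_oneForm_comm (τ y), wedge_neg_right (l y),
      wedge_wedge_comm (l y) (θ y), neg_neg]
  rw [e1, e2, e3]; module

/-- `ρ ∧ λ̄ ∧ τ̄ ∧ d(λ ∧ τ) = 0`. -/
theorem d_phi (h : StructureEqs θ l τ ρ y) :
    wedge (ρ y) (wedge (conjForm (l y)) (wedge (conjForm (τ y))
      (extDeriv (fun z => wedge (l z) (oneForm (τ z))) y))) = 0 := by
  have dl := h.smooth_l.differentiableAt (by norm_num)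
  have dτ := h.smooth_τ.differentiableAt (by norm_num)
  rw [extDeriv_wedge_oneForm dl dτ, h.d_l.self_of_nhds]
  -- After multiplication by ρ ∧ λ ∧ τ̄ every term of d²θ = 0 has a repeated factor except the one
  -- with λ̄ ∧ dτ; this is the term needed.
  have h1 := congrArg (fun ψ => wedge (ρ y) (wedge (l y) (wedge (conjForm (τ y)) ψ))) h.dd_θ
  simp only [h.d_conj_l, wedge_smul_right, wedge_sub_right, wedge_add_right, wedge_wedge_self,
    wedge_zero_right] at h1
  have e1 : wedge (ρ y) (wedge (l y) (wedge (conjForm (τ y)) (wedge (l y)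
      (dOne (fun z => conjForm (τ z)) y)))) = 0 := by
    rw [wedge_wedge_comm (conjForm (τ y)) (l y), wedge_neg_right, wedge_wedge_self, neg_zero,
      wedge_zero_right]
  have e2 : wedge (ρ y) (wedge (l y) (wedge (conjForm (τ y)) (wedge (τ y)
      (wedge (ρ y) (oneForm (conjForm (l y))))))) = 0 := by
    rw [wedge_wedge_comm (τ y) (ρ y), wedge_neg_right, wedge_wedge_comm (conjForm (τ y)) (ρ y),
      neg_neg, wedge_wedge_comm (l y) (ρ y), wedge_neg_right, wedge_wedge_self, neg_zero]
  have e3 : wedge (ρ y) (wedge (l y) (wedge (conjForm (τ y)) (wedge (τ y)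
      (wedge (conjForm (τ y)) (oneForm (θ y)))))) = 0 := by
    rw [wedge_wedge_comm (τ y) (conjForm (τ y)), wedge_neg_right, wedge_wedge_self, neg_zero,
      wedge_zero_right, wedge_zero_right]
  rw [e1, e2, e3] at h1
  have e4 : wedge (ρ y) (wedge (conjForm (l y)) (wedge (conjForm (τ y)) (wedge (τ y)
      (wedge (ρ y) (oneForm (l y)))))) = 0 := by
    rw [wedge_wedge_comm (τ y) (ρ y), wedge_neg_right, wedge_wedge_comm (conjForm (τ y)) (ρ y),
      neg_neg, wedge_wedge_comm (conjForm (l y)) (ρ y), wedge_neg_right, wedge_wedge_self, neg_zero]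
  have e5 : wedge (conjForm (l y)) (wedge (conjForm (τ y)) (wedge (l y) (dOne τ y))) =
      -wedge (l y) (wedge (conjForm (τ y)) (wedge (conjForm (l y)) (dOne τ y))) := by
    rw [wedge_wedge_comm (conjForm (τ y)) (l y), wedge_neg_right, wedge_wedge_comm (conjForm (l y)) (l y),
      neg_neg, wedge_wedge_comm (conjForm (l y)) (conjForm (τ y)), wedge_neg_right]
  have e6 : wedge (ρ y) (wedge (conjForm (l y)) (wedge (conjForm (τ y)) (wedge (τ y)
      (wedge (τ y) (oneForm (θ y)))))) = 0 := by simp only [wedge_wedge_self, wedge_zero_right]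
  simp only [wedge_smul_right, wedge_sub_right, e4, e5, e6, wedge_neg_right]
  rw [← h1]; module

/-- The `(τ, τ̄)` part of `dρ`. -/
theorem d_rho (h : StructureEqs θ l τ ρ y) {V : E} (hl : l y V ≠ 0) (hθ : θ y V = 0) {z w : E × E}
    (hlz : evalC (l y) z = 0) (hθz : evalC (θ y) z = 0) (hlw : evalC (l y) w = 0)
    (hθw : evalC (θ y) w = 0) :
    evalC2 (dOne ρ y) z w = Complex.I *
      (evalC (τ y) z * evalC (conjForm (τ y)) w - evalC (τ y) w * evalC (conjForm (τ y)) z) := by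
  -- The identity d²λ = 0 evaluated on (V, X, Y), using θ(V) = 0. Every term except λ(V) dρ(X, Y)
  -- and the λ(V) part of iτ ∧ λ ∧ τ̄ carries λ or θ of X or Y.
  have key : ∀ X Y : E, l y V * dOne ρ y ![X, Y] - l y X * dOne ρ y ![V, Y] + l y Y * dOne ρ y ![V, X]
      + Complex.I * (θ y Y * (ρ y V * τ y X - ρ y X * τ y V)
        - θ y X * (ρ y V * τ y Y - ρ y Y * τ y V))
      - (θ y Y * dOne τ y ![V, X] - θ y X * dOne τ y ![V, Y])
      + Complex.I * (τ y V * (l y X * conjForm (τ y) Y - l y Y * conjForm (τ y) X)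
        - τ y X * (l y V * conjForm (τ y) Y - l y Y * conjForm (τ y) V)
        + τ y Y * (l y V * conjForm (τ y) X - l y X * conjForm (τ y) V)) = 0 := by
    intro X Y
    have h1 := congrArg (fun ψ : E [⋀^Fin 3]→L[ℝ] ℂ => ψ ![V, X, Y]) h.dd_l
    simp only [ContinuousAlternatingMap.add_apply, ContinuousAlternatingMap.sub_apply,
      ContinuousAlternatingMap.smul_apply, wedge_apply_three, wedge_oneForm_apply, smul_eq_mul,
      hθ] at h1
    have h0 : (0 : E [⋀^Fin 3]→L[ℝ] ℂ) ![V, X, Y] = 0 := rfl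
    linear_combination h1 + h0
  have k11 := key z.1 w.1
  have k12 := key z.1 w.2
  have k21 := key z.2 w.1
  have k22 := key z.2 w.2
  simp only [evalC] at hlz hθz hlw hθw ⊢
  apply mul_left_cancel₀ hl
  rw [evalC2]
  have hI := Complex.I_mul_I
  -- The weights 1, i, i, −1 form the complex bilinear extension to z and w; the remaining multiples
  -- use that λ and θ annihilate z and w.
  linear_combination k11 + Complex.I * k21 + Complex.I * k12 - k22
    + (dOne ρ y ![V, w.1] + Complex.I * dOne ρ y ![V, w.2]
      - Complex.I * τ y V * (conjForm (τ y) w.1 + Complex.I * conjForm (τ y) w.2)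
      + Complex.I * (τ y w.1 + Complex.I * τ y w.2) * conjForm (τ y) V) * hlz
    + (-(dOne ρ y ![V, z.1] + Complex.I * dOne ρ y ![V, z.2])
      + Complex.I * τ y V * (conjForm (τ y) z.1 + Complex.I * conjForm (τ y) z.2)
      - Complex.I * (τ y z.1 + Complex.I * τ y z.2) * conjForm (τ y) V) * hlw
    + (Complex.I * (ρ y V * (τ y w.1 + Complex.I * τ y w.2) - (ρ y w.1 + Complex.I * ρ y w.2) * τ y V)
      - (dOne τ y ![V, w.1] + Complex.I * dOne τ y ![V, w.2])) * hθz
    + (-Complex.I * (ρ y V * (τ y z.1 + Complex.I * τ y z.2) - (ρ y z.1 + Complex.I * ρ y z.2) * τ y V)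
      + (dOne τ y ![V, z.1] + Complex.I * dOne τ y ![V, z.2])) * hθw
    + (-l y z.2 * dOne ρ y ![V, w.2] + l y w.2 * dOne ρ y ![V, z.2]
      + Complex.I * (θ y w.2 * (ρ y V * τ y z.2 - ρ y z.2 * τ y V)
        - θ y z.2 * (ρ y V * τ y w.2 - ρ y w.2 * τ y V))
      - (θ y w.2 * dOne τ y ![V, z.2] - θ y z.2 * dOne τ y ![V, w.2])
      + Complex.I * (τ y V * (l y z.2 * conjForm (τ y) w.2 - l y w.2 * conjForm (τ y) z.2)
        - τ y z.2 * (l y V * conjForm (τ y) w.2 - l y w.2 * conjForm (τ y) V)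
        + τ y w.2 * (l y V * conjForm (τ y) z.2 - l y z.2 * conjForm (τ y) V))) * hI

end StructureEqs

end CoframeAlgebra

/-! ### Comparison of an adapted coframe with an arbitrary normalized coframe. -/

section FrameComparison

open ComplexConjugate UnitAdmissibleFrame

set_option synthInstance.maxHeartbeats 400000
set_option maxHeartbeats 1000000

variable {W : Set E5} {T10 : E5 → Set (E5 × E5)} {θ : E5 → E5 →L[ℝ] ℂ}
  (F : UnitAdmissibleFrame W T10 θ) {y : E5} {q : E6}

namespace UnitAdmissibleFrame

theorem lift_apply (α : E5 →L[ℝ] ℂ) (v : E6) : lift α v = α v.1 := rfl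

/-- Half the sum of the values on Z_β and on its conjugate. The real and imaginary parts of Z_β are
the real vectors on which real-multilinear forms can be evaluated below. -/
theorem coframe_Z_fst (hy : y ∈ W) (α β : Fin 2) :
    F.coframe α y (F.Z β y).1 = if α = β then 1 / 2 else 0 := by
  have h1 := F.coframe_Z y hy α β
  have h2 := F.coframe_conjZ y hy α β
  simp only [evalC, conjVec, map_neg] at h1 h2
  have : F.coframe α y (F.Z β y).1 = (if α = β then 1 else 0) / 2 := by
    linear_combination (1 / 2 : ℂ) * h1 + (1 / 2 : ℂ) * h2
  rw [this]; split_ifs <;> simp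

theorem coframe_Z_snd (hy : y ∈ W) (α β : Fin 2) :
    F.coframe α y (F.Z β y).2 = if α = β then -(Complex.I / 2) else 0 := by
  have h1 := F.coframe_Z y hy α β
  have h2 := F.coframe_conjZ y hy α β
  simp only [evalC, conjVec, map_neg] at h1 h2
  have : F.coframe α y (F.Z β y).2 = (if α = β then 1 else 0) * (-(Complex.I / 2)) := by
    linear_combination (-(Complex.I / 2) : ℂ) * h1 + (Complex.I / 2 : ℂ) * h2
      + F.coframe α y (F.Z β y).2 * Complex.I_mul_I
  rw [this]; split_ifs <;> simp

/-- A real covector that annihilates Z_α annihilates its real and imaginary parts separately. -/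
theorem theta_Z_parts (hy : y ∈ W) (hr : conjForm (θ y) = θ y) (α : Fin 2) :
    θ y (F.Z α y).1 = 0 ∧ θ y (F.Z α y).2 = 0 := by
  have h1 := F.theta_Z y hy α
  have hr' : ∀ v, conj (θ y v) = θ y v := fun v => congrArg (fun L : E5 →L[ℝ] ℂ => L v) hr
  have h2 := congrArg conj h1
  simp only [evalC, map_add, map_mul, Complex.conj_I, hr', map_zero] at h1 h2
  refine ⟨by linear_combination (1 / 2 : ℂ) * h1 + (1 / 2 : ℂ) * h2, ?_⟩
  linear_combination (-(Complex.I / 2) : ℂ) * h1 + (Complex.I / 2 : ℂ) * h2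
    + θ y (F.Z α y).2 * Complex.I_mul_I

/-- A covector whose product with `ξ` vanishes is a combination of `θ` and the coframe. -/
theorem expand_of_wedge_xi (hq : q.1 ∈ W) (hr : conjForm (θ q.1) = θ q.1) {β : E6 →L[ℝ] ℂ}
    (hβ : wedge β (F.xi q) = 0) :
    β = β (F.T q.1, 0) • lift (θ q.1) + (2 * β ((F.Z 0 q.1).1, 0)) • lift (F.coframe 0 q.1)
      + (2 * β ((F.Z 1 q.1).1, 0)) • lift (F.coframe 1 q.1) := by
  refine ContinuousLinearMap.ext fun v => ?_
  have h1 : wedge β (wedge (lift (θ q.1)) (wedge (lift (F.coframe 0 q.1))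
      (oneForm (lift (F.coframe 1 q.1))))) = 0 := by
    rw [xi, phi, wedge_smul_right, wedge_smul_right] at hβ
    exact (smul_eq_zero.1 hβ).resolve_left (Complex.exp_ne_zero _)
  -- Evaluation on v, the Reeb field and the real parts of Z_0, Z_1. The coframe takes the values
  -- 1/2 on the latter, so the coefficient of β(v) is 1/4.
  have h2 := congrArg (fun ψ : E6 [⋀^Fin 4]→L[ℝ] ℂ =>
    ψ ![v, (F.T q.1, 0), ((F.Z 0 q.1).1, 0), ((F.Z 1 q.1).1, 0)]) h1
  have h0 : (0 : E6 [⋀^Fin 4]→L[ℝ] ℂ) ![v, (F.T q.1, 0), ((F.Z 0 q.1).1, 0), ((F.Z 1 q.1).1, 0)] = 0 := rfl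
  simp only [wedge_apply_four, wedge_apply_three, wedge_oneForm_apply, lift_apply, F.reeb_one _ hq,
    F.coframe_T _ hq, F.coframe_Z_fst hq, (F.theta_Z_parts hq hr _).1, h0] at h2
  simp only [_root_.add_apply, _root_.smul_apply, lift_apply, smul_eq_mul]
  norm_num at h2
  linear_combination 4 * h2

/-- Two adapted coframes with proportional `ξ` are related by a matrix of determinant `e^{is}`. -/
theorem frame_change (hq : q.1 ∈ W) (hr : conjForm (θ q.1) = θ q.1) {l τ : E6 →L[ℝ] ℂ}
    (hd : ∀ v w : E6, dOne θ q.1 ![v.1, w.1] = Complex.I *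
      ((l v * conj (τ w) - l w * conj (τ v)) + (τ v * conj (l w) - τ w * conj (l v))))
    {r : ℝ} (hr0 : 0 < r)
    (hξ : wedge (lift (θ q.1)) (wedge l (oneForm τ)) = (r : ℂ) • F.xi q) :
    ∃ U : Fin 2 → Fin 2 → ℂ,
      l = U 0 0 • lift (F.coframe 0 q.1) + U 0 1 • lift (F.coframe 1 q.1) ∧
      τ = U 1 0 • lift (F.coframe 0 q.1) + U 1 1 • lift (F.coframe 1 q.1) ∧
      U 0 0 * U 1 1 - U 0 1 * U 1 0 = Complex.exp (Complex.I * q.2) ∧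
      ∀ α β, F.h q.1 α β = U 0 α * conj (U 1 β) + U 1 α * conj (U 0 β) := by
  have hrc : (r : ℂ) ≠ 0 := by exact_mod_cast hr0.ne'
  have hl : wedge l (F.xi q) = 0 := by
    refine (smul_eq_zero.1 ?_).resolve_left hrc
    rw [← wedge_smul_right, ← hξ, wedge_wedge_comm l, wedge_wedge_self, wedge_zero_right, neg_zero]
  have hτ : wedge τ (F.xi q) = 0 := by
    refine (smul_eq_zero.1 ?_).resolve_left hrc
    rw [← wedge_smul_right, ← hξ, wedge_wedge_comm τ, wedge_wedge_comm τ, wedge_oneForm_self,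
      wedge_zero_right, neg_zero, wedge_zero_right, neg_zero]
  have el := F.expand_of_wedge_xi hq hr hl
  have eτ := F.expand_of_wedge_xi hq hr hτ
  set a0 := l (F.T q.1, 0)
  set a1 := τ (F.T q.1, 0)
  set U : Fin 2 → Fin 2 → ℂ := ![![2 * l ((F.Z 0 q.1).1, 0), 2 * l ((F.Z 1 q.1).1, 0)],
    ![2 * τ ((F.Z 0 q.1).1, 0), 2 * τ ((F.Z 1 q.1).1, 0)]] with hU
  have el' : l = a0 • lift (θ q.1) + U 0 0 • lift (F.coframe 0 q.1) + U 0 1 • lift (F.coframe 1 q.1) := el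
  have eτ' : τ = a1 • lift (θ q.1) + U 1 0 • lift (F.coframe 0 q.1) + U 1 1 • lift (F.coframe 1 q.1) := eτ
  clear_value U a0 a1
  clear el eτ hU
  have hθA := fun α => (F.theta_Z_parts hq hr α).1
  have hθB := fun α => (F.theta_Z_parts hq hr α).2
  have lA : ∀ β, l ((F.Z β q.1).1, 0) = U 0 β / 2 := fun β => by
    rw [el']
    simp only [_root_.add_apply, _root_.smul_apply, lift_apply, smul_eq_mul, hθA, F.coframe_Z_fst hq]
    fin_cases β <;> simp <;> ring
  have lB : ∀ β, l ((F.Z β q.1).2, 0) = U 0 β * (-(Complex.I / 2)) := fun β => by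
    rw [el']
    simp only [_root_.add_apply, _root_.smul_apply, lift_apply, smul_eq_mul, hθB, F.coframe_Z_snd hq]
    fin_cases β <;> simp
  have τA : ∀ β, τ ((F.Z β q.1).1, 0) = U 1 β / 2 := fun β => by
    rw [eτ']
    simp only [_root_.add_apply, _root_.smul_apply, lift_apply, smul_eq_mul, hθA, F.coframe_Z_fst hq]
    fin_cases β <;> simp <;> ring
  have τB : ∀ β, τ ((F.Z β q.1).2, 0) = U 1 β * (-(Complex.I / 2)) := fun β => by
    rw [eτ']
    simp only [_root_.add_apply, _root_.smul_apply, lift_apply, smul_eq_mul, hθB, F.coframe_Z_snd hq]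
    fin_cases β <;> simp
  have lT : l (F.T q.1, 0) = a0 := by
    rw [el']; simp [lift_apply, F.reeb_one _ hq, F.coframe_T _ hq]
  have τT : τ (F.T q.1, 0) = a1 := by
    rw [eτ']; simp [lift_apply, F.reeb_one _ hq, F.coframe_T _ hq]
  -- The hypothesis on ξ evaluated on the Reeb field and the real parts of Z_0, Z_1; the
  -- θ-components of λ and τ do not contribute because of the factor θ.
  have hdet : U 0 0 * U 1 1 - U 0 1 * U 1 0 = r * Complex.exp (Complex.I * q.2) := by
    have h2 := congrArg (fun ψ : E6 [⋀^Fin 3]→L[ℝ] ℂ =>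
      ψ ![(F.T q.1, 0), ((F.Z 0 q.1).1, 0), ((F.Z 1 q.1).1, 0)]) hξ
    simp only [xi, phi, wedge_smul_right, ContinuousAlternatingMap.smul_apply, wedge_apply_three,
      wedge_oneForm_apply, lift_apply, F.reeb_one _ hq,
      F.coframe_T _ hq, F.coframe_Z_fst hq, hθA, lA, τA, smul_eq_mul] at h2
    norm_num at h2
    linear_combination 4 * h2
  have hdet0 : U 0 0 * U 1 1 - U 0 1 * U 1 0 ≠ 0 := by
    rw [hdet]; exact mul_ne_zero hrc (Complex.exp_ne_zero _)
  -- The contraction of dθ with the Reeb field vanishes. Evaluated against the conjugates of Z_0,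
  -- Z_1 this is a linear system for the θ-components a0, a1 whose determinant is nonzero by `hdet`.
  have hT : ∀ β, a0 * conj (U 1 β) + a1 * conj (U 0 β) = 0 := by
    intro β
    have h1 := (hd (F.T q.1, 0) ((F.Z β q.1).1, 0)).symm.trans (F.reeb_contract _ hq _)
    have h2 := (hd (F.T q.1, 0) ((F.Z β q.1).2, 0)).symm.trans (F.reeb_contract _ hq _)
    have h1 := (mul_eq_zero.1 h1).resolve_left Complex.I_ne_zero
    have h2 := (mul_eq_zero.1 h2).resolve_left Complex.I_ne_zero
    simp only [lT, τT, lA, lB, τA, τB, map_mul, map_neg, map_div₀, Complex.conj_I, map_ofNat] at h1 h2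
    linear_combination h1 - Complex.I * h2 + (a0 * conj (U 1 β) / 2 + U 0 β * conj a1 / 2
      + a1 * conj (U 0 β) / 2 + U 1 β * conj a0 / 2) * Complex.I_mul_I
  have hT0 := hT 0
  have hT1 := hT 1
  have hdetc : conj (U 0 0) * conj (U 1 1) - conj (U 0 1) * conj (U 1 0) ≠ 0 := by
    rw [← map_mul, ← map_mul, ← map_sub]; exact (map_ne_zero _).2 hdet0
  have ha0 : a0 = 0 := mul_right_cancel₀ hdetc (by
    linear_combination conj (U 0 0) * hT1 - conj (U 0 1) * hT0)
  have ha1 : a1 = 0 := mul_right_cancel₀ hdetc (by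
    linear_combination conj (U 1 1) * hT0 - conj (U 1 0) * hT1)
  have el'' : l = U 0 0 • lift (F.coframe 0 q.1) + U 0 1 • lift (F.coframe 1 q.1) :=
    el'.trans (ContinuousLinearMap.ext fun v => by
      simp only [ha0, _root_.add_apply, _root_.smul_apply, smul_eq_mul, zero_mul, zero_add])
  have eτ'' : τ = U 1 0 • lift (F.coframe 0 q.1) + U 1 1 • lift (F.coframe 1 q.1) :=
    eτ'.trans (ContinuousLinearMap.ext fun v => by
      simp only [ha1, _root_.add_apply, _root_.smul_apply, smul_eq_mul, zero_mul, zero_add])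
  have hh : ∀ α β, F.h q.1 α β = U 0 α * conj (U 1 β) + U 1 α * conj (U 0 β) := by
    intro α β
    have h1 := (hd ((F.Z α q.1).1, 0) ((F.Z β q.1).1, 0)).symm.trans (F.levi _ hq _ _)
    have h2 := (hd ((F.Z α q.1).1, 0) ((F.Z β q.1).2, 0)).symm.trans (F.levi _ hq _ _)
    have h1 := mul_left_cancel₀ Complex.I_ne_zero h1
    have h2 := mul_left_cancel₀ Complex.I_ne_zero h2
    simp only [lA, τA, lB, τB, F.coframe_Z_fst hq, F.coframe_Z_snd hq, map_mul, map_neg, map_div₀,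
      Complex.conj_I, map_ofNat, apply_ite conj, map_zero, map_one, mul_ite, ite_mul, mul_zero, zero_mul,
      mul_sub, Finset.sum_sub_distrib, Finset.sum_ite_eq', Finset.mem_univ,
      if_true] at h1 h2
    linear_combination -2 * h1 + 2 * Complex.I * h2 + (1 / 2) * (F.h q.1 α β + F.h q.1 β α
      - (U 0 α * conj (U 1 β) + U 1 α * conj (U 0 β)) - (U 0 β * conj (U 1 α) + U 1 β * conj (U 0 α))) *
      Complex.I_mul_I
  refine ⟨U, el'', eτ'', ?_, hh⟩
  have hn := F.unit_det _ hq
  rw [Matrix.det_fin_two, hh, hh, hh, hh] at hn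
  -- Thus det h = −|det U|². As |det h| = 1 and |det U| = r, the positive factor r equals 1.
  have e : (U 0 0 * conj (U 1 0) + U 1 0 * conj (U 0 0)) * (U 0 1 * conj (U 1 1) + U 1 1 * conj (U 0 1))
      - (U 0 0 * conj (U 1 1) + U 1 0 * conj (U 0 1)) * (U 0 1 * conj (U 1 0) + U 1 1 * conj (U 0 0)) =
      -((U 0 0 * U 1 1 - U 0 1 * U 1 0) * conj (U 0 0 * U 1 1 - U 0 1 * U 1 0)) := by
    simp only [map_sub, map_mul]; ring
  rw [e, norm_neg, norm_mul, RCLike.norm_conj, hdet, norm_mul, Complex.norm_exp] at hn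
  simp at hn
  have hr1 : r = 1 := by
    exact (mul_self_eq_one_iff.1 hn).resolve_right (by linarith)
  rw [hdet, hr1]; simp

theorem dOne_lift (hθ : DifferentiableAt ℝ θ q.1) (v w : E6) :
    dOne (fun z : E6 => lift (θ z.1)) q ![v, w] = dOne θ q.1 ![v.1, w.1] := by
  have h : HasFDerivAt (fun z : E6 => lift (θ z.1)) _ q :=
    (hθ.hasFDerivAt.comp q hasFDerivAt_fst).clm_comp
      (hasFDerivAt_const (ContinuousLinearMap.fst ℝ E5 ℝ) q)
  rw [dOne_apply h.differentiableAt, dOne_apply hθ, h.fderiv]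
  simp

/-- Forms `λ, τ, ρ` on `W × ℝ` that satisfy the structure equations together with `θ`, and such that
`θ ∧ λ ∧ τ` is a positive multiple of `ξ`. -/
def AdaptedAt (l τ ρ : E6 → E6 →L[ℝ] ℂ) (q : E6) : Prop :=
  q.1 ∈ W ∧
  StructureEqs (fun z : E6 => lift (θ z.1)) l τ ρ q ∧
  (∀ᶠ z in 𝓝 q, ∃ r : ℝ, 0 < r ∧
    wedge (lift (θ z.1)) (wedge (l z) (oneForm (τ z))) = (r : ℂ) • F.xi z)

variable {F} {l τ ρ : E6 → E6 →L[ℝ] ℂ}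

theorem AdaptedAt.mem (h : F.AdaptedAt l τ ρ q) :
    q.1 ∈ W := h.1

theorem AdaptedAt.eqs (h : F.AdaptedAt l τ ρ q) :
    StructureEqs (fun z : E6 => lift (θ z.1)) l τ ρ q := h.2.1

theorem AdaptedAt.xi (h : F.AdaptedAt l τ ρ q) :
    ∀ᶠ z in 𝓝 q, ∃ r : ℝ, 0 < r ∧
    wedge (lift (θ z.1)) (wedge (l z) (oneForm (τ z))) = (r : ℂ) • F.xi z := h.2.2

theorem AdaptedAt.frame_change (h : F.AdaptedAt l τ ρ q) (hW : IsOpen W) (hθ : ContDiffOn ℝ ∞ θ W) :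
    ∀ᶠ z in 𝓝 q, ∃ U : Fin 2 → Fin 2 → ℂ,
      l z = U 0 0 • lift (F.coframe 0 z.1) + U 0 1 • lift (F.coframe 1 z.1) ∧
      τ z = U 1 0 • lift (F.coframe 0 z.1) + U 1 1 • lift (F.coframe 1 z.1) ∧
      U 0 0 * U 1 1 - U 0 1 * U 1 0 = Complex.exp (Complex.I * z.2) ∧
      ∀ α β, F.h z.1 α β = U 0 α * conj (U 1 β) + U 1 α * conj (U 0 β) := by
  filter_upwards [h.xi, h.eqs.real_θ, h.eqs.d_θ, continuousAt_fst.preimage_mem_nhds (hW.mem_nhds h.mem)]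
    with z ⟨r, hr, hξ⟩ hz hd hzW
  have hreal : conjForm (θ z.1) = θ z.1 := ContinuousLinearMap.ext fun v =>
    congrArg (fun L : E6 →L[ℝ] ℂ => L (v, 0)) hz
  refine F.frame_change hzW hreal (fun v w => ?_) hr hξ
  rw [← dOne_lift ((hθ.contDiffAt (hW.mem_nhds hzW)).differentiableAt (by norm_num)), hd]
  simp only [ContinuousAlternatingMap.smul_apply, ContinuousAlternatingMap.add_apply,
    wedge_oneForm_apply, conjForm_apply, smul_eq_mul]

/-- A change of frame multiplies θ¹ ∧ θ² by its determinant, which is exactly e^{is}. From here on φ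
and ξ may be computed from λ and τ. -/
theorem AdaptedAt.phi_eq (h : F.AdaptedAt l τ ρ q) (hW : IsOpen W) (hθ : ContDiffOn ℝ ∞ θ W) :
    ∀ᶠ z in 𝓝 q, F.phi z = wedge (l z) (oneForm (τ z)) := by
  filter_upwards [h.frame_change hW hθ] with z ⟨U, h1, h2, h3, _⟩
  rw [h1, h2, wedge_oneForm_comb, h3, phi]

theorem AdaptedAt.xi_eq (h : F.AdaptedAt l τ ρ q) (hW : IsOpen W) (hθ : ContDiffOn ℝ ∞ θ W) :
    ∀ᶠ z in 𝓝 q, F.xi z = wedge (lift (θ z.1)) (wedge (l z) (oneForm (τ z))) := by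
  filter_upwards [h.phi_eq hW hθ] with z hz
  rw [UnitAdmissibleFrame.xi, hz]

theorem conjForm_comb {E : Type*} [NormedAddCommGroup E] [NormedSpace ℝ E] (α β : E →L[ℝ] ℂ) (a b : ℂ) :
    conjForm (a • α + b • β) = conj a • conjForm α + conj b • conjForm β := by
  ext v
  simp [conjForm_apply]

theorem AdaptedAt.wedgePhiBar_eq (h : F.AdaptedAt l τ ρ q) (hW : IsOpen W) (hθ : ContDiffOn ℝ ∞ θ W)
    {k : ℕ} (ψ : E6 [⋀^Fin k]→L[ℝ] ℂ) :
    F.wedgePhiBar q ψ = wedge (conjForm (l q)) (wedge (conjForm (τ q)) ψ) := by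
  obtain ⟨U, h1, h2, h3, _⟩ := (h.frame_change hW hθ).self_of_nhds
  rw [h1, h2, conjForm_comb, conjForm_comb, wedge_wedge_comb, ← map_mul, ← map_mul, ← map_sub, h3,
    wedgePhiBar]

/-- The matrix h consists of the coefficients of this hermitian form after λ and τ are expanded in
the chart's coframe. -/
theorem AdaptedAt.metric_eq (h : F.AdaptedAt l τ ρ q) (hW : IsOpen W) (hθ : ContDiffOn ℝ ∞ θ W)
    (v w : E6) :
    ∑ α, ∑ β, F.h q.1 α β *
      symProd (lift (F.coframe α q.1)) (conjForm (lift (F.coframe β q.1))) v w =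
    symProd (l q) (conjForm (τ q)) v w + symProd (τ q) (conjForm (l q)) v w := by
  obtain ⟨U, h1, h2, _, h4⟩ := (h.frame_change hW hθ).self_of_nhds
  simp only [Fin.sum_univ_two, h4]
  rw [h1, h2, conjForm_comb, conjForm_comb]
  simp only [symProd, _root_.add_apply, _root_.smul_apply, smul_eq_mul, conjForm_apply]
  ring

theorem differentiableAt_wedge {E : Type*} [NormedAddCommGroup E] [NormedSpace ℝ E] {k : ℕ}
    {α : E → E →L[ℝ] ℂ} {ψ : E → E [⋀^Fin k]→L[ℝ] ℂ} {y : E} (hα : DifferentiableAt ℝ α y)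
    (hψ : DifferentiableAt ℝ ψ y) : DifferentiableAt ℝ (fun z => wedge (α z) (ψ z)) y :=
  DifferentiableAt.comp (g := fun x : (E →L[ℝ] ℂ) × (E [⋀^Fin k]→L[ℝ] ℂ) => wedgeCLM x.1 x.2)
    (f := fun z => (α z, ψ z)) y
    ((wedgeCLM (E := E) (k := k)).isBoundedBilinearMap.differentiableAt (α y, ψ y)) (hα.prodMk hψ)

theorem xi_apply_of_zero (z : E6) (u : Fin 3 → E6) (i : Fin 3) (hi : (u i).1 = 0) : F.xi z u = 0 := by
  have h0 : ∀ α : E5 →L[ℝ] ℂ, lift α (u i) = 0 := fun α => by rw [lift_apply, hi, map_zero]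
  have hu : u = ![u 0, u 1, u 2] := by ext i <;> fin_cases i <;> rfl
  rw [hu, xi, phi, wedge_smul_right, ContinuousAlternatingMap.smul_apply, wedge_apply_three,
    wedge_oneForm_apply, wedge_oneForm_apply, wedge_oneForm_apply]
  fin_cases i <;> simp only [Fin.isValue, Fin.zero_eta, Fin.mk_one, Fin.reduceFinMk] at h0 <;>
    simp only [h0] <;> simp

/-- The fibre coordinate enters ξ only through e^{is}, and ξ annihilates ∂_s. Contracting dξ = 2iρ ∧
ξ with ∂_s therefore gives iξ = 2iρ(∂_s) ξ. -/
theorem AdaptedAt.rho_fibre (h : F.AdaptedAt l τ ρ q) (hW : IsOpen W) (hθ : ContDiffOn ℝ ∞ θ W) :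
    ρ q (0, 1) = 1 / 2 := by
  have hd := h.eqs.d_xi
  have he := h.xi_eq hW hθ
  rw [← Filter.EventuallyEq.extDeriv_eq he, ← he.self_of_nhds] at hd
  have hdiff : DifferentiableAt ℝ F.xi q :=
    (differentiableAt_wedge (h.eqs.smooth_θ.differentiableAt (by norm_num))
      (differentiableAt_wedge_oneForm (h.eqs.smooth_l.differentiableAt (by norm_num))
      (h.eqs.smooth_τ.differentiableAt (by norm_num)))).congr_of_eventuallyEq he
  set u : Fin 3 → E6 := ![(F.T q.1, 0), ((F.Z 0 q.1).1, 0), ((F.Z 1 q.1).1, 0)] with hu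
  have hxi : F.xi q u = Complex.exp (Complex.I * q.2) / 4 := by
    have hreal : conjForm (θ q.1) = θ q.1 := ContinuousLinearMap.ext fun v =>
      congrArg (fun L : E6 →L[ℝ] ℂ => L (v, 0)) h.eqs.real_θ.self_of_nhds
    simp only [hu, UnitAdmissibleFrame.xi, phi, wedge_smul_right, ContinuousAlternatingMap.smul_apply, wedge_apply_three,
      wedge_oneForm_apply, lift_apply, F.reeb_one _ h.mem,
      F.coframe_T _ h.mem, F.coframe_Z_fst h.mem, (F.theta_Z_parts h.mem hreal _).1, smul_eq_mul]
    norm_num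
    ring
  have h1 := congrArg (fun ψ : E6 [⋀^Fin 4]→L[ℝ] ℂ => ψ (Matrix.vecCons (0, 1) u)) hd
  have h2 : extDeriv F.xi q (Matrix.vecCons (0, 1) u) = Complex.I * F.xi q u := by
    rw [extDeriv_apply hdiff, Fin.sum_univ_succ, Finset.sum_eq_zero, add_zero]
    · have e : (Fin.removeNth 0 (Matrix.vecCons ((0, 1) : E6) u) : Fin 3 → E6) = u := by
        ext i <;> rfl
      have hfun : (fun t : ℝ => F.xi (q.1, t) u) = fun t : ℝ => Complex.exp (Complex.I * t) *
          wedge (lift (θ q.1)) (wedge (lift (F.coframe 0 q.1)) (oneForm (lift (F.coframe 1 q.1)))) u := by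
        funext t
        rw [UnitAdmissibleFrame.xi, phi, wedge_smul_right]; rfl
      have hline : HasDerivAt (fun t : ℝ => F.xi (q.1, t) u) (Complex.I * F.xi q u) q.2 := by
        have := congrFun hfun q.2
        rw [hfun, this]
        have h4 : HasDerivAt (fun t : ℝ => Complex.exp (Complex.I * t))
            (Complex.exp (Complex.I * q.2) * (Complex.I * 1)) q.2 :=
          ((Complex.ofRealCLM.hasDerivAt (x := q.2)).const_mul Complex.I).cexp
        refine (h4.mul_const _).congr_deriv ?_
        ring
      have hpath : HasDerivAt (fun t : ℝ => ((q.1, t) : E6)) (0, 1) q.2 :=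
        (hasDerivAt_const q.2 q.1).prodMk (hasDerivAt_id q.2)
      have hu' : DifferentiableAt ℝ (fun z => F.xi z u) q :=
        (ContinuousAlternatingMap.apply ℝ E6 ℂ u).differentiableAt.comp q hdiff
      have h5 := hu'.hasFDerivAt.comp_hasDerivAt_of_eq q.2 hpath rfl
      rw [e]
      simp only [Fin.val_zero, pow_zero, one_smul]
      exact h5.unique hline
    · intro i _
      have : (fun z => F.xi z (i.succ.removeNth (Matrix.vecCons (0, 1) u))) = fun _ => 0 := by
        funext z
        exact xi_apply_of_zero z _ 0 rfl
      rw [this]; simp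
  have h3 : wedge (ρ q) (F.xi q) (Matrix.vecCons (0, 1) u) = ρ q (0, 1) * F.xi q u := by
    rw [wedge_apply, Fin.sum_univ_succ, Finset.sum_eq_zero, add_zero]
    · simp
    · intro i _
      rw [xi_apply_of_zero q _ 0 (by rfl)]; ring
  simp only [ContinuousAlternatingMap.smul_apply, smul_eq_mul] at h1
  rw [h2, h3] at h1
  have hne : F.xi q u ≠ 0 := by rw [hxi]; exact div_ne_zero (Complex.exp_ne_zero _) (by norm_num)
  have := mul_right_cancel₀ hne (show (Complex.I) * F.xi q u = (2 * Complex.I * ρ q (0, 1)) * F.xi q u by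
    rw [h1]; ring)
  have := mul_left_cancel₀ Complex.I_ne_zero (show Complex.I * 1 = Complex.I * (2 * ρ q (0, 1)) by
    rw [mul_one]; linear_combination this)
  linear_combination (-1 / 2 : ℂ) * this

end UnitAdmissibleFrame

end FrameComparison

/-! ### The Fefferman connection form is half of ρ, and it is unique. -/

section Connection

open ComplexConjugate UnitAdmissibleFrame

set_option synthInstance.maxHeartbeats 400000
set_option maxHeartbeats 1000000

variable {W : Set E5} {T10 : E5 → Set (E5 × E5)} {θ : E5 → E5 →L[ℝ] ℂ}
  {F : UnitAdmissibleFrame W T10 θ} {q : E6} {l τ ρ : E6 → E6 →L[ℝ] ℂ}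

namespace UnitAdmissibleFrame

variable (F q) in
/-- The lift of `Z_α` to `W × ℝ`. -/
def liftZ (α : Fin 2) : E6 × E6 := (((F.Z α q.1).1, 0), ((F.Z α q.1).2, 0))

theorem evalC_lift_conj_liftZ (α : E5 →L[ℝ] ℂ) (β : Fin 2) :
    evalC (lift α) (conjVec (F.liftZ q β)) = evalC α (conjVec (F.Z β q.1)) := rfl

theorem trace_eq (ψ : E6 [⋀^Fin 2]→L[ℝ] ℂ) :
    F.trace q ψ = -Complex.I * (F.h q.1).det⁻¹ *
      (F.h q.1 1 1 * evalC2 ψ (F.liftZ q 0) (conjVec (F.liftZ q 0))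
      - F.h q.1 1 0 * evalC2 ψ (F.liftZ q 0) (conjVec (F.liftZ q 1))
      - F.h q.1 0 1 * evalC2 ψ (F.liftZ q 1) (conjVec (F.liftZ q 0))
      + F.h q.1 0 0 * evalC2 ψ (F.liftZ q 1) (conjVec (F.liftZ q 1))) := by
  have hinv : ((F.h q.1)ᵀ)⁻¹ = (F.h q.1).det⁻¹ • !![F.h q.1 1 1, -F.h q.1 1 0; -F.h q.1 0 1, F.h q.1 0 0] := by
    rw [Matrix.inv_def, Matrix.det_transpose, Matrix.adjugate_fin_two, Ring.inverse_eq_inv']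
    rfl
  rw [trace, hinv]
  simp only [Fin.sum_univ_two, Matrix.smul_apply, smul_eq_mul, liftZ]
  simp
  ring

theorem trace_add (ψ χ : E6 [⋀^Fin 2]→L[ℝ] ℂ) :
    F.trace q (ψ + χ) = F.trace q ψ + F.trace q χ := by
  simp only [trace_eq, evalC2_add]; ring

theorem trace_smul (c : ℂ) (ψ : E6 [⋀^Fin 2]→L[ℝ] ℂ) :
    F.trace q (c • ψ) = c * F.trace q ψ := by
  simp only [trace_eq, evalC2_smul]; ring

theorem AdaptedAt.real_theta (h : F.AdaptedAt l τ ρ q) : conjForm (θ q.1) = θ q.1 :=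
  ContinuousLinearMap.ext fun v =>
    congrArg (fun L : E6 →L[ℝ] ℂ => L (v, 0)) h.eqs.real_θ.self_of_nhds

/-- In the frame dual to (λ, τ) the Levi matrix is antidiagonal, so the trace pairs a vector in ker
λ with the conjugate of one in ker τ, and conversely. On such pairs dρ agrees with a multiple of τ ∧
τ̄ by `d_rho`, which vanishes there. The proof writes this in the frame Z_α by means of U. -/
theorem AdaptedAt.trace_rho (h : F.AdaptedAt l τ ρ q) (hW : IsOpen W) (hθ : ContDiffOn ℝ ∞ θ W) :
    F.trace q (dOne ρ q) = 0 := by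
  obtain ⟨U, h1, h2, h3, h4⟩ := (h.frame_change hW hθ).self_of_nhds
  have hq := h.mem
  set d := Complex.exp (Complex.I * q.2)
  have hd0 : d ≠ 0 := Complex.exp_ne_zero _
  have lZ : ∀ α, evalC (l q) (F.liftZ q α) = U 0 α := fun α => by
    rw [h1]
    have : evalC (U 0 0 • lift (F.coframe 0 q.1) + U 0 1 • lift (F.coframe 1 q.1)) (F.liftZ q α) =
      U 0 0 * evalC (F.coframe 0 q.1) (F.Z α q.1) + U 0 1 * evalC (F.coframe 1 q.1) (F.Z α q.1) := by
      simp only [evalC, _root_.add_apply, _root_.smul_apply, smul_eq_mul, lift_apply, liftZ]; ring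
    rw [this, F.coframe_Z _ hq, F.coframe_Z _ hq]
    fin_cases α <;> simp
  have lZc : ∀ α, evalC (l q) (conjVec (F.liftZ q α)) = 0 := fun α => by
    rw [h1]
    have : evalC (U 0 0 • lift (F.coframe 0 q.1) + U 0 1 • lift (F.coframe 1 q.1))
      (conjVec (F.liftZ q α)) = U 0 0 * evalC (F.coframe 0 q.1) (conjVec (F.Z α q.1)) +
        U 0 1 * evalC (F.coframe 1 q.1) (conjVec (F.Z α q.1)) := by
      rw [← evalC_lift_conj_liftZ, ← evalC_lift_conj_liftZ]
      simp only [evalC, _root_.add_apply, _root_.smul_apply, smul_eq_mul]; ring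
    rw [this, F.coframe_conjZ _ hq, F.coframe_conjZ _ hq]; ring
  have τZ : ∀ α, evalC (τ q) (F.liftZ q α) = U 1 α := fun α => by
    rw [h2]
    have : evalC (U 1 0 • lift (F.coframe 0 q.1) + U 1 1 • lift (F.coframe 1 q.1)) (F.liftZ q α) =
      U 1 0 * evalC (F.coframe 0 q.1) (F.Z α q.1) + U 1 1 * evalC (F.coframe 1 q.1) (F.Z α q.1) := by
      simp only [evalC, _root_.add_apply, _root_.smul_apply, smul_eq_mul, lift_apply, liftZ]; ring
    rw [this, F.coframe_Z _ hq, F.coframe_Z _ hq]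
    fin_cases α <;> simp
  have τZc : ∀ α, evalC (τ q) (conjVec (F.liftZ q α)) = 0 := fun α => by
    rw [h2]
    have : evalC (U 1 0 • lift (F.coframe 0 q.1) + U 1 1 • lift (F.coframe 1 q.1))
      (conjVec (F.liftZ q α)) = U 1 0 * evalC (F.coframe 0 q.1) (conjVec (F.Z α q.1)) +
        U 1 1 * evalC (F.coframe 1 q.1) (conjVec (F.Z α q.1)) := by
      rw [← evalC_lift_conj_liftZ, ← evalC_lift_conj_liftZ]
      simp only [evalC, _root_.add_apply, _root_.smul_apply, smul_eq_mul]; ring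
    rw [this, F.coframe_conjZ _ hq, F.coframe_conjZ _ hq]; ring
  have θZ : ∀ α, evalC (lift (θ q.1)) (F.liftZ q α) = 0 := fun α => F.theta_Z _ hq α
  have θZc : ∀ α, evalC (lift (θ q.1)) (conjVec (F.liftZ q α)) = 0 := fun α => by
    simp [evalC, conjVec, liftZ, lift_apply, (F.theta_Z_parts hq h.real_theta α).1,
      (F.theta_Z_parts hq h.real_theta α).2]
  -- If λ vanished on ker θ, the first row of U would be zero, contrary to det U = e^{is}.
  obtain ⟨V, hV1, hV2⟩ : ∃ V : E6, l q V ≠ 0 ∧ lift (θ q.1) V = 0 := by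
    by_contra! hne
    have hA : ∀ α, lift (θ q.1) ((F.Z α q.1).1, 0) = 0 := fun α => (F.theta_Z_parts hq h.real_theta α).1
    have hz : ∀ α, U 0 α = 0 := fun α => by
      have h5 : l q ((F.Z α q.1).1, 0) = 0 := by
        by_contra h6; exact hne _ h6 (hA α)
      rw [h1] at h5
      simp only [_root_.add_apply, _root_.smul_apply, lift_apply, smul_eq_mul, F.coframe_Z_fst hq] at h5
      fin_cases α <;> simpa using h5
    rw [hz 0, hz 1] at h3
    exact hd0 (by linear_combination -h3)
  -- The combination U₀₁ Z_0 − U₀₀ Z_1 is annihilated by λ and θ, so `d_rho` applies to it.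
  have hr : ∀ β, U 0 1 * evalC2 (dOne ρ q) (F.liftZ q 0) (conjVec (F.liftZ q β))
      - U 0 0 * evalC2 (dOne ρ q) (F.liftZ q 1) (conjVec (F.liftZ q β)) =
      -Complex.I * d * conj (U 1 β) := by
    intro β
    have h5 := h.eqs.d_rho (V := V) hV1 hV2
      (z := smulVec (U 0 1) (F.liftZ q 0) + smulVec (-U 0 0) (F.liftZ q 1))
      (w := conjVec (F.liftZ q β)) (by
        rw [evalC_add, evalC_smulVec, evalC_smulVec, lZ, lZ]; ring) (by
        rw [evalC_add, evalC_smulVec, evalC_smulVec, θZ, θZ]; ring) (lZc β) (θZc β)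
    have hcc : conjVec (conjVec (F.liftZ q β)) = F.liftZ q β := by simp [conjVec]
    rw [evalC2_add_left, evalC2_smulVec_left, evalC2_smulVec_left, evalC_add, evalC_smulVec,
      evalC_smulVec, τZ, τZ, τZc, evalC_conjForm (τ q) (conjVec (F.liftZ q β)), hcc, τZ] at h5
    linear_combination h5 - Complex.I * conj (U 1 β) * h3
  have hreal : ∀ v w, conj (dOne ρ q ![v, w]) = dOne ρ q ![v, w] := fun v w => by
    rw [← dOne_conjForm (h.eqs.smooth_ρ.differentiableAt (by norm_num)), dOne_congr h.eqs.real_ρ]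
  have hc := fun α β => evalC2_conj hreal (F.liftZ q α) (F.liftZ q β)
  -- The conjugate equations, available because ρ is real; they supply the other half of the trace.
  have hr' : ∀ β, conj (U 0 1) * evalC2 (dOne ρ q) (F.liftZ q β) (conjVec (F.liftZ q 0))
      - conj (U 0 0) * evalC2 (dOne ρ q) (F.liftZ q β) (conjVec (F.liftZ q 1)) =
      -Complex.I * conj d * U 1 β := by
    intro β
    have h5 := congrArg conj (hr β)
    simp only [map_sub, map_mul, map_neg, Complex.conj_I, Complex.conj_conj, hc] at h5
    linear_combination -h5
  rw [trace_eq, h4, h4, h4, h4]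
  have e0 := hr 0
  have e1 := hr 1
  have e0' := hr' 0
  have e1' := hr' 1
  linear_combination (-Complex.I * (F.h q.1).det⁻¹) * (conj (U 1 1) * e0 - conj (U 1 0) * e1
    + U 1 1 * e0' - U 1 0 * e1')

/-- The components of dθ are the Levi matrix itself, so its trace is that of the 2×2 identity. -/
theorem trace_dtheta (hq : q.1 ∈ W) (hθ : DifferentiableAt ℝ θ q.1) :
    F.trace q (dOne (fun z : E6 => lift (θ z.1)) q) = 2 := by
  have hM : ∀ α β, evalC2 (dOne (fun z : E6 => lift (θ z.1)) q) (F.liftZ q α) (conjVec (F.liftZ q β)) =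
      Complex.I * F.h q.1 α β := by
    intro α β
    simp only [evalC2, dOne_lift hθ, F.levi _ hq, liftZ, conjVec, Prod.fst_neg, map_neg,
      F.coframe_Z_fst hq, F.coframe_Z_snd hq, map_div₀, Complex.conj_I, map_ofNat, apply_ite conj,
      map_zero, map_one, Fin.sum_univ_two]
    have hI := Complex.I_mul_I
    fin_cases α <;> fin_cases β <;> simp <;> ring_nf <;> simp only [Complex.I_pow_three] <;>
      ring
  rw [trace_eq, hM, hM, hM, hM]
  have hdet : (F.h q.1).det ≠ 0 := fun h0 => by
    have := F.unit_det _ hq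
    rw [h0] at this; simp at this
  field_simp
  rw [Matrix.det_fin_two]
  linear_combination (-2 * (F.h q.1 0 0 * F.h q.1 1 1 - F.h q.1 0 1 * F.h q.1 1 0)) * Complex.I_mul_I

theorem trace_wedge_theta (hq : q.1 ∈ W) (hr : conjForm (θ q.1) = θ q.1) (β : E6 →L[ℝ] ℂ) :
    F.trace q (wedge β (oneForm (lift (θ q.1)))) = 0 := by
  have θZ : ∀ α, evalC (lift (θ q.1)) (F.liftZ q α) = 0 := fun α => F.theta_Z _ hq α
  have θZc : ∀ α, evalC (lift (θ q.1)) (conjVec (F.liftZ q α)) = 0 := fun α => by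
    simp [evalC, conjVec, liftZ, lift_apply, (F.theta_Z_parts hq hr α).1,
      (F.theta_Z_parts hq hr α).2]
  simp only [trace_eq, evalC2_wedge, θZ, θZc]
  ring

/-- Half of `ρ` satisfies the equations of the Fefferman connection form. -/
theorem AdaptedAt.isConnection (h : F.AdaptedAt l τ ρ q) (hW : IsOpen W) (hθ : ContDiffOn ℝ ∞ θ W)
    {σ : E6 → E6 →L[ℝ] ℝ} (hσ : ∀ᶠ z in 𝓝 q, ofRealForm (σ z) = (1 / 2 : ℂ) • ρ z) :
    extDeriv F.xi q = (4 * Complex.I) • wedge (ofRealForm (σ q)) (F.xi q) ∧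
    wedge (ofRealForm (σ q)) (F.wedgePhiBar q (extDeriv F.phi q)) =
      (F.trace q (dOne (fun z => ofRealForm (σ z)) q) * Complex.I) •
        wedge (ofRealForm (σ q)) (wedge (lift (θ q.1)) (F.wedgePhiBar q (F.phi q))) := by
  have hx := h.xi_eq hW hθ
  have hp := h.phi_eq hW hθ
  rw [dOne_congr hσ, dOne_const_smul (h.eqs.smooth_ρ.differentiableAt (by norm_num)),
    trace_smul, h.trace_rho hW hθ, hσ.self_of_nhds, Filter.EventuallyEq.extDeriv_eq hx,
    Filter.EventuallyEq.extDeriv_eq hp, hx.self_of_nhds, h.eqs.d_xi, h.wedgePhiBar_eq hW hθ,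
    wedge_smul_left, wedge_smul_left, wedge_smul_left, h.eqs.d_phi]
  constructor
  · module
  · rw [mul_zero, zero_mul]
    module

theorem dOne_add {E : Type*} [NormedAddCommGroup E] [NormedSpace ℝ E] {α β : E → E →L[ℝ] ℂ} {y : E}
    (hα : DifferentiableAt ℝ α y) (hβ : DifferentiableAt ℝ β y) :
    dOne (fun z => α z + β z) y = dOne α y + dOne β y := by
  refine twoForm_ext fun v w => ?_
  have h : HasFDerivAt (fun z => α z + β z) _ y := hα.hasFDerivAt.add hβ.hasFDerivAt
  rw [dOne_apply h.differentiableAt, ContinuousAlternatingMap.add_apply, dOne_apply hα, dOne_apply hβ,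
    h.fderiv]
  simp
  ring

theorem form_eq_zero_of_smul {E : Type*} [NormedAddCommGroup E] [NormedSpace ℝ E] {k : ℕ} {c : ℂ}
    (hc : c ≠ 0) {ψ : E [⋀^Fin k]→L[ℝ] ℂ} (h : c • ψ = 0) : ψ = 0 := by
  ext v
  have := congrArg (fun χ : E [⋀^Fin k]→L[ℝ] ℂ => χ v) h
  exact (mul_eq_zero.1 this).resolve_left hc

theorem wedge_four_ne_zero (hq : q.1 ∈ W) (a0 a1 b0 b1 : E6)
    (h0 : a0.1 = (F.Z 0 q.1).1) (h1 : a1.1 = (F.Z 1 q.1).1) (h2 : b0.1 = (F.Z 0 q.1).2)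
    (h3 : b1.1 = (F.Z 1 q.1).2) :
    wedge (conjForm (lift (F.coframe 0 q.1))) (wedge (conjForm (lift (F.coframe 1 q.1)))
      (wedge (lift (F.coframe 0 q.1)) (oneForm (lift (F.coframe 1 q.1))))) ![a0, b0, a1, b1] ≠ 0 := by
  simp only [wedge_apply_four, wedge_apply_three, wedge_oneForm_apply, conjForm_apply, lift_apply, h0, h1,
    h2, h3, F.coframe_Z_fst hq, F.coframe_Z_snd hq]
  simp
  ring_nf
  simp

/-- The volume form `ρ ∧ θ ∧ λ̄ ∧ τ̄ ∧ λ ∧ τ` does not vanish. -/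
theorem AdaptedAt.volume_ne_zero (h : F.AdaptedAt l τ ρ q) (hW : IsOpen W) (hθ : ContDiffOn ℝ ∞ θ W) :
    wedge (ρ q) (wedge (lift (θ q.1)) (wedge (conjForm (l q)) (wedge (conjForm (τ q))
      (wedge (l q) (oneForm (τ q)))))) ≠ 0 := by
  intro h0
  have hq := h.mem
  rw [← h.wedgePhiBar_eq hW hθ, ← (h.phi_eq hW hθ).self_of_nhds, wedgePhiBar, phi] at h0
  simp only [wedge_smul_right, smul_smul] at h0
  have h1 := form_eq_zero_of_smul (mul_ne_zero
    ((map_ne_zero _).2 (Complex.exp_ne_zero _)) (Complex.exp_ne_zero _)) h0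
  have hreal : ∀ v, ((ρ q v).re : ℂ) = ρ q v := fun v => by
    have : conj (ρ q v) = ρ q v := congrArg (fun L : E6 →L[ℝ] ℂ => L v) h.eqs.real_ρ.self_of_nhds
    exact Complex.conj_eq_iff_re.1 this
  -- Lifts corrected by a multiple of ∂_s so that ρ vanishes on them, possible because ρ(∂_s) = 1/2.
  -- The volume form then splits into a product of values.
  let adj : E5 → E6 := fun v => (v, -2 * (ρ q (v, 0)).re)
  have hadj : ∀ v, ρ q (adj v) = 0 := fun v => by
    have : adj v = (v, 0) + (-2 * (ρ q (v, 0)).re) • ((0, 1) : E6) := by simp [adj]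
    rw [this, map_add, map_smul, h.rho_fibre hW hθ, Complex.real_smul]
    push_cast
    rw [hreal]; ring
  have h2 := congrArg (fun ψ : E6 [⋀^Fin 6]→L[ℝ] ℂ => ψ (Matrix.vecCons (0, 1) (Matrix.vecCons (adj (F.T q.1))
    ![adj (F.Z 0 q.1).1, adj (F.Z 0 q.1).2, adj (F.Z 1 q.1).1, adj (F.Z 1 q.1).2]))) h1
  rw [wedge_cons_of_tail _ _ _ _ (by intro i; fin_cases i <;> exact hadj _),
    wedge_cons_of_tail _ _ _ _ (by
      intro i
      fin_cases i
      · exact (F.theta_Z_parts hq h.real_theta 0).1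
      · exact (F.theta_Z_parts hq h.real_theta 0).2
      · exact (F.theta_Z_parts hq h.real_theta 1).1
      · exact (F.theta_Z_parts hq h.real_theta 1).2), h.rho_fibre hW hθ, lift_apply] at h2
  have h3 : θ q.1 (adj (F.T q.1)).1 = 1 := F.reeb_one _ hq
  rw [h3] at h2
  exact mul_ne_zero (by norm_num) (mul_ne_zero one_ne_zero
    (wedge_four_ne_zero hq _ _ _ _ rfl rfl rfl rfl)) h2

/-- The Fefferman connection form is unique. -/
theorem AdaptedAt.connection_unique (h : F.AdaptedAt l τ ρ q) (hev : ∀ᶠ z in 𝓝 q, F.AdaptedAt l τ ρ z)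
    (hW : IsOpen W) (hθ : ContDiffOn ℝ ∞ θ W) {σ : E6 → E6 →L[ℝ] ℝ} (hσ : DifferentiableAt ℝ σ q)
    (h1 : ∀ᶠ z in 𝓝 q, extDeriv F.xi z = (4 * Complex.I) • wedge (ofRealForm (σ z)) (F.xi z))
    (h2 : wedge (ofRealForm (σ q)) (F.wedgePhiBar q (extDeriv F.phi q)) =
      (F.trace q (dOne (fun z => ofRealForm (σ z)) q) * Complex.I) •
        wedge (ofRealForm (σ q)) (wedge (lift (θ q.1)) (F.wedgePhiBar q (F.phi q)))) :
    ofRealForm (σ q) = (1 / 2 : ℂ) • ρ q := by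
  have hq := h.mem
  have dρ := h.eqs.smooth_ρ.differentiableAt (by norm_num)
  have dθ := h.eqs.smooth_θ.differentiableAt (by norm_num)
  have dl := h.eqs.smooth_l.differentiableAt (by norm_num)
  have dτ := h.eqs.smooth_τ.differentiableAt (by norm_num)
  -- The only possible θ-coefficient of σ − ρ/2. Defined by evaluation on the Reeb field, it is
  -- visibly differentiable.
  let a : E6 → ℂ := fun z => ofRealForm (σ z) (F.T z.1, 0) - (1 / 2 : ℂ) * ρ z (F.T z.1, 0)
  have key : ∀ᶠ z in 𝓝 q, ofRealForm (σ z) = (1 / 2 : ℂ) • ρ z + a z • lift (θ z.1) := by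
    filter_upwards [h1, hev] with z hz1 hz
    have e1 := hz.eqs.d_xi
    have e2 := hz.xi_eq hW hθ
    rw [← Filter.EventuallyEq.extDeriv_eq e2, ← e2.self_of_nhds, hz1] at e1
    have e3 : wedge (ofRealForm (σ z) - (1 / 2 : ℂ) • ρ z) (F.xi z) = 0 := by
      refine (smul_eq_zero.1 (?_ : (4 * Complex.I) • _ = _)).resolve_left
        (mul_ne_zero (by norm_num) Complex.I_ne_zero)
      rw [wedge_sub_left, wedge_smul_left, smul_sub, e1]
      module
    have e4 := F.expand_of_wedge_xi hz.mem hz.real_theta e3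
    have hb : ∀ v, conj ((ofRealForm (σ z) - (1 / 2 : ℂ) • ρ z) v) =
        (ofRealForm (σ z) - (1 / 2 : ℂ) • ρ z) v := fun v => by
      have : conj (ρ z v) = ρ z v := congrArg (fun L : E6 →L[ℝ] ℂ => L v) hz.eqs.real_ρ.self_of_nhds
      simp only [_root_.sub_apply, _root_.smul_apply, smul_eq_mul, map_sub, map_mul, this]
      simp [ofRealForm, map_ofNat]
    set b := ofRealForm (σ z) - (1 / 2 : ℂ) • ρ z with hbdef
    have hA : ∀ α, b ((F.Z α z.1).1, 0) = 0 := by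
      intro α
      -- The coframe part of b is of type (1,0), so its values on the real and imaginary parts of
      -- Z_α differ by the factor −i. As b is real, both values are zero.
      have e5 : b ((F.Z α z.1).2, 0) = -Complex.I * b ((F.Z α z.1).1, 0) := by
        conv_lhs => rw [e4]
        simp only [_root_.add_apply, _root_.smul_apply, lift_apply, smul_eq_mul, F.coframe_Z_snd hz.mem,
          (F.theta_Z_parts hz.mem hz.real_theta _).2]
        fin_cases α <;> simp <;> ring
      have e6 := congrArg conj e5
      rw [map_mul, map_neg, Complex.conj_I, hb, hb, e5] at e6
      have e7 : Complex.I * b ((F.Z α z.1).1, 0) = 0 := by linear_combination -(1 / 2 : ℂ) * e6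
      exact (mul_eq_zero.1 e7).resolve_left Complex.I_ne_zero
    refine ContinuousLinearMap.ext fun v => ?_
    have e8 := congrArg (fun L : E6 →L[ℝ] ℂ => L v) e4
    simp only [hA, _root_.add_apply, _root_.smul_apply, smul_eq_mul] at e8
    simp only [hbdef, _root_.smul_apply, smul_eq_mul, _root_.sub_apply] at e8
    simp only [_root_.add_apply, _root_.smul_apply, smul_eq_mul, a]
    linear_combination e8
  have da : DifferentiableAt ℝ a q := by
    have hT : DifferentiableAt ℝ (fun z : E6 => ((F.T z.1, 0) : E6)) q :=
      (((F.smooth_T.contDiffAt (hW.mem_nhds hq)).differentiableAt (by norm_num)).comp q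
        differentiableAt_fst).prodMk (differentiableAt_const 0)
    have hσ' : DifferentiableAt ℝ (fun z => ofRealForm (σ z)) q :=
      (differentiableAt_const Complex.ofRealCLM).clm_comp hσ
    exact (hσ'.clm_apply hT).sub ((dρ.clm_apply hT).const_mul _)
  have hsm := differentiableAt_smulForm (differentiableAt_const (1 / 2 : ℂ)) dρ
  -- Of dσ = dρ/2 + a dθ + da ∧ θ only the middle term has a trace.
  have htr : F.trace q (dOne (fun z => ofRealForm (σ z)) q) = 2 * a q := by
    rw [dOne_congr key, dOne_add hsm (differentiableAt_smulForm da dθ), dOne_const_smul dρ,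
      dOne_smul dθ da, trace_add, trace_add, trace_smul, trace_smul, h.trace_rho hW hθ,
      trace_dtheta hq ((hθ.contDiffAt (hW.mem_nhds hq)).differentiableAt (by norm_num)),
      trace_wedge_theta hq h.real_theta]
    ring
  have hp := h.phi_eq hW hθ
  have hdphi : wedge (lift (θ q.1)) (extDeriv F.phi q) =
      -((2 * Complex.I) • wedge (ρ q) (wedge (lift (θ q.1)) (wedge (l q) (oneForm (τ q))))) := by
    rw [Filter.EventuallyEq.extDeriv_eq hp, ← h.eqs.d_xi, extDeriv_wedge_wedge_oneForm dθ dl dτ,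
      extDeriv_wedge_oneForm dl dτ, h.eqs.d_θ.self_of_nhds]
    have e : wedge (l q) (wedge (τ q) (wedge (l q) (oneForm (conjForm (τ q))))) = 0 := by
      rw [wedge_wedge_comm (τ q) (l q), wedge_neg_right, wedge_wedge_self, neg_zero]
    simp only [wedge_smul_right, wedge_add_right, wedge_wedge_self, wedge_zero_right, e]
    module
  rw [htr, key.self_of_nhds] at h2
  simp only [wedge_add_left, wedge_smul_left, wedge_wedge_self] at h2
  rw [h.wedgePhiBar_eq hW hθ, h.wedgePhiBar_eq hW hθ, wedge_wedge_comm (lift (θ q.1)) (conjForm (l q)),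
    wedge_wedge_comm (lift (θ q.1)) (conjForm (τ q)), wedge_neg_right, neg_neg, hdphi,
    Filter.EventuallyEq.extDeriv_eq hp, h.eqs.d_phi, hp.self_of_nhds] at h2
  have hΩ := h.volume_ne_zero hW hθ
  set Ω := wedge (ρ q) (wedge (lift (θ q.1)) (wedge (conjForm (l q)) (wedge (conjForm (τ q))
      (wedge (l q) (oneForm (τ q)))))) with hΩdef
  have e : wedge (conjForm (l q)) (wedge (conjForm (τ q)) (wedge (ρ q) (wedge (lift (θ q.1))
      (wedge (l q) (oneForm (τ q)))))) = Ω := by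
    rw [wedge_wedge_comm (conjForm (τ q)) (ρ q), wedge_neg_right, wedge_wedge_comm (conjForm (l q)) (ρ q),
      neg_neg, wedge_wedge_comm (conjForm (τ q)) (lift (θ q.1)), wedge_neg_right,
      wedge_wedge_comm (conjForm (l q)) (lift (θ q.1)), neg_neg]
  simp only [wedge_neg_right, wedge_smul_right, e] at h2
  have ha : a q = 0 := by
    -- The second equation reads −2ia Ω = ia Ω: the left side comes from aθ ∧ dφ, the right side
    -- from the trace 2a multiplied by ρ/2.
    have h3 : (3 * Complex.I * a q) • Ω = 0 := by
      have h4 := sub_eq_zero.2 h2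
      rw [← neg_eq_zero, ← h4]
      module
    have h5 := (smul_eq_zero.1 h3).resolve_right hΩ
    exact (mul_eq_zero.1 h5).resolve_left (mul_ne_zero (by norm_num) Complex.I_ne_zero)
  have hk := key.self_of_nhds
  rw [ha] at hk
  rw [hk]
  module

end UnitAdmissibleFrame

end Connection

/-! ### The adapted coframe on the null cone, at one point. -/

section Pointwise

open ComplexConjugate

variable {S : Type*} [TopologicalSpace S] [ChartedSpace E3 S]

theorem theta1_apply (p : CCot S) (v : TCot) : theta1 p v = comp p ⬝ᵥ realC v.1 := by
  simp only [theta1, _root_.sum_apply, _root_.smul_apply, smul_eq_mul, dotProduct]; rfl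

variable [IsManifold (𝓡 3) ∞ S]

/-! ### The tangent space of the null cone -/

/-- The covariant differential `δζ` applied to a tangent vector. -/
def dlt (g : Metric3 S) (p : CCot S) (v : TCot) : Fin 3 → ℂ :=
  delta (gram g p.1) (dGram g p.1) (comp p) (compv v.2) v.1

theorem deltaZeta_apply (g : Metric3 S) (p : CCot S) (v : TCot) (j : Fin 3) :
    deltaZeta g p j v = dlt g p v j := by
  rw [← cDelta_self, cDelta_apply, crd_self, gramC_self]; rfl

theorem comp_ne_zero {g : Metric3 S} {p : CCot S} (hp : p ∈ NullCone g) : comp p ≠ 0 := fun h => by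
  obtain ⟨i, hi⟩ := hp.2
  exact hi (congrFun h i)

/-- The form `ζ̄^j δζ_j`. -/
def fA (g : Metric3 S) (p : CCot S) : TCot →L[ℝ] ℂ := ∑ j, conj (compUp g p j) • deltaZeta g p j

/-- The form `ζ^j δζ_j`. -/
def fB (g : Metric3 S) (p : CCot S) : TCot →L[ℝ] ℂ := ∑ j, compUp g p j • deltaZeta g p j

/-- The form `η^j δζ_j`. -/
def fC (g : Metric3 S) (p : CCot S) : TCot →L[ℝ] ℂ := ∑ j, (etaUp g p j : ℂ) • deltaZeta g p j

theorem fA_apply (g : Metric3 S) (p : CCot S) (v : TCot) :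
    fA g p v = conjC (upC (gram g p.1) (comp p)) ⬝ᵥ dlt g p v := by
  simp only [fA, _root_.sum_apply, _root_.smul_apply, smul_eq_mul, deltaZeta_apply]; rfl

theorem fB_apply (g : Metric3 S) (p : CCot S) (v : TCot) :
    fB g p v = upC (gram g p.1) (comp p) ⬝ᵥ dlt g p v := by
  simp only [fB, _root_.sum_apply, _root_.smul_apply, smul_eq_mul, deltaZeta_apply]; rfl

theorem fC_apply (g : Metric3 S) (p : CCot S) (v : TCot) :
    fC g p v = realC (etaU (gram g p.1) (comp p)) ⬝ᵥ dlt g p v := by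
  simp only [fC, _root_.sum_apply, _root_.smul_apply, smul_eq_mul, deltaZeta_apply]; rfl

theorem theta2_eq (g : Metric3 S) (p : CCot S) (v : TCot) : theta2 g p v = Complex.I * fC g p v := by
  simp only [fC, theta2, _root_.sum_apply, _root_.smul_apply, smul_eq_mul, Finset.mul_sum, mul_assoc]

theorem conj_theta (g : Metric3 S) (p : CCot S) (v : TCot) : conj (theta g p v) = theta g p v := by
  rw [theta_apply, conj_dot, conjC_realC, conjC_realC]

theorem theta_re (g : Metric3 S) (p : CCot S) (v : TCot) : ((theta g p v).re : ℂ) = theta g p v :=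
  Complex.conj_eq_iff_re.1 (conj_theta g p v)

theorem mfderiv_of_chart {E H M : Type*} [NormedAddCommGroup E] [NormedSpace ℝ E] [TopologicalSpace H]
    {I : ModelWithCorners ℝ E H} [TopologicalSpace M] [ChartedSpace H M] [IsManifold I 1 M]
    {f : M → ℂ} {x : M} {N : E → ℂ} (hN : DifferentiableAt ℝ N (extChartAt I x x))
    (h : f =ᶠ[𝓝 x] fun x' => N (extChartAt I x x')) :
    mfderiv I 𝓘(ℝ, ℂ) f x = fderiv ℝ N (extChartAt I x x) := by
  have h1 : HasMFDerivAt I 𝓘(ℝ, ℂ) (fun x' => N (extChartAt I x x')) x _ :=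
    HasMFDerivAt.comp (g := N) x hN.hasFDerivAt.hasMFDerivAt
      (mdifferentiableAt_extChartAt (I := I) (mem_chart_source H x)).hasMFDerivAt
  rw [h.mfderiv_eq, h1.mfderiv, mfderiv_extChartAt_self]
  rfl

/-- By metric compatibility, applied to the identity map of the coordinate space, d g(ζ, ζ) = 2 ζ^j
δζ_j. Hence the tangent space of the null cone is the kernel of `fB`. -/
theorem mfderiv_nullFn (hS : IsOrientedAtlas S) (g : Metric3 S) (p : CCot S) :
    ∃ L : TCot →L[ℝ] ℂ, L = mfderiv ICot 𝓘(ℝ, ℂ) (nullFn g) p ∧ ∀ v, L v = 2 * fB g p v := by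
  let N : TCot → ℂ := fun q => pairC (gramC g p.1 q.1) (compv q.2) (compv q.2)
  have hsrc : p.1 ∈ (chartAt E3 p.1).source := mem_chart_source E3 p.1
  have hmem : (crd p.1 p).1 ∈ (chartAt E3 p.1).target := by
    rw [crd_self]; simp
  have he : nullFn g =ᶠ[𝓝 p] fun p' => N (extChartAt ICot p p') := by
    have : ∀ᶠ p' : CCot S in 𝓝 p, p'.1 ∈ (chartAt E3 p.1).source :=
      (FiberBundle.continuous_proj _ _).continuousAt.preimage_mem_nhds
        ((chartAt E3 p.1).open_source.mem_nhds hsrc)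
    filter_upwards [this] with p' hp'
    rw [extChartAt_cot hp', nullFn_crd hS g hp']
  have hcv : ∀ i, DifferentiableAt ℝ (fun q : TCot => compv q.2 i) (crd p.1 p) := fun i =>
    (contDiffAt_compv _ i).differentiableAt (by norm_num)
  have hN : DifferentiableAt ℝ N (crd p.1 p) := by
    have hup := ContDiffAt.upC (contDiffAt_gramC_fst g hmem) (gramC_posDef hS g hmem).det_pos.ne'
      (contDiffAt_compv (crd p.1 p))
    have hNeq : N = fun q => ∑ i, upC (gramC g p.1 q.1) (compv q.2) i * compv q.2 i := rfl
    rw [hNeq]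
    exact DifferentiableAt.fun_sum (A := fun i (q : TCot) => upC (gramC g p.1 q.1) (compv q.2) i * compv q.2 i)
      fun i _ => ((hup i).differentiableAt (by norm_num)).mul (hcv i)
  have hx : extChartAt ICot p p = crd p.1 p := extChartAt_cot hsrc
  refine ⟨fderiv ℝ N (crd p.1 p), ?_, fun v => ?_⟩
  · have h1 := mfderiv_of_chart (I := ICot) (x := p) (N := N) (by rw [hx]; exact hN) he
    rw [hx] at h1
    exact h1.symm
  · have h2 := fderiv_pairC hS g (X := Prod.fst) hmem contDiffAt_fst hcv hcv v
    have h3 := covDeriv_zeta (g := g) (x₀ := p.1) (c := fun q : TCot => q) (z := crd p.1 p)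
      differentiableAt_id v
    simp only [fderiv_fun_id] at h3
    refine h2.trans ?_
    rw [pairC_comm (gramC_posDef hS g hmem)]
    have h4 : covDeriv g p.1 Prod.fst (fun q : TCot => compv q.2) (crd p.1 p) v = dlt g p v := by
      refine h3.trans ?_
      rw [crd_self, gramC_self]; rfl
    rw [h4, crd_self, gramC_self, fB_apply]
    change pairC _ (comp p) _ + pairC _ (comp p) _ = 2 * pairC _ (comp p) _
    ring

theorem mem_tangentNull (hS : IsOrientedAtlas S) {g : Metric3 S} {p : CCot S} {v : TCot} :
    v ∈ tangentNull g p ↔ fB g p v = 0 := by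
  obtain ⟨L, hL, h⟩ := mfderiv_nullFn hS g p
  have h1 : v ∈ tangentNull g p ↔ L v = 0 := by rw [hL]; rfl
  rw [h1, h]; simp

variable {g : Metric3 S} {p : CCot S}

/-- `g(ζ, ζ̄)` as a real number. -/
def hrm (g : Metric3 S) (p : CCot S) : ℝ := hermR (gram g p.1) (comp p)

theorem hrm_pos (hp : p ∈ NullCone g) : 0 < hrm g p := hermR_pos (gram_posDef g p.1) (comp_ne_zero hp)

theorem hermFn_eq_hrm (g : Metric3 S) (p : CCot S) : hermFn g p = (hrm g p : ℂ) := hermFn_eq_hermR g p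

/-- The tangent vectors of the null cone in terms of the adapted coframe. -/
theorem dot_base (hp : p ∈ NullCone g) (α : Fin 3 → ℂ) (v : TCot) :
    α ⬝ᵥ realC v.1 =
      theta1 p v / hrm g p * (conjC (upC (gram g p.1) (comp p)) ⬝ᵥ α)
      + conj (theta1 p v) / hrm g p * (upC (gram g p.1) (comp p) ⬝ᵥ α)
      + theta g p v / (hrm g p : ℂ) ^ 2 * (realC (etaU (gram g p.1) (comp p)) ⬝ᵥ α) := by
  conv_lhs => rw [triad_complete (gram_posDef g p.1) hp.1 (comp_ne_zero hp) (realC v.1)]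
  simp only [theta1_apply, theta_apply, dotProduct_add, dotProduct_smul, conj_dot,
    conjC_realC, smul_eq_mul]
  rw [dotProduct_comm α, dotProduct_comm α, dotProduct_comm α]
  rfl

theorem omega_eq_dlt (g : Metric3 S) (p : CCot S) (v w : TCot) :
    omega v w = dlt g p v ⬝ᵥ realC w.1 - dlt g p w ⬝ᵥ realC v.1 := by
  rw [dlt, dlt, delta_torsion (dG := dGram g p.1) (dGramC_symm g p.1 (extChartAt (𝓡 3) p.1 p.1)),
    omega, covec_apply, covec_apply]

/-- Torsion-freeness replaces dζ by δζ in the symplectic form, and dx is expanded in the triad. The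
term with ζ^j δζ_j drops out on the null cone, which leaves two pairs of forms. -/
theorem omega_eq (hp : p ∈ NullCone g) {v w : TCot} (hv : fB g p v = 0) (hw : fB g p w = 0) :
    omega v w = (fA g p v * theta1 p w - fA g p w * theta1 p v) / hrm g p
      + (fC g p v * theta g p w - fC g p w * theta g p v) / (hrm g p : ℂ) ^ 2 := by
  rw [omega_eq_dlt g p, dot_base hp, dot_base hp, ← fB_apply, ← fB_apply, hv, hw, ← fA_apply, ← fA_apply,
    ← fC_apply, ← fC_apply]
  ring

/-- A tangent vector of the null cone is determined by the values of the adapted coframe. -/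
theorem tangent_ext (hp : p ∈ NullCone g) {v w : TCot} (hB : fB g p v = fB g p w)
    (h0 : theta g p v = theta g p w) (h1 : theta1 p v = theta1 p w) (hC : fC g p v = fC g p w)
    (hA : fA g p v = fA g p w) : v = w := by
  suffices h : ∀ u : TCot, fB g p u = 0 → theta g p u = 0 → theta1 p u = 0 → fC g p u = 0 →
      fA g p u = 0 → u = 0 by
    refine sub_eq_zero.1 (h (v - w) ?_ ?_ ?_ ?_ ?_) <;> rw [map_sub, sub_eq_zero] <;> assumption
  intro u hB h0 h1 hC hA
  have hu1 : u.1 = 0 := by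
    ext i
    have := dot_base hp (Pi.single i 1) u
    rw [h0, h1] at this
    simp [realC] at this
    exact this
  have hd : dlt g p u = compv u.2 := by
    ext j
    simp [dlt, delta, hu1]
  have hz : dlt g p u = 0 := by
    ext j
    -- Since the base part of u vanishes, the components of δζ(u) are recovered from its three
    -- contractions with the triad, all zero.
    have h2 := triad_complete (gram_posDef g p.1) hp.1 (comp_ne_zero hp) (Pi.single j (1 : ℂ))
    have h3 : dlt g p u ⬝ᵥ Pi.single j (1 : ℂ) = dlt g p u j := by simp
    rw [Pi.zero_apply, ← h3, h2, dotProduct_add, dotProduct_add, dotProduct_smul, dotProduct_smul,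
      dotProduct_smul, dotProduct_comm (dlt g p u) (conjC _), dotProduct_comm (dlt g p u) (upC _ _),
      dotProduct_comm (dlt g p u) (realC _), ← fA_apply, ← fB_apply, ← fC_apply, hA, hB, hC]
    simp
  refine Prod.ext hu1 ?_
  rw [hz] at hd
  rw [← ofComp_compv u.2, ← hd]
  ext
  simp [ofComp_apply]

/-- The tangent vector of the null cone with given values of the adapted coframe. -/
theorem exists_tangent (hp : p ∈ NullCone g) (t : ℝ) (lam c a : ℂ) :
    ∃ v : TCot, fB g p v = 0 ∧ theta g p v = t ∧ theta1 p v = lam ∧ fC g p v = c ∧ fA g p v = a := by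
  have hG := gram_posDef g p.1
  have hH : (hrm g p : ℂ) ≠ 0 := by exact_mod_cast (hrm_pos hp).ne'
  set z := comp p with hz
  set G := gram g p.1 with hGdef
  have hzz : upC G z ⬝ᵥ z = 0 := hp.1
  have hzc : conjC (upC G z) ⬝ᵥ z = hrm g p := by
    rw [← upC_conjC]
    exact (pairC_comm hG _ _).trans (pairC_conjC hG z)
  have hcz : upC G z ⬝ᵥ conjC z = hrm g p := pairC_conjC hG z
  have hcc : conjC (upC G z) ⬝ᵥ conjC z = 0 := by rw [← conj_dot, hzz, map_zero]
  have hez : realC (etaU G z) ⬝ᵥ z = 0 := etaU_dot G z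
  have hezc : realC (etaU G z) ⬝ᵥ conjC z = 0 := by
    have := congrArg conj hez
    rwa [conj_dot, conjC_realC, map_zero] at this
  have hee : realC (etaU G z) ⬝ᵥ realC (etaD G z) = (hrm g p : ℂ) ^ 2 := etaU_dot_etaD hG hp.1
  have hue : upC G z ⬝ᵥ realC (etaD G z) = 0 := by
    have : pairC G z (realC (etaD G z)) = 0 := by rw [pairC_comm hG, pairC, upC_etaD hG, hez]
    exact this
  have hce : conjC (upC G z) ⬝ᵥ realC (etaD G z) = 0 := by
    have := congrArg conj hue
    rwa [conj_dot, conjC_realC, map_zero] at this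
  -- The base component, built from the dual triad. The conjugate coefficients and the real t make
  -- it a real vector.
  set X : Fin 3 → ℂ := (lam / hrm g p) • conjC (upC G z) + (conj lam / hrm g p) • upC G z
    + (t / (hrm g p : ℂ) ^ 2) • realC (etaU G z) with hX
  have hXr : conjC X = X := by
    ext i
    simp only [hX, conjC, Pi.add_apply, Pi.smul_apply, smul_eq_mul, map_add, map_mul, map_div₀,
      Complex.conj_conj, Complex.conj_ofReal, map_pow, realC]
    ring
  let b : E3 := WithLp.toLp 2 fun i => (X i).re
  have hb : realC b = X := by
    ext i
    exact Complex.conj_eq_iff_re.1 (congrFun hXr i)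
  -- The prescribed value of δζ; dζ is then Y plus the connection term. There is no z̄-component, so
  -- the vector is tangent to the null cone.
  set Y : Fin 3 → ℂ := (a / hrm g p) • z + (c / (hrm g p : ℂ) ^ 2) • realC (etaD G z) with hY
  let v : TCot := (b, ofComp (Y + (connMat G (dGram g p.1) b).map Complex.ofReal *ᵥ z))
  have hd : dlt g p v = Y := by
    rw [dlt, delta_eq, compv_ofComp]
    exact add_sub_cancel_right _ _
  have hzup : z ⬝ᵥ upC G z = 0 := by rw [dotProduct_comm]; exact hzz
  have hzupc : z ⬝ᵥ conjC (upC G z) = hrm g p := by rw [dotProduct_comm]; exact hzc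
  have hzeta : z ⬝ᵥ realC (etaU G z) = 0 := by rw [dotProduct_comm]; exact hez
  refine ⟨v, ?_, ?_, ?_, ?_, ?_⟩
  · rw [fB_apply, hd, hY, dotProduct_add, dotProduct_smul, dotProduct_smul, hzz, hue]; simp
  · rw [theta_apply]
    change realC (etaD G z) ⬝ᵥ realC b = _
    rw [hb, hX, dotProduct_add, dotProduct_add, dotProduct_smul, dotProduct_smul, dotProduct_smul,
      dotProduct_comm _ (conjC _), hce, dotProduct_comm _ (upC _ _), hue, dotProduct_comm, hee]
    simp [hH]
  · rw [theta1_apply]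
    change z ⬝ᵥ realC b = _
    rw [hb, hX, dotProduct_add, dotProduct_add, dotProduct_smul, dotProduct_smul, dotProduct_smul,
      hzup, hzupc, hzeta]
    simp [hH]
  · rw [fC_apply, hd, hY, dotProduct_add, dotProduct_smul, dotProduct_smul, hez, hee]
    simp [hH]
  · rw [fA_apply, hd, hY, dotProduct_add, dotProduct_smul, dotProduct_smul, hzc, hce]
    simp [hH]

end Pointwise

/-! ### The kernel of the symplectic form and the canonical bundle. -/

section Canonical

open ComplexConjugate

variable {S : Type*} [TopologicalSpace S] [ChartedSpace E3 S] [IsManifold (𝓡 3) ∞ S]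
  {g : Metric3 S} {p : CCot S}

/-! ### Vertical vectors and the kernel of the restricted form -/

theorem vertical_values (hp : p ∈ NullCone g) (c : ℂ) :
    fB g p (0, c • covec p) = 0 ∧ theta g p (0, c • covec p) = 0 ∧ theta1 p (0, c • covec p) = 0 ∧
      fC g p (0, c • covec p) = 0 ∧ fA g p (0, c • covec p) = c * hrm g p := by
  have hd : dlt g p (0, c • covec p) = c • comp p := by
    ext j
    simp [dlt, delta, compv]
    exact Or.inl rfl
  have h0 : realC ((0, c • covec p) : TCot).1 = 0 := by ext i; simp [realC]
  refine ⟨?_, ?_, ?_, ?_, ?_⟩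
  · rw [fB_apply, hd, dotProduct_smul]
    have : upC (gram g p.1) (comp p) ⬝ᵥ comp p = 0 := hp.1
    rw [this, smul_zero]
  · rw [theta_apply, h0, dotProduct_zero]
  · rw [theta1_apply, h0, dotProduct_zero]
  · rw [fC_apply, hd, dotProduct_smul, etaU_dot, smul_zero]
  · rw [fA_apply, hd, dotProduct_smul, ← upC_conjC, smul_eq_mul]
    congr 1
    exact (pairC_comm (gram_posDef g p.1) _ _).trans (pairC_conjC (gram_posDef g p.1) _)

/-- On the vertical vector cζ the form `fA` equals c times the nonzero hermitian square. So `fA` is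
a coordinate on the orbit direction, and the other forms of the coframe cut that direction out. -/
theorem mem_vertical_iff (hp : p ∈ NullCone g) {v : TCot} :
    v ∈ vertical p ↔ fB g p v = 0 ∧ theta g p v = 0 ∧ theta1 p v = 0 ∧ fC g p v = 0 := by
  constructor
  · rintro ⟨c, rfl⟩
    obtain ⟨h1, h2, h3, h4, _⟩ := vertical_values hp c
    exact ⟨h1, h2, h3, h4⟩
  · rintro ⟨h1, h2, h3, h4⟩
    have hH : (hrm g p : ℂ) ≠ 0 := by exact_mod_cast (hrm_pos hp).ne'
    obtain ⟨k1, k2, k3, k4, k5⟩ := vertical_values hp (fA g p v / hrm g p)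
    refine ⟨fA g p v / hrm g p, tangent_ext hp ?_ ?_ ?_ ?_ ?_⟩
    · rw [h1, k1]
    · rw [h2, k2]
    · rw [h3, k3]
    · rw [h4, k4]
    · rw [k5, div_mul_cancel₀ _ hH]

/-- By `omega_eq` the restricted symplectic form pairs `fA` with θ̃¹ and `fC` with θ. The values of
these forms on a tangent vector are arbitrary by `exists_tangent`, so z is in the kernel only if all
four vanish on it. -/
theorem mem_kernelD_iff (hS : IsOrientedAtlas S) (hp : p ∈ NullCone g) {z : TCot × TCot} :
    z ∈ kernelD g p ↔ (fB g p z.1 = 0 ∧ fB g p z.2 = 0) ∧ evalC (theta g p) z = 0 ∧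
      evalC (theta1 p) z = 0 ∧ evalC (fC g p) z = 0 ∧ evalC (fA g p) z = 0 := by
  have hH : (hrm g p : ℂ) ≠ 0 := by exact_mod_cast (hrm_pos hp).ne'
  have key : ∀ v, fB g p z.1 = 0 → fB g p z.2 = 0 → fB g p v = 0 →
      omega z.1 v + Complex.I * omega z.2 v =
        (evalC (fA g p) z * theta1 p v - fA g p v * evalC (theta1 p) z) / hrm g p
        + (evalC (fC g p) z * theta g p v - fC g p v * evalC (theta g p) z) / (hrm g p : ℂ) ^ 2 := by
    intro v h1 h2 hv
    rw [omega_eq hp h1 hv, omega_eq hp h2 hv]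
    simp only [evalC]
    ring
  constructor
  · rintro ⟨h1, h2, h3⟩
    have h1 := (mem_tangentNull hS).1 h1
    have h2 := (mem_tangentNull hS).1 h2
    have h4 : ∀ (t : ℝ) (lam c a : ℂ), (evalC (fA g p) z * lam - a * evalC (theta1 p) z) / hrm g p
        + (evalC (fC g p) z * t - c * evalC (theta g p) z) / (hrm g p : ℂ) ^ 2 = 0 := by
      intro t lam c a
      obtain ⟨v, e1, e2, e3, e4, e5⟩ := exists_tangent hp t lam c a
      have := key v h1 h2 e1
      rw [h3 v ((mem_tangentNull hS).2 e1), e2, e3, e4, e5] at this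
      exact this.symm
    have a1 := h4 0 0 1 0
    have a2 := h4 0 0 0 1
    have a3 := h4 1 0 0 0
    have a4 := h4 0 1 0 0
    simp [hH] at a1 a2 a3 a4
    exact ⟨⟨h1, h2⟩, a1, a2, a3, a4⟩
  · rintro ⟨⟨h1, h2⟩, h3, h4, h5, h6⟩
    refine ⟨(mem_tangentNull hS).2 h1, (mem_tangentNull hS).2 h2, fun v hv => ?_⟩
    rw [key v h1 h2 ((mem_tangentNull hS).1 hv), h3, h4, h5, h6]
    ring

/-! ### Elements of the canonical bundle -/

theorem theta012_apply (g : Metric3 S) (p : CCot S) (u v w : TCot) :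
    theta012 g p ![u, v, w] = theta g p u * (theta1 p v * theta2 g p w - theta1 p w * theta2 g p v)
      - theta g p v * (theta1 p u * theta2 g p w - theta1 p w * theta2 g p u)
      + theta g p w * (theta1 p u * theta2 g p v - theta1 p v * theta2 g p u) := by
  rw [theta012, wedge_apply_three, wedge_oneForm_apply, wedge_oneForm_apply, wedge_oneForm_apply]

/-- The form `θ ∧ θ̃¹ ∧ θ̃²` as an element of the canonical bundle. -/
def canonicalElt (hS : IsOrientedAtlas S) (p : CCot S) (hp : p ∈ NullCone g) : CanonicalElement g where
  pt := p
  pt_mem := hp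
  form := theta012 g p
  vertical_contract := by
    intro c hc v _ w _
    obtain ⟨_, h2, h3, h4⟩ := (mem_vertical_iff hp).1 hc
    rw [theta012_apply, theta2_eq g p c, h2, h3, h4]
    ring
  kernel_contract := by
    intro z hz v _ w _
    obtain ⟨_, h2, h3, h4, _⟩ := (mem_kernelD_iff hS hp).1 hz
    rw [theta012_apply, theta012_apply, theta2_eq g p z.1, theta2_eq g p z.2]
    simp only [evalC] at h2 h3 h4
    linear_combination (theta1 p v * theta2 g p w - theta1 p w * theta2 g p v) * h2
      + (-theta g p v * theta2 g p w + theta g p w * theta2 g p v) * h3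
      + (theta g p v * theta1 p w - theta g p w * theta1 p v) * Complex.I * h4
  ne_zero := by
    obtain ⟨T, t1, t2, t3, t4, _⟩ := exists_tangent hp 1 0 0 0
    obtain ⟨X, x1, x2, x3, x4, _⟩ := exists_tangent hp 0 1 0 0
    obtain ⟨Y, y1, y2, y3, y4, _⟩ := exists_tangent hp 0 0 1 0
    refine ⟨![T, X, Y], fun i => (mem_tangentNull hS).2 ?_, ?_⟩
    · fin_cases i
      exacts [t1, x1, y1]
    · rw [theta012_apply, theta2_eq, theta2_eq, theta2_eq, t2, x2, y2, t3, x3, y3, t4, x4, y4]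
      simp

theorem form_cyclic (ψ : TCot [⋀^Fin 3]→L[ℝ] ℂ) (u v w : TCot) : ψ ![u, v, w] = ψ ![v, w, u] := by
  have h1 := ψ.map_swap ![u, v, w] (i := 0) (j := 1) (by decide)
  have h2 := ψ.map_swap ![v, u, w] (i := 1) (j := 2) (by decide)
  have e1 : (![u, v, w] ∘ (Equiv.swap (0 : Fin 3) 1)) = ![v, u, w] := by
    funext i; fin_cases i <;> rfl
  have e2 : (![v, u, w] ∘ (Equiv.swap (1 : Fin 3) 2)) = ![v, w, u] := by
    funext i; fin_cases i <;> rfl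
  rw [e1] at h1
  rw [e2] at h2
  have h1' : ψ ![v, u, w] = -ψ ![u, v, w] := h1
  have h2' : ψ ![v, w, u] = -ψ ![v, u, w] := h2
  rw [h2', h1', neg_neg]

theorem form_swap (ψ : TCot [⋀^Fin 3]→L[ℝ] ℂ) (u v w : TCot) : ψ ![u, v, w] = -ψ ![v, u, w] := by
  have h1 := ψ.map_swap ![v, u, w] (i := 0) (j := 1) (by decide)
  have e1 : (![v, u, w] ∘ (Equiv.swap (0 : Fin 3) 1)) = ![u, v, w] := by
    funext i; fin_cases i <;> rfl
  rw [e1] at h1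
  exact h1

theorem form_add (ψ : TCot [⋀^Fin 3]→L[ℝ] ℂ) (u u' v w : TCot) :
    ψ ![u + u', v, w] = ψ ![u, v, w] + ψ ![u', v, w] := by
  have h : ∀ a, Function.update ![0, v, w] 0 a = ![a, v, w] := fun a => by
    ext1 i; fin_cases i <;> rfl
  have := ψ.map_update_add ![0, v, w] 0 u u'
  rwa [h, h, h] at this

theorem form_smul (ψ : TCot [⋀^Fin 3]→L[ℝ] ℂ) (r : ℝ) (u v w : TCot) :
    ψ ![r • u, v, w] = r * ψ ![u, v, w] := by
  have h : ∀ a, Function.update ![0, v, w] 0 a = ![a, v, w] := fun a => by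
    ext1 i; fin_cases i <;> rfl
  have := ψ.map_update_smul ![0, v, w] 0 r u
  rwa [h, h, Complex.real_smul] at this

/-- Every element of the canonical bundle is a multiple of `θ ∧ θ̃¹ ∧ θ̃²`. -/
theorem CanonicalElement.exists_coef (hS : IsOrientedAtlas S) (k : CanonicalElement g) :
    ∃ κ : ℂ, κ ≠ 0 ∧ ∀ v : Fin 3 → TCot, (∀ i, v i ∈ tangentNull g k.pt) →
      k.form v = κ * theta012 g k.pt v := by
  have hp := k.pt_mem
  -- T, X, Y are dual to θ, θ̃¹, `fC`, and on X', Y' the latter two take the value i. So X + iX' and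
  -- Y + iY' lie in the kernel D, and contraction with them makes the form complex linear in these
  -- directions.
  obtain ⟨T, t1, t2, t3, t4, t5⟩ := exists_tangent hp 1 0 0 0
  obtain ⟨X, x1, x2, x3, x4, x5⟩ := exists_tangent hp 0 1 0 0
  obtain ⟨X', x1', x2', x3', x4', x5'⟩ := exists_tangent hp 0 Complex.I 0 0
  obtain ⟨Y, y1, y2, y3, y4, y5⟩ := exists_tangent hp 0 0 1 0
  obtain ⟨Y', y1', y2', y3', y4', y5'⟩ := exists_tangent hp 0 0 Complex.I 0
  simp only [Complex.ofReal_one, Complex.ofReal_zero] at t2 x2 x2' y2 y2'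
  have hX : ∀ v w, fB g k.pt v = 0 → fB g k.pt w = 0 → k.form ![X', v, w] = Complex.I * k.form ![X, v, w] := by
    intro v w hv hw
    have := k.kernel_contract (X, X') ((mem_kernelD_iff hS hp).2 ⟨⟨x1, x1'⟩, by
      simp [evalC, x2, x2'], by simp [evalC, x3, x3'], by simp [evalC, x4, x4'],
      by simp [evalC, x5, x5']⟩) v ((mem_tangentNull hS).2 hv) w ((mem_tangentNull hS).2 hw)
    simp only at this
    linear_combination -Complex.I * this + k.form ![X', v, w] * Complex.I_mul_I
  have hY : ∀ v w, fB g k.pt v = 0 → fB g k.pt w = 0 → k.form ![Y', v, w] = Complex.I * k.form ![Y, v, w] := by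
    intro v w hv hw
    have := k.kernel_contract (Y, Y') ((mem_kernelD_iff hS hp).2 ⟨⟨y1, y1'⟩, by
      simp [evalC, y2, y2'], by simp [evalC, y3, y3'], by simp [evalC, y4, y4'],
      by simp [evalC, y5, y5']⟩) v ((mem_tangentNull hS).2 hv) w ((mem_tangentNull hS).2 hw)
    simp only at this
    linear_combination -Complex.I * this + k.form ![Y', v, w] * Complex.I_mul_I
  -- Modulo a vertical vector, which does not contribute, u is a real combination of T, X, X', Y,
  -- Y'.
  have hexp : ∀ u v w, fB g k.pt u = 0 → fB g k.pt v = 0 → fB g k.pt w = 0 →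
      k.form ![u, v, w] = theta g k.pt u * k.form ![T, v, w] + theta1 k.pt u * k.form ![X, v, w]
        + fC g k.pt u * k.form ![Y, v, w] := by
    intro u v w hu hv hw
    obtain ⟨A, hA⟩ : ∃ A : TCot, A = u - ((theta g k.pt u).re • T + ((theta1 k.pt u).re • X
      + (theta1 k.pt u).im • X') + ((fC g k.pt u).re • Y + (fC g k.pt u).im • Y')) := ⟨_, rfl⟩
    have hAv : A ∈ vertical k.pt := by
      refine (mem_vertical_iff hp).2 ⟨?_, ?_, ?_, ?_⟩ <;>
        simp only [hA, map_sub, map_add, map_smul, hu, t1, x1, x1', y1, y1', t2, x2, x2', y2, y2', t3, x3,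
          x3', y3, y3', t4, x4, x4', y4, y4', Complex.real_smul, mul_one, mul_zero, add_zero, zero_add,
          theta_re, sub_self, Complex.re_add_im]
    have hu' : u = A + ((theta g k.pt u).re • T + ((theta1 k.pt u).re • X
      + (theta1 k.pt u).im • X') + ((fC g k.pt u).re • Y + (fC g k.pt u).im • Y')) := by
      rw [hA, sub_add_cancel]
    have h0 := k.vertical_contract A hAv v ((mem_tangentNull hS).2 hv) w ((mem_tangentNull hS).2 hw)
    conv_lhs => rw [hu']
    simp only [form_add, form_smul, h0, hX v w hv hw, hY v w hv hw, theta_re]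
    linear_combination k.form ![X, v, w] * Complex.re_add_im (theta1 k.pt u)
      + k.form ![Y, v, w] * Complex.re_add_im (fC g k.pt u)
  have hself : ∀ u w, k.form ![u, u, w] = 0 := fun u w => self_eq_neg.1 (form_swap k.form u u w)
  have hself' : ∀ u w, k.form ![u, w, u] = 0 := fun u w => by
    rw [form_cyclic, form_cyclic, hself]
  have hself'' : ∀ u w, k.form ![w, u, u] = 0 := fun u w => by rw [form_cyclic, hself]
  have s1 : k.form ![X, T, Y] = -k.form ![T, X, Y] := form_swap _ _ _ _
  have s2 : k.form ![X, Y, T] = k.form ![T, X, Y] := (form_cyclic _ _ _ _).symm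
  have s3 : k.form ![Y, T, X] = k.form ![T, X, Y] := form_cyclic _ _ _ _
  have s4 : k.form ![T, Y, X] = -k.form ![T, X, Y] := by rw [form_swap, s3]
  have s5 : k.form ![Y, X, T] = -k.form ![T, X, Y] := by rw [form_swap, s2]
  -- The factor −i compensates θ̃² = i η^j δζ_j.
  have hfull : ∀ u v w, fB g k.pt u = 0 → fB g k.pt v = 0 → fB g k.pt w = 0 →
      k.form ![u, v, w] = (-Complex.I * k.form ![T, X, Y]) * theta012 g k.pt ![u, v, w] := by
    intro u v w hu hv hw
    have e3 : ∀ a b, fB g k.pt a = 0 → fB g k.pt b = 0 → k.form ![a, b, w] =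
        theta g k.pt w * k.form ![T, a, b] + theta1 k.pt w * k.form ![X, a, b]
          + fC g k.pt w * k.form ![Y, a, b] := fun a b ha hb => by
      rw [form_cyclic, form_cyclic, hexp w a b hw ha hb]
    have e2 : ∀ a, fB g k.pt a = 0 → k.form ![a, v, w] =
        theta g k.pt v * k.form ![T, w, a] + theta1 k.pt v * k.form ![X, w, a]
          + fC g k.pt v * k.form ![Y, w, a] := fun a ha => by
      rw [form_cyclic, hexp v w a hv hw ha]
    rw [hexp u v w hu hv hw, e2 T t1, e2 X x1, e2 Y y1]
    have e4 : ∀ a b, fB g k.pt a = 0 → fB g k.pt b = 0 → k.form ![a, w, b] =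
        theta g k.pt w * k.form ![T, b, a] + theta1 k.pt w * k.form ![X, b, a]
          + fC g k.pt w * k.form ![Y, b, a] := fun a b ha hb => by
      rw [form_cyclic, hexp w b a hw hb ha]
    rw [e4 T T t1 t1, e4 T X t1 x1, e4 T Y t1 y1, e4 X T x1 t1, e4 X X x1 x1, e4 X Y x1 y1,
      e4 Y T y1 t1, e4 Y X y1 x1, e4 Y Y y1 y1]
    simp only [hself, hself', hself'', s1, s2, s3, s4, s5, theta012_apply, theta2_eq]
    linear_combination (k.form ![T, X, Y] * (theta g k.pt u * (theta1 k.pt v * fC g k.pt w - theta1 k.pt w * fC g k.pt v)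
      - theta g k.pt v * (theta1 k.pt u * fC g k.pt w - theta1 k.pt w * fC g k.pt u)
      + theta g k.pt w * (theta1 k.pt u * fC g k.pt v - theta1 k.pt v * fC g k.pt u))) * Complex.I_mul_I
  have hv3 : ∀ v : Fin 3 → TCot, v = ![v 0, v 1, v 2] := fun v => by
    ext1 i; fin_cases i <;> rfl
  refine ⟨-Complex.I * k.form ![T, X, Y], fun h0 => ?_, fun v hv => ?_⟩
  · obtain ⟨v, hv, hne⟩ := k.ne_zero
    apply hne
    rw [hv3 v, hfull _ _ _ ((mem_tangentNull hS).1 (hv 0)) ((mem_tangentNull hS).1 (hv 1))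
      ((mem_tangentNull hS).1 (hv 2)), h0, zero_mul]
  · rw [hv3 v]
    exact hfull _ _ _ ((mem_tangentNull hS).1 (hv 0)) ((mem_tangentNull hS).1 (hv 1))
      ((mem_tangentNull hS).1 (hv 2))

end Canonical

/-! ### Homogeneity, and the fibres of the canonical map. -/

section Scale

open ComplexConjugate

variable {S : Type*} [TopologicalSpace S] [ChartedSpace E3 S]

/-! ### Homogeneity -/

theorem comp_scale (c : ℂ) (p : CCot S) : comp (scale c p) = c • comp p := rfl

theorem theta1_scale (c : ℂ) (p : CCot S) {v w : TCot} (h : v.1 = w.1) :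
    theta1 (scale c p) v = c * theta1 p w := by
  rw [theta1_apply, theta1_apply, comp_scale, smul_dotProduct, h, smul_eq_mul]

variable [IsManifold (𝓡 3) ∞ S] {g : Metric3 S} {p : CCot S}

theorem upC_smul (G : Matrix (Fin 3) (Fin 3) ℝ) (c : ℂ) (z : Fin 3 → ℂ) :
    upC G (c • z) = c • upC G z := Matrix.mulVec_smul _ _ _

theorem conjC_smul (c : ℂ) (z : Fin 3 → ℂ) : conjC (c • z) = conj c • conjC z := by
  ext i; simp [conjC]

/-- Multiplication by c acts on (Re z, Im z) by a real 2×2 matrix of determinant |c|², and the cross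
product is alternating. -/
theorem realC_etaU_smul (G : Matrix (Fin 3) (Fin 3) ℝ) (c : ℂ) (z : Fin 3 → ℂ) :
    etaU G (c • z) = (Complex.normSq c) • etaU G z := by
  rw [etaU, etaU, smul_comm (Complex.normSq c)]
  congr 1
  ext i
  fin_cases i <;> simp [crossProduct, Complex.normSq_apply] <;> ring

theorem nullFn_scale (g : Metric3 S) (c : ℂ) (p : CCot S) :
    nullFn g (scale c p) = c ^ 2 * nullFn g p := by
  rw [nullFn_eq, nullFn_eq, comp_scale, pairC, pairC, upC_smul, smul_dotProduct, dotProduct_smul,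
    smul_eq_mul, smul_eq_mul]
  change c * (c * (upC (gram g p.1) (comp p) ⬝ᵥ comp p)) = _
  ring

theorem hermFn_scale (g : Metric3 S) (c : ℂ) (p : CCot S) :
    hermFn g (scale c p) = Complex.normSq c * hermFn g p := by
  rw [hermFn_eq, hermFn_eq, comp_scale, conjC_smul, pairC, pairC, upC_smul, smul_dotProduct,
    dotProduct_smul, smul_eq_mul, smul_eq_mul, Complex.normSq_eq_conj_mul_self]
  change c * (conj c * (upC (gram g p.1) (comp p) ⬝ᵥ conjC (comp p))) = _
  ring

theorem scale_mem_nullCone (hp : p ∈ NullCone g) {c : ℂ} (hc : c ≠ 0) : scale c p ∈ NullCone g := by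
  refine ⟨by rw [nullFn_scale, hp.1, mul_zero], ?_⟩
  obtain ⟨i, hi⟩ := hp.2
  exact ⟨i, mul_ne_zero hc hi⟩

theorem theta_scale (g : Metric3 S) (c : ℂ) (p : CCot S) {v w : TCot} (h : v.1 = w.1) :
    theta g (scale c p) v = Complex.normSq c * theta g p w := by
  rw [theta_apply, theta_apply, etaDown_eq, etaDown_eq, comp_scale, etaD, etaD, realC_etaU_smul,
    Matrix.mulVec_smul, h]
  simp only [realC, dotProduct, Pi.smul_apply, smul_eq_mul, Complex.ofReal_mul, Finset.mul_sum]
  exact Finset.sum_congr rfl fun i _ => mul_assoc _ _ _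

theorem dlt_scale (g : Metric3 S) (c : ℂ) (p : CCot S) (v : TCot) :
    dlt g (scale c p) (dScale c v) = c • dlt g p v := by
  have : compv (dScale c v).2 = c • compv v.2 := rfl
  rw [dlt, dlt, delta_eq, delta_eq, comp_scale, this, Matrix.mulVec_smul, smul_sub]
  rfl

theorem fB_scale (g : Metric3 S) (c : ℂ) (p : CCot S) (v : TCot) :
    fB g (scale c p) (dScale c v) = c ^ 2 * fB g p v := by
  rw [fB_apply, fB_apply, dlt_scale, comp_scale, upC_smul, smul_dotProduct, dotProduct_smul]
  change c * (c * (upC (gram g p.1) (comp p) ⬝ᵥ dlt g p v)) = _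
  ring

theorem fC_scale (g : Metric3 S) (c : ℂ) (p : CCot S) (v : TCot) :
    fC g (scale c p) (dScale c v) = Complex.normSq c * c * fC g p v := by
  have h : realC (etaU (gram g (scale c p).1) (c • comp p)) =
      (Complex.normSq c : ℂ) • realC (etaU (gram g p.1) (comp p)) := by
    rw [realC_etaU_smul]
    ext i
    simp only [realC, Pi.smul_apply, smul_eq_mul, Complex.ofReal_mul]
    rfl
  rw [fC_apply, fC_apply, dlt_scale, comp_scale, h, smul_dotProduct, dotProduct_smul, smul_eq_mul,
    smul_eq_mul, mul_assoc]

theorem vec3_eta {α : Type*} (v : Fin 3 → α) : v = ![v 0, v 1, v 2] := by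
  ext1 i; fin_cases i <;> rfl

/-- The three factors have weights |c|², c and |c|²c. The phase is thus that of c², the source of
the two sheets. -/
theorem theta012_scale (g : Metric3 S) (c : ℂ) (p : CCot S) (v : Fin 3 → TCot) :
    theta012 g (scale c p) (fun i => dScale c (v i)) =
      (Complex.normSq c : ℂ) ^ 2 * c ^ 2 * theta012 g p v := by
  rw [vec3_eta (fun i => dScale c (v i)), vec3_eta v, theta012_apply, theta012_apply]
  simp only [theta2_eq, fC_scale]
  have h0 : ∀ u, theta g (scale c p) (dScale c u) = Complex.normSq c * theta g p u :=
    fun u => theta_scale g c p rfl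
  have h1 : ∀ u, theta1 (scale c p) (dScale c u) = c * theta1 p u := fun u => theta1_scale c p rfl
  simp only [h0, h1, Matrix.cons_val]
  ring

theorem dScale_mem (hS : IsOrientedAtlas S) {c : ℂ} {v : TCot} (hv : v ∈ tangentNull g p) :
    dScale c v ∈ tangentNull g (scale c p) := by
  rw [mem_tangentNull hS] at hv ⊢
  rw [fB_scale, hv, mul_zero]

/-! ### Coefficients of elements of the canonical bundle -/

namespace CanonicalElement

/-- The coefficient of an element of the canonical bundle with respect to `θ ∧ θ̃¹ ∧ θ̃²`. -/
def coef (hS : IsOrientedAtlas S) (k : CanonicalElement g) : ℂ := (k.exists_coef hS).choose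

theorem coef_ne_zero (hS : IsOrientedAtlas S) (k : CanonicalElement g) : k.coef hS ≠ 0 :=
  (k.exists_coef hS).choose_spec.1

theorem form_eq (hS : IsOrientedAtlas S) (k : CanonicalElement g) (v : Fin 3 → TCot)
    (hv : ∀ i, v i ∈ tangentNull g k.pt) : k.form v = k.coef hS * theta012 g k.pt v :=
  (k.exists_coef hS).choose_spec.2 v hv

theorem coef_unique (hS : IsOrientedAtlas S) (k : CanonicalElement g) {κ : ℂ}
    (h : ∀ v : Fin 3 → TCot, (∀ i, v i ∈ tangentNull g k.pt) → k.form v = κ * theta012 g k.pt v) :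
    k.coef hS = κ := by
  obtain ⟨v, hv, hne⟩ := (canonicalElt hS k.pt k.pt_mem).ne_zero
  have h1 := h v hv
  rw [form_eq hS k v hv] at h1
  exact mul_right_cancel₀ hne h1

/-- The positive part |c|⁴ of the weight is absorbed into r, so only the coefficients and c² remain.
All questions about points of the Fefferman space are reduced to this condition. -/
theorem rel_iff (hS : IsOrientedAtlas S) (k k' : CanonicalElement g) :
    Rel k k' ↔ ∃ c : ℂ, c ≠ 0 ∧ k'.pt = scale c k.pt ∧
      ∃ r : ℝ, 0 < r ∧ k'.coef hS * c ^ 2 = r * k.coef hS := by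
  constructor
  · rintro ⟨c, hc, hpt, r, hr, h⟩
    have hn : 0 < Complex.normSq c := Complex.normSq_pos.2 hc
    refine ⟨c, hc, hpt, r / Complex.normSq c ^ 2, by positivity, ?_⟩
    obtain ⟨v, hv, hne⟩ := (canonicalElt hS k.pt k.pt_mem).ne_zero
    change theta012 g k.pt v ≠ 0 at hne
    have h1 := h v hv
    rw [form_eq hS k v hv, form_eq hS k' _ (fun i => by rw [hpt]; exact dScale_mem hS (hv i)), hpt,
      theta012_scale] at h1
    have hn' : (Complex.normSq c : ℂ) ≠ 0 := by exact_mod_cast hn.ne'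
    push_cast
    rw [div_mul_eq_mul_div, eq_div_iff (pow_ne_zero 2 hn')]
    apply mul_right_cancel₀ hne
    linear_combination h1
  · rintro ⟨c, hc, hpt, r, hr, h⟩
    have hn : 0 < Complex.normSq c := Complex.normSq_pos.2 hc
    refine ⟨c, hc, hpt, r * Complex.normSq c ^ 2, by positivity, fun v hv => ?_⟩
    rw [form_eq hS k v hv, form_eq hS k' _ (fun i => by rw [hpt]; exact dScale_mem hS (hv i)), hpt,
      theta012_scale]
    push_cast
    linear_combination (Complex.normSq c : ℂ) ^ 2 * theta012 g k.pt v * h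

theorem rel_equivalence (hS : IsOrientedAtlas S) :
    Equivalence (Rel : CanonicalElement g → CanonicalElement g → Prop) where
  refl k := (rel_iff hS k k).2 ⟨1, one_ne_zero, (scale_one _).symm, 1, one_pos, by simp⟩
  symm {k k'} h := by
    obtain ⟨c, hc, hpt, r, hr, h⟩ := (rel_iff hS k k').1 h
    refine (rel_iff hS k' k).2 ⟨c⁻¹, inv_ne_zero hc, ?_, r⁻¹, by positivity, ?_⟩
    · rw [hpt, ← scale_mul, inv_mul_cancel₀ hc, scale_one]
    · have hr' : (r : ℂ) ≠ 0 := by exact_mod_cast hr.ne'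
      push_cast
      field_simp
      linear_combination -h
  trans {k k' k''} h h' := by
    obtain ⟨c, hc, hpt, r, hr, h⟩ := (rel_iff hS k k').1 h
    obtain ⟨c', hc', hpt', r', hr', h'⟩ := (rel_iff hS k' k'').1 h'
    refine (rel_iff hS k k'').2 ⟨c' * c, mul_ne_zero hc' hc, ?_, r' * r, by positivity, ?_⟩
    · rw [hpt', hpt, scale_mul]
    · push_cast
      linear_combination c ^ 2 * h' + (r' : ℂ) * h

theorem mk_eq_iff (hS : IsOrientedAtlas S) (k k' : CanonicalElement g) :
    (Quot.mk Rel k : FeffermanSpace g) = Quot.mk Rel k' ↔ Rel k k' :=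
  ⟨fun h => ((rel_equivalence hS).eqvGen_iff).1 (Quot.eqvGen_exact h), fun h => Quot.sound h⟩

end CanonicalElement

/-! ### The canonical map on points -/

theorem nullCone_of_cHat (u : CHat g) : (u : CCot S) ∈ NullCone g := by
  refine ⟨u.2.1, ?_⟩
  by_contra! h
  have h1 : hermFn g (u : CCot S) = 1 := u.2.2
  simp [hermFn, h] at h1

theorem hrm_cHat (u : CHat g) : hrm g (u : CCot S) = 1 := by
  have h1 : hermFn g (u : CCot S) = 1 := u.2.2
  rw [hermFn_eq_hrm] at h1
  exact_mod_cast h1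

/-- The map `u ↦ [(θ ∧ θ̃¹ ∧ θ̃²)_u]`. -/
def canonicalMap (hS : IsOrientedAtlas S) (g : Metric3 S) (u : CHat g) : FeffermanSpace g :=
  Quot.mk _ (canonicalElt hS (u : CCot S) (nullCone_of_cHat u))

theorem isCanonicalMap_canonicalMap (hS : IsOrientedAtlas S) (g : Metric3 S) :
    IsCanonicalMap g (canonicalMap hS g) :=
  fun u => ⟨canonicalElt hS (u : CCot S) (nullCone_of_cHat u), rfl, rfl, rfl⟩

theorem coef_canonicalElt (hS : IsOrientedAtlas S) (hp : p ∈ NullCone g) :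
    (canonicalElt hS p hp).coef hS = 1 :=
  CanonicalElement.coef_unique hS _ fun _ _ => (one_mul _).symm

theorem canonicalMap_eq_mk_iff (hS : IsOrientedAtlas S) (u : CHat g) (k : CanonicalElement g) :
    canonicalMap hS g u = Quot.mk _ k ↔
      ∃ c : ℂ, c ≠ 0 ∧ k.pt = scale c (u : CCot S) ∧ ∃ r : ℝ, 0 < r ∧ k.coef hS * c ^ 2 = r := by
  refine (CanonicalElement.mk_eq_iff hS _ k).trans ((CanonicalElement.rel_iff hS _ k).trans ?_)
  rw [coef_canonicalElt]
  simp only [mul_one]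
  rfl

theorem scale_mem_cHat (u : CHat g) {c : ℂ} (hc : Complex.normSq c = 1) :
    scale c (u : CCot S) ∈ CHat g :=
  ⟨by rw [nullFn_scale, u.2.1, mul_zero], by rw [hermFn_scale, u.2.2, hc]; simp⟩

/-- The deck transformation `u ↦ -u`. -/
def negHat (u : CHat g) : CHat g := ⟨scale (-1) (u : CCot S), scale_mem_cHat u (by simp)⟩

theorem negHat_negHat (u : CHat g) : negHat (negHat u) = u := by
  apply Subtype.ext
  change scale (-1) (scale (-1) (u : CCot S)) = u
  rw [← scale_mul]
  norm_num [scale_one]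

theorem negHat_ne (u : CHat g) : negHat u ≠ u := by
  intro h
  obtain ⟨i, hi⟩ := (nullCone_of_cHat u).2
  have h1 : comp (negHat u : CCot S) i = comp (u : CCot S) i := by rw [h]
  have h2 : comp (negHat u : CCot S) i = -1 * comp (u : CCot S) i := rfl
  apply hi
  linear_combination (h2 - h1) / 2

/-- Both coefficients are 1 and |c| = 1, so c² is positive of modulus one; hence c = ±1. -/
theorem canonicalMap_eq_iff (hS : IsOrientedAtlas S) (u u' : CHat g) :
    canonicalMap hS g u = canonicalMap hS g u' ↔ u' = u ∨ u' = negHat u := by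
  refine (canonicalMap_eq_mk_iff hS u _).trans ?_
  rw [coef_canonicalElt]
  constructor
  · rintro ⟨c, hc, hpt, r, hr, h⟩
    have hpt : (u' : CCot S) = scale c (u : CCot S) := hpt
    have hn : Complex.normSq c = 1 := by
      have h1 : hermFn g (u' : CCot S) = 1 := u'.2.2
      rw [hpt, hermFn_scale, u.2.2, mul_one] at h1
      exact_mod_cast h1
    have hr1 : r = 1 := by
      have : Complex.normSq (c ^ 2) = Complex.normSq r := by rw [← h, one_mul]
      rw [map_pow, hn, Complex.normSq_ofReal] at this
      nlinarith
    have : (c - 1) * (c + 1) = 0 := by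
      rw [hr1] at h
      push_cast at h
      linear_combination h
    rcases mul_eq_zero.1 this with h | h
    · left
      apply Subtype.ext
      rw [hpt, sub_eq_zero.1 h, scale_one]
    · right
      apply Subtype.ext
      rw [hpt, eq_neg_of_add_eq_zero_left h]
      rfl
  · rintro (rfl | rfl)
    · exact ⟨1, one_ne_zero, (scale_one _).symm, 1, one_pos, by simp⟩
    · exact ⟨-1, by simp, rfl, 1, one_pos, by simp⟩

/-- With a square root d of the coefficient κ, the covector dζ rescaled by a positive m to hermitian
square one is a preimage: its scale factor back to ζ is c = (md)⁻¹, and κc² = m⁻² > 0. -/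
theorem canonicalMap_surjective (hS : IsOrientedAtlas S) (g : Metric3 S) :
    Function.Surjective (canonicalMap hS g) := by
  intro b
  induction b using Quot.ind with
  | mk k =>
    have hH := hrm_pos k.pt_mem
    obtain ⟨d, hd⟩ : ∃ d : ℂ, k.coef hS = d ^ 2 := by
      obtain ⟨d, hd⟩ := IsAlgClosed.exists_pow_nat_eq (k.coef hS) (n := 2) two_pos
      exact ⟨d, hd.symm⟩
    have hd0 : d ≠ 0 := fun h => k.coef_ne_zero hS (by rw [hd, h]; simp)
    have hn : 0 < Complex.normSq d := Complex.normSq_pos.2 hd0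
    obtain ⟨m, hm⟩ : ∃ m : ℝ, m = (Real.sqrt (Complex.normSq d * hrm g k.pt))⁻¹ := ⟨_, rfl⟩
    have hs : 0 < Real.sqrt (Complex.normSq d * hrm g k.pt) := Real.sqrt_pos.2 (by positivity)
    have hm0 : 0 < m := by rw [hm]; positivity
    have hm2 : m * m * (Complex.normSq d * hrm g k.pt) = 1 := by
      rw [hm, ← mul_inv, Real.mul_self_sqrt (by positivity)]
      exact inv_mul_cancel₀ (by positivity)
    have hmd : (m : ℂ) * d ≠ 0 := mul_ne_zero (by exact_mod_cast hm0.ne') hd0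
    refine ⟨⟨scale (m * d) k.pt, by rw [nullFn_scale, k.pt_mem.1, mul_zero], ?_⟩, ?_⟩
    · rw [hermFn_scale, hermFn_eq_hrm, map_mul, Complex.normSq_ofReal, ← Complex.ofReal_mul, mul_assoc,
        hm2, Complex.ofReal_one]
    · refine (canonicalMap_eq_mk_iff hS _ k).2 ⟨((m : ℂ) * d)⁻¹, inv_ne_zero hmd, ?_, (m ^ 2)⁻¹,
        by positivity, ?_⟩
      · rw [← scale_mul, inv_mul_cancel₀ hmd, scale_one]
      · rw [hd]
        push_cast
        field_simp

theorem canonicalMap_preimage (hS : IsOrientedAtlas S) (u : CHat g) :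
    canonicalMap hS g ⁻¹' {canonicalMap hS g u} = {u, negHat u} := by
  ext u'
  rw [Set.mem_preimage, Set.mem_singleton_iff, eq_comm, canonicalMap_eq_iff hS u u']
  rfl

theorem card_fibre (hS : IsOrientedAtlas S) (b : FeffermanSpace g) :
    Nat.card (canonicalMap hS g ⁻¹' {b}) = 2 := by
  obtain ⟨u, rfl⟩ := canonicalMap_surjective hS g b
  rw [canonicalMap_preimage, Nat.card_coe_set_eq, Set.ncard_pair (negHat_ne u).symm]

end Scale

/-! ### Pull-backs of the coframe by maps into the complexified cotangent bundle. -/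

section Pullback

open ComplexConjugate

variable {S : Type*} [TopologicalSpace S] [ChartedSpace E3 S] {x₀ : S}

theorem crd_mem_target {p : CCot S} (hx : p.1 ∈ (chartAt E3 x₀).source) :
    (crd x₀ p).1 ∈ (chartAt E3 x₀).target := by
  have := (chartAt E3 x₀).map_source hx
  simpa [crd] using this

theorem crd_scale (x₀ : S) (c : ℂ) (p : CCot S) : crd x₀ (scale c p) = ((crd x₀ p).1, c • (crd x₀ p).2) :=
  rfl

variable [IsManifold (𝓡 3) ∞ S]
  {E : Type*} [NormedAddCommGroup E] [NormedSpace ℝ E] {g : Metric3 S} {u w : E → CCot S} {z : E}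

/-! ### Pull back of forms by maps to `ℂT*S` -/

/-- The pull back of a one-form on `ℂT*S` by a map. -/
def pullForm (Ω : CCot S → TCot →L[ℝ] ℂ) (u : E → CCot S) (z : E) : E →L[ℝ] ℂ :=
  (Ω (u z)).comp (mapDeriv u z)

theorem pullForm_apply (Ω : CCot S → TCot →L[ℝ] ℂ) (u : E → CCot S) (z v : E) :
    pullForm Ω u z v = Ω (u z) (mapDeriv u z v) := rfl

theorem eventually_mem_source (hu : ContMDiffAt 𝓘(ℝ, E) ICot ∞ u z)
    (hx : (u z).1 ∈ (chartAt E3 x₀).source) : ∀ᶠ z' in 𝓝 z, (u z').1 ∈ (chartAt E3 x₀).source := by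
  have h1 : ContinuousAt (fun z => (u z).1) z :=
    (FiberBundle.continuous_proj (E3 →L[ℝ] ℂ)
      (fun x : S => TangentSpace (𝓡 3) x →L[ℝ] Bundle.Trivial S ℂ x)).continuousAt.comp hu.continuousAt
  exact h1.eventually ((chartAt E3 x₀).open_source.mem_nhds hx)

theorem fderiv_crd_fst (hu : ContMDiffAt 𝓘(ℝ, E) ICot ∞ u z) (hx : (u z).1 ∈ (chartAt E3 x₀).source)
    (v : E) : (fderiv ℝ (fun z => crd x₀ (u z)) z v).1 = chartD x₀ (u z).1 (mapDeriv u z v).1 := by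
  rw [fderiv_fst_apply ((contDiffAt_crd hx hu).differentiableAt (by simp))]
  exact fderiv_base hx hu v

theorem pbForm_cTheta1 (hu : ContMDiffAt 𝓘(ℝ, E) ICot ∞ u z) (hx : (u z).1 ∈ (chartAt E3 x₀).source) :
    pbForm cTheta1 (fun z => crd x₀ (u z)) z = pullForm theta1 u z := by
  refine ContinuousLinearMap.ext fun v => ?_
  rw [pbForm_apply, pullForm_apply, cTheta1_apply, fderiv_crd_fst hu hx, theta1_crd hx, covec_apply]

theorem pbForm_cTheta (hS : IsOrientedAtlas S) (hu : ContMDiffAt 𝓘(ℝ, E) ICot ∞ u z)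
    (hx : (u z).1 ∈ (chartAt E3 x₀).source) :
    pbForm (cTheta g x₀) (fun z => crd x₀ (u z)) z = pullForm (theta g) u z := by
  refine ContinuousLinearMap.ext fun v => ?_
  rw [pbForm_apply, pullForm_apply, cTheta_apply, fderiv_crd_fst hu hx, theta_crd hS g hx]

theorem pbForm_cTheta2_self (hu : ContMDiffAt 𝓘(ℝ, E) ICot ∞ u z) :
    pbForm (cTheta2 g (u z).1) (fun z' => crd (u z).1 (u z')) z = pullForm (theta2 g) u z := by
  rw [pbForm, pullForm, (hasFDerivAt_crd hu).fderiv, cTheta2_self]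

theorem pbForm_cTheta3_self (hu : ContMDiffAt 𝓘(ℝ, E) ICot ∞ u z) :
    pbForm (cTheta3 g (u z).1) (fun z' => crd (u z).1 (u z')) z = pullForm (theta3 g) u z := by
  rw [pbForm, pullForm, (hasFDerivAt_crd hu).fderiv, cTheta3_self]

theorem isUnitNull_crd (hS : IsOrientedAtlas S)
    (hu : ∀ᶠ z' in 𝓝 z, ContMDiffAt 𝓘(ℝ, E) ICot ∞ u z') (hx : (u z).1 ∈ (chartAt E3 x₀).source)
    (hn : ∀ᶠ z' in 𝓝 z, u z' ∈ CHat g) : IsUnitNull g x₀ (fun z => crd x₀ (u z)) z := by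
  refine ⟨crd_mem_target hx, ?_, ?_, ?_⟩
  · filter_upwards [hu, eventually_mem_source hu.self_of_nhds hx] with z' h1 h2
    exact contDiffAt_crd h2 h1
  · filter_upwards [hn, eventually_mem_source hu.self_of_nhds hx] with z' h1 h2
    rw [← nullFn_crd hS g h2]
    exact h1.1
  · filter_upwards [hn, eventually_mem_source hu.self_of_nhds hx] with z' h1 h2
    rw [← hermFn_crd hS g h2]
    exact h1.2

theorem pullForm_theta1_eventuallyEq (hu : ∀ᶠ z' in 𝓝 z, ContMDiffAt 𝓘(ℝ, E) ICot ∞ u z')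
    (hx : (u z).1 ∈ (chartAt E3 x₀).source) :
    pullForm theta1 u =ᶠ[𝓝 z] pbForm cTheta1 (fun z => crd x₀ (u z)) := by
  filter_upwards [hu, eventually_mem_source hu.self_of_nhds hx] with z' h1 h2
  exact (pbForm_cTheta1 h1 h2).symm

theorem pullForm_theta_eventuallyEq (hS : IsOrientedAtlas S)
    (hu : ∀ᶠ z' in 𝓝 z, ContMDiffAt 𝓘(ℝ, E) ICot ∞ u z') (hx : (u z).1 ∈ (chartAt E3 x₀).source) :
    pullForm (theta g) u =ᶠ[𝓝 z] pbForm (cTheta g x₀) (fun z => crd x₀ (u z)) := by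
  filter_upwards [hu, eventually_mem_source hu.self_of_nhds hx] with z' h1 h2
  exact (pbForm_cTheta hS h1 h2).symm

/-- Modulo θ̃¹, dθ̃¹ is −iθ̃² ∧ θ. So the triple product is determined by the tautological form θ̃¹
alone, whose coordinate expression involves no connection. -/
theorem wedge_theta012_eq (hS : IsOrientedAtlas S) {c : E → TCot} (h : IsUnitNull g x₀ c z) :
    wedge (pbForm (cTheta g x₀) c z) (wedge (pbForm cTheta1 c z) (oneForm (pbForm (cTheta2 g x₀) c z))) =
      Complex.I • wedge (pbForm cTheta1 c z) (dOne (pbForm cTheta1 c) z) := by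
  rw [dOne_cTheta1 h hS]
  ext v
  rw [vec3_eta v]
  simp only [wedge_apply_three, wedge_oneForm_apply, ContinuousAlternatingMap.smul_apply,
    ContinuousAlternatingMap.sub_apply, smul_eq_mul]
  linear_combination (exp := 1) (pbForm cTheta1 c z (v 0) * (pbForm (cTheta2 g x₀) c z (v 1) * pbForm (cTheta g x₀) c z (v 2)
      - pbForm (cTheta2 g x₀) c z (v 2) * pbForm (cTheta g x₀) c z (v 1))
    - pbForm cTheta1 c z (v 1) * (pbForm (cTheta2 g x₀) c z (v 0) * pbForm (cTheta g x₀) c z (v 2)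
      - pbForm (cTheta2 g x₀) c z (v 2) * pbForm (cTheta g x₀) c z (v 0))
    + pbForm cTheta1 c z (v 2) * (pbForm (cTheta2 g x₀) c z (v 0) * pbForm (cTheta g x₀) c z (v 1)
      - pbForm (cTheta2 g x₀) c z (v 1) * pbForm (cTheta g x₀) c z (v 0))) * Complex.I_mul_I

/-- The pull back of `θ ∧ θ̃¹ ∧ θ̃²` can be computed in any chart. -/
theorem pull_theta012 (hS : IsOrientedAtlas S)
    (hu : ∀ᶠ z' in 𝓝 z, ContMDiffAt 𝓘(ℝ, E) ICot ∞ u z') (hx : (u z).1 ∈ (chartAt E3 x₀).source)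
    (hn : ∀ᶠ z' in 𝓝 z, u z' ∈ CHat g) (v : Fin 3 → E) :
    wedge (pbForm (cTheta g x₀) (fun z => crd x₀ (u z)) z)
      (wedge (pbForm cTheta1 (fun z => crd x₀ (u z)) z)
        (oneForm (pbForm (cTheta2 g x₀) (fun z => crd x₀ (u z)) z))) v =
      theta012 g (u z) (fun i => mapDeriv u z (v i)) := by
  have hx' := mem_chart_source E3 (u z).1
  -- Both sides equal i θ̃¹ ∧ dθ̃¹, computed in the chart at x₀ and in the preferred chart at u z;
  -- the pull-backs of θ̃¹ agree near z.
  have key : wedge (pbForm (cTheta g x₀) (fun z => crd x₀ (u z)) z)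
      (wedge (pbForm cTheta1 (fun z => crd x₀ (u z)) z)
        (oneForm (pbForm (cTheta2 g x₀) (fun z => crd x₀ (u z)) z))) =
      wedge (pullForm (theta g) u z) (wedge (pullForm theta1 u z) (oneForm (pullForm (theta2 g) u z))) := by
    have h1 := wedge_theta012_eq hS (isUnitNull_crd hS hu hx hn)
    have h2 := wedge_theta012_eq hS (isUnitNull_crd hS hu hx' hn)
    rw [h1, ← pbForm_cTheta2_self hu.self_of_nhds, ← pbForm_cTheta1 hu.self_of_nhds hx',
      ← pbForm_cTheta hS hu.self_of_nhds hx', h2,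
      dOne_congr (pullForm_theta1_eventuallyEq hu hx).symm,
      dOne_congr (pullForm_theta1_eventuallyEq hu hx').symm, pbForm_cTheta1 hu.self_of_nhds hx,
      pbForm_cTheta1 hu.self_of_nhds hx']
  rw [key, vec3_eta v, vec3_eta (fun i => mapDeriv u z (![v 0, v 1, v 2] i)), theta012_apply,
    wedge_apply_three, wedge_oneForm_apply, wedge_oneForm_apply, wedge_oneForm_apply]
  simp only [pullForm_apply, Matrix.cons_val]

theorem mapDeriv_mem_tangentNull (hS : IsOrientedAtlas S) (hu : ContMDiffAt 𝓘(ℝ, E) ICot ∞ u z)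
    (hn : ∀ᶠ z' in 𝓝 z, u z' ∈ NullCone g) (v : E) : fB g (u z) (mapDeriv u z v) = 0 := by
  have hx := mem_chart_source E3 (u z).1
  have hc := contDiffAt_crd hx hu
  have hd := hc.differentiableAt (by simp)
  have hz : ∀ i, DifferentiableAt ℝ (fun z' => compv (crd (u z).1 (u z')).2 i) z := fun i =>
    (contDiffAt_compv_comp hc i).differentiableAt (by simp)
  have h1 := fderiv_pairC hS g (X := fun z' => (crd (u z).1 (u z')).1) (z := z)
    (α := fun z' => compv (crd (u z).1 (u z')).2) (β := fun z' => compv (crd (u z).1 (u z')).2)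
    (crd_mem_target hx) hc.fst hz hz v
  have h0 : (fun z' => pairC (gramC g (u z).1 (crd (u z).1 (u z')).1) (compv (crd (u z).1 (u z')).2)
      (compv (crd (u z).1 (u z')).2)) =ᶠ[𝓝 z] fun _ => 0 := by
    filter_upwards [hn, eventually_mem_source hu hx] with z' h1 h2
    rw [← nullFn_crd hS g h2]
    exact h1.1
  rw [h0.fderiv_eq, pairC_comm (gramC_posDef hS g (crd_mem_target hx))
    (covDeriv g (u z).1 _ _ z v), covDeriv_zeta hd, (hasFDerivAt_crd hu).fderiv] at h1
  have e : pairC (gramC g (u z).1 (crd (u z).1 (u z)).1) (compv (crd (u z).1 (u z)).2)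
      (delta (gramC g (u z).1 (crd (u z).1 (u z)).1) (dGramC g (u z).1 (crd (u z).1 (u z)).1)
        (compv (crd (u z).1 (u z)).2) (compv (mapDeriv u z v).2) (mapDeriv u z v).1) =
      fB g (u z) (mapDeriv u z v) := by
    rw [fB_apply, crd_self, gramC_self]
    rfl
  rw [e] at h1
  simp only [fderiv_fun_const, Pi.zero_apply, _root_.zero_apply] at h1
  linear_combination -h1 / 2

/-! ### Scaling of maps -/

theorem contMDiffAt_scale {c : E → ℂ} (hc : ContDiffAt ℝ ∞ c z) (hu : ContMDiffAt 𝓘(ℝ, E) ICot ∞ u z) :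
    ContMDiffAt 𝓘(ℝ, E) ICot ∞ (fun z => scale (c z) (u z)) z := by
  have hx := mem_chart_source E3 (u z).1
  have h1 := contDiffAt_crd hx hu
  have h2 : ContDiffAt ℝ ∞ (fun z' => c z' • (crd (u z).1 (u z')).2) z :=
    contDiffAt_smulForm hc h1.snd
  refine (contMDiffAt_crdInv (x₀ := (u z).1) (c := fun z' => crd (u z).1 (scale (c z') (u z')))
    (crd_mem_target (p := scale (c z) (u z)) hx) (h1.fst.prodMk h2)).congr_of_eventuallyEq ?_
  filter_upwards [eventually_mem_source hu hx] with z' h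
  exact (crdInv_crd (p := scale (c z') (u z')) h).symm

/-- The product rule in the fibre coordinate. The extra term points along the orbit of the scaling,
so forms that annihilate vertical vectors do not see it. -/
theorem mapDeriv_scale {c : E → ℂ} (hc : DifferentiableAt ℝ c z) (hu : ContMDiffAt 𝓘(ℝ, E) ICot ∞ u z)
    (hw : ContMDiffAt 𝓘(ℝ, E) ICot ∞ w z) (h : ∀ᶠ z' in 𝓝 z, w z' = scale (c z') (u z')) (v : E) :
    mapDeriv w z v = dScale (c z) (mapDeriv u z v) + (0, fderiv ℝ c z v • covec (u z)) := by
  have hb : w z = scale (c z) (u z) := h.self_of_nhds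
  have hb1 : (w z).1 = (u z).1 := by rw [hb]; rfl
  have h1 := hasFDerivAt_crd hw
  rw [hb1] at h1
  have h2 := hasFDerivAt_crd hu
  have h3 : HasFDerivAt (fun z' => (crd (u z).1 (u z')).2)
      ((ContinuousLinearMap.snd ℝ E3 (E3 →L[ℝ] ℂ)).comp (mapDeriv u z)) z := h2.snd
  have h4 : HasFDerivAt (fun z' => c z' • (crd (u z).1 (u z')).2) _ z := hc.hasFDerivAt.smul h3
  have h5 := (h2.fst.prodMk h4).congr_of_eventuallyEq (f₁ := fun z' => crd (u z).1 (w z')) (by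
    filter_upwards [h] with z' h
    rw [h, crd_scale])
  refine (congrArg (fun L : E →L[ℝ] TCot => L v) (h1.unique h5)).trans ?_
  have h7 : (crd (u z).1 (u z)).2 = covec (u z) := by rw [crd_self]
  apply Prod.ext
  · simp [dScale]
  · simp [dScale, h7]

/-- The factor is the quotient of the i-th components, for an i with nonzero component at z. -/
theorem exists_ratio (hu : ContMDiffAt 𝓘(ℝ, E) ICot ∞ u z) (hw : ContMDiffAt 𝓘(ℝ, E) ICot ∞ w z)
    (h0 : comp (u z) ≠ 0) (h : ∀ᶠ z' in 𝓝 z, ∃ c : ℂ, w z' = scale c (u z')) :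
    ∃ c : E → ℂ, ContDiffAt ℝ ∞ c z ∧ ∀ᶠ z' in 𝓝 z, w z' = scale (c z') (u z') := by
  have hx := mem_chart_source E3 (u z).1
  have hb1 : (w z).1 = (u z).1 := by obtain ⟨c, hc⟩ := h.self_of_nhds; rw [hc]; rfl
  have h1 := contDiffAt_crd hx hu
  have h2 := contDiffAt_crd (x₀ := (u z).1) (by rw [hb1]; exact hx) hw
  obtain ⟨i, hi⟩ := Function.ne_iff.1 h0
  have h3 := contDiffAt_compv_comp h1 i
  have h4 := contDiffAt_compv_comp h2 i
  have h5 : compv (crd (u z).1 (u z)).2 i ≠ 0 := by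
    rw [crd_self]
    exact hi
  refine ⟨fun z' => compv (crd (u z).1 (w z')).2 i * (compv (crd (u z).1 (u z')).2 i)⁻¹,
    h4.mul (h3.inv h5), ?_⟩
  filter_upwards [h, h3.continuousAt.eventually_ne h5] with z' h6 h7
  obtain ⟨c, hc⟩ := h6
  have : compv (crd (u z).1 (w z')).2 i * (compv (crd (u z).1 (u z')).2 i)⁻¹ = c := by
    rw [hc, crd_scale, ← div_eq_mul_inv, div_eq_iff h7]
    rfl
  rw [this, hc]

theorem theta012_add_vertical {p : CCot S} (hp : p ∈ NullCone g) (v c : Fin 3 → TCot)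
    (hc : ∀ i, c i ∈ vertical p) : theta012 g p (fun i => v i + c i) = theta012 g p v := by
  have h : ∀ i, theta g p (v i + c i) = theta g p (v i) ∧ theta1 p (v i + c i) = theta1 p (v i) ∧
      theta2 g p (v i + c i) = theta2 g p (v i) := by
    intro i
    obtain ⟨_, h2, h3, h4⟩ := (mem_vertical_iff hp).1 (hc i)
    rw [theta2_eq, theta2_eq, map_add, map_add, map_add, h2, h3, h4]
    simp
  rw [vec3_eta (fun i => v i + c i), vec3_eta v, theta012_apply, theta012_apply]
  simp only [(h _).1, (h _).2.1, (h _).2.2, Matrix.cons_val]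

/-- The pull back of `θ ∧ θ̃¹ ∧ θ̃²` by a multiple of a map to `M̂`. -/
theorem theta012_pull_scale {c : E → ℂ} (hc : DifferentiableAt ℝ c z) (hc0 : c z ≠ 0)
    (hu : ContMDiffAt 𝓘(ℝ, E) ICot ∞ u z) (hw : ContMDiffAt 𝓘(ℝ, E) ICot ∞ w z)
    (hp : u z ∈ NullCone g) (h : ∀ᶠ z' in 𝓝 z, w z' = scale (c z') (u z')) (v : Fin 3 → E) :
    theta012 g (w z) (fun i => mapDeriv w z (v i)) =
      (Complex.normSq (c z) : ℂ) ^ 2 * c z ^ 2 * theta012 g (u z) (fun i => mapDeriv u z (v i)) := by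
  have hb : w z = scale (c z) (u z) := h.self_of_nhds
  simp only [mapDeriv_scale hc hu hw h]
  rw [hb, theta012_add_vertical (scale_mem_nullCone hp hc0), theta012_scale]
  intro i
  refine ⟨fderiv ℝ c z (v i) / c z, ?_⟩
  have : covec (scale (c z) (u z)) = c z • covec (u z) := rfl
  rw [this, smul_smul, div_mul_cancel₀ _ hc0]

end Pullback

/-! ### Local lifts of charts to `CHat` carry adapted coframes. -/

section Lifts

open ComplexConjugate UnitAdmissibleFrame

variable {S : Type*} [TopologicalSpace S] [ChartedSpace E3 S] [IsManifold (𝓡 3) ∞ S]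
  {E : Type*} [NormedAddCommGroup E] [NormedSpace ℝ E] {g : Metric3 S} {u w : E → CCot S} {z : E}
  {x₀ : S}

/-! ### The unit representative -/

theorem contDiffAt_hrm (hS : IsOrientedAtlas S) (hu : ContMDiffAt 𝓘(ℝ, E) ICot ∞ u z) :
    ContDiffAt ℝ ∞ (fun z => hrm g (u z)) z := by
  have hx := mem_chart_source E3 (u z).1
  have hc := contDiffAt_crd hx hu
  have hG : ∀ i j, ContDiffAt ℝ ∞ (fun z' => gramC g (u z).1 (crd (u z).1 (u z')).1 i j) z := fun i j =>
    ContDiffAt.comp (g := fun y => gramC g (u z).1 y i j) z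
      (contDiffAt_gramC g (crd_mem_target hx) i j) hc.fst
  have h1 : ContDiffAt ℝ ∞ (fun z' => pairC (gramC g (u z).1 (crd (u z).1 (u z')).1)
      (compv (crd (u z).1 (u z')).2) (conjC (compv (crd (u z).1 (u z')).2))) z := by
    unfold pairC dotProduct
    refine ContDiffAt.sum fun i _ => ?_
    refine (ContDiffAt.upC hG (gramC_posDef hS g (crd_mem_target hx)).det_pos.ne'
      (fun i => contDiffAt_compv_comp hc i) i).mul ?_
    exact Complex.conjCLE.contDiff.contDiffAt.comp z (contDiffAt_compv_comp hc i)
  have h2 : ContDiffAt ℝ ∞ (fun z' => (hermFn g (u z')).re) z := by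
    refine (Complex.reCLM.contDiff.contDiffAt.comp z h1).congr_of_eventuallyEq ?_
    filter_upwards [eventually_mem_source hu hx] with z' h
    rw [Function.comp_apply, ← hermFn_crd hS g h]
    rfl
  simpa only [hermFn_eq_hrm, Complex.ofReal_re] using h2

/-- The multiple of `p` with hermitian square one. -/
def unitRep (g : Metric3 S) (p : CCot S) : CCot S := scale (((Real.sqrt (hrm g p))⁻¹ : ℝ) : ℂ) p

theorem unitRep_mem {p : CCot S} (hp : p ∈ NullCone g) : unitRep g p ∈ CHat g := by
  have hH := hrm_pos hp
  refine ⟨by rw [unitRep, nullFn_scale, hp.1, mul_zero], ?_⟩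
  rw [unitRep, hermFn_scale, hermFn_eq_hrm, Complex.normSq_ofReal, ← mul_inv,
    Real.mul_self_sqrt hH.le, ← Complex.ofReal_mul, inv_mul_cancel₀ hH.ne', Complex.ofReal_one]

theorem contDiffAt_unitFactor (hS : IsOrientedAtlas S) (hu : ContMDiffAt 𝓘(ℝ, E) ICot ∞ u z)
    (hp : u z ∈ NullCone g) :
    ContDiffAt ℝ ∞ (fun z => (((Real.sqrt (hrm g (u z)))⁻¹ : ℝ) : ℂ)) z :=
  ContDiffAt.ofReal
    (((contDiffAt_hrm hS hu).sqrt (hrm_pos hp).ne').inv (Real.sqrt_pos.2 (hrm_pos hp)).ne')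

theorem contMDiffAt_unitRep (hS : IsOrientedAtlas S) (hu : ContMDiffAt 𝓘(ℝ, E) ICot ∞ u z)
    (hp : u z ∈ NullCone g) : ContMDiffAt 𝓘(ℝ, E) ICot ∞ (fun z => unitRep g (u z)) z :=
  contMDiffAt_scale (contDiffAt_unitFactor hS hu hp) hu

theorem pullForm_theta_scale {c : E → ℂ} (hc : DifferentiableAt ℝ c z)
    (hu : ContMDiffAt 𝓘(ℝ, E) ICot ∞ u z) (hw : ContMDiffAt 𝓘(ℝ, E) ICot ∞ w z)
    (h : ∀ᶠ z' in 𝓝 z, w z' = scale (c z') (u z')) (v : E) :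
    pullForm (theta g) w z v = Complex.normSq (c z) * pullForm (theta g) u z v := by
  have hb : w z = scale (c z) (u z) := h.self_of_nhds
  rw [pullForm_apply, pullForm_apply, hb]
  refine theta_scale g (c z) (u z) ?_
  rw [mapDeriv_scale hc hu hw h]
  simp [dScale]

theorem mapDeriv_comp_fst {F : Type*} [NormedAddCommGroup F] [NormedSpace ℝ F] {z : E × F}
    (hu : ContMDiffAt 𝓘(ℝ, E) ICot ∞ u z.1) :
    ContMDiffAt 𝓘(ℝ, E × F) ICot ∞ (fun z : E × F => u z.1) z ∧
      ∀ v, mapDeriv (fun z : E × F => u z.1) z v = mapDeriv u z.1 v.1 := by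
  have h1 : ContMDiffAt 𝓘(ℝ, E × F) ICot ∞ (fun z : E × F => u z.1) z :=
    ContMDiffAt.comp z hu contDiff_fst.contMDiff.contMDiffAt
  refine ⟨h1, fun v => ?_⟩
  have h2 := hasFDerivAt_crd h1
  have h3 : HasFDerivAt (fun z' : E × F => crd (u z.1).1 (u z'.1))
      ((mapDeriv u z.1).comp (ContinuousLinearMap.fst ℝ E F)) z :=
    (hasFDerivAt_crd hu).comp z hasFDerivAt_fst
  exact congrArg (fun L : E × F →L[ℝ] TCot => L v) (h2.unique h3)

/-! ### The contact form in a local parametrization -/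

namespace TwistorPatch

variable (P : TwistorPatch g) {y : E5}

theorem eventually_smooth (hy : y ∈ P.W) :
    ∀ᶠ y' in 𝓝 y, ContMDiffAt 𝓘(ℝ, E5) ICot ∞ (fun y => (P.f y : CCot S)) y' := by
  filter_upwards [P.isOpen.mem_nhds hy] with y' hy'
  exact P.smooth.contMDiffAt (P.isOpen.mem_nhds hy')

theorem smoothAt (hy : y ∈ P.W) : ContMDiffAt 𝓘(ℝ, E5) ICot ∞ (fun y => (P.f y : CCot S)) y :=
  (P.eventually_smooth hy).self_of_nhds

theorem contactForm_apply (y v : E5) :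
    P.contactForm y v = (hrm g (P.f y : CCot S) : ℂ)⁻¹ *
      pullForm (theta g) (fun y => (P.f y : CCot S)) y v := by
  rw [← hermFn_eq_hrm]
  rfl

theorem conj_contactForm (y : E5) : conjForm (P.contactForm y) = P.contactForm y := by
  refine ContinuousLinearMap.ext fun v => ?_
  rw [conjForm_apply, contactForm_apply, pullForm_apply, map_mul, map_inv₀, Complex.conj_ofReal,
    conj_theta]

/-- The unit representative differs by the factor g(ζ, ζ̄)^{-1/2}, and θ has weight |c|². This form
of the contact form is the one accessible to the structure equations. -/
theorem contactForm_eq (hS : IsOrientedAtlas S) (hy : y ∈ P.W) :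
    P.contactForm y = pullForm (theta g) (fun y => unitRep g (P.f y : CCot S)) y := by
  refine ContinuousLinearMap.ext fun v => ?_
  have h1 := P.smoothAt hy
  have hp := (P.f y).2
  have hH := hrm_pos hp
  rw [contactForm_apply, pullForm_theta_scale
    ((contDiffAt_unitFactor hS h1 hp).differentiableAt (by simp)) h1 (contMDiffAt_unitRep hS h1 hp)
    (Filter.Eventually.of_forall fun _ => rfl), Complex.normSq_ofReal, ← mul_inv,
    Real.mul_self_sqrt hH.le, Complex.ofReal_inv]

theorem contDiffOn_contactForm (hS : IsOrientedAtlas S) : ContDiffOn ℝ ∞ P.contactForm P.W := by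
  intro y hy
  refine ContDiffAt.contDiffWithinAt ?_
  have h1 : ∀ᶠ y' in 𝓝 y, ContMDiffAt 𝓘(ℝ, E5) ICot ∞ (fun y => unitRep g (P.f y : CCot S)) y' := by
    filter_upwards [P.isOpen.mem_nhds hy] with y' hy'
    exact contMDiffAt_unitRep hS (P.smoothAt hy') (P.f y').2
  have hx := mem_chart_source E3 (unitRep g (P.f y : CCot S)).1
  have hc := contDiffAt_crd (f := fun y => unitRep g (P.f y : CCot S)) hx h1.self_of_nhds
  refine (contDiffAt_pbForm (c := fun y' => crd (unitRep g (P.f y : CCot S)).1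
    (unitRep g (P.f y' : CCot S))) (z := y)
    (contDiffAt_cTheta (g := g) hS (crd_mem_target hx)) hc).congr_of_eventuallyEq ?_
  filter_upwards [P.isOpen.mem_nhds hy,
    pullForm_theta_eventuallyEq (g := g) hS h1 hx] with y' h2 h3
  rw [P.contactForm_eq hS h2, h3]

end TwistorPatch

/-! ### Lifts are adapted -/

theorem xi_eq_canonicalForm {W : Set E5} {T10 : E5 → Set (E5 × E5)} {θ : E5 → E5 →L[ℝ] ℂ}
    (F : UnitAdmissibleFrame W T10 θ) (q : E6) (v : Fin 3 → E6) :
    F.xi q v = F.canonicalForm q (fun i => (v i).1) := by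
  rw [vec3_eta (fun i => (v i).1), vec3_eta v, UnitAdmissibleFrame.xi, UnitAdmissibleFrame.phi,
    canonicalForm, ContinuousAlternatingMap.smul_apply, wedge_smul_right,
    ContinuousAlternatingMap.smul_apply]
  simp only [wedge_apply_three, wedge_oneForm_apply, lift_apply, Matrix.cons_val]

variable {hS : IsOrientedAtlas S} {Φ : FeffermanChart g} {O : Set E6} {τ : E6 → CHat g} {q : E6}

namespace IsLocalLift

theorem eventually_smooth {ϖ : CHat g → FeffermanSpace g} (h : IsLocalLift ϖ Φ O τ) (hq : q ∈ O) :
    ∀ᶠ q' in 𝓝 q, ContMDiffAt 𝓘(ℝ, E6) ICot ∞ (fun q => (τ q : CCot S)) q' := by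
  filter_upwards [h.isOpen.mem_nhds hq] with y' hy'
  exact h.smooth.contMDiffAt (h.isOpen.mem_nhds hy')

theorem exists_scale (h : IsLocalLift (canonicalMap hS g) Φ O τ) (hq : q ∈ O) :
    ∃ c : ℂ, c ≠ 0 ∧ (Φ.patch.f q.1 : CCot S) = scale c (τ q : CCot S) ∧
      ∃ r : ℝ, 0 < r ∧ (Φ.elt q).coef hS * c ^ 2 = r := by
  have := (canonicalMap_eq_mk_iff hS (τ q) (Φ.elt q)).1 (h.lift q hq)
  rwa [Φ.elt_pt q (h.subset hq)] at this

/-- The scale factors obtained pointwise from the equality of canonical elements coincide with the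
quotient of components, because the covector of τ is nonzero. -/
theorem exists_smooth_scale (h : IsLocalLift (canonicalMap hS g) Φ O τ) (hq : q ∈ O) :
    ∃ c : E6 → ℂ, DifferentiableAt ℝ c q ∧ c q ≠ 0 ∧
      (∀ᶠ z in 𝓝 q, (Φ.patch.f z.1 : CCot S) = scale (c z) (τ z : CCot S)) ∧
      ∃ r : ℝ, 0 < r ∧ (Φ.elt q).coef hS * c q ^ 2 = r := by
  have h1 := (mapDeriv_comp_fst (F := ℝ) (z := q) (Φ.patch.smoothAt (h.subset hq).1)).1
  have h0 := comp_ne_zero (nullCone_of_cHat (τ q))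
  obtain ⟨c, hc, hc'⟩ := exists_ratio (h.eventually_smooth hq).self_of_nhds h1 h0 (by
    filter_upwards [h.isOpen.mem_nhds hq] with z hz
    obtain ⟨c, _, hc, _⟩ := h.exists_scale hz
    exact ⟨c, hc⟩)
  obtain ⟨c₀, hc₀, hpt, r, hr, hcoef⟩ := h.exists_scale hq
  have he : c q = c₀ := by
    obtain ⟨i, hi⟩ := Function.ne_iff.1 h0
    have h2 := hc'.self_of_nhds
    rw [hpt] at h2
    have h3 : c₀ * comp (τ q : CCot S) i = c q * comp (τ q : CCot S) i :=
      congrArg (fun p => comp p i) h2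
    exact (mul_right_cancel₀ hi h3).symm
  exact ⟨c, hc.differentiableAt (by simp), by rwa [he], hc', r, hr, by rwa [he]⟩

/-- If the patch map is c times the lift, then |c|² is its hermitian square, which cancels the
weight of θ. -/
theorem lift_contactForm (h : IsLocalLift (canonicalMap hS g) Φ O τ) (hq : q ∈ O) :
    UnitAdmissibleFrame.lift (Φ.patch.contactForm q.1) = pullForm (theta g) (fun q => (τ q : CCot S)) q := by
  obtain ⟨c, hc, hc0, hc', -⟩ := h.exists_smooth_scale hq
  obtain ⟨h1, h2⟩ := mapDeriv_comp_fst (F := ℝ) (z := q) (Φ.patch.smoothAt (h.subset hq).1)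
  refine ContinuousLinearMap.ext fun v => ?_
  have h3 := pullForm_theta_scale (g := g) hc (h.eventually_smooth hq).self_of_nhds h1 hc' v
  rw [pullForm_apply, h2] at h3
  have h4 : (hrm g (Φ.patch.f q.1 : CCot S) : ℂ) = Complex.normSq (c q) := by
    rw [← hermFn_eq_hrm, hc'.self_of_nhds, hermFn_scale, (τ q).2.2, mul_one]
  rw [lift_apply, TwistorPatch.contactForm_apply, pullForm_apply, h3, h4]
  exact inv_mul_cancel_left₀ (by exact_mod_cast (Complex.normSq_pos.2 hc0).ne') _

/-- On the patch map, ξ is κ θ∧θ̃¹∧θ̃²; passing to the lift multiplies it by c²|c|⁴. The lift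
property says precisely that κc² is positive. -/
theorem theta012_eq_xi (h : IsLocalLift (canonicalMap hS g) Φ O τ) (hq : q ∈ O) :
    ∃ r : ℝ, 0 < r ∧ ∀ v : Fin 3 → E6,
      theta012 g (τ q : CCot S) (fun i => mapDeriv (fun q => (τ q : CCot S)) q (v i)) =
        r * Φ.frame.xi q v := by
  obtain ⟨c, hc, hc0, hc', r, hr, hr'⟩ := h.exists_smooth_scale hq
  have hy := (h.subset hq).1
  obtain ⟨h1, h2⟩ := mapDeriv_comp_fst (F := ℝ) (z := q) (Φ.patch.smoothAt hy)
  have hn := Complex.normSq_pos.2 hc0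
  refine ⟨(r * Complex.normSq (c q) ^ 2)⁻¹, by positivity, fun v => ?_⟩
  have h3 := theta012_pull_scale (g := g) hc hc0 (h.eventually_smooth hq).self_of_nhds h1
    (nullCone_of_cHat (τ q)) hc' v
  simp only [h2] at h3
  have h4 := Φ.elt_form q (h.subset hq) (fun i => (v i).1)
  have hpt := Φ.elt_pt q (h.subset hq)
  have hT : ∀ i, Φ.patch.df q.1 (v i).1 ∈ tangentNull g (Φ.elt q).pt := by
    intro i
    rw [hpt, mem_tangentNull hS]
    exact mapDeriv_mem_tangentNull hS (Φ.patch.smoothAt hy)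
      (Filter.Eventually.of_forall fun y => (Φ.patch.f y).2) _
  rw [(Φ.elt q).form_eq hS _ hT, hpt] at h4
  have h5 : theta012 g (Φ.patch.f q.1 : CCot S) (fun i => Φ.patch.df q.1 (v i).1) = _ := h3
  rw [xi_eq_canonicalForm, ← h4, h5]
  have e : (r * Complex.normSq (c q) ^ 2 : ℂ) ≠ 0 := by exact_mod_cast (by positivity : r * Complex.normSq (c q) ^ 2 ≠ 0)
  push_cast
  rw [eq_inv_mul_iff_mul_eq₀ e, ← hr']
  ring

/-- Brings the structure equations on `CHat` and the chart's own frame together. The chart at x₀ is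
kept fixed so that the equations hold in a neighbourhood and can be differentiated. -/
theorem adaptedAt (h : IsLocalLift (canonicalMap hS g) Φ O τ) (hq : q ∈ O)
    (hx : (τ q : CCot S).1 ∈ (chartAt E3 x₀).source) :
    Φ.frame.AdaptedAt (pbForm cTheta1 fun z => crd x₀ (τ z : CCot S))
      (pbForm (cTheta2 g x₀) fun z => crd x₀ (τ z : CCot S))
      (pbForm (cTheta3 g x₀) fun z => crd x₀ (τ z : CCot S)) q := by
  have hu := h.eventually_smooth hq
  have hn : ∀ᶠ z in 𝓝 q, (τ z : CCot S) ∈ CHat g := Filter.Eventually.of_forall fun z => (τ z).2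
  have hU := isUnitNull_crd hS hu hx hn
  have hθ : (fun z : E6 => UnitAdmissibleFrame.lift (Φ.patch.contactForm z.1)) =ᶠ[𝓝 q]
      pbForm (cTheta g x₀) fun z => crd x₀ (τ z : CCot S) := by
    filter_upwards [h.isOpen.mem_nhds hq,
      pullForm_theta_eventuallyEq (g := g) hS hu hx] with z h1 h2
    rw [h.lift_contactForm h1, h2]
  have hmem : (crd x₀ (τ q : CCot S)).1 ∈ (chartAt E3 x₀).target := crd_mem_target hx
  refine ⟨(h.subset hq).1, ⟨?_, ?_, ?_, ?_, ?_, ?_, ?_, ?_⟩, ?_⟩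
  · exact (contDiffAt_pbForm (c := fun z => crd x₀ (τ z : CCot S)) (z := q)
      (contDiffAt_cTheta hS hmem) hU.smooth).congr_of_eventuallyEq hθ
  · exact contDiffAt_pbForm contDiffAt_cTheta1 hU.smooth
  · exact contDiffAt_pbForm (contDiffAt_cTheta2 hS hmem) hU.smooth
  · exact contDiffAt_pbForm (contDiffAt_cTheta3 hS hmem) hU.smooth
  · refine Filter.Eventually.of_forall fun z => ContinuousLinearMap.ext fun v => ?_
    exact congrArg (fun α : E5 →L[ℝ] ℂ => α v.1) (Φ.patch.conj_contactForm z.1)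
  · refine Filter.Eventually.of_forall fun z => ContinuousLinearMap.ext fun v => ?_
    rw [conjForm_apply, pbForm_apply, cTheta3_apply]
    simp only [map_mul, map_neg, map_div₀, map_sub, Complex.conj_conj, Complex.conj_I, map_ofNat]
    ring
  · filter_upwards [hU.eventually, hθ] with z h1 h2
    rw [dOne_cTheta1 h1 hS, h2]
  · filter_upwards [hU.eventually, hθ.eventuallyEq_nhds] with z h1 h2
    rw [dOne_congr h2, dOne_cTheta h1 hS]
  · filter_upwards [h.isOpen.mem_nhds hq, hu.eventually_nhds, hθ,
      eventually_mem_source hu.self_of_nhds hx] with z h1 h2 h3 h4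
    obtain ⟨r, hr, hr'⟩ := h.theta012_eq_xi h1
    refine ⟨r, hr, ?_⟩
    ext v
    have h5 := pull_theta012 (g := g) hS h2 h4 (Filter.Eventually.of_forall fun z => (τ z).2) v
    rw [hr' v] at h5
    simp only [h3]
    rw [h5]
    rfl

theorem eventually_adaptedAt (h : IsLocalLift (canonicalMap hS g) Φ O τ) (hq : q ∈ O)
    (hx : (τ q : CCot S).1 ∈ (chartAt E3 x₀).source) :
    ∀ᶠ z in 𝓝 q, Φ.frame.AdaptedAt (pbForm cTheta1 fun z => crd x₀ (τ z : CCot S))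
      (pbForm (cTheta2 g x₀) fun z => crd x₀ (τ z : CCot S))
      (pbForm (cTheta3 g x₀) fun z => crd x₀ (τ z : CCot S)) z := by
  filter_upwards [h.isOpen.mem_nhds hq,
    eventually_mem_source (h.eventually_smooth hq).self_of_nhds hx] with z h1 h2
  exact h.adaptedAt h1 h2

/-- A lift through the canonical map is an immersion. -/
theorem injective (h : IsLocalLift (canonicalMap hS g) Φ O τ) (hq : q ∈ O) :
    Function.Injective (dLift τ q) := by
  obtain ⟨c, hc, hc0, hc', -⟩ := h.exists_smooth_scale hq
  have hy := (h.subset hq).1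
  obtain ⟨h1, h2⟩ := mapDeriv_comp_fst (F := ℝ) (z := q) (Φ.patch.smoothAt hy)
  have hu := (h.eventually_smooth hq).self_of_nhds
  rw [injective_iff_map_eq_zero]
  intro v hv
  have hv : mapDeriv (fun z => (τ z : CCot S)) q v = 0 := hv
  have hv1 : v.1 = 0 := by
    refine Φ.patch.immersive q.1 hy v.1 ⟨fderiv ℝ c q v / c q, ?_⟩
    have h3 := mapDeriv_scale hc hu h1 hc' v
    rw [h2, hv] at h3
    refine Eq.trans h3 ?_
    have h4 : covec (Φ.patch.f q.1 : CCot S) = c q • covec (τ q : CCot S) := by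
      have := hc'.self_of_nhds
      rw [this]
      rfl
    have h5 : dScale (c q) 0 = 0 :=
      Prod.ext rfl (ContinuousLinearMap.ext fun _ => mul_zero (c q))
    rw [h4, smul_smul, div_mul_cancel₀ _ hc0, h5, zero_add]
  -- The base part of v vanishes because the patch is an immersion modulo the orbits. The remaining
  -- multiple of ∂_s is detected by θ̃³, which equals 1/2 on ∂_s.
  have hr := (h.adaptedAt hq (mem_chart_source E3 (τ q : CCot S).1)).rho_fibre Φ.patch.isOpen
    (Φ.patch.contDiffOn_contactForm hS)
  rw [pbForm_cTheta3_self hu] at hr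
  have hv' : v = v.2 • ((0, 1) : E6) := by
    apply Prod.ext
    · rw [hv1]; simp
    · simp
  have h5 : pullForm (theta3 g) (fun z => (τ z : CCot S)) q v = 0 := by
    rw [pullForm_apply, hv, map_zero]
  rw [hv', map_smul, hr] at h5
  have h6 : v.2 = 0 := by simpa using h5
  exact Prod.ext hv1 h6

/-- The pull back of the Fefferman metric by the canonical map. -/
theorem feffermanMetric_eq (h : IsLocalLift (canonicalMap hS g) Φ O τ) (hq : q ∈ O)
    {σ : E6 → E6 →L[ℝ] ℝ} (hσ : Φ.frame.IsFeffermanConnection σ) (v w : E6) :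
    Φ.frame.feffermanMetric σ q v w =
      adaptedMetric g (τ q : CCot S) (dLift τ q v) (dLift τ q w) := by
  -- With the preferred chart at the base point of τ q, the chart forms at q are the invariantly
  -- defined θ̃² and θ̃³.
  have hx := mem_chart_source E3 (τ q : CCot S).1
  have hA := h.adaptedAt hq hx
  have hu := (h.eventually_smooth hq).self_of_nhds
  have hW := Φ.patch.isOpen
  have hθ := Φ.patch.contDiffOn_contactForm hS
  have hD : IsOpen (Φ.patch.W ×ˢ (Set.univ : Set ℝ)) := hW.prod isOpen_univ
  have hs := hA.connection_unique (h.eventually_adaptedAt hq hx) hW hθ (σ := σ)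
    ((hσ.smooth.contDiffAt (hD.mem_nhds (h.subset hq))).differentiableAt (by simp))
    (by filter_upwards [hD.mem_nhds (h.subset hq)] with z hz; exact hσ.d_xi z hz)
    (hσ.d_phi q (h.subset hq))
  have hd : dLift τ q = mapDeriv (fun z => (τ z : CCot S)) q := rfl
  rw [feffermanMetric, hA.metric_eq hW hθ, hs, h.lift_contactForm hq, pbForm_cTheta1 hu hx,
    pbForm_cTheta2_self hu, pbForm_cTheta3_self hu, adaptedMetric, hd]
  clear hs hA hd
  unfold pullForm
  generalize mapDeriv (fun z => (τ z : CCot S)) q = D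
  simp only [symProd, _root_.smul_apply, smul_eq_mul, conjForm_apply,
    ContinuousLinearMap.comp_apply]
  ring

end IsLocalLift

end Lifts

/-! ### Existence of local lifts and of the connection form. -/

section LocalLifts

open ComplexConjugate UnitAdmissibleFrame

variable {S : Type*} [TopologicalSpace S] [ChartedSpace E3 S] [IsManifold (𝓡 3) ∞ S]
  {E : Type*} [NormedAddCommGroup E] [NormedSpace ℝ E] {g : Metric3 S} {u : E → CCot S} {z : E}

/-! ### Existence of local lifts -/

theorem contDiffAt_wedge_apply {α β γ : E → E →L[ℝ] ℂ} (hα : ContDiffAt ℝ ∞ α z)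
    (hβ : ContDiffAt ℝ ∞ β z) (hγ : ContDiffAt ℝ ∞ γ z) (v : Fin 3 → E) :
    ContDiffAt ℝ ∞ (fun z => wedge (α z) (wedge (β z) (oneForm (γ z))) v) z := by
  rw [vec3_eta v]
  simp only [wedge_apply_three, wedge_oneForm_apply]
  have h1 : ∀ i, ContDiffAt ℝ ∞ (fun z => α z (v i)) z := fun i => hα.clm_apply contDiffAt_const
  have h2 : ∀ i, ContDiffAt ℝ ∞ (fun z => β z (v i)) z := fun i => hβ.clm_apply contDiffAt_const
  have h3 : ∀ i, ContDiffAt ℝ ∞ (fun z => γ z (v i)) z := fun i => hγ.clm_apply contDiffAt_const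
  have h4 : ∀ i j, ContDiffAt ℝ ∞ (fun z => β z (v i) * γ z (v j) - β z (v j) * γ z (v i)) z :=
    fun i j => ((h2 i).mul (h3 j)).sub ((h2 j).mul (h3 i))
  exact (((h1 0).mul (h4 1 2)).sub ((h1 1).mul (h4 0 2))).add ((h1 2).mul (h4 0 1))

theorem contDiffAt_theta012_pull (hS : IsOrientedAtlas S)
    (hu : ∀ᶠ z' in 𝓝 z, ContMDiffAt 𝓘(ℝ, E) ICot ∞ u z') (hn : ∀ᶠ z' in 𝓝 z, u z' ∈ CHat g)
    (v : Fin 3 → E) :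
    ContDiffAt ℝ ∞ (fun z => theta012 g (u z) (fun i => mapDeriv u z (v i))) z := by
  have hx := mem_chart_source E3 (u z).1
  have hU := isUnitNull_crd hS hu hx hn
  have hmem := crd_mem_target hx
  have h := contDiffAt_wedge_apply (z := z)
    (contDiffAt_pbForm (c := fun z' => crd (u z).1 (u z')) (z := z)
      (contDiffAt_cTheta (g := g) hS hmem) hU.smooth)
    (contDiffAt_pbForm contDiffAt_cTheta1 hU.smooth)
    (contDiffAt_pbForm (c := fun z' => crd (u z).1 (u z')) (z := z)
      (contDiffAt_cTheta2 (g := g) hS hmem) hU.smooth) v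
  refine h.congr_of_eventuallyEq ?_
  filter_upwards [hu.eventually_nhds, hn.eventually_nhds,
    eventually_mem_source hu.self_of_nhds hx] with z' h1 h2 h3
  exact (pull_theta012 hS h1 h3 h2 v).symm

namespace FeffermanChart

variable {Φ : FeffermanChart g} {q : E6}

theorem isOpen_domain (Φ : FeffermanChart g) : IsOpen Φ.domain := Φ.patch.isOpen.prod isOpen_univ

theorem contDiffAt_canonicalForm (hS : IsOrientedAtlas S) (hq : q ∈ Φ.domain) (v : Fin 3 → E5) :
    ContDiffAt ℝ ∞ (fun q => Φ.frame.canonicalForm q v) q := by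
  have hW := Φ.patch.isOpen.mem_nhds hq.1
  have h1 := contDiffAt_wedge_apply ((Φ.patch.contDiffOn_contactForm hS).contDiffAt hW)
    ((Φ.frame.smooth_coframe 0).contDiffAt hW) ((Φ.frame.smooth_coframe 1).contDiffAt hW) v
  have h2 : ContDiffAt ℝ ∞ (fun q : E6 => Complex.exp (Complex.I * q.2)) q := by
    refine ContDiffAt.cexp (contDiffAt_const.mul ?_)
    exact Complex.ofRealCLM.contDiff.contDiffAt.comp q contDiffAt_snd
  exact h2.mul (h1.comp q contDiffAt_fst)

theorem exists_canonicalForm_ne_zero (hq : q ∈ Φ.domain) :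
    ∃ v : Fin 3 → E5, Φ.frame.canonicalForm q v ≠ 0 := by
  have hy := hq.1
  have hr := fun α => (Φ.frame.theta_Z_parts hy (Φ.patch.conj_contactForm q.1) α).1
  refine ⟨![Φ.frame.T q.1, (Φ.frame.Z 0 q.1).1, (Φ.frame.Z 1 q.1).1], ?_⟩
  rw [canonicalForm, ContinuousAlternatingMap.smul_apply, wedge_apply_three, wedge_oneForm_apply,
    wedge_oneForm_apply, wedge_oneForm_apply, Φ.frame.reeb_one _ hy, hr, hr, Φ.frame.coframe_T _ hy,
    Φ.frame.coframe_T _ hy, Φ.frame.coframe_Z_fst hy, Φ.frame.coframe_Z_fst hy,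
    Φ.frame.coframe_Z_fst hy, Φ.frame.coframe_Z_fst hy]
  simp [Complex.exp_ne_zero]

/-- The coefficient is chosen pointwise. It is smooth as a quotient of two smooth functions: the
chart's canonical form and the pull-back of θ∧θ̃¹∧θ̃² by the unit representative, evaluated on fixed
vectors. -/
theorem contDiffAt_coef (hS : IsOrientedAtlas S) (hq : q ∈ Φ.domain) :
    ContDiffAt ℝ ∞ (fun q => (Φ.elt q).coef hS) q := by
  obtain ⟨v, hv⟩ := Φ.exists_canonicalForm_ne_zero hq
  have hsm : ∀ y ∈ Φ.patch.W, ContMDiffAt 𝓘(ℝ, E5) ICot ∞ (fun y => unitRep g (Φ.patch.f y : CCot S)) y :=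
    fun y hy => contMDiffAt_unitRep hS (Φ.patch.smoothAt hy) (Φ.patch.f y).2
  obtain ⟨m, hm⟩ : ∃ m : E5 → ℝ, ∀ y, m y = (Real.sqrt (hrm g (Φ.patch.f y : CCot S)))⁻¹ :=
    ⟨_, fun _ => rfl⟩
  have hm0 : ∀ y, 0 < m y := fun y => by
    rw [hm]
    exact inv_pos.2 (Real.sqrt_pos.2 (hrm_pos (Φ.patch.f y).2))
  have hms : ∀ y ∈ Φ.patch.W, ContDiffAt ℝ ∞ (fun y => (m y : ℂ)) y := fun y hy => by
    simp only [hm]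
    exact contDiffAt_unitFactor hS (Φ.patch.smoothAt hy) (Φ.patch.f y).2
  obtain ⟨N, hN⟩ : ∃ N : E5 → ℂ, ∀ y, N y = theta012 g (unitRep g (Φ.patch.f y : CCot S))
      (fun i => mapDeriv (fun y => unitRep g (Φ.patch.f y : CCot S)) y (v i)) := ⟨_, fun _ => rfl⟩
  have hNs : ContDiffAt ℝ ∞ N q.1 := by
    have h1 := contDiffAt_theta012_pull (g := g) (u := fun y => unitRep g (Φ.patch.f y : CCot S)) (z := q.1)
      hS (by filter_upwards [Φ.patch.isOpen.mem_nhds hq.1] with y hy; exact hsm y hy)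
      (Filter.Eventually.of_forall fun y => unitRep_mem (Φ.patch.f y).2) v
    simpa only [← hN] using h1
  -- The exponent is the weight |m|⁴m² for the positive factor m of the unit representative.
  have key : ∀ z ∈ Φ.domain, (Φ.elt z).coef hS * N z.1 = (m z.1 : ℂ) ^ 6 * Φ.frame.canonicalForm z v := by
    intro z hz
    have hpt := Φ.elt_pt z hz
    have hT : ∀ i, Φ.patch.df z.1 (v i) ∈ tangentNull g (Φ.elt z).pt := by
      intro i
      rw [hpt, mem_tangentNull hS]
      exact mapDeriv_mem_tangentNull hS (Φ.patch.smoothAt hz.1)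
        (Filter.Eventually.of_forall fun y => (Φ.patch.f y).2) _
    have h4 := Φ.elt_form z hz v
    rw [(Φ.elt z).form_eq hS _ hT, hpt] at h4
    have h5 := theta012_pull_scale (g := g) (z := z.1) (c := fun y => (m y : ℂ))
      ((hms z.1 hz.1).differentiableAt (by simp))
      (by exact_mod_cast (hm0 z.1).ne') (Φ.patch.smoothAt hz.1) (hsm z.1 hz.1) (Φ.patch.f z.1).2
      (Filter.Eventually.of_forall fun y => by rw [hm]; rfl) v
    have h6 : theta012 g (Φ.patch.f z.1 : CCot S) (fun i => Φ.patch.df z.1 (v i)) =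
      theta012 g (Φ.patch.f z.1 : CCot S)
        (fun i => mapDeriv (fun y => (Φ.patch.f y : CCot S)) z.1 (v i)) := rfl
    rw [hN, h5, ← h4, h6, Complex.normSq_ofReal]
    push_cast
    ring
  have hN0 : N q.1 ≠ 0 := fun h0 => by
    have h1 := key q hq
    rw [h0, mul_zero] at h1
    have h2 : (m q.1 : ℂ) ≠ 0 := by exact_mod_cast (hm0 q.1).ne'
    exact mul_ne_zero (pow_ne_zero 6 h2) hv h1.symm
  have hNs' : ContDiffAt ℝ ∞ (fun z : E6 => N z.1) q := hNs.comp q contDiffAt_fst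
  have hms' : ContDiffAt ℝ ∞ (fun z : E6 => (m z.1 : ℂ)) q :=
    ContDiffAt.comp (g := fun y => (m y : ℂ)) q (hms q.1 hq.1) contDiffAt_fst
  refine (((hms'.pow 6).mul (Φ.contDiffAt_canonicalForm hS hq v)).mul
    (hNs'.inv hN0)).congr_of_eventuallyEq ?_
  filter_upwards [Φ.isOpen_domain.mem_nhds hq, hNs'.continuousAt.eventually_ne hN0] with z h1 h2
  rw [← key z h1]
  exact (mul_inv_cancel_right₀ h2 _).symm

/-- A lift is a phase times the unit representative, where the square of the phase must be that of
the coefficient κ. Near q such a square root exists smoothly, and its sign is fixed by the value u₀.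
-/
theorem exists_localLift (hS : IsOrientedAtlas S) (hq : q ∈ Φ.domain) {u₀ : CHat g}
    (hu₀ : canonicalMap hS g u₀ = Φ.param q) :
    ∃ (O : Set E6) (τ : E6 → CHat g), q ∈ O ∧ IsLocalLift (canonicalMap hS g) Φ O τ ∧ τ q = u₀ := by
  obtain ⟨c₀, hc₀, hpt, r₀, hr₀, hκ⟩ := (canonicalMap_eq_mk_iff hS u₀ (Φ.elt q)).1 hu₀
  rw [Φ.elt_pt q hq] at hpt
  obtain ⟨κ, hκe⟩ : ∃ κ : E6 → ℂ, ∀ z, κ z = (Φ.elt z).coef hS := ⟨_, fun _ => rfl⟩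
  have hκ0 : ∀ z, κ z ≠ 0 := fun z => by rw [hκe]; exact (Φ.elt z).coef_ne_zero hS
  have hκs : ∀ z ∈ Φ.domain, ContDiffAt ℝ ∞ κ z := fun z hz => by
    have := Φ.contDiffAt_coef hS hz
    simpa only [← hκe] using this
  rw [← hκe] at hκ
  obtain ⟨m, hm⟩ : ∃ m : E5 → ℝ, ∀ y, m y = (Real.sqrt (hrm g (Φ.patch.f y : CCot S)))⁻¹ :=
    ⟨_, fun _ => rfl⟩
  have hm0 : ∀ y, 0 < m y := fun y => by
    rw [hm]
    exact inv_pos.2 (Real.sqrt_pos.2 (hrm_pos (Φ.patch.f y).2))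
  have hmc : ∀ y, (m y : ℂ) ≠ 0 := fun y => by exact_mod_cast (hm0 y).ne'
  have hû : ∀ y, unitRep g (Φ.patch.f y : CCot S) = scale (m y : ℂ) (Φ.patch.f y : CCot S) := fun y => by
    rw [hm]; rfl
  -- The phase at q for which the lift passes through u₀.
  obtain ⟨a₀, ha₀⟩ : ∃ a₀ : ℂ, a₀ = ((m q.1 : ℂ) * c₀)⁻¹ := ⟨_, rfl⟩
  have hmc₀ : (m q.1 : ℂ) * c₀ ≠ 0 := mul_ne_zero (hmc _) hc₀
  have ha₀n : Complex.normSq a₀ = 1 := by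
    have h1 : hermFn g (unitRep g (Φ.patch.f q.1 : CCot S)) = 1 := (unitRep_mem (Φ.patch.f q.1).2).2
    rw [hû, hpt, ← scale_mul, hermFn_scale, u₀.2.2, mul_one] at h1
    have h2 : Complex.normSq ((m q.1 : ℂ) * c₀) = 1 := by exact_mod_cast h1
    rw [ha₀, map_inv₀, h2, inv_one]
  -- Half the argument of κ(z)/κ(q); the principal logarithm is smooth where this quotient stays in
  -- the slit plane, and it is 1 at z = q.
  obtain ⟨a, ha⟩ : ∃ a : E6 → ℂ, ∀ z, a z = a₀ * Complex.exp (((Complex.log (κ z / κ q)).im / 2 : ℝ) * Complex.I) :=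
    ⟨_, fun _ => rfl⟩
  have han : ∀ z, Complex.normSq (a z) = 1 := fun z => by
    rw [ha, map_mul, ha₀n, one_mul, Complex.normSq_eq_norm_sq, Complex.norm_exp_ofReal_mul_I, one_pow]
  have ha0 : ∀ z, a z ≠ 0 := fun z h => by
    have := han z
    rw [h, map_zero] at this
    exact zero_ne_one this
  have hslit : ∀ᶠ z in 𝓝 q, κ z / κ q ∈ Complex.slitPlane := by
    have h1 : ContinuousAt (fun z => κ z / κ q) q := (hκs q hq).continuousAt.div_const _
    refine h1.eventually (Complex.isOpen_slitPlane.mem_nhds ?_)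
    change κ q / κ q ∈ _
    rw [div_self (hκ0 q)]
    exact Complex.one_mem_slitPlane
  obtain ⟨O, hO, hOo, hqO⟩ := mem_nhds_iff.1 (Filter.inter_mem (Φ.isOpen_domain.mem_nhds hq) hslit)
  refine ⟨O, fun z => ⟨scale (a z) (unitRep g (Φ.patch.f z.1 : CCot S)),
    scale_mem_cHat ⟨_, unitRep_mem (Φ.patch.f z.1).2⟩ (han z)⟩, hqO,
    ⟨hOo, fun z hz => (hO hz).1, fun z hz => ?_, fun z hz => ?_⟩, ?_⟩
  · refine ContMDiffAt.contMDiffWithinAt ?_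
    have hz1 := (hO hz).1
    refine contMDiffAt_scale (u := fun z : E6 => unitRep g (Φ.patch.f z.1 : CCot S)) ?_
      (mapDeriv_comp_fst (F := ℝ) (u := fun y => unitRep g (Φ.patch.f y : CCot S))
        (contMDiffAt_unitRep hS (Φ.patch.smoothAt hz1.1) (Φ.patch.f z.1).2)).1
    have h1 : ContDiffAt ℝ ∞ (fun z => κ z / κ q) z := (hκs z hz1).div_const _
    have h2 : ContDiffAt ℝ ∞ (fun z => Complex.log (κ z / κ q)) z :=
      ContDiffAt.comp (g := Complex.log) z ((Complex.contDiffAt_log (hO hz).2).restrict_scalars ℝ) h1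
    have h3 : ContDiffAt ℝ ∞ (fun z => (Complex.log (κ z / κ q)).im / 2) z :=
      (Complex.imCLM.contDiff.contDiffAt.comp z h2).div_const 2
    have h4 : a = fun z => a₀ * Complex.exp (((Complex.log (κ z / κ q)).im / 2 : ℝ) * Complex.I) :=
      funext ha
    rw [h4]
    exact contDiffAt_const.mul ((ContDiffAt.ofReal h3).mul contDiffAt_const).cexp
  · have hz1 := (hO hz).1
    have ham : a z * (m z.1 : ℂ) ≠ 0 := mul_ne_zero (ha0 z) (hmc _)
    refine (canonicalMap_eq_mk_iff hS _ (Φ.elt z)).2 ⟨(a z * (m z.1 : ℂ))⁻¹, inv_ne_zero ham, ?_,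
      r₀ * m q.1 ^ 2 * ‖κ z / κ q‖ / m z.1 ^ 2, ?_, ?_⟩
    · change (Φ.elt z).pt = scale _ (scale (a z) (unitRep g (Φ.patch.f z.1 : CCot S)))
      rw [Φ.elt_pt z hz1, hû, ← scale_mul, ← scale_mul, mul_assoc, inv_mul_cancel₀ ham, scale_one]
    · have h1 : 0 < ‖κ z / κ q‖ := norm_pos_iff.2 (div_ne_zero (hκ0 z) (hκ0 q))
      have := hm0 z.1
      have := hm0 q.1
      positivity
    · have hb0 : κ z / κ q ≠ 0 := div_ne_zero (hκ0 z) (hκ0 q)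
      have h1 : Complex.exp (((Complex.log (κ z / κ q)).im / 2 : ℝ) * Complex.I) ^ 2 * ‖κ z / κ q‖
          = κ z / κ q := by
        rw [← Complex.exp_nat_mul, Complex.log_im]
        have h2 := Complex.norm_mul_exp_arg_mul_I (κ z / κ q)
        rw [mul_comm] at h2
        rw [← h2]
        congr 2
        · push_cast; rw [h2]; ring
        · rw [h2]
      have h2 : κ z = κ q * (Complex.exp (((Complex.log (κ z / κ q)).im / 2 : ℝ) * Complex.I) ^ 2
          * ‖κ z / κ q‖) := by rw [h1, mul_div_cancel₀ _ (hκ0 q)]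
      have h3 : κ q = r₀ * m q.1 ^ 2 * a₀ ^ 2 := by
        rw [ha₀, ← hκ]
        have := hmc q.1
        field_simp
      rw [← hκe, inv_pow, mul_inv_eq_iff_eq_mul₀ (pow_ne_zero 2 ham), mul_pow, ha z]
      rw [Complex.ofReal_div (r₀ * m q.1 ^ 2 * ‖κ z / κ q‖), Complex.ofReal_mul (r₀ * m q.1 ^ 2),
        Complex.ofReal_mul r₀, Complex.ofReal_pow, Complex.ofReal_pow]
      have h4 := hmc z.1
      generalize Complex.exp (((Complex.log (κ z / κ q)).im / 2 : ℝ) * Complex.I) = e at h2 ⊢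
      generalize ((‖κ z / κ q‖ : ℝ) : ℂ) = n at h2 ⊢
      rw [h2, h3]
      field_simp
  · apply Subtype.ext
    change scale (a q) (unitRep g (Φ.patch.f q.1 : CCot S)) = u₀
    rw [ha, div_self (hκ0 q), Complex.log_one, hû, hpt, ← scale_mul, ← scale_mul, ha₀]
    simp only [Complex.zero_im, zero_div, Complex.ofReal_zero, zero_mul, Complex.exp_zero, mul_one]
    rw [mul_assoc, inv_mul_cancel₀ hmc₀, scale_one]

/-! ### Existence of the connection form -/

/-- Half of θ̃³ pulled back by a local lift is a local solution. Solutions of different lifts agree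
by uniqueness, so they glue. -/
theorem exists_connection (hS : IsOrientedAtlas S) (Φ : FeffermanChart g) :
    ∃ σ, Φ.frame.IsFeffermanConnection σ := by
  have hW := Φ.patch.isOpen
  have hθ := Φ.patch.contDiffOn_contactForm hS
  have hex : ∀ q : E6, ∃ (O : Set E6) (τ : E6 → CHat g), q ∈ Φ.domain →
      q ∈ O ∧ IsLocalLift (canonicalMap hS g) Φ O τ := by
    intro q
    by_cases hq : q ∈ Φ.domain
    · obtain ⟨u₀, hu₀⟩ := canonicalMap_surjective hS g (Φ.param q)
      obtain ⟨O, τ, h1, h2, _⟩ := Φ.exists_localLift hS hq hu₀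
      exact ⟨O, τ, fun _ => ⟨h1, h2⟩⟩
    -- Off the domain the values are irrelevant; they only make the choice total.
    · obtain ⟨u₀, -⟩ := canonicalMap_surjective hS g (Φ.param q)
      exact ⟨∅, fun _ => u₀, fun h => absurd h hq⟩
  choose O τ hO using hex
  obtain ⟨ρ, hρ⟩ : ∃ ρ : E6 → E6 → E6 →L[ℝ] ℂ, ∀ q, ρ q =
      pbForm (cTheta3 g (τ q q : CCot S).1) fun z => crd (τ q q : CCot S).1 (τ q z : CCot S) :=
    ⟨_, fun _ => rfl⟩
  have hA : ∀ q ∈ Φ.domain, ∃ l t, ∀ᶠ z in 𝓝 q, Φ.frame.AdaptedAt l t (ρ q) z := by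
    intro q hq
    rw [hρ]
    exact ⟨_, _, (hO q hq).2.eventually_adaptedAt (hO q hq).1 (mem_chart_source E3 _)⟩
  obtain ⟨σ', hσ'⟩ : ∃ σ' : E6 → E6 → E6 →L[ℝ] ℝ, ∀ q z, σ' q z =
      Complex.reCLM.comp ((1 / 2 : ℂ) • ρ q z) := ⟨_, fun _ _ => rfl⟩
  have hreal : ∀ q z, conjForm (ρ q z) = ρ q z → ofRealForm (σ' q z) = (1 / 2 : ℂ) • ρ q z := by
    intro q z h
    refine ContinuousLinearMap.ext fun v => ?_
    have h1 : conj (ρ q z v) = ρ q z v := congrArg (fun α : E6 →L[ℝ] ℂ => α v) h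
    have h2 : conj ((1 / 2 : ℂ) * ρ q z v) = (1 / 2 : ℂ) * ρ q z v := by
      rw [map_mul, h1, map_div₀, map_one, map_ofNat]
    rw [hσ']
    exact Complex.conj_eq_iff_re.1 h2
  have hsm : ∀ q z, ContDiffAt ℝ ∞ (ρ q) z → ContDiffAt ℝ ∞ (σ' q) z := by
    intro q z h
    have h1 : ContDiffAt ℝ ∞ (fun z => (1 / 2 : ℂ) • ρ q z) z := contDiffAt_smulForm contDiffAt_const h
    have h2 : σ' q = fun z => Complex.reCLM.comp ((1 / 2 : ℂ) • ρ q z) := funext (hσ' q)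
    rw [h2]
    exact contDiffAt_const.clm_comp h1
  -- Near z both σ' z and σ' q come from adapted coframes, so `connection_unique` identifies them at
  -- z. The diagonal z ↦ σ' z z is therefore locally one of the smooth solutions.
  have hloc : ∀ q ∈ Φ.domain, ∀ᶠ z in 𝓝 q, σ' z z = σ' q z := by
    intro q hq
    obtain ⟨l, t, h1⟩ := hA q hq
    filter_upwards [Φ.isOpen_domain.mem_nhds hq, h1.eventually_nhds] with z hz h2
    obtain ⟨l', t', h3⟩ := hA z hz
    have h4 := h3.self_of_nhds
    have hc : ∀ᶠ w in 𝓝 z, _ := h2.mono fun w hw =>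
      hw.isConnection hW hθ (σ := σ' q) (hw.eqs.real_ρ.mono fun w' hw' => hreal q w' hw')
    have h5 := h4.connection_unique h3 hW hθ (σ := σ' q)
      ((hsm q z h2.self_of_nhds.eqs.smooth_ρ).differentiableAt (by simp))
      (hc.mono fun w hw => hw.1) hc.self_of_nhds.2
    rw [← hreal z z h4.eqs.real_ρ.self_of_nhds] at h5
    refine ContinuousLinearMap.ext fun v => ?_
    have h6 : ((σ' q z v : ℝ) : ℂ) = (σ' z z v : ℝ) := congrArg (fun α : E6 →L[ℝ] ℂ => α v) h5
    exact_mod_cast h6.symm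
  have hev : ∀ q ∈ Φ.domain, ∀ᶠ z in 𝓝 q, ofRealForm (σ' z z) = (1 / 2 : ℂ) • ρ q z := by
    intro q hq
    obtain ⟨l, t, h1⟩ := hA q hq
    filter_upwards [hloc q hq, h1.self_of_nhds.eqs.real_ρ] with z h3 h4
    rw [h3, hreal q z h4]
  refine ⟨fun z => σ' z z, fun q hq => ?_, fun q hq => ?_, fun q hq => ?_⟩
  rotate_left
  · obtain ⟨l, t, h1⟩ := hA q hq
    exact (h1.self_of_nhds.isConnection hW hθ (σ := fun z => σ' z z) (hev q hq)).1
  · obtain ⟨l, t, h1⟩ := hA q hq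
    exact (h1.self_of_nhds.isConnection hW hθ (σ := fun z => σ' z z) (hev q hq)).2
  obtain ⟨l, t, h1⟩ := hA q hq
  exact ((hsm q q h1.self_of_nhds.eqs.smooth_ρ).congr_of_eventuallyEq (hloc q hq)).contDiffWithinAt

end FeffermanChart

end LocalLifts

/-! ### Trivializations of the Fefferman space from unit null covector fields. -/

section AdaptedCharts

open ComplexConjugate UnitAdmissibleFrame

variable {S : Type*} [TopologicalSpace S] [ChartedSpace E3 S] [IsManifold (𝓡 3) ∞ S] {g : Metric3 S}

/-! ### Local trivializations from unit null covector fields -/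

/-- Three covectors, the first of them real, as one map. -/
def coframeMap {E : Type*} [NormedAddCommGroup E] [NormedSpace ℝ E] (θ l τ : E →L[ℝ] ℂ) :
    E →L[ℝ] ℝ × ℂ × ℂ := (Complex.reCLM.comp θ).prod (l.prod τ)

variable (g) in
/-- A local parametrization of `M` by elements of `Ĉ` for which the pull backs of `θ`, `θ̃¹`, `θ̃²`,
computed in a fixed chart, form a coframe. -/
structure UnitPatch where
  W : Set E5
  isOpen : IsOpen W
  f : E5 → CHat g
  x₀ : S
  smooth : ContMDiffOn 𝓘(ℝ, E5) ICot ∞ (fun y => (f y : CCot S)) W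
  source : ∀ y ∈ W, (f y : CCot S).1 ∈ (chartAt E3 x₀).source
  inj : ∀ y ∈ W, ∀ y' ∈ W, ∀ c : ℂ, (f y' : CCot S) = scale c (f y : CCot S) → y = y'
  invertible : ∀ y ∈ W, (coframeMap (pbForm (cTheta g x₀) (fun y => crd x₀ (f y : CCot S)) y)
    (pbForm cTheta1 (fun y => crd x₀ (f y : CCot S)) y)
    (pbForm (cTheta2 g x₀) (fun y => crd x₀ (f y : CCot S)) y)).IsInvertible

namespace UnitPatch

variable (D : UnitPatch g) {y : E5}

/-- The pull back of `θ`. -/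
def θ : E5 → E5 →L[ℝ] ℂ := pbForm (cTheta g D.x₀) fun y => crd D.x₀ (D.f y : CCot S)

/-- The pull back of `θ̃¹`. -/
def l : E5 → E5 →L[ℝ] ℂ := pbForm cTheta1 fun y => crd D.x₀ (D.f y : CCot S)

/-- The pull back of `θ̃²`. -/
def τ : E5 → E5 →L[ℝ] ℂ := pbForm (cTheta2 g D.x₀) fun y => crd D.x₀ (D.f y : CCot S)

/-- The pull back of `θ̃³`. -/
def ρ : E5 → E5 →L[ℝ] ℂ := pbForm (cTheta3 g D.x₀) fun y => crd D.x₀ (D.f y : CCot S)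

/-- The frame vector with given components in the coframe. -/
def vec (y : E5) (x : ℝ × ℂ × ℂ) : E5 := (coframeMap (D.θ y) (D.l y) (D.τ y)).inverse x

theorem eventually_smooth (hy : y ∈ D.W) :
    ∀ᶠ y' in 𝓝 y, ContMDiffAt 𝓘(ℝ, E5) ICot ∞ (fun y => (D.f y : CCot S)) y' := by
  filter_upwards [D.isOpen.mem_nhds hy] with y' hy'
  exact D.smooth.contMDiffAt (D.isOpen.mem_nhds hy')

theorem smoothAt (hy : y ∈ D.W) : ContMDiffAt 𝓘(ℝ, E5) ICot ∞ (fun y => (D.f y : CCot S)) y :=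
  (D.eventually_smooth hy).self_of_nhds

theorem isUnitNull (hS : IsOrientedAtlas S) (hy : y ∈ D.W) :
    IsUnitNull g D.x₀ (fun y => crd D.x₀ (D.f y : CCot S)) y :=
  isUnitNull_crd hS (D.eventually_smooth hy) (D.source y hy) (Filter.Eventually.of_forall fun y => (D.f y).2)

theorem θ_eq (hS : IsOrientedAtlas S) (hy : y ∈ D.W) :
    D.θ y = pullForm (theta g) (fun y => (D.f y : CCot S)) y :=
  pbForm_cTheta hS (D.smoothAt hy) (D.source y hy)

theorem l_eq (hy : y ∈ D.W) : D.l y = pullForm theta1 (fun y => (D.f y : CCot S)) y :=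
  pbForm_cTheta1 (D.smoothAt hy) (D.source y hy)

theorem θ_re (hS : IsOrientedAtlas S) (hy : y ∈ D.W) (v : E5) : ((D.θ y v).re : ℂ) = D.θ y v := by
  rw [D.θ_eq hS hy, pullForm_apply, theta_re]

theorem vec_spec (hS : IsOrientedAtlas S) (hy : y ∈ D.W) (x : ℝ × ℂ × ℂ) :
    D.θ y (D.vec y x) = x.1 ∧ D.l y (D.vec y x) = x.2.1 ∧ D.τ y (D.vec y x) = x.2.2 := by
  have h : coframeMap (D.θ y) (D.l y) (D.τ y) (D.vec y x) = x := (D.invertible y hy).self_apply_inverse x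
  refine ⟨?_, congrArg (fun x => x.2.1) h, congrArg (fun x => x.2.2) h⟩
  have h1 : (D.θ y (D.vec y x)).re = x.1 := congrArg Prod.fst h
  rw [← D.θ_re hS hy, h1]

theorem ext_zero (hy : y ∈ D.W) {v : E5} (h0 : D.θ y v = 0) (h1 : D.l y v = 0) (h2 : D.τ y v = 0) :
    v = 0 := by
  apply (D.invertible y hy).injective
  rw [map_zero]
  change ((D.θ y v).re, D.l y v, D.τ y v) = 0
  rw [h0, h1, h2]
  rfl

theorem contDiffAt_θ (hS : IsOrientedAtlas S) (hy : y ∈ D.W) : ContDiffAt ℝ ∞ D.θ y :=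
  contDiffAt_pbForm (c := fun y => crd D.x₀ (D.f y : CCot S)) (z := y)
    (contDiffAt_cTheta hS (D.isUnitNull hS hy).mem) (D.isUnitNull hS hy).smooth

theorem contDiffAt_l (hS : IsOrientedAtlas S) (hy : y ∈ D.W) : ContDiffAt ℝ ∞ D.l y :=
  contDiffAt_pbForm contDiffAt_cTheta1 (D.isUnitNull hS hy).smooth

theorem contDiffAt_τ (hS : IsOrientedAtlas S) (hy : y ∈ D.W) : ContDiffAt ℝ ∞ D.τ y :=
  contDiffAt_pbForm (c := fun y => crd D.x₀ (D.f y : CCot S)) (z := y)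
    (contDiffAt_cTheta2 hS (D.isUnitNull hS hy).mem) (D.isUnitNull hS hy).smooth

theorem contDiffAt_coframeMap {E F : Type*} [NormedAddCommGroup E] [NormedSpace ℝ E]
    [NormedAddCommGroup F] [NormedSpace ℝ F] {z : F} {α β γ : F → E →L[ℝ] ℂ}
    (hα : ContDiffAt ℝ ∞ α z) (hβ : ContDiffAt ℝ ∞ β z) (hγ : ContDiffAt ℝ ∞ γ z) :
    ContDiffAt ℝ ∞ (fun z => coframeMap (α z) (β z) (γ z)) z := by
  have h1 : ContDiffAt ℝ ∞ (fun z => Complex.reCLM.comp (α z)) z := contDiffAt_const.clm_comp hα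
  have h2 : ∀ {E F G H : Type _} [NormedAddCommGroup E] [NormedSpace ℝ E] [NormedAddCommGroup F]
      [NormedSpace ℝ F] [NormedAddCommGroup G] [NormedSpace ℝ G] [NormedAddCommGroup H] [NormedSpace ℝ H]
      {z : H} {f : H → E →L[ℝ] F} {k : H → E →L[ℝ] G}, ContDiffAt ℝ ∞ f z → ContDiffAt ℝ ∞ k z →
      ContDiffAt ℝ ∞ (fun z => (f z).prod (k z)) z := fun {E F G H} _ _ _ _ _ _ _ _ {z f k} hf hk =>
    (ContinuousLinearMap.prodₗᵢ ℝ :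
      ((E →L[ℝ] F) × (E →L[ℝ] G)) ≃ₗᵢ[ℝ] (E →L[ℝ] F × G)).toContinuousLinearEquiv.contDiff.contDiffAt.comp
        z (hf.prodMk hk)
  exact h2 h1 (h2 hβ hγ)

theorem contDiffAt_vec (hS : IsOrientedAtlas S) (hy : y ∈ D.W) (x : ℝ × ℂ × ℂ) :
    ContDiffAt ℝ ∞ (fun y => D.vec y x) y := by
  have h1 := contDiffAt_coframeMap (D.contDiffAt_θ hS hy) (D.contDiffAt_l hS hy) (D.contDiffAt_τ hS hy)
  have h2 := ((D.invertible y hy).contDiffAt_map_inverse (n := ∞)).comp y h1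
  exact h2.clm_apply contDiffAt_const

theorem dOne_l (hS : IsOrientedAtlas S) (hy : y ∈ D.W) : dOne D.l y = Complex.I •
    (wedge (D.ρ y) (oneForm (D.l y)) - wedge (D.τ y) (oneForm (D.θ y))) :=
  dOne_cTheta1 (D.isUnitNull hS hy) hS

theorem dOne_θ (hS : IsOrientedAtlas S) (hy : y ∈ D.W) : dOne D.θ y = Complex.I •
    (wedge (D.l y) (oneForm (conjForm (D.τ y))) + wedge (D.τ y) (oneForm (conjForm (D.l y)))) :=
  dOne_cTheta (D.isUnitNull hS hy) hS

/-- On the common kernel of `θ` and `θ̃¹`, the form `θ̃²` does not depend on the chart. -/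
theorem evalC_τ (hS : IsOrientedAtlas S) (hy : y ∈ D.W) {z : E5 × E5} (h0 : evalC (D.θ y) z = 0)
    (h1 : evalC (D.l y) z = 0) :
    evalC (D.τ y) z = evalC (pullForm (theta2 g) (fun y => (D.f y : CCot S)) y) z := by
  have hu := D.eventually_smooth hy
  have hx := mem_chart_source E3 (D.f y : CCot S).1
  have hU := isUnitNull_crd hS hu hx (Filter.Eventually.of_forall fun y => (D.f y).2)
  have e1 := D.dOne_l hS hy
  have e2 := dOne_cTheta1 hU hS
  rw [dOne_congr ((pullForm_theta1_eventuallyEq hu hx).symm.trans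
    (pullForm_theta1_eventuallyEq hu (D.source y hy))), pbForm_cTheta2_self hu.self_of_nhds,
    pbForm_cTheta3_self hu.self_of_nhds, pbForm_cTheta1 hu.self_of_nhds hx,
    pbForm_cTheta hS hu.self_of_nhds hx, ← D.θ_eq hS hy, ← D.l_eq hy] at e2
  have e3 := e1.symm.trans e2
  -- Two charts give two expressions for the same dλ. Evaluated on z and a vector w with θ(w) = 1,
  -- λ(w) = 0, only −iτ(z) survives in each.
  obtain ⟨w, w0, w1, -⟩ : ∃ w, D.θ y w = 1 ∧ D.l y w = 0 ∧ True := by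
    obtain ⟨a, b, -⟩ := D.vec_spec hS hy (1, 0, 0)
    exact ⟨_, by simpa using a, b, trivial⟩
  have e4 := congrArg (fun ψ : E5 [⋀^Fin 2]→L[ℝ] ℂ => ψ ![z.1, w] + Complex.I * ψ ![z.2, w]) e3
  simp only [ContinuousAlternatingMap.smul_apply, ContinuousAlternatingMap.sub_apply,
    wedge_oneForm_apply, w0, w1, smul_eq_mul] at e4
  simp only [evalC] at h0 h1 ⊢
  have hI := Complex.I_ne_zero
  apply mul_left_cancel₀ hI
  linear_combination -e4 + (Complex.I * D.ρ y w - Complex.I * pullForm (theta3 g) (fun y => (D.f y : CCot S)) y w) * (-h1)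
    + (Complex.I * D.τ y w - Complex.I * pullForm (theta2 g) (fun y => (D.f y : CCot S)) y w) * h0

/-- The underlying local parametrization of the twistor space. -/
def toPatch (hS : IsOrientedAtlas S) : TwistorPatch g where
  W := D.W
  isOpen := D.isOpen
  f y := ⟨(D.f y : CCot S), nullCone_of_cHat (D.f y)⟩
  smooth := D.smooth
  inj := by
    intro y hy y' hy' h
    obtain ⟨c, _, hc⟩ := Quotient.exact h
    exact D.inj y hy y' hy' c hc
  immersive := by
    intro y hy v hv
    have hv : mapDeriv (fun y => (D.f y : CCot S)) y v ∈ vertical (D.f y : CCot S) := hv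
    obtain ⟨_, h2, h3, h4⟩ := (mem_vertical_iff (nullCone_of_cHat (D.f y))).1 hv
    have h0 : D.θ y v = 0 := by rw [D.θ_eq hS hy, pullForm_apply, h2]
    have h1 : D.l y v = 0 := by rw [D.l_eq hy, pullForm_apply, h3]
    refine D.ext_zero hy h0 h1 ?_
    have h5 := D.evalC_τ hS hy (z := (v, 0)) (by simp [evalC, h0]) (by simp [evalC, h1])
    simpa [evalC, pullForm_apply, theta2_eq, h4] using h5

theorem contactForm_toPatch (hS : IsOrientedAtlas S) (hy : y ∈ D.W) :
    (D.toPatch hS).contactForm y = D.θ y := by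
  refine ContinuousLinearMap.ext fun v => ?_
  rw [TwistorPatch.contactForm_apply, D.θ_eq hS hy]
  have : hrm g ((D.toPatch hS).f y : CCot S) = 1 := hrm_cHat (D.f y)
  rw [this, Complex.ofReal_one, inv_one, one_mul]
  rfl

theorem contactForm_eventuallyEq (hS : IsOrientedAtlas S) (hy : y ∈ D.W) :
    (D.toPatch hS).contactForm =ᶠ[𝓝 y] D.θ := by
  filter_upwards [D.isOpen.mem_nhds hy] with y' hy'
  exact D.contactForm_toPatch hS hy'

/-- The kernel D is cut out by θ, θ̃¹, `fC` and `fA`. Vectors are taken modulo vertical ones, and a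
vertical correction changes `fA` arbitrarily and nothing else, so the last condition disappears. -/
theorem mem_T01 (hS : IsOrientedAtlas S) (hy : y ∈ D.W) {z : E5 × E5} :
    z ∈ (D.toPatch hS).T01 y ↔
      evalC (D.θ y) z = 0 ∧ evalC (D.l y) z = 0 ∧ evalC (D.τ y) z = 0 := by
  have hp := nullCone_of_cHat (D.f y)
  obtain ⟨d, hd⟩ : ∃ d : E5 →L[ℝ] TCot, d = mapDeriv (fun y => (D.f y : CCot S)) y := ⟨_, rfl⟩
  have hθ : ∀ v, D.θ y v = theta g (D.f y : CCot S) (d v) := fun v => by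
    rw [D.θ_eq hS hy, pullForm_apply, hd]
  have hl : ∀ v, D.l y v = theta1 (D.f y : CCot S) (d v) := fun v => by
    rw [D.l_eq hy, pullForm_apply, hd]
  have hτ : ∀ v, pullForm (theta2 g) (fun y => (D.f y : CCot S)) y v =
      Complex.I * fC g (D.f y : CCot S) (d v) := fun v => by
    rw [pullForm_apply, hd, theta2_eq]
  have hB : ∀ v, fB g (D.f y : CCot S) (d v) = 0 := fun v => by
    rw [hd]
    exact mapDeriv_mem_tangentNull hS (D.smoothAt hy)
      (Filter.Eventually.of_forall fun y => nullCone_of_cHat (D.f y)) v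
  have hT : z ∈ (D.toPatch hS).T01 y ↔ ∃ c₁ ∈ vertical (D.f y : CCot S),
      ∃ c₂ ∈ vertical (D.f y : CCot S), (d z.1 + c₁, d z.2 + c₂) ∈ kernelD g (D.f y : CCot S) := by
    rw [hd]; exact Iff.rfl
  rw [hT]
  constructor
  · rintro ⟨c₁, hc₁, c₂, hc₂, hk⟩
    obtain ⟨_, a2, a3, a4⟩ := (mem_vertical_iff hp).1 hc₁
    obtain ⟨_, b2, b3, b4⟩ := (mem_vertical_iff hp).1 hc₂
    obtain ⟨_, k2, k3, k4, _⟩ := (mem_kernelD_iff hS hp).1 hk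
    simp only [evalC, map_add, a2, b2, a3, b3, a4, b4, add_zero] at k2 k3 k4
    have h0 : evalC (D.θ y) z = 0 := by rw [evalC, hθ, hθ, k2]
    have h1 : evalC (D.l y) z = 0 := by rw [evalC, hl, hl, k3]
    refine ⟨h0, h1, ?_⟩
    rw [D.evalC_τ hS hy h0 h1, evalC, hτ, hτ]
    linear_combination Complex.I * k4
  · rintro ⟨h0, h1, h2⟩
    rw [D.evalC_τ hS hy h0 h1] at h2
    have hH : (hrm g (D.f y : CCot S) : ℂ) = 1 := by rw [hrm_cHat]; simp
    obtain ⟨a, ha⟩ : ∃ a : ℂ, a = -(fA g (D.f y : CCot S) (d z.1)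
      + Complex.I * fA g (D.f y : CCot S) (d z.2)) := ⟨_, rfl⟩
    obtain ⟨v1, v2, v3, v4, v5⟩ := vertical_values hp a
    refine ⟨(0, a • covec (D.f y : CCot S)), ⟨a, rfl⟩, 0, ⟨0, ?_⟩, ?_⟩
    · exact Prod.ext rfl (ContinuousLinearMap.ext fun _ => (zero_mul _).symm)
    · rw [mem_kernelD_iff hS hp]
      simp only [evalC, hθ, hl, hτ] at h0 h1 h2
      simp only [evalC, map_add, v1, v2, v3, v4, v5, hB, hH, add_zero, and_self, true_and,
        mul_one]
      refine ⟨h0, h1, ?_, by rw [ha]; ring⟩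
      apply mul_left_cancel₀ Complex.I_ne_zero
      linear_combination h2

theorem evalC_parts {E : Type*} [NormedAddCommGroup E] [NormedSpace ℝ E] {α : E →L[ℝ] ℂ} {z : E × E}
    (h : evalC α (conjVec z) = 0) : α z.1 = evalC α z / 2 ∧ α z.2 = -(Complex.I / 2) * evalC α z := by
  simp only [evalC, conjVec, map_neg] at h ⊢
  constructor
  · linear_combination h / 2
  · linear_combination (Complex.I / 2) * h + α z.2 * Complex.I_mul_I

/-- The frame dual to the coframe. -/
def frame (hS : IsOrientedAtlas S) :
    UnitAdmissibleFrame (D.toPatch hS).W (D.toPatch hS).T10 (D.toPatch hS).contactForm where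
  T y := D.vec y (1, 0, 0)
  -- With values 1/2 and −i/2 on the two parts, a form takes the value 1 on Z and 0 on its
  -- conjugate.
  Z := ![fun y => (D.vec y (0, 1 / 2, 0), D.vec y (0, -(Complex.I / 2), 0)),
    fun y => (D.vec y (0, 0, 1 / 2), D.vec y (0, 0, -(Complex.I / 2)))]
  coframe := ![D.l, D.τ]
  h _ := !![0, 1; 1, 0]
  smooth_T y hy := (D.contDiffAt_vec hS hy _).contDiffWithinAt
  smooth_Z α y hy := by
    fin_cases α
    · exact ((D.contDiffAt_vec hS hy _).prodMk (D.contDiffAt_vec hS hy _)).contDiffWithinAt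
    · exact ((D.contDiffAt_vec hS hy _).prodMk (D.contDiffAt_vec hS hy _)).contDiffWithinAt
  smooth_coframe α y hy := by
    fin_cases α
    · exact (D.contDiffAt_l hS hy).contDiffWithinAt
    · exact (D.contDiffAt_τ hS hy).contDiffWithinAt
  reeb_one y hy := by
    rw [D.contactForm_toPatch hS hy, (D.vec_spec hS hy _).1]
    simp
  reeb_contract y hy v := by
    rw [dOne_congr (D.contactForm_eventuallyEq hS hy), D.dOne_θ hS hy]
    obtain ⟨_, h1, h2⟩ := D.vec_spec hS hy (1, 0, 0)
    simp only [ContinuousAlternatingMap.smul_apply, ContinuousAlternatingMap.add_apply,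
      wedge_oneForm_apply, conjForm_apply, h1, h2, map_zero]
    simp
  Z_mem y hy α := by
    refine (D.mem_T01 hS hy).2 ?_
    have key : ∀ x x' : ℝ × ℂ × ℂ, x.1 = 0 → x'.1 = 0 → x.2.1 = Complex.I * x'.2.1 →
        x.2.2 = Complex.I * x'.2.2 → evalC (D.θ y) (conjVec (D.vec y x, D.vec y x')) = 0 ∧
        evalC (D.l y) (conjVec (D.vec y x, D.vec y x')) = 0 ∧
        evalC (D.τ y) (conjVec (D.vec y x, D.vec y x')) = 0 := by
      intro x x' e1 e2 e3 e4
      obtain ⟨a1, a2, a3⟩ := D.vec_spec hS hy x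
      obtain ⟨b1, b2, b3⟩ := D.vec_spec hS hy x'
      simp only [evalC, conjVec, map_neg, a1, a2, a3, b1, b2, b3, e1, e2, e3, e4]
      simp
    fin_cases α
    · exact key _ _ rfl rfl (by simp; linear_combination (1 / 2 : ℂ) * Complex.I_mul_I) (by simp)
    · exact key _ _ rfl rfl (by simp) (by simp; linear_combination (1 / 2 : ℂ) * Complex.I_mul_I)
  Z_span y hy z hz := by
    obtain ⟨h0, h1, h2⟩ := (D.mem_T01 hS hy).1 hz
    obtain ⟨l1, l2⟩ := evalC_parts h1
    obtain ⟨t1, t2⟩ := evalC_parts h2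
    have hr := D.θ_re hS hy
    have h00 : D.θ y z.1 = 0 ∧ D.θ y z.2 = 0 := by
      simp only [evalC, conjVec, map_neg] at h0
      rw [← hr z.1, ← hr z.2] at h0 ⊢
      have a := congrArg Complex.re h0
      have b := congrArg Complex.im h0
      simp at a b
      simp [a, b]
    refine ⟨![evalC (D.l y) z, evalC (D.τ y) z], ?_⟩
    generalize evalC (D.l y) z = a at *
    generalize evalC (D.τ y) z = b at *
    obtain ⟨p1, p2, p3⟩ := D.vec_spec hS hy (0, 1 / 2, 0)
    obtain ⟨q1, q2, q3⟩ := D.vec_spec hS hy (0, -(Complex.I / 2), 0)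
    obtain ⟨r1, r2, r3⟩ := D.vec_spec hS hy (0, 0, 1 / 2)
    obtain ⟨s1, s2, s3⟩ := D.vec_spec hS hy (0, 0, -(Complex.I / 2))
    simp only [Fin.sum_univ_two, Matrix.cons_val_zero, Matrix.cons_val_one]
    apply Prod.ext
    · refine sub_eq_zero.1 (D.ext_zero hy ?_ ?_ ?_)
      · simp only [map_sub, map_add, map_smul, h00.1, p1, q1, r1, s1]
        simp
      · simp only [map_sub, map_add, map_smul, l1, p2, q2, r2, s2, Complex.real_smul]
        linear_combination (-1 / 2 : ℂ) * Complex.re_add_im a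
      · simp only [map_sub, map_add, map_smul, t1, p3, q3, r3, s3, Complex.real_smul]
        linear_combination (-1 / 2 : ℂ) * Complex.re_add_im b
    · refine sub_eq_zero.1 (D.ext_zero hy ?_ ?_ ?_)
      · simp only [map_sub, map_add, map_smul, h00.2, p1, q1, r1, s1]
        simp
      · simp only [map_sub, map_add, map_smul, l2, p2, q2, r2, s2, Complex.real_smul]
        linear_combination (Complex.I / 2 : ℂ) * Complex.re_add_im a - (a.im / 2 : ℂ) * Complex.I_mul_I
      · simp only [map_sub, map_add, map_smul, t2, p3, q3, r3, s3, Complex.real_smul]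
        linear_combination (Complex.I / 2 : ℂ) * Complex.re_add_im b - (b.im / 2 : ℂ) * Complex.I_mul_I
  theta_Z y hy α := by
    rw [D.contactForm_toPatch hS hy]
    fin_cases α <;> simp [evalC, (D.vec_spec hS hy _).1]
  coframe_T y hy α := by
    fin_cases α <;> simp [(D.vec_spec hS hy _).2.1, (D.vec_spec hS hy _).2.2]
  coframe_Z y hy α β := by
    fin_cases α <;> fin_cases β <;>
      simp [evalC, (D.vec_spec hS hy _).2.1, (D.vec_spec hS hy _).2.2] <;>
      linear_combination (-1 / 2 : ℂ) * Complex.I_mul_I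
  coframe_conjZ y hy α β := by
    fin_cases α <;> fin_cases β <;>
      simp [evalC, conjVec, (D.vec_spec hS hy _).2.1, (D.vec_spec hS hy _).2.2] <;>
      linear_combination (1 / 2 : ℂ) * Complex.I_mul_I
  levi y hy v w := by
    rw [dOne_congr (D.contactForm_eventuallyEq hS hy), D.dOne_θ hS hy]
    simp only [ContinuousAlternatingMap.smul_apply, ContinuousAlternatingMap.add_apply,
      wedge_oneForm_apply, conjForm_apply, Fin.sum_univ_two, Matrix.cons_val_zero, Matrix.cons_val_one,
      Matrix.of_apply, smul_eq_mul]
    simp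
  unit_det y _ := by simp [Matrix.det_fin_two]

/-- The element of the canonical bundle with coefficient `κ`. -/
def _root_.TwistorFefferman.CanonicalElement.smul (κ : ℂ) (hκ : κ ≠ 0) (k : CanonicalElement g) :
    CanonicalElement g where
  pt := k.pt
  pt_mem := k.pt_mem
  form := κ • k.form
  vertical_contract c hc v hv w hw := by
    rw [ContinuousAlternatingMap.smul_apply, k.vertical_contract c hc v hv w hw, smul_zero]
  kernel_contract z hz v hv w hw := by
    rw [ContinuousAlternatingMap.smul_apply, ContinuousAlternatingMap.smul_apply]
    simp only [smul_eq_mul]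
    linear_combination κ * k.kernel_contract z hz v hv w hw
  ne_zero := by
    obtain ⟨v, hv, h⟩ := k.ne_zero
    exact ⟨v, hv, mul_ne_zero hκ h⟩

/-- The local trivialization of the Fefferman space. -/
def toChart (hS : IsOrientedAtlas S) : FeffermanChart g where
  patch := D.toPatch hS
  frame := D.frame hS
  elt q := (canonicalElt hS (D.f q.1 : CCot S) (nullCone_of_cHat (D.f q.1))).smul
    (Complex.exp (Complex.I * q.2)) (Complex.exp_ne_zero _)
  elt_pt q hq := rfl
  elt_form q hq v := by
    have h := pull_theta012 (g := g) hS (D.eventually_smooth hq.1) (D.source q.1 hq.1)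
      (Filter.Eventually.of_forall fun y => (D.f y).2) v
    rw [canonicalForm, D.contactForm_toPatch hS hq.1]
    exact congrArg (fun c => Complex.exp (Complex.I * q.2) * c) h.symm

theorem coef_elt (hS : IsOrientedAtlas S) (q : E6) :
    ((D.toChart hS).elt q).coef hS = Complex.exp (Complex.I * q.2) :=
  CanonicalElement.coef_unique hS _ fun _ _ => rfl

end UnitPatch

end AdaptedCharts

/-! ### The conic of null directions, and unit null covectors by orthogonalization. -/

section Stereographic

open ComplexConjugate

variable {G : Matrix (Fin 3) (Fin 3) ℝ} {z ζ : Fin 3 → ℂ} {w : ℂ}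

/-! ### Stereographic parametrization of the null cone of a positive definite form -/

theorem pairC_add_left (G : Matrix (Fin 3) (Fin 3) ℝ) (a b c : Fin 3 → ℂ) :
    pairC G (a + b) c = pairC G a c + pairC G b c := by
  simp [pairC, upC, Matrix.mulVec_add]

theorem pairC_smul_left (G : Matrix (Fin 3) (Fin 3) ℝ) (t : ℂ) (a b : Fin 3 → ℂ) :
    pairC G (t • a) b = t * pairC G a b := by
  simp [pairC, upC, Matrix.mulVec_smul]

theorem pairC_add_right (G : Matrix (Fin 3) (Fin 3) ℝ) (a b c : Fin 3 → ℂ) :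
    pairC G a (b + c) = pairC G a b + pairC G a c := by
  simp [pairC]

theorem pairC_smul_right (G : Matrix (Fin 3) (Fin 3) ℝ) (t : ℂ) (a b : Fin 3 → ℂ) :
    pairC G a (t • b) = t * pairC G a b := by
  simp [pairC]

theorem conjC_add (z w : Fin 3 → ℂ) : conjC (z + w) = conjC z + conjC w := by
  funext i
  simp [conjC]

/-- The covector is null and has hermitian square one. -/
structure IsUnitCovector (G : Matrix (Fin 3) (Fin 3) ℝ) (z : Fin 3 → ℂ) : Prop where
  posDef : G.PosDef
  null : pairC G z z = 0
  unit : pairC G z (conjC z) = 1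

namespace IsUnitCovector

theorem null_conj (h : IsUnitCovector G z) : pairC G (conjC z) (conjC z) = 0 := by
  rw [← conj_pairC, h.null, map_zero]

theorem conj_unit (h : IsUnitCovector G z) : pairC G (conjC z) z = 1 := by
  rw [pairC_comm h.posDef, h.unit]

theorem eta_left (h : IsUnitCovector G z) : pairC G (realC (etaD G z)) z = 0 := by
  rw [pairC, upC_etaD h.posDef, etaU_dot]

theorem eta_right (h : IsUnitCovector G z) : pairC G z (realC (etaD G z)) = 0 := by
  rw [pairC_comm h.posDef, h.eta_left]

theorem eta_conj_left (h : IsUnitCovector G z) : pairC G (realC (etaD G z)) (conjC z) = 0 := by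
  rw [pairC, upC_etaD h.posDef, etaU_conjC]

theorem eta_conj_right (h : IsUnitCovector G z) : pairC G (conjC z) (realC (etaD G z)) = 0 := by
  rw [pairC_comm h.posDef, h.eta_conj_left]

theorem eta_eta (h : IsUnitCovector G z) :
    pairC G (realC (etaD G z)) (realC (etaD G z)) = 1 := by
  have h1 := h.unit
  rw [pairC_conjC h.posDef] at h1
  rw [pairC, upC_etaD h.posDef, etaU_dot_etaD h.posDef h.null, h1, one_pow]

theorem expand (h : IsUnitCovector G z) (ζ : Fin 3 → ℂ) :
    ζ = pairC G ζ (conjC z) • z + pairC G ζ (realC (etaD G z)) • realC (etaD G z)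
      + pairC G ζ z • conjC z := by
  have := expand_of_biorthogonal ![upC G (conjC z), upC G (realC (etaD G z)), upC G z]
    ![z, realC (etaD G z), conjC z] (fun i j => by
      fin_cases i <;> fin_cases j
      exacts [h.conj_unit, h.eta_conj_right, h.null_conj, h.eta_left, h.eta_eta, h.eta_conj_left,
        h.null, h.eta_right, h.unit]) ζ
  rw [Fin.sum_univ_three] at this
  rw [pairC_comm h.posDef ζ, pairC_comm h.posDef ζ, pairC_comm h.posDef ζ]
  exact this

end IsUnitCovector

/-- The positive factor in the stereographic parametrization. -/
def stereoFactor (w : ℂ) : ℝ := (1 + Complex.normSq w / 2)⁻¹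

theorem stereoFactor_pos (w : ℂ) : 0 < stereoFactor w :=
  inv_pos.2 (by have := Complex.normSq_nonneg w; positivity)

/-- The unit null covector with stereographic coordinate `w` with respect to the unit null covector
`z`. -/
def stereo (G : Matrix (Fin 3) (Fin 3) ℝ) (z : Fin 3 → ℂ) (w : ℂ) : Fin 3 → ℂ :=
  (stereoFactor w : ℂ) • (z + w • realC (etaD G z) + (-(w ^ 2 / 2)) • conjC z)

theorem pairC_stereo_conj (h : IsUnitCovector G z) (w : ℂ) :
    pairC G (stereo G z w) (conjC z) = stereoFactor w := by
  simp only [stereo, pairC_smul_left, pairC_add_left, h.unit, h.eta_conj_left, h.null_conj]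
  ring

theorem pairC_stereo_eta (h : IsUnitCovector G z) (w : ℂ) :
    pairC G (stereo G z w) (realC (etaD G z)) = stereoFactor w * w := by
  simp only [stereo, pairC_smul_left, pairC_add_left, h.eta_right, h.eta_eta, h.eta_conj_right]
  ring

/-- In the triad (z, η, z̄) the square of z + wη − (w²/2)z̄ is w² − w² = 0, and its hermitian square
is 1 + |w|² + |w|⁴/4 = (1 + |w|²/2)². -/
theorem isUnitCovector_stereo (h : IsUnitCovector G z) (w : ℂ) : IsUnitCovector G (stereo G z w) where
  posDef := h.posDef
  null := by
    simp only [stereo, pairC_smul_left, pairC_add_left, pairC_smul_right, pairC_add_right, h.null,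
      h.unit, h.conj_unit, h.null_conj, h.eta_left, h.eta_right, h.eta_eta, h.eta_conj_left,
      h.eta_conj_right]
    ring
  unit := by
    have hw : (Complex.normSq w : ℂ) = w * conj w := (Complex.mul_conj w).symm
    have h1 : (1 + w * conj w / 2) * (stereoFactor w : ℂ) = 1 := by
      have hne : (1 + Complex.normSq w / 2) ≠ 0 := by
        have := Complex.normSq_nonneg w
        positivity
      have := mul_inv_cancel₀ hne
      rw [← hw, stereoFactor]
      exact_mod_cast this
    simp only [stereo, conjC_smul, conjC_add, conjC_conjC, conjC_realC, pairC_smul_left, pairC_add_left,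
      pairC_smul_right, pairC_add_right, h.null, Complex.conj_ofReal, map_neg, map_div₀, map_pow,
      h.unit, h.conj_unit, h.null_conj, h.eta_left, h.eta_right, h.eta_eta, h.eta_conj_left,
      h.eta_conj_right, Complex.conj_ofNat]
    linear_combination ((1 + w * conj w / 2) * (stereoFactor w : ℂ) + 1) * h1

/-- A null covector is a multiple of the unit null covector with the same stereographic coordinate. -/
theorem eq_smul_stereo (h : IsUnitCovector G z) (h0 : pairC G ζ ζ = 0)
    (h1 : pairC G ζ (conjC z) ≠ 0) :
    ζ = (pairC G ζ (conjC z) / stereoFactor (pairC G ζ (realC (etaD G z)) / pairC G ζ (conjC z))) •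
      stereo G z (pairC G ζ (realC (etaD G z)) / pairC G ζ (conjC z)) := by
  have h2 := h.expand ζ
  generalize pairC G ζ (conjC z) = α at *
  generalize pairC G ζ (realC (etaD G z)) = β at *
  generalize pairC G ζ z = γ at *
  -- Nullity in the triad. Since α ≠ 0 it determines the z̄-component from the other two.
  have h3 : β ^ 2 + 2 * α * γ = 0 := by
    rw [← h0, h2]
    simp only [pairC_smul_left, pairC_add_left, pairC_smul_right, pairC_add_right, h.null,
      h.unit, h.conj_unit, h.null_conj, h.eta_left, h.eta_right, h.eta_eta, h.eta_conj_left,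
      h.eta_conj_right]
    ring
  have hm : (stereoFactor (β / α) : ℂ) ≠ 0 := Complex.ofReal_ne_zero.2 (stereoFactor_pos _).ne'
  rw [stereo, smul_smul, div_mul_cancel₀ _ hm, smul_add, smul_add, smul_smul, smul_smul,
    mul_div_cancel₀ _ h1]
  have h4 : α * -((β / α) ^ 2 / 2) = γ := by
    field_simp
    linear_combination -h3
  rw [h4]
  exact h2

/-! ### Extension of a unit null covector to nearby forms -/

/-- The unit null covector for `G` obtained from the real and imaginary parts `a`, `b` of a given one
by orthogonalization. -/
def orthoNull (G : Matrix (Fin 3) (Fin 3) ℝ) (a b : Fin 3 → ℝ) : Fin 3 → ℂ := fun i =>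
  (((Real.sqrt (2 * pairR G a a))⁻¹ * a i : ℝ) : ℂ) +
    (((Real.sqrt (2 * pairR G (b - (pairR G a b / pairR G a a) • a)
      (b - (pairR G a b / pairR G a a) • a)))⁻¹ * (b - (pairR G a b / pairR G a a) • a) i : ℝ) : ℂ) *
      Complex.I

theorem pairR_smul_smul (G : Matrix (Fin 3) (Fin 3) ℝ) (s t : ℝ) (a b : Fin 3 → ℝ) :
    pairR G (s • a) (t • b) = s * t * pairR G a b := by
  simp [pairR, Matrix.mulVec_smul]
  ring

/-- Gram–Schmidt on the two real parts: orthogonal with equal length means null, and squared lengths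
1/2 give hermitian square one. -/
theorem isUnitCovector_orthoNull (hG : G.PosDef) {a b : Fin 3 → ℝ} (ha : a ≠ 0)
    (hb : b - (pairR G a b / pairR G a a) • a ≠ 0) : IsUnitCovector G (orthoNull G a b) := by
  have pa := pairR_pos hG ha
  have pb := pairR_pos hG hb
  have hab : pairR G a (b - (pairR G a b / pairR G a a) • a) = 0 := by
    have : pairR G a (b - (pairR G a b / pairR G a a) • a) =
        pairR G a b - (pairR G a b / pairR G a a) * pairR G a a := by simp [pairR]
    rw [this]
    field_simp
    ring
  have hre : (fun i => (orthoNull G a b i).re) = (Real.sqrt (2 * pairR G a a))⁻¹ • a := by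
    funext i
    simp only [orthoNull, Complex.add_re, Complex.mul_re,
      Complex.ofReal_re, Complex.ofReal_im, Complex.I_re, Complex.I_im, Pi.smul_apply, smul_eq_mul]
    ring
  have him : (fun i => (orthoNull G a b i).im) = (Real.sqrt (2 * pairR G
      (b - (pairR G a b / pairR G a a) • a) (b - (pairR G a b / pairR G a a) • a)))⁻¹ •
      (b - (pairR G a b / pairR G a a) • a) := by
    funext i
    simp only [orthoNull, Complex.add_im, Complex.mul_im,
      Complex.ofReal_re, Complex.ofReal_im, Complex.I_re, Complex.I_im, Pi.smul_apply, smul_eq_mul]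
    ring
  have key : ∀ t : ℝ, 0 < t → (Real.sqrt (2 * t))⁻¹ * (Real.sqrt (2 * t))⁻¹ * t = 1 / 2 := by
    intro t ht
    rw [← mul_inv, Real.mul_self_sqrt (by positivity)]
    field_simp
  refine ⟨hG, ?_, ?_⟩
  · rw [pairC_re_im hG, hre, him, pairR_smul_smul, pairR_smul_smul, pairR_smul_smul, hab, key _ pa,
      key _ pb]
    simp
  · rw [pairC_conj_re_im hG, hre, him, pairR_smul_smul, pairR_smul_smul, key _ pa, key _ pb]
    norm_num

theorem IsUnitCovector.parts (h : IsUnitCovector G z) :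
    pairR G (fun i => (z i).re) (fun i => (z i).re) = 1 / 2 ∧
      pairR G (fun i => (z i).im) (fun i => (z i).im) = 1 / 2 ∧
      pairR G (fun i => (z i).re) (fun i => (z i).im) = 0 := by
  have h1 := h.null
  have h2 := h.unit
  rw [pairC_re_im h.posDef] at h1
  rw [pairC_conj_re_im h.posDef] at h2
  have h3 := congrArg Complex.re h1
  have h4 := congrArg Complex.im h1
  have h5 := congrArg Complex.re h2
  simp only [Complex.add_re, Complex.add_im, Complex.ofReal_re, Complex.ofReal_im, Complex.mul_re,
    Complex.mul_im, Complex.I_re, Complex.I_im, Complex.zero_re, Complex.zero_im, Complex.one_re] at h3 h4 h5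
  refine ⟨by linarith, by linarith, by linarith⟩

theorem IsUnitCovector.orthoNull_self (h : IsUnitCovector G z) :
    orthoNull G (fun i => (z i).re) (fun i => (z i).im) = z := by
  obtain ⟨h1, h2, h3⟩ := h.parts
  funext i
  rw [orthoNull, h3, zero_div, zero_smul, sub_zero, h1, h2]
  norm_num

/-- The orthogonalization does not degenerate. -/
theorem IsUnitCovector.independent (h : IsUnitCovector G z) :
    (fun i => (z i).re) ≠ 0 ∧ ∀ t : ℝ, (fun i => (z i).im) - t • (fun i => (z i).re) ≠ 0 := by
  obtain ⟨h1, h2, h3⟩ := h.parts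
  refine ⟨fun h0 => ?_, fun t ht => ?_⟩
  · rw [h0] at h1
    simp [pairR] at h1
  · have h4 : (fun i => (z i).im) = t • (fun i => (z i).re) := sub_eq_zero.1 ht
    have h5 : pairR G (fun i => (z i).re) (fun i => (z i).im) = t * (1 / 2) := by
      rw [h4, ← one_smul ℝ (fun i => (z i).re), pairR_smul_smul, one_smul, h1]
      ring
    have h6 : t = 0 := by linarith
    rw [h4, h6] at h2
    simp [pairR] at h2

end Stereographic

/-! ### The stereographic patch around an element of `CHat`. -/

section StereographicPatch

open ComplexConjugate

/-! ### Smooth dependence on parameters -/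

section Smooth

variable {E : Type*} [NormedAddCommGroup E] [NormedSpace ℝ E] {z₀ : E}
  {G : E → Matrix (Fin 3) (Fin 3) ℝ}

theorem ContDiffAt.pairR {a b : E → Fin 3 → ℝ} (hG : ∀ i j, ContDiffAt ℝ ∞ (fun z => G z i j) z₀)
    (h0 : (G z₀).det ≠ 0) (ha : ∀ i, ContDiffAt ℝ ∞ (fun z => a z i) z₀)
    (hb : ∀ i, ContDiffAt ℝ ∞ (fun z => b z i) z₀) :
    ContDiffAt ℝ ∞ (fun z => pairR (G z) (a z) (b z)) z₀ := by
  unfold TwistorFefferman.pairR Matrix.mulVec dotProduct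
  exact ContDiffAt.sum fun i _ => (ContDiffAt.sum fun j _ =>
    (ContDiffAt.matrix_inv hG h0 i j).mul (ha j)).mul (hb i)

theorem ContDiffAt.orthoNull {a b : Fin 3 → ℝ} (hG : ∀ i j, ContDiffAt ℝ ∞ (fun z => G z i j) z₀)
    (h0 : (G z₀).PosDef) (ha : a ≠ 0) (hb : ∀ t : ℝ, b - t • a ≠ 0) (i : Fin 3) :
    ContDiffAt ℝ ∞ (fun z => orthoNull (G z) a b i) z₀ := by
  have hd := h0.det_pos.ne'
  have h1 := ContDiffAt.pairR (a := fun _ => a) (b := fun _ => a) hG hd (fun _ => contDiffAt_const)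
    (fun _ => contDiffAt_const)
  have h2 := ContDiffAt.pairR (a := fun _ => a) (b := fun _ => b) hG hd (fun _ => contDiffAt_const)
    (fun _ => contDiffAt_const)
  have p1 := pairR_pos h0 ha
  have h3 : ∀ i, ContDiffAt ℝ ∞ (fun z => (b - (TwistorFefferman.pairR (G z) a b /
      TwistorFefferman.pairR (G z) a a) • a) i) z₀ := fun i =>
    contDiffAt_const.sub ((h2.div h1 p1.ne').mul contDiffAt_const)
  have h4 := ContDiffAt.pairR hG hd h3 h3
  have p2 := pairR_pos h0 (hb (TwistorFefferman.pairR (G z₀) a b / TwistorFefferman.pairR (G z₀) a a))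
  have key : ∀ f : E → ℝ, ContDiffAt ℝ ∞ f z₀ → 0 < f z₀ →
      ContDiffAt ℝ ∞ (fun z => (Real.sqrt (2 * f z))⁻¹) z₀ := fun f hf hp =>
    ((contDiffAt_const.mul hf).sqrt (by positivity)).inv (Real.sqrt_pos.2 (by positivity)).ne'
  exact (ContDiffAt.ofReal ((key _ h1 p1).mul contDiffAt_const)).add
    ((ContDiffAt.ofReal ((key _ h4 p2).mul (h3 i))).mul contDiffAt_const)

theorem contDiff_stereoFactor : ContDiff ℝ ∞ stereoFactor := by
  unfold stereoFactor
  have h : ContDiff ℝ ∞ (fun w : ℂ => 1 + Complex.normSq w / 2) := by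
    simp only [Complex.normSq_apply]
    exact contDiff_const.add (((Complex.reCLM.contDiff.mul Complex.reCLM.contDiff).add
      (Complex.imCLM.contDiff.mul Complex.imCLM.contDiff)).div_const 2)
  exact h.inv fun w => by have := Complex.normSq_nonneg w; positivity

theorem ContDiffAt.stereo {Z : E → Fin 3 → ℂ} {w : E → ℂ}
    (hG : ∀ i j, ContDiffAt ℝ ∞ (fun z => G z i j) z₀)
    (h0 : 0 < (G z₀).det) (hZ : ∀ i, ContDiffAt ℝ ∞ (fun z => Z z i) z₀) (hw : ContDiffAt ℝ ∞ w z₀)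
    (i : Fin 3) : ContDiffAt ℝ ∞ (fun z => stereo (G z) (Z z) (w z) i) z₀ := by
  have h1 := ContDiffAt.ofReal (contDiff_stereoFactor.contDiffAt.comp z₀ hw)
  have h2 : ContDiffAt ℝ ∞ (fun z => conj (Z z i)) z₀ := Complex.conjCLE.contDiff.contDiffAt.comp z₀ (hZ i)
  exact h1.mul (((hZ i).add (hw.mul (ContDiffAt.ofReal (ContDiffAt.etaD hG h0 hZ i)))).add
    ((((hw.pow 2).div_const 2).neg).mul h2))

theorem ContDiffAt.ofComp {Z : E → Fin 3 → ℂ} (hZ : ∀ i, ContDiffAt ℝ ∞ (fun z => Z z i) z₀) :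
    ContDiffAt ℝ ∞ (fun z => ofComp (Z z)) z₀ :=
  ContDiffAt.sum fun i _ => contDiffAt_smulForm (hZ i) contDiffAt_const

end Smooth

/-! ### The stereographic patch around an element of `Ĉ` -/

theorem crdInv_mem_source {S : Type*} [TopologicalSpace S] [ChartedSpace E3 S] {x₀ : S} {q : TCot} (hq : q.1 ∈ (chartAt E3 x₀).target) :
    (crdInv x₀ q).1 ∈ (chartAt E3 x₀).source := by
  have h : (extChartAt (𝓡 3) x₀).symm q.1 ∈ (extChartAt (𝓡 3) x₀).source :=
    (extChartAt (𝓡 3) x₀).map_target (by simpa using hq)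
  rwa [extChartAt_source] at h

variable {S : Type*} [TopologicalSpace S] [ChartedSpace E3 S] [IsManifold (𝓡 3) ∞ S] {g : Metric3 S}

/-- Identification of `ℝ⁵` with `ℝ³ × ℂ`. -/
def splitE5 : E5 ≃L[ℝ] E3 × ℂ := ContinuousLinearEquiv.ofFinrankEq (by simp)

theorem isUnitCovector_comp (u : CHat g) : IsUnitCovector (gram g (u : CCot S).1) (comp (u : CCot S)) :=
  ⟨gram_posDef g _, u.2.1, u.2.2⟩

theorem isUnitCovector_crd (hS : IsOrientedAtlas S) (u : CHat g) {x₀ : S}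
    (hx : (u : CCot S).1 ∈ (chartAt E3 x₀).source) :
    IsUnitCovector (gramC g x₀ (crd x₀ (u : CCot S)).1) (compv (crd x₀ (u : CCot S)).2) where
  posDef := gramC_posDef hS g (crd_mem_target hx)
  null := by rw [← nullFn_crd hS g hx]; exact u.2.1
  unit := by rw [← hermFn_crd hS g hx]; exact u.2.2

/-- The extension of `u₀` to a local unit null covector field, in the chart at its base point. -/
def baseNull (u₀ : CHat g) (y : E3) : Fin 3 → ℂ :=
  orthoNull (gramC g (u₀ : CCot S).1 y) (fun i => (comp (u₀ : CCot S) i).re)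
    (fun i => (comp (u₀ : CCot S) i).im)

/-- The coordinates of the element of `Ĉ` with given base point and stereographic coordinate. -/
def stereoCrd (u₀ : CHat g) (q : E3 × ℂ) : TCot :=
  (q.1, ofComp (stereo (gramC g (u₀ : CCot S).1 q.1) (baseNull u₀ q.1) q.2))

variable {u₀ : CHat g} {q : E3 × ℂ}

theorem isUnitCovector_baseNull (hS : IsOrientedAtlas S) {y : E3}
    (hy : y ∈ (chartAt E3 (u₀ : CCot S).1).target) :
    IsUnitCovector (gramC g (u₀ : CCot S).1 y) (baseNull u₀ y) :=
  isUnitCovector_orthoNull (gramC_posDef hS g hy) (isUnitCovector_comp u₀).independent.1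
    ((isUnitCovector_comp u₀).independent.2 _)

theorem baseNull_self (u₀ : CHat g) :
    baseNull u₀ (extChartAt (𝓡 3) (u₀ : CCot S).1 (u₀ : CCot S).1) = comp (u₀ : CCot S) := by
  rw [baseNull, gramC_self, (isUnitCovector_comp u₀).orthoNull_self]

theorem contDiffAt_baseNull (hS : IsOrientedAtlas S) {y : E3}
    (hy : y ∈ (chartAt E3 (u₀ : CCot S).1).target) (i : Fin 3) :
    ContDiffAt ℝ ∞ (fun y => baseNull u₀ y i) y :=
  ContDiffAt.orthoNull (contDiffAt_gramC g hy) (gramC_posDef hS g hy)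
    (isUnitCovector_comp u₀).independent.1 (isUnitCovector_comp u₀).independent.2 i

theorem contDiffAt_stereoCrd (hS : IsOrientedAtlas S)
    (hq : q.1 ∈ (chartAt E3 (u₀ : CCot S).1).target) : ContDiffAt ℝ ∞ (stereoCrd u₀) q := by
  refine contDiffAt_fst.prodMk (ContDiffAt.ofComp fun i => ContDiffAt.stereo (z₀ := q)
    (G := fun q => gramC g (u₀ : CCot S).1 q.1) (Z := fun q => baseNull u₀ q.1) (w := fun q => q.2)
    (fun i j => ?_) (gramC_posDef hS g hq).det_pos (fun i => ?_) contDiffAt_snd i)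
  · exact ContDiffAt.comp (g := fun y => gramC g (u₀ : CCot S).1 y i j) q
      (contDiffAt_gramC g hq i j) contDiffAt_fst
  · exact ContDiffAt.comp (g := fun y => baseNull u₀ y i) q (contDiffAt_baseNull hS hq i) contDiffAt_fst

theorem crdInv_stereoCrd_mem (hS : IsOrientedAtlas S)
    (hq : q.1 ∈ (chartAt E3 (u₀ : CCot S).1).target) :
    crdInv (u₀ : CCot S).1 (stereoCrd u₀ q) ∈ CHat g := by
  have hq' : (stereoCrd u₀ q).1 ∈ (chartAt E3 (u₀ : CCot S).1).target := hq
  have hx := crdInv_mem_source hq'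
  have hu := isUnitCovector_stereo (isUnitCovector_baseNull (u₀ := u₀) hS hq) q.2
  constructor
  · rw [nullFn_crd hS g hx, crd_crdInv hq', stereoCrd, compv_ofComp, hu.null]
  · rw [hermFn_crd hS g hx, crd_crdInv hq', stereoCrd, compv_ofComp, hu.unit]

open Classical in
/-- The stereographic parametrization. -/
def stereoMap (u₀ : CHat g) (y : E5) : CHat g :=
  if h : crdInv (u₀ : CCot S).1 (stereoCrd u₀ (splitE5 y)) ∈ CHat g then ⟨_, h⟩ else u₀

theorem coe_stereoMap (hS : IsOrientedAtlas S) {y : E5}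
    (hy : (splitE5 y).1 ∈ (chartAt E3 (u₀ : CCot S).1).target) :
    (stereoMap u₀ y : CCot S) = crdInv (u₀ : CCot S).1 (stereoCrd u₀ (splitE5 y)) := by
  rw [stereoMap, dif_pos (crdInv_stereoCrd_mem hS hy)]

theorem crd_stereoMap (hS : IsOrientedAtlas S) {y : E5}
    (hy : (splitE5 y).1 ∈ (chartAt E3 (u₀ : CCot S).1).target) :
    crd (u₀ : CCot S).1 (stereoMap u₀ y : CCot S) = stereoCrd u₀ (splitE5 y) := by
  rw [coe_stereoMap hS hy, crd_crdInv hy]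

/-- The domain of the stereographic parametrization. -/
def stereoDomain (u₀ : CHat g) : Set E5 := {y | (splitE5 y).1 ∈ (chartAt E3 (u₀ : CCot S).1).target}

theorem isOpen_stereoDomain (u₀ : CHat g) : IsOpen (stereoDomain u₀) :=
  (chartAt E3 (u₀ : CCot S).1).open_target.preimage (continuous_fst.comp splitE5.continuous)

theorem contMDiffAt_stereoMap (hS : IsOrientedAtlas S) {y : E5} (hy : y ∈ stereoDomain u₀) :
    ContMDiffAt 𝓘(ℝ, E5) ICot ∞ (fun y => (stereoMap u₀ y : CCot S)) y := by
  have h1 : ContDiffAt ℝ ∞ (fun y : E5 => stereoCrd u₀ (splitE5 y)) y :=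
    (contDiffAt_stereoCrd hS hy).comp y splitE5.contDiff.contDiffAt
  refine (contMDiffAt_crdInv (x₀ := (u₀ : CCot S).1)
    (c := fun y => stereoCrd u₀ (splitE5 y)) hy h1).congr_of_eventuallyEq ?_
  filter_upwards [(isOpen_stereoDomain u₀).mem_nhds hy] with y' hy'
  exact coe_stereoMap hS hy'

/-- The coordinate w is the quotient of the pairings with η and z̄, which does not change under
scaling. -/
theorem eq_of_stereo_smul {G : Matrix (Fin 3) (Fin 3) ℝ} {z : Fin 3 → ℂ} (h : IsUnitCovector G z)
    {w w' c : ℂ} (hc : stereo G z w' = c • stereo G z w) : w = w' := by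
  have h1 := congrArg (fun ζ => pairC G ζ (conjC z)) hc
  have h2 := congrArg (fun ζ => pairC G ζ (realC (etaD G z))) hc
  simp only [pairC_smul_left, pairC_stereo_conj h, pairC_stereo_eta h] at h1 h2
  have hm : (stereoFactor w' : ℂ) ≠ 0 := Complex.ofReal_ne_zero.2 (stereoFactor_pos _).ne'
  apply mul_left_cancel₀ hm
  linear_combination w * h1 - h2

theorem stereoMap_injective (hS : IsOrientedAtlas S) {y y' : E5} (hy : y ∈ stereoDomain u₀)
    (hy' : y' ∈ stereoDomain u₀) {c : ℂ}
    (h : (stereoMap u₀ y' : CCot S) = scale c (stereoMap u₀ y : CCot S)) : y = y' := by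
  have h1 := congrArg (crd (u₀ : CCot S).1) h
  rw [crd_scale, crd_stereoMap hS hy, crd_stereoMap hS hy'] at h1
  have h2 : (splitE5 y').1 = (splitE5 y).1 := congrArg (fun q : TCot => q.1) h1
  have h3 := congrArg (fun q : TCot => compv q.2) h1
  have h4 : ∀ (c : ℂ) (z : Fin 3 → ℂ), compv (c • ofComp z) = c • z := fun c z =>
    (congrArg (c • ·) (compv_ofComp z) :)
  simp only [stereoCrd, h4, compv_ofComp, h2] at h3
  exact splitE5.injective (Prod.ext h2.symm (eq_of_stereo_smul (isUnitCovector_baseNull hS hy) h3))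

/-- The derivative of the stereographic parametrization in a direction with vanishing base part is not
a multiple of the position. -/
theorem eq_zero_of_fderiv_stereoCrd (hS : IsOrientedAtlas S)
    (hq : q.1 ∈ (chartAt E3 (u₀ : CCot S).1).target) {w c : ℂ}
    (h : compv (fderiv ℝ (stereoCrd u₀) q (0, w)).2 = c • compv (stereoCrd u₀ q).2) : w = 0 := by
  obtain ⟨G, hG⟩ : ∃ G, G = gramC g (u₀ : CCot S).1 q.1 := ⟨_, rfl⟩
  obtain ⟨z, hz⟩ : ∃ z, z = baseNull u₀ q.1 := ⟨_, rfl⟩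
  have hu : IsUnitCovector G z := by rw [hG, hz]; exact isUnitCovector_baseNull hS hq
  have hd := ((contDiffAt_stereoCrd (u₀ := u₀) hS hq).differentiableAt (by simp)).hasFDerivAt
  -- Along this line the base point, hence the Gram matrix and the triad, are constant; only the
  -- stereographic coordinate moves.
  have hline : HasDerivAt (fun t : ℝ => q + t • ((0, w) : E3 × ℂ)) (0, w) 0 := by
    simpa using (hasDerivAt_id (0 : ℝ)).smul_const ((0, w) : E3 × ℂ) |>.const_add q
  have hd' : HasFDerivAt (stereoCrd u₀) (fderiv ℝ (stereoCrd u₀) q)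
      (q + (0 : ℝ) • ((0, w) : E3 × ℂ)) := by simpa using hd
  have h1 := hd'.comp_hasDerivAt 0 hline
  have key : ∀ κ : Fin 3 → ℂ, HasDerivAt (fun t : ℝ => pairC G (stereo G z (q.2 + t * w)) κ)
      (pairC G (compv (fderiv ℝ (stereoCrd u₀) q (0, w)).2) κ) 0 := by
    intro κ
    have h2 : ∀ i, HasDerivAt (fun t : ℝ => stereo G z (q.2 + t * w) i)
        (compv (fderiv ℝ (stereoCrd u₀) q (0, w)).2 i) 0 := by
      intro i
      have h3 := (((ContinuousLinearMap.apply ℝ ℂ (coordVec i)).comp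
        (ContinuousLinearMap.snd ℝ E3 (E3 →L[ℝ] ℂ))).hasFDerivAt).comp_hasDerivAt (0 : ℝ) h1
      refine h3.congr_of_eventuallyEq (Filter.Eventually.of_forall fun t => ?_)
      have h4 : compv (stereoCrd u₀ (q + t • ((0, w) : E3 × ℂ))).2 = stereo G z (q.2 + t * w) := by
        simp only [stereoCrd, compv_ofComp, Prod.fst_add, Prod.smul_fst, smul_zero, add_zero,
          Prod.snd_add, Prod.smul_snd, Complex.real_smul, ← hG, ← hz]
      exact (congrFun h4 i).symm
    unfold pairC upC Matrix.mulVec dotProduct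
    exact HasDerivAt.fun_sum fun i _ => (HasDerivAt.fun_sum fun j _ => (h2 j).const_mul _).mul_const _
  have ha := key (conjC z)
  have hb := key (realC (etaD G z))
  have hs : compv (stereoCrd u₀ q).2 = stereo G z q.2 := by
    rw [stereoCrd, compv_ofComp, ← hG, ← hz]
  rw [h, hs] at ha hb
  simp only [pairC_smul_left, pairC_stereo_conj hu, pairC_stereo_eta hu] at ha hb
  have hl : HasDerivAt (fun t : ℝ => q.2 + t * w) w 0 := by
    simpa using ((hasDerivAt_id (0 : ℝ)).ofReal_comp.mul_const w).const_add q.2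
  -- The η-pairing is the z̄-pairing times the coordinate. Both have logarithmic derivative c by
  -- assumption, so the product rule leaves the positive factor times w equal to zero.
  have hb' := hb.unique (ha.mul hl)
  have hm : (stereoFactor q.2 : ℂ) ≠ 0 := Complex.ofReal_ne_zero.2 (stereoFactor_pos _).ne'
  apply mul_left_cancel₀ hm
  simp only [Complex.ofReal_zero, zero_mul, add_zero] at hb'
  linear_combination -hb'

theorem isInvertible_coframeMap {θ l τ : E5 →L[ℝ] ℂ} (hθ : ∀ v, ((θ v).re : ℂ) = θ v)
    (h : ∀ v, θ v = 0 → l v = 0 → τ v = 0 → v = 0) : (coframeMap θ l τ).IsInvertible := by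
  have hinj : Function.Injective (coframeMap θ l τ : E5 →ₗ[ℝ] ℝ × ℂ × ℂ) := by
    refine (injective_iff_map_eq_zero _).2 fun v hv => ?_
    have h1 : (θ v).re = 0 := congrArg Prod.fst hv
    refine h v ?_ (congrArg (fun x => x.2.1) hv) (congrArg (fun x => x.2.2) hv)
    rw [← hθ, h1, Complex.ofReal_zero]
  exact ⟨(LinearEquiv.ofInjectiveOfFinrankEq _ hinj (by simp)).toContinuousLinearEquiv,
    ContinuousLinearMap.ext fun _ => rfl⟩

/-- Vanishing of θ and θ̃¹ kills the base part by completeness of the triad. Then δζ = dζ, whose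
contractions with ζ and η vanish, so that it is a multiple of ζ. -/
theorem IsUnitNull.kernel {E : Type*} [NormedAddCommGroup E] [NormedSpace ℝ E] {x₀ : S}
    {c : E → TCot} {y : E} (h : IsUnitNull g x₀ c y) (hS : IsOrientedAtlas S) {v : E}
    (h0 : pbForm (cTheta g x₀) c y v = 0) (h1 : pbForm cTheta1 c y v = 0)
    (h2 : pbForm (cTheta2 g x₀) c y v = 0) : (fderiv ℝ c y v).1 = 0 ∧
      ∃ t : ℂ, compv (fderiv ℝ c y v).2 = t • compv (c y).2 := by
  have hb : (fderiv ℝ c y v).1 = 0 := by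
    ext i
    have h3 := h.dot_base hS (Pi.single i 1) v
    rw [h0, h1] at h3
    simpa [realC] using h3
  have hz : dZ g x₀ c y v = compv (fderiv ℝ c y v).2 := by
    rw [dZ, hb]
    funext j
    simp [delta]
  have hu : IsUnitCovector (gramC g x₀ (c y).1) (compv (c y).2) :=
    ⟨gramC_posDef hS g h.mem, h.null.self_of_nhds, h.unit.self_of_nhds⟩
  have h3 := h.zeta_contract hS v
  have h4 := eta_contract (g := g) (x₀ := x₀) (c := c) (z := y) v
  rw [h2, mul_zero, hz, ← upC_etaD hu.posDef] at h4
  rw [hz] at h3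
  have h5 := hu.expand (compv (fderiv ℝ c y v).2)
  rw [pairC_comm hu.posDef _ (realC _), pairC_comm hu.posDef _ (compv (c y).2)] at h5
  rw [show pairC _ (realC _) _ = 0 from h4, show pairC _ (compv (c y).2) _ = 0 from h3, zero_smul,
    zero_smul, add_zero, add_zero] at h5
  exact ⟨hb, _, h5⟩

/-- The stereographic patch. -/
def stereoPatch (hS : IsOrientedAtlas S) (u₀ : CHat g) : UnitPatch g where
  W := stereoDomain u₀
  isOpen := isOpen_stereoDomain u₀
  f := stereoMap u₀
  x₀ := (u₀ : CCot S).1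
  smooth y hy := (contMDiffAt_stereoMap hS hy).contMDiffWithinAt
  source y hy := by
    rw [coe_stereoMap hS hy]
    exact crdInv_mem_source (q := stereoCrd u₀ (splitE5 y)) hy
  inj y hy y' hy' c h := stereoMap_injective hS hy hy' h
  invertible y hy := by
    have hsrc : (stereoMap u₀ y : CCot S).1 ∈ (chartAt E3 (u₀ : CCot S).1).source := by
      rw [coe_stereoMap hS hy]
      exact crdInv_mem_source (q := stereoCrd u₀ (splitE5 y)) hy
    have hsm : ∀ᶠ y' in 𝓝 y, ContMDiffAt 𝓘(ℝ, E5) ICot ∞ (fun y => (stereoMap u₀ y : CCot S)) y' := by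
      filter_upwards [(isOpen_stereoDomain u₀).mem_nhds hy] with y' hy'
      exact contMDiffAt_stereoMap hS hy'
    have hU := isUnitNull_crd hS hsm hsrc (Filter.Eventually.of_forall fun y => (stereoMap u₀ y).2)
    -- Injectivity suffices as both spaces have real dimension five. A kernel vector changes only
    -- the stereographic coordinate, in a direction proportional to the position, which
    -- `eq_zero_of_fderiv_stereoCrd` excludes.
    refine isInvertible_coframeMap (fun v => ?_) fun v h0 h1 h2 => ?_
    · rw [pbForm_cTheta hS hsm.self_of_nhds hsrc, pullForm_apply, theta_re]
    · obtain ⟨hb, t, ht⟩ := hU.kernel hS h0 h1 h2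
      have he : (fun y => crd (u₀ : CCot S).1 (stereoMap u₀ y : CCot S)) =ᶠ[𝓝 y]
          fun y => stereoCrd u₀ (splitE5 y) := by
        filter_upwards [(isOpen_stereoDomain u₀).mem_nhds hy] with y' hy'
        exact crd_stereoMap hS hy'
      have hd : fderiv ℝ (fun y => stereoCrd u₀ (splitE5 y)) y v =
          fderiv ℝ (stereoCrd u₀) (splitE5 y) (splitE5 v) := by
        have h3 := ((contDiffAt_stereoCrd (u₀ := u₀) hS hy).differentiableAt
          (by simp)).hasFDerivAt.comp y splitE5.hasFDerivAt
        exact congrArg (fun A : E5 →L[ℝ] TCot => A v) h3.fderiv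
      rw [he.fderiv_eq, hd] at hb ht
      rw [crd_stereoMap hS hy] at ht
      have hfst : (splitE5 v).1 = 0 := by
        rw [fderiv_fst_apply ((contDiffAt_stereoCrd (u₀ := u₀) hS hy).differentiableAt (by simp))] at hb
        have h4 : fderiv ℝ (fun q : E3 × ℂ => (stereoCrd u₀ q).1) (splitE5 y) =
          ContinuousLinearMap.fst ℝ E3 ℂ := hasFDerivAt_fst.fderiv
        rw [h4] at hb
        exact hb
      have hsv : splitE5 v = (0, (splitE5 v).2) := Prod.ext hfst rfl
      rw [hsv] at ht
      have h5 := eq_zero_of_fderiv_stereoCrd hS hy ht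
      rw [h5] at hsv
      exact (map_eq_zero_iff splitE5 splitE5.injective).1 hsv

end StereographicPatch

/-! ### Quotients by an involution are coverings. -/

section Involution

/-- The action of `±1` by an involution. -/
@[reducible] def signAction {X : Type*} {ν : X → X} (hν : ∀ x, ν (ν x) = x) : MulAction ℤˣ X where
  smul ε x := if ε = 1 then x else ν x
  one_smul x := if_pos rfl
  mul_smul ε ε' x := by
    change (if ε * ε' = 1 then x else ν x) =
      if ε = 1 then (if ε' = 1 then x else ν x) else ν (if ε' = 1 then x else ν x)
    rcases Int.units_eq_one_or ε with rfl | rfl <;> rcases Int.units_eq_one_or ε' with rfl | rfl <;>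
      simp [hν]

/-- The quotient by an involution that moves every point away from a neighbourhood is a covering. -/
theorem isCoveringMap_of_involution {X Y : Type*} [TopologicalSpace X] [TopologicalSpace Y] {f : X → Y}
    {ν : X → X} (hν : ∀ x, ν (ν x) = x) (hc : Continuous ν) (hf : IsOpenQuotientMap f)
    (h : ∀ x x', f x = f x' ↔ x' = x ∨ x' = ν x) (hd : ∀ x, ∃ U ∈ 𝓝 x, ∀ y ∈ U, ν y ∉ U) :
    IsCoveringMap f := by
  let := signAction hν
  have hone : ∀ x : X, (1 : ℤˣ) • x = x := one_smul _
  have hneg : ∀ x : X, (-1 : ℤˣ) • x = ν x := fun x => if_neg (by decide)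
  refine IsQuotientCoveringMap.isCoveringMap _ ℤˣ ⟨hf.isQuotientMap, ⟨?_⟩, ?_, ?_⟩
  · intro ε
    rcases Int.units_eq_one_or ε with rfl | rfl
    · simpa only [hone] using continuous_id'
    · simpa only [hneg] using hc
  · intro x₁ x₂
    rw [eq_comm, h]
    constructor
    · rintro (h | h)
      · exact ⟨1, by simp only [hone, h]⟩
      · exact ⟨-1, by simp only [hneg, h]⟩
    · rintro ⟨ε, h⟩
      rcases Int.units_eq_one_or ε with rfl | rfl
      · simp only [hone] at h
        exact Or.inl h.symm
      · simp only [hneg] at h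
        exact Or.inr h.symm
  · intro x
    obtain ⟨U, hU, hd⟩ := hd x
    refine ⟨U, hU, ?_⟩
    rintro ε ⟨_, ⟨y, hy, rfl⟩, hy'⟩
    rcases Int.units_eq_one_or ε with rfl | rfl
    · rfl
    · simp only [hneg] at hy'
      exact absurd hy' (hd y hy)

end Involution

/-! ### Continuity, openness and the covering property of the canonical map. -/

section Covering

open ComplexConjugate

variable {S : Type*} [TopologicalSpace S] [ChartedSpace E3 S] [IsManifold (𝓡 3) ∞ S] {g : Metric3 S}

/-! ### The topology of `Ĉ` -/

theorem eventually_source (u₀ : CHat g) :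
    ∀ᶠ u : CHat g in 𝓝 u₀, (u : CCot S).1 ∈ (chartAt E3 (u₀ : CCot S).1).source := by
  have h : Continuous fun u : CHat g => (u : CCot S).1 :=
    (FiberBundle.continuous_proj (E3 →L[ℝ] ℂ)
      (fun x : S => TangentSpace (𝓡 3) x →L[ℝ] Bundle.Trivial S ℂ x)).comp continuous_subtype_val
  exact h.continuousAt.eventually ((chartAt E3 (u₀ : CCot S).1).open_source.mem_nhds
    (mem_chart_source E3 _))

theorem continuousAt_crd (u₀ : CHat g) :
    ContinuousAt (fun u : CHat g => crd (u₀ : CCot S).1 (u : CCot S)) u₀ := by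
  have h : ContinuousAt (fun u : CHat g => extChartAt ICot (u₀ : CCot S) (u : CCot S)) u₀ :=
    ContinuousAt.comp (g := extChartAt ICot (u₀ : CCot S)) (continuousAt_extChartAt (u₀ : CCot S))
      continuous_subtype_val.continuousAt
  refine h.congr ?_
  filter_upwards [eventually_source u₀] with u hu
  exact extChartAt_cot hu

theorem continuousAt_crdInv {x₀ : S} {q : TCot} (hq : q.1 ∈ (chartAt E3 x₀).target) :
    ContinuousAt (crdInv x₀) q :=
  (contMDiffAt_crdInv (c := fun q : TCot => q) hq contDiffAt_id).continuousAt

theorem continuous_negHat : Continuous (negHat : CHat g → CHat g) := by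
  refine continuous_iff_continuousAt.2 fun u₀ => ?_
  refine Topology.IsInducing.subtypeVal.continuousAt_iff.2 ?_
  have h1 := continuousAt_crd u₀
  have h2 : ContinuousAt (fun u : CHat g => (((crd (u₀ : CCot S).1 (u : CCot S)).1,
      (-1 : ℂ) • (crd (u₀ : CCot S).1 (u : CCot S)).2) : TCot)) u₀ :=
    h1.fst.prodMk (h1.snd.const_smul (-1 : ℂ))
  have h3 := ContinuousAt.comp (g := crdInv (u₀ : CCot S).1) (x := u₀)
    (continuousAt_crdInv (crd_mem_target (mem_chart_source E3 (u₀ : CCot S).1))) h2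
  refine h3.congr ?_
  filter_upwards [eventually_source u₀] with u hu
  change crdInv _ _ = scale (-1) (u : CCot S)
  rw [← crdInv_crd (x₀ := (u₀ : CCot S).1) (p := scale (-1) (u : CCot S)) hu, crd_scale]

/-! ### Local sections of the parametrizations -/

/-- The component of `u` along the local unit null covector field that extends `u₀`. -/
def mainCoef (u₀ : CHat g) (q : TCot) : ℂ :=
  pairC (gramC g (u₀ : CCot S).1 q.1) (compv q.2) (conjC (baseNull u₀ q.1))

/-- The component of `u` along the vector `η` of that field. -/
def etaCoef (u₀ : CHat g) (q : TCot) : ℂ :=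
  pairC (gramC g (u₀ : CCot S).1 q.1) (compv q.2)
    (realC (etaD (gramC g (u₀ : CCot S).1 q.1) (baseNull u₀ q.1)))

/-- The parameters of an element of `Ĉ` with given coordinates. -/
def stereoParam (u₀ : CHat g) (q : TCot) : E6 :=
  (splitE5.symm (q.1, etaCoef u₀ q / mainCoef u₀ q), Complex.arg (mainCoef u₀ q ^ 2))

theorem ContDiffAt.pairC {E : Type*} [NormedAddCommGroup E] [NormedSpace ℝ E] {z₀ : E}
    {G : E → Matrix (Fin 3) (Fin 3) ℝ} {Z Z' : E → Fin 3 → ℂ}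
    (hG : ∀ i j, ContDiffAt ℝ ∞ (fun z => G z i j) z₀) (h0 : (G z₀).det ≠ 0)
    (hZ : ∀ i, ContDiffAt ℝ ∞ (fun z => Z z i) z₀) (hZ' : ∀ i, ContDiffAt ℝ ∞ (fun z => Z' z i) z₀) :
    ContDiffAt ℝ ∞ (fun z => pairC (G z) (Z z) (Z' z)) z₀ := by
  unfold TwistorFefferman.pairC dotProduct
  exact ContDiffAt.sum fun i _ => (ContDiffAt.upC hG h0 hZ i).mul (hZ' i)

variable {u₀ : CHat g}

theorem contDiffAt_baseNull_fst (hS : IsOrientedAtlas S) {q : TCot}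
    (hq : q.1 ∈ (chartAt E3 (u₀ : CCot S).1).target) (i : Fin 3) :
    ContDiffAt ℝ ∞ (fun q : TCot => baseNull u₀ q.1 i) q :=
  ContDiffAt.comp (g := fun y => baseNull u₀ y i) q (contDiffAt_baseNull hS hq i) contDiffAt_fst

theorem continuousAt_mainCoef (hS : IsOrientedAtlas S) {q : TCot}
    (hq : q.1 ∈ (chartAt E3 (u₀ : CCot S).1).target) : ContinuousAt (mainCoef u₀) q :=
  (ContDiffAt.pairC (z₀ := q) (G := fun q : TCot => gramC g (u₀ : CCot S).1 q.1)
    (contDiffAt_gramC_fst g hq) (gramC_posDef hS g hq).det_pos.ne' (contDiffAt_compv q)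
    (fun i => Complex.conjCLE.contDiff.contDiffAt.comp q (contDiffAt_baseNull_fst hS hq i))).continuousAt

theorem continuousAt_etaCoef (hS : IsOrientedAtlas S) {q : TCot}
    (hq : q.1 ∈ (chartAt E3 (u₀ : CCot S).1).target) : ContinuousAt (etaCoef u₀) q :=
  (ContDiffAt.pairC (z₀ := q) (G := fun q : TCot => gramC g (u₀ : CCot S).1 q.1)
    (contDiffAt_gramC_fst g hq) (gramC_posDef hS g hq).det_pos.ne' (contDiffAt_compv q)
    (fun i => ContDiffAt.ofReal (ContDiffAt.etaD (z₀ := q)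
      (G := fun q : TCot => gramC g (u₀ : CCot S).1 q.1) (Z := fun q : TCot => baseNull u₀ q.1)
      (contDiffAt_gramC_fst g hq) (gramC_posDef hS g hq).det_pos
      (contDiffAt_baseNull_fst hS hq) i))).continuousAt

theorem mainCoef_self (u₀ : CHat g) : mainCoef u₀ (crd (u₀ : CCot S).1 (u₀ : CCot S)) = 1 := by
  rw [crd_self, mainCoef, baseNull_self, gramC_self]
  exact (isUnitCovector_comp u₀).unit

theorem continuousAt_mainCoef_crd (hS : IsOrientedAtlas S) (u₀ : CHat g) :
    ContinuousAt (fun u : CHat g => mainCoef u₀ (crd (u₀ : CCot S).1 (u : CCot S))) u₀ :=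
  ContinuousAt.comp (g := mainCoef u₀)
    (continuousAt_mainCoef hS (crd_mem_target (mem_chart_source E3 (u₀ : CCot S).1))) (continuousAt_crd u₀)

theorem continuousAt_stereoParam (hS : IsOrientedAtlas S) (u₀ : CHat g) :
    ContinuousAt (fun u : CHat g => stereoParam u₀ (crd (u₀ : CCot S).1 (u : CCot S))) u₀ := by
  have hq := crd_mem_target (p := (u₀ : CCot S)) (mem_chart_source E3 (u₀ : CCot S).1)
  have h1 := continuousAt_mainCoef hS hq
  have h2 := continuousAt_etaCoef hS hq
  refine ContinuousAt.comp (g := stereoParam u₀) ?_ (continuousAt_crd u₀)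
  refine ContinuousAt.prodMk ?_ ?_
  · refine splitE5.symm.continuous.continuousAt.comp (continuous_fst.continuousAt.prodMk (h2.div h1 ?_))
    rw [mainCoef_self]
    exact one_ne_zero
  -- At u₀ the square of the main coefficient is 1, away from the cut of the argument.
  · refine ContinuousAt.comp (g := Complex.arg) ?_ (h1.pow 2)
    apply Complex.continuousAt_arg
    rw [mainCoef_self, one_pow]
    exact Complex.one_mem_slitPlane

theorem ofComp_smul (c : ℂ) (z : Fin 3 → ℂ) : ofComp (c • z) = c • ofComp z := by
  refine ContinuousLinearMap.ext fun a => ?_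
  rw [ofComp_apply, smul_dotProduct, ← ofComp_apply]
  rfl

theorem stereoParam_mem (hS : IsOrientedAtlas S) {u : CHat g}
    (hu : (u : CCot S).1 ∈ (chartAt E3 (u₀ : CCot S).1).source) :
    stereoParam u₀ (crd (u₀ : CCot S).1 (u : CCot S)) ∈ ((stereoPatch hS u₀).toChart hS).domain := by
  refine ⟨?_, Set.mem_univ _⟩
  change (splitE5 (splitE5.symm _)).1 ∈ (chartAt E3 (u₀ : CCot S).1).target
  rw [ContinuousLinearEquiv.apply_symm_apply]
  exact crd_mem_target hu

/-- Every element of `Ĉ` near `u₀` lies over the point of the Fefferman space with its parameters. -/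
theorem canonicalMap_eq_param (hS : IsOrientedAtlas S) {u : CHat g}
    (hu : (u : CCot S).1 ∈ (chartAt E3 (u₀ : CCot S).1).source)
    (h0 : mainCoef u₀ (crd (u₀ : CCot S).1 (u : CCot S)) ≠ 0) :
    canonicalMap hS g u = ((stereoPatch hS u₀).toChart hS).param
      (stereoParam u₀ (crd (u₀ : CCot S).1 (u : CCot S))) := by
  have hd := (stereoParam_mem (u₀ := u₀) hS hu).1
  have hz := isUnitCovector_baseNull (u₀ := u₀) hS (crd_mem_target hu)
  have hn := (isUnitCovector_crd hS u hu).null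
  have h1 := eq_smul_stereo hz hn h0
  refine (canonicalMap_eq_mk_iff hS u _).2 ?_
  rw [UnitPatch.coef_elt]
  change ∃ c : ℂ, c ≠ 0 ∧ (stereoMap u₀ _ : CCot S) = _ ∧ _
  rw [coe_stereoMap hS hd]
  have hm := stereoFactor_pos (etaCoef u₀ (crd (u₀ : CCot S).1 (u : CCot S)) /
    mainCoef u₀ (crd (u₀ : CCot S).1 (u : CCot S)))
  simp only [stereoParam, ContinuousLinearEquiv.apply_symm_apply]
  change compv _ = (mainCoef u₀ _ / stereoFactor (etaCoef u₀ _ / mainCoef u₀ _)) •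
    stereo _ _ (etaCoef u₀ _ / mainCoef u₀ _) at h1
  obtain ⟨w, hw⟩ : ∃ w, w = etaCoef u₀ (crd (u₀ : CCot S).1 (u : CCot S)) /
    mainCoef u₀ (crd (u₀ : CCot S).1 (u : CCot S)) := ⟨_, rfl⟩
  rw [← hw] at h1 hm ⊢
  generalize mainCoef u₀ (crd (u₀ : CCot S).1 (u : CCot S)) = α at *
  have hm' : (stereoFactor w : ℂ) ≠ 0 := Complex.ofReal_ne_zero.2 hm.ne'
  -- This factor c carries u to the stereographic representative. The fibre coordinate was chosen as
  -- arg(α²), so e^{is}c² is the positive number given as r.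
  refine ⟨stereoFactor w / α, div_ne_zero hm' h0, ?_, stereoFactor w ^ 2 / ‖α ^ 2‖, by
    have := norm_pos_iff.2 (pow_ne_zero 2 h0)
    positivity, ?_⟩
  · rw [← crdInv_crd (x₀ := (u₀ : CCot S).1) (p := scale (stereoFactor w / α) (u : CCot S)) hu, crd_scale,
      stereoCrd, ← ofComp_compv (crd (u₀ : CCot S).1 (u : CCot S)).2, h1, ← ofComp_smul, smul_smul,
      div_mul_div_cancel₀ h0, div_self hm', one_smul]
  · have h2 := Complex.norm_mul_exp_arg_mul_I (α ^ 2)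
    have h3 : (‖α ^ 2‖ : ℂ) ≠ 0 := Complex.ofReal_ne_zero.2 (norm_ne_zero_iff.2 (pow_ne_zero 2 h0))
    rw [mul_comm Complex.I]
    push_cast at h2 h3 ⊢
    field_simp
    linear_combination h2

/-! ### The covering -/

theorem isOpen_feffermanSpace_iff {V : Set (FeffermanSpace g)} :
    IsOpen V ↔ ∀ Φ : FeffermanChart g, IsOpen (Φ.domain ∩ Φ.param ⁻¹' V) := by
  refine isOpen_iSup_iff.trans (forall_congr' fun Φ => isOpen_coinduced.trans ?_)
  rw [Φ.isOpen_domain.isOpenEmbedding_subtypeVal.isOpen_iff_image_isOpen]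
  have : Subtype.val '' ((fun q : Φ.domain => Φ.param q) ⁻¹' V) = Φ.domain ∩ Φ.param ⁻¹' V := by
    rw [Set.inter_comm]
    exact Subtype.image_preimage_coe Φ.domain (Φ.param ⁻¹' V) |>.trans (Set.inter_comm _ _)
  rw [this]

/-- Near u₀ the map is the parametrization of the stereographic chart at u₀ composed with the
parameters of u, and the latter are continuous at u₀. -/
theorem continuous_canonicalMap (hS : IsOrientedAtlas S) (g : Metric3 S) :
    Continuous (canonicalMap hS g) := by
  refine ⟨fun V hV => isOpen_iff_mem_nhds.2 fun u₀ hu₀ => ?_⟩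
  have h1 := isOpen_feffermanSpace_iff.1 hV ((stereoPatch hS u₀).toChart hS)
  have hs := mem_chart_source E3 (u₀ : CCot S).1
  have h0 : mainCoef u₀ (crd (u₀ : CCot S).1 (u₀ : CCot S)) ≠ 0 := by
    rw [mainCoef_self]
    exact one_ne_zero
  have h2 := (continuousAt_stereoParam hS u₀).eventually (h1.mem_nhds ⟨stereoParam_mem hS hs, by
    rw [Set.mem_preimage, ← canonicalMap_eq_param hS hs h0]
    exact hu₀⟩)
  filter_upwards [h2, eventually_source u₀, (continuousAt_mainCoef_crd hS u₀).eventually_ne h0]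
    with u h3 h4 h5
  rw [Set.mem_preimage, canonicalMap_eq_param hS h4 h5]
  exact h3.2

/-- In any chart, a local lift through u₀ exhibits the points near the image of u₀ as images of
points near u₀. -/
theorem isOpenMap_canonicalMap (hS : IsOrientedAtlas S) (g : Metric3 S) :
    IsOpenMap (canonicalMap hS g) := by
  refine fun U hU => isOpen_feffermanSpace_iff.2 fun Φ => isOpen_iff_mem_nhds.2 ?_
  rintro q ⟨hq, u₀, hu₀, hp⟩
  obtain ⟨O, τ, hqO, hτ, rfl⟩ := Φ.exists_localLift hS hq hp
  have h1 : ContinuousAt τ q := Topology.IsInducing.subtypeVal.continuousAt_iff.2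
    (hτ.smooth.contMDiffAt (hτ.isOpen.mem_nhds hqO)).continuousAt
  filter_upwards [h1.eventually (hU.mem_nhds hu₀), hτ.isOpen.mem_nhds hqO] with q' h2 h3
  exact ⟨hτ.subset h3, τ q', h2, hτ.lift q' h3⟩

/-- The main coefficient is 1 at e and changes sign under ζ ↦ −ζ, so the set where its real part is
positive is a neighbourhood of e disjoint from its reflection. -/
theorem isCoveringMap_canonicalMap (hS : IsOrientedAtlas S) (g : Metric3 S) :
    IsCoveringMap (canonicalMap hS g) := by
  refine isCoveringMap_of_involution negHat_negHat continuous_negHat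
    ⟨canonicalMap_surjective hS g, continuous_canonicalMap hS g, isOpenMap_canonicalMap hS g⟩
    (fun u u' => canonicalMap_eq_iff hS u u') fun e => ?_
  have h1 := (continuousAt_mainCoef_crd hS e).eventually
    ((isOpen_lt continuous_const Complex.continuous_re).mem_nhds
      (show 0 < (mainCoef e (crd (e : CCot S).1 (e : CCot S))).re by rw [mainCoef_self]; simp))
  refine ⟨_, h1, fun u hu hu' => ?_⟩
  have h2 : mainCoef e (crd (e : CCot S).1 (negHat u : CCot S)) =
      -mainCoef e (crd (e : CCot S).1 (u : CCot S)) := by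
    have h3 : crd (e : CCot S).1 (negHat u : CCot S) = _ := crd_scale (e : CCot S).1 (-1) (u : CCot S)
    have h4 : compv ((-1 : ℂ) • (crd (e : CCot S).1 (u : CCot S)).2) =
      (-1 : ℂ) • compv (crd (e : CCot S).1 (u : CCot S)).2 := rfl
    rw [h3, mainCoef, h4, pairC_smul_left, neg_one_mul]
    rfl
  have h5 : 0 < (mainCoef e (crd (e : CCot S).1 (u : CCot S))).re := hu
  have h6 : 0 < (mainCoef e (crd (e : CCot S).1 (negHat u : CCot S))).re := hu'
  rw [h2, Complex.neg_re] at h6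
  linarith

end Covering

end TwistorFefferman

end

/-- The map `ϖ : Ĉ → 𝒞`, `u ↦ [(θ ∧ θ̃¹ ∧ θ̃²)_u]`, is well defined and a double covering of the
Fefferman space; it is a local diffeomorphism (in each local parametrization of `𝒞` it has smooth
immersive local inverses), and the pull back of the Fefferman metric by `ϖ` is
`2 (θ̃¹·conj θ̃² + θ̃²·conj θ̃¹ + θ·θ̃³)`. -/
theorem theorem4p5 {S : Type*} [TopologicalSpace S] [ChartedSpace E3 S] [IsManifold (𝓡 3) ∞ S]
    (hS : IsOrientedAtlas S) (g : Metric3 S) :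
    ∃ ϖ : CHat g → FeffermanSpace g,
      IsCanonicalMap g ϖ ∧
      IsCoveringMap ϖ ∧
      (∀ c : FeffermanSpace g, Nat.card (ϖ ⁻¹' {c}) = 2) ∧
      ∀ Φ : FeffermanChart g,
        (∀ q₀ ∈ Φ.domain, ∀ u₀ : CHat g, ϖ u₀ = Φ.param q₀ →
          ∃ (O : Set E6) (τ : E6 → CHat g), q₀ ∈ O ∧ IsLocalLift ϖ Φ O τ ∧ τ q₀ = u₀ ∧
            ∀ q ∈ O, Function.Injective (dLift τ q)) ∧
        (∃ σ, Φ.frame.IsFeffermanConnection σ) ∧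
        ∀ σ, Φ.frame.IsFeffermanConnection σ →
          ∀ (O : Set E6) (τ : E6 → CHat g), IsLocalLift ϖ Φ O τ →
            ∀ q ∈ O, ∀ v w : E6,
              Φ.frame.feffermanMetric σ q v w =
                adaptedMetric g (τ q : CCot S) (dLift τ q v) (dLift τ q w) :=
  ⟨canonicalMap hS g, isCanonicalMap_canonicalMap hS g, isCoveringMap_canonicalMap hS g,
    card_fibre hS, fun Φ => ⟨fun _ hq₀ _ hu₀ =>
      let ⟨O, τ, hO, hτ, h⟩ := Φ.exists_localLift hS hq₀ hu₀
      ⟨O, τ, hO, hτ, h, fun _ hq => hτ.injective hq⟩,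
    Φ.exists_connection hS, fun _ hσ _ _ hτ _ hq v w => hτ.feffermanMetric_eq hq hσ v w⟩⟩
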